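/- Let $\Gamma\subset\mathbb{R}^3$ be a closed (compact, without boundary), connected, oriented surface of class $C^5$ with unit normal vector field $n$ (for instance the outward one). Let $\nabla_\Gamma=P\nabla$ be the tangential gradient, $P=I_3-n\otimes n$, and let $W=-\nabla_\Gamma n$ be the Weingarten map, whose eigenvalues are $0$ and the principal curvatures $\kappa_1,\kappa_2$. Call $\delta>0$ a tubular radius if $(y,r)\mapsto y+rn(y)$ is injective on $\Gamma\times(-\delta,\delta)$ and $1-r\kappa_i(y)$ $(i=1,2)$ is bounded above and bounded below by positive constants for $y\in\Gamma$, $|r|<\delta$. For $x$ within distance less than $\delta$ of $\Gamma$ write $x=\pi(x)+d(x)n(\pi(x))$, where $\pi(x)\in\Gamma$ is the closest point and $d$ is the signed distance from $\Gamma$, and let $\bar\eta:=\eta\circ\pi$ be the constant extension of a function $\eta$ on $\Gamma$ in the normal direction. Let $g_0,g_1\in C^4(\Gamma)$ satisfy $g:=g_1-g_0\ge a$ on $\Gamma$ for some constant $a>0$ and $|g_0|,|g_1|<\delta$ on $\Gamma$. For $\varepsilon\in(0,1]$ set $$\Omega_\varepsilon:=\{y+rn(y)\mid y\in\Gamma,\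 \varepsilon g_0(y)<r<\varepsilon g_1(y)\}.$$ For a vector field $u$ on $\Omega_\varepsilon$ let $$M_\tau u(y):=P(y)\,\frac{1}{\varepsilon g(y)}\int_{\varepsilon g_0(y)}^{\varepsilon g_1(y)}u(y+rn(y))\,dr,\qquad y\in\Gamma,$$ $$\tau_\varepsilon^i:=\{I_3-\varepsilon g_iW\}^{-1}\nabla_\Gamma g_i\ (i=0,1),\qquad \Psi_\varepsilon:=\frac1{\bar g}\bigl\{(d-\varepsilon\bar g_0)\bar\tau_\varepsilon^1+(\varepsilon\bar g_1-d)\bar\tau_\varepsilon^0\bigr\},$$ and define the average part of $u$ by $$u^a:=\overline{M_\tau u}+\bigl(\overline{M_\tau u}\cdot\Psi_\varepsilon\bigr)\bar n .$$ Then $\Gamma$ has a tubular radius, and for every tubular radius $\delta$ and all $g_0,g_1$ as above there is a constant $c>0$ such that for every $\varepsilon\in(0,1]$ the following hold; that is, $c$ is independent of $\varepsilon$, $\eta$, $\varphi$ and $u$. (i) For all $\eta\in H^1(\Gamma)$ and $\varphi\in H^1(\Omega_\varepsilon)$ we have $\bar\eta\varphi\in L^2(\Omega_\varepsilon)$ and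 $$\|\bar\eta\varphi\|_{L^2(\Omega_\varepsilon)}\le c\,\|\eta\|_{L^2(\Gamma)}^{1/2}\|\eta\|_{H^1(\Gamma)}^{1/2}\|\varphi\|_{L^2(\Omega_\varepsilon)}^{1/2}\|\varphi\|_{H^1(\Omega_\varepsilon)}^{1/2}.$$ (ii) For all $\varphi\in H^1(\Omega_\varepsilon)$ and $u\in H^1(\Omega_\varepsilon)^3$ we have $|u^a|\varphi\in L^2(\Omega_\varepsilon)$ and $$\bigl\|\,|u^a|\,\varphi\bigr\|_{L^2(\Omega_\varepsilon)}\le c\,\varepsilon^{-1/2}\|\varphi\|_{L^2(\Omega_\varepsilon)}^{1/2}\|\varphi\|_{H^1(\Omega_\varepsilon)}^{1/2}\|u\|_{L^2(\Omega_\varepsilon)}^{1/2}\|u\|_{H^1(\Omega_\varepsilon)}^{1/2}.$$ (iii) For all $\varphi\in H^1(\Omega_\varepsilon)$ and $u\in H^2(\Omega_\varepsilon)^3$ we have $u^a\in H^1(\Omega_\varepsilon)^3$, $|\nabla u^a|\varphi\in L^2(\Omega_\varepsilon)$ and $$\bigl\|\,|\nabla u^a|\,\varphi\bigr\|_{L^2(\Omega_\varepsilon)}\le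 c\,\varepsilon^{-1/2}\|\varphi\|_{L^2(\Omega_\varepsilon)}^{1/2}\|\varphi\|_{H^1(\Omega_\varepsilon)}^{1/2}\|u\|_{H^1(\Omega_\varepsilon)}^{1/2}\|u\|_{H^2(\Omega_\varepsilon)}^{1/2}.$$ -/

import Mathlib

open MeasureTheory Set
open scoped ENNReal ContDiff

noncomputable section

namespace CTD

/-- Three-dimensional Euclidean space. -/
abbrev E3 := EuclideanSpace ℝ (Fin 3)

/-! ### The closed surface

Functions and vector fields on `Γ` are represented by total functions on `E3` of which only the
values on `Γ` are used.  For a function `η`, membership in `C^k(Γ)` is `ContDiffOn ℝ k η Γ`: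
locally on `Γ` there are Taylor coefficients relative to `Γ`, equivalently `η` is the restriction
of a `C^k` function, provided `Γ` itself is smooth enough. -/

/-- `Γ` is a closed (compact, without boundary), connected surface of class `C^5` in `E3`, oriented
by the unit normal field `n`: near each of its points, `Γ` is the zero set of a `C^5` function `f`
whose gradient does not vanish on `Γ`, and `n = ∇f / |∇f|` on `Γ`. -/
structure IsClosedSurface (Γ : Set E3) (n : E3 → E3) : Prop where
  isCompact : IsCompact Γ
  isConnected : IsConnected Γ
  exists_defining : ∀ y ∈ Γ, ∃ U : Set E3, IsOpen U ∧ y ∈ U ∧ ∃ f : E3 → ℝ,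
    ContDiffOn ℝ 5 f U ∧ Γ ∩ U = {x ∈ U | f x = 0} ∧
    ∀ x ∈ Γ ∩ U, gradient f x ≠ 0 ∧ n x = ‖gradient f x‖⁻¹ • gradient f x

/-- The two-dimensional Hausdorff measure (normalised to be area on planes) on `Γ`. -/
def surf (Γ : Set E3) : Measure E3 := (μHE[2] : Measure E3).restrict Γ

/-- The orthogonal projection `P(y) = I - n(y) ⊗ n(y)` applied to the vector `a`. -/
def P (n : E3 → E3) (y a : E3) : E3 := a - (inner ℝ (n y) a) • n y

/-- The tangential gradient `∇_Γ η = P ∇η̃` of `η ∈ C¹(Γ)`.  The derivative of any `C¹` extension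
`η̃` of `η` is a derivative of `η` within `Γ`, and `P` removes the normal component, which is the
part that is not determined by `η`. -/
def tanGrad (Γ : Set E3) (n : E3 → E3) (η : E3 → ℝ) (y : E3) : E3 :=
  P n y (gradientWithin η Γ y)

/-- The tangential gradient matrix `(∇_Γ v)_{ij} = D_i v_j` of a vector field on `Γ`. -/
def tanGradMat (Γ : Set E3) (n : E3 → E3) (v : E3 → E3) (y : E3) : Matrix (Fin 3) (Fin 3) ℝ :=
  Matrix.of fun i j => tanGrad Γ n (fun x => v x j) y i

/-- The Weingarten map `W = -∇_Γ n`. -/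
def W (Γ : Set E3) (n : E3 → E3) (y : E3) : Matrix (Fin 3) (Fin 3) ℝ := -tanGradMat Γ n n y

/-- (Twice) the mean curvature `H = tr W`. -/
def H (Γ : Set E3) (n : E3 → E3) (y : E3) : ℝ := (W Γ n y).trace

/-- `δ` is an admissible radius of a tubular neighbourhood of `Γ`: the normal coordinates
`(y, r) ↦ y + r n(y)` are injective on `Γ × (-δ, δ)`, and `c⁻¹ ≤ 1 - r κ ≤ c` there for the
principal curvatures `κ` of `Γ` (the eigenvalues of `W` are the principal curvatures and zero). -/
def IsTubularRadius (Γ : Set E3) (n : E3 → E3) (δ : ℝ) : Prop :=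
  0 < δ ∧ InjOn (fun p : E3 × ℝ => p.1 + p.2 • n p.1) (Γ ×ˢ Ioo (-δ) δ) ∧
  ∃ c : ℝ, 0 < c ∧ ∀ y ∈ Γ, ∀ r ∈ Ioo (-δ) δ, ∀ κ ∈ spectrum ℝ (W Γ n y),
    c⁻¹ ≤ 1 - r * κ ∧ 1 - r * κ ≤ c

open Classical in
/-- The closest point projection `π` onto `Γ` (unique in a tubular neighbourhood). -/
def proj (Γ : Set E3) (x : E3) : E3 :=
  if h : ∃ y ∈ Γ, dist x y = Metric.infDist x Γ then h.choose else x

/-- The signed distance `d` from `Γ`, increasing in the direction of `n`; in a tubular neighbourhood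
`x = π(x) + d(x) n(π(x))`. -/
def sdist (Γ : Set E3) (n : E3 → E3) (x : E3) : ℝ := inner ℝ (x - proj Γ x) (n (proj Γ x))

/-- The constant extension `η̄ = η ∘ π` in the normal direction. -/
def ext {F : Type*} (Γ : Set E3) (η : E3 → F) (x : E3) : F := η (proj Γ x)

/-! ### Sobolev spaces on the surface -/

/-- `ηi` is the `i`-th weak tangential derivative of `η`. -/
def HasWeakTanDeriv (Γ : Set E3) (n : E3 → E3) (i : Fin 3) (η ηi : E3 → ℝ) : Prop :=
  ∀ ξ : E3 → ℝ, ContDiffOn ℝ 1 ξ Γ →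
    ∫ y, ηi y * ξ y ∂(surf Γ) = -∫ y, η y * (tanGrad Γ n ξ y i + ξ y * H Γ n y * n y i) ∂(surf Γ)

/-- `η ∈ H¹(Γ)`. -/
def MemH1Surf (Γ : Set E3) (n : E3 → E3) (η : E3 → ℝ) : Prop :=
  MemLp η 2 (surf Γ) ∧ ∀ i, ∃ ηi : E3 → ℝ, MemLp ηi 2 (surf Γ) ∧ HasWeakTanDeriv Γ n i η ηi

open Classical in
/-- The `i`-th weak tangential derivative in `L²(Γ)` (a representative; zero if there is none). -/
def weakTanDeriv (Γ : Set E3) (n : E3 → E3) (i : Fin 3) (η : E3 → ℝ) : E3 → ℝ :=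
  if h : ∃ ηi : E3 → ℝ, MemLp ηi 2 (surf Γ) ∧ HasWeakTanDeriv Γ n i η ηi then h.choose else 0

/-- `‖η‖_{L²(Γ)}`. -/
def L2Surf (Γ : Set E3) (η : E3 → ℝ) : ℝ≥0∞ := eLpNorm η 2 (surf Γ)

/-- `‖η‖_{H¹(Γ)} = (‖η‖² + ‖∇_Γ η‖²)^{1/2}`. -/
def H1Surf (Γ : Set E3) (n : E3 → E3) (η : E3 → ℝ) : ℝ≥0∞ :=
  (L2Surf Γ η ^ 2 + ∑ i, L2Surf Γ (weakTanDeriv Γ n i η) ^ 2) ^ (1 / 2 : ℝ)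

/-! ### Sobolev spaces on an open set -/

/-- `ψ` is the weak partial derivative `∂_i φ` in `Ω`. -/
def HasWeakDeriv (Ω : Set E3) (i : Fin 3) (φ ψ : E3 → ℝ) : Prop :=
  ∀ ζ : E3 → ℝ, ContDiff ℝ ∞ ζ → HasCompactSupport ζ → tsupport ζ ⊆ Ω →
    ∫ x in Ω, φ x * fderiv ℝ ζ x (EuclideanSpace.single i 1) = -∫ x in Ω, ψ x * ζ x

/-- `φ ∈ L²(Ω)`, for scalar or vector valued `φ`. -/
def MemL2 {F : Type*} [NormedAddCommGroup F] (Ω : Set E3) (φ : E3 → F) : Prop :=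
  MemLp φ 2 (volume.restrict Ω)

/-- `‖φ‖_{L²(Ω)}`, for scalar or vector valued `φ`. -/
def L2 {F : Type*} [NormedAddCommGroup F] (Ω : Set E3) (φ : E3 → F) : ℝ≥0∞ :=
  eLpNorm φ 2 (volume.restrict Ω)

/-- `φ ∈ H¹(Ω)`. -/
def MemH1 (Ω : Set E3) (φ : E3 → ℝ) : Prop :=
  MemL2 Ω φ ∧ ∀ i, ∃ ψ : E3 → ℝ, MemL2 Ω ψ ∧ HasWeakDeriv Ω i φ ψ

open Classical in
/-- The weak derivative `∂_i φ` in `L²(Ω)` (a representative; zero if there is none). -/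
def weakDeriv (Ω : Set E3) (i : Fin 3) (φ : E3 → ℝ) : E3 → ℝ :=
  if h : ∃ ψ : E3 → ℝ, MemL2 Ω ψ ∧ HasWeakDeriv Ω i φ ψ then h.choose else 0

/-- `φ ∈ H²(Ω)`. -/
def MemH2 (Ω : Set E3) (φ : E3 → ℝ) : Prop :=
  MemH1 Ω φ ∧ ∀ i, MemH1 Ω (weakDeriv Ω i φ)

/-- `‖φ‖_{H¹(Ω)} = (‖φ‖² + ‖∇φ‖²)^{1/2}`. -/
def H1 (Ω : Set E3) (φ : E3 → ℝ) : ℝ≥0∞ :=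
  (L2 Ω φ ^ 2 + ∑ i, L2 Ω (weakDeriv Ω i φ) ^ 2) ^ (1 / 2 : ℝ)

/-- `u ∈ H¹(Ω)³`. -/
def MemH1Vec (Ω : Set E3) (u : E3 → E3) : Prop := ∀ j, MemH1 Ω (fun x => u x j)

/-- `u ∈ H²(Ω)³`. -/
def MemH2Vec (Ω : Set E3) (u : E3 → E3) : Prop := ∀ j, MemH2 Ω (fun x => u x j)

/-- The weak gradient matrix `(∇u)_{ij} = ∂_i u_j`. -/
def weakGradMat (Ω : Set E3) (u : E3 → E3) (x : E3) : Matrix (Fin 3) (Fin 3) ℝ :=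
  Matrix.of fun i j => weakDeriv Ω i (fun z => u z j) x

/-- `‖u‖_{H¹(Ω)} = (‖u‖² + ‖∇u‖²)^{1/2}` for a vector field. -/
def H1Vec (Ω : Set E3) (u : E3 → E3) : ℝ≥0∞ :=
  (L2 Ω u ^ 2 + ∑ i, ∑ j, L2 Ω (fun x => weakGradMat Ω u x i j) ^ 2) ^ (1 / 2 : ℝ)

/-- `‖u‖_{H²(Ω)} = (‖u‖² + ‖∇u‖² + ‖∇²u‖²)^{1/2}` for a vector field. -/
def H2Vec (Ω : Set E3) (u : E3 → E3) : ℝ≥0∞ :=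
  (H1Vec Ω u ^ 2 +
    ∑ i, ∑ j, ∑ k, L2 Ω (weakDeriv Ω i (fun x => weakGradMat Ω u x j k)) ^ 2) ^ (1 / 2 : ℝ)

/-- The norm `|A| = (∑ A_{ij}²)^{1/2}` of a matrix. -/
def frob (A : Matrix (Fin 3) (Fin 3) ℝ) : ℝ := Real.sqrt (∑ i, ∑ j, A i j ^ 2)

/-! ### The curved thin domain and the average part of a vector field -/

/-- `Ω_ε = {y + r n(y) | y ∈ Γ, ε g₀(y) < r < ε g₁(y)}`. -/
def thin (Γ : Set E3) (n : E3 → E3) (g₀ g₁ : E3 → ℝ) (ε : ℝ) : Set E3 :=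
  {x | ∃ y ∈ Γ, ∃ r : ℝ, ε * g₀ y < r ∧ r < ε * g₁ y ∧ x = y + r • n y}

/-- The average `Mu(y) = (ε g(y))⁻¹ ∫_{ε g₀(y)}^{ε g₁(y)} u(y + r n(y)) dr`, `g = g₁ - g₀`. -/
def avg (n : E3 → E3) (g₀ g₁ : E3 → ℝ) (ε : ℝ) (u : E3 → E3) (y : E3) : E3 :=
  (ε * (g₁ y - g₀ y))⁻¹ • ∫ r in (ε * g₀ y)..(ε * g₁ y), u (y + r • n y)

/-- The averaged tangential component `M_τ u = P M u`. -/
def avgTan (n : E3 → E3) (g₀ g₁ : E3 → ℝ) (ε : ℝ) (u : E3 → E3) (y : E3) : E3 :=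
  P n y (avg n g₀ g₁ ε u y)

/-- `τ_ε^i = (I - ε g_i W)⁻¹ ∇_Γ g_i`, where `gi` is one of `g₀`, `g₁`. -/
def tau (Γ : Set E3) (n : E3 → E3) (gi : E3 → ℝ) (ε : ℝ) (y : E3) : E3 :=
  Matrix.toEuclideanCLM (𝕜 := ℝ) (1 - (ε * gi y) • W Γ n y)⁻¹ (tanGrad Γ n gi y)

/-- `Ψ_ε = ḡ⁻¹ ((d - ε ḡ₀) τ̄_ε^1 + (ε ḡ₁ - d) τ̄_ε^0)`. -/
def Psi (Γ : Set E3) (n : E3 → E3) (g₀ g₁ : E3 → ℝ) (ε : ℝ) (x : E3) : E3 :=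
  (ext Γ g₁ x - ext Γ g₀ x)⁻¹ •
    ((sdist Γ n x - ε * ext Γ g₀ x) • ext Γ (tau Γ n g₁ ε) x +
      (ε * ext Γ g₁ x - sdist Γ n x) • ext Γ (tau Γ n g₀ ε) x)

/-- The impermeable extension `E_ε v = v̄ + (v̄ · Ψ_ε) n̄` of a tangential field `v` on `Γ`. -/
def impExt (Γ : Set E3) (n : E3 → E3) (g₀ g₁ : E3 → ℝ) (ε : ℝ) (v : E3 → E3) (x : E3) : E3 :=
  ext Γ v x + (inner ℝ (ext Γ v x) (Psi Γ n g₀ g₁ ε x)) • ext Γ n x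

/-- The average part `u^a = E_ε M_τ u`. -/
def avgPart (Γ : Set E3) (n : E3 → E3) (g₀ g₁ : E3 → ℝ) (ε : ℝ) (u : E3 → E3) : E3 → E3 :=
  impExt Γ n g₀ g₁ ε (avgTan n g₀ g₁ ε u)

end CTD

end

/-!
The factor `ε^(-1/2)`, and its absence for functions on the surface, both come from the planar
inequality `lintegral_sq_mul_sq_le` of Ladyzhenskaya type: on a square, `∫ a² b²` is at most the
product of `∫ (a² + |a||∇a|)` and `∫ (b² + |b||∇b|)`, up to a constant, since `a²` is dominated by
its maximal function in one coordinate direction and `b²` by its maximal function in the other.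

The thin domain is foliated by the layers `y ↦ y + ε (g₀ + τ (g₁ - g₀)) n(y)`, `τ ∈ (0, 1)`, and
`T_τ` denotes the projection onto the layer `τ` along the normals (`layerProj`). After the affine
change of variables in the fibre, the average of `u` over the normal segment through `x` is `∫₀¹
u(T_τ x) dτ`, so that its square is at most `∫₀¹ |u(T_τ x)|² dτ` (`layerSq`). In the coordinates
given by a graph chart of `Γ` and `τ`, the volume is comparable to `ε ds dτ`, uniformly in `ε`
(`GraphPatch.exists_lintegral_part`). The integral of `layerSq · |φ|²` is therefore of order `ε`
times an integral over pairs of layers `(τ, t)` of planar integrals of `|u(T_τ ·)|² |φ(T_t ·)|²`.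
The planar inequality splits each of these into two factors, and every factor, integrated over its
own layer parameter, is `ε⁻¹` times an integral over the thin domain. This leaves `ε⁻¹`
(`IsThinDatum.exists_lintegral_layerProj_sq_mul_sq_le`). If one factor lives on `Γ`, it does not
need the fibre integral, and no power of `ε` is left
(`IsThinDatum.exists_lintegral_ext_sq_mul_sq_le`).

These estimates are proved for smooth functions and carried over to Sobolev functions by interior
mollification on compact unions of layers and Fatou's lemma; no boundary regularity is used. For
functions in `H¹(Γ)`, whose weak derivatives are defined by testing on the surface, the area
formula for graphs (`IsGraphChart.map_coord_surf`) and a formula for the surface divergence in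
coordinates show that the coordinate expressions have the expected weak derivatives
(`GraphPatch.hasWeakLineDeriv_comp_χ`).

The average part is `∑ₖ (∫₀¹ uₖ(T_τ x) dτ) Xₖ(x)`, where the fields `Xₖ` (`impCol`) do not depend
on `u`. They are smooth jointly in `ε ∈ [0, 1]` and `x`, hence bounded in `C¹` uniformly in `ε`,
and so are the maps `T_τ`. By integration by parts for compositions with a family of maps
(`integral_prod_deriv_mul_comp_eq_zero`), the means `∫₀¹ w(T_τ x) dτ` are weakly differentiable,
with derivatives given by the means of `∇w` contracted with `DT_τ`. The gradient of the average
part is thus bounded by means of `u` and `∇u` (`IsThinDatum.exists_avgPart_bound`), and the last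
estimate is the product inequality applied to the components of `u` and `∇u`.

The geometry rests on `exists_normal_coords`: with a defining function `f` and an extension `ν` of
the normal, `(y, r) ↦ (y + r ν(y), f(y))` is a local diffeomorphism as long as `1 - r W` is
invertible. This gives regularity of the closest point projection and of the signed distance, and,
with compactness, the existence of a tubular radius.
-/

noncomputable section

namespace CTD

open Filter Topology
open scoped RealInnerProductSpace Convolution

/-! ### Mollification and interior approximation -/

section Mollification

variable {E : Type*} [NormedAddCommGroup E] [NormedSpace ℝ E] [FiniteDimensional ℝ E]
  [MeasureSpace E] [BorelSpace E] [(volume : Measure E).IsAddHaarMeasure]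

/-- The mollification of `h` by the normalised bump function `ρ`. -/
def mollify (ρ : ContDiffBump (0 : E)) (h : E → ℝ) : E → ℝ :=
  (ρ.normed volume ⋆[ContinuousLinearMap.lsmul ℝ ℝ, volume] h)

omit [BorelSpace E] [(volume : Measure E).IsAddHaarMeasure] in
lemma mollify_apply (ρ : ContDiffBump (0 : E)) (h : E → ℝ) (x : E) :
    mollify ρ h x = ∫ t, ρ.normed volume t * h (x - t) := by
  simp [mollify, convolution_def]

lemma mollify_congr (ρ : ContDiffBump (0 : E)) {h h' : E → ℝ} (hh : h =ᵐ[volume] h') :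
    mollify ρ h = mollify ρ h' := by
  ext x
  rw [mollify_apply, mollify_apply]
  apply integral_congr_ae
  have : (fun t => h (x - t)) =ᵐ[volume] fun t => h' (x - t) :=
    (quasiMeasurePreserving_sub_left volume x).ae_eq_comp hh
  filter_upwards [this] with t ht
  rw [ht]

lemma lintegral_normed_bump (ρ : ContDiffBump (0 : E)) :
    ∫⁻ t, ENNReal.ofReal (ρ.normed volume t) = 1 := by
  rw [← ofReal_integral_eq_lintegral_ofReal ρ.integrable_normed
    (Eventually.of_forall ρ.nonneg_normed), ρ.integral_normed, ENNReal.ofReal_one]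

/-- Mollification is a contraction of `L²`, by Jensen's inequality and Tonelli's theorem. -/
lemma eLpNorm_mollify_le (ρ : ContDiffBump (0 : E)) {h : E → ℝ}
    (hh : AEStronglyMeasurable h volume) :
    eLpNorm (mollify ρ h) 2 volume ≤ eLpNorm h 2 volume := by
  rw [mollify_congr ρ hh.ae_eq_mk, eLpNorm_congr_ae hh.ae_eq_mk]
  set k := hh.mk h with hk
  have hkm : Measurable k := hh.stronglyMeasurable_mk.measurable
  have hρm : Measurable fun t => ENNReal.ofReal (ρ.normed volume t) :=
    ρ.continuous_normed.measurable.ennreal_ofReal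
  rw [eLpNorm_eq_lintegral_rpow_enorm_toReal (by norm_num) (by norm_num),
    eLpNorm_eq_lintegral_rpow_enorm_toReal (by norm_num) (by norm_num)]
  gcongr ?_ ^ _
  have key : ∀ x, ‖mollify ρ k x‖ₑ ^ (2 : ℝ≥0∞).toReal ≤
      ∫⁻ t, ENNReal.ofReal (ρ.normed volume t) * ‖k (x - t)‖ₑ ^ (2 : ℝ) := by
    intro x
    have h1 : ‖mollify ρ k x‖ₑ ≤ ∫⁻ t, ENNReal.ofReal (ρ.normed volume t) * ‖k (x - t)‖ₑ := by
      rw [mollify_apply]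
      refine (enorm_integral_le_lintegral_enorm _).trans (le_of_eq ?_)
      congr 1 with t
      rw [enorm_mul, Real.enorm_eq_ofReal (ρ.nonneg_normed t)]
    have hkx : Measurable fun t => ‖k (x - t)‖ₑ :=
      (hkm.comp (measurable_const.sub measurable_id)).enorm
    have h2 : ∫⁻ t, ENNReal.ofReal (ρ.normed volume t) * ‖k (x - t)‖ₑ ≤
        (∫⁻ t, ENNReal.ofReal (ρ.normed volume t) * ‖k (x - t)‖ₑ ^ (2 : ℝ)) ^ (1 / 2 : ℝ) := by
      have := ENNReal.lintegral_mul_le_Lp_mul_Lq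
        (volume.withDensity fun t => ENNReal.ofReal (ρ.normed volume t))
        (Real.HolderConjugate.two_two) (f := fun t => ‖k (x - t)‖ₑ) (g := fun _ => 1)
        hkx.aemeasurable aemeasurable_const
      simp only [Pi.mul_apply, mul_one, ENNReal.one_rpow] at this
      rw [lintegral_withDensity_eq_lintegral_mul _ hρm hkx,
        lintegral_withDensity_eq_lintegral_mul _ hρm (hkx.pow_const _),
        lintegral_withDensity_eq_lintegral_mul _ hρm measurable_const] at this
      simpa [lintegral_normed_bump] using this
    calc ‖mollify ρ k x‖ₑ ^ (2 : ℝ≥0∞).toReal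
        ≤ ((∫⁻ t, ENNReal.ofReal (ρ.normed volume t) * ‖k (x - t)‖ₑ ^ (2 : ℝ)) ^ (1 / 2 : ℝ))
          ^ (2 : ℝ≥0∞).toReal := by gcongr; exact h1.trans h2
      _ = _ := by rw [← ENNReal.rpow_mul]; norm_num
  refine (lintegral_mono key).trans ?_
  have hm2 : Measurable (Function.uncurry fun (x t : E) =>
      ENNReal.ofReal (ρ.normed volume t) * ‖k (x - t)‖ₑ ^ (2 : ℝ)) := by
    apply Measurable.mul
    · exact hρm.comp measurable_snd
    · exact ((hkm.comp (measurable_fst.sub measurable_snd)).enorm).pow_const _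
  rw [lintegral_lintegral_swap hm2.aemeasurable]
  have : ∀ t : E, ∫⁻ x, ENNReal.ofReal (ρ.normed volume t) * ‖k (x - t)‖ₑ ^ (2 : ℝ) =
      ENNReal.ofReal (ρ.normed volume t) * ∫⁻ x, ‖k x‖ₑ ^ (2 : ℝ) := by
    intro t
    have hkt : Measurable fun x => ‖k (x - t)‖ₑ ^ (2 : ℝ) :=
      (hkm.comp (measurable_id.sub measurable_const)).enorm.pow_const _
    rw [lintegral_const_mul _ hkt]
    congr 1
    exact lintegral_sub_right_eq_self (fun x => ‖k x‖ₑ ^ (2 : ℝ)) t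
  simp_rw [this]
  rw [lintegral_mul_const _ hρm, lintegral_normed_bump, one_mul]
  simp

lemma mollify_sub (ρ : ContDiffBump (0 : E)) {h h' : E → ℝ}
    (hh : LocallyIntegrable h volume) (hh' : LocallyIntegrable h' volume) :
    mollify ρ (h - h') = mollify ρ h - mollify ρ h' := by
  ext x
  have e : ∀ {f : E → ℝ}, LocallyIntegrable f volume →
      Integrable (fun t => ρ.normed volume t * f (x - t)) volume := fun hf => by
    simpa [ConvolutionExistsAt] using
      (ρ.hasCompactSupport_normed.convolutionExists_left (ContinuousLinearMap.lsmul ℝ ℝ)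
        ρ.continuous_normed hf) x
  simp only [mollify_apply, Pi.sub_apply, mul_sub]
  exact integral_sub (e hh) (e hh')

/-- Mollifications converge in `L²` as the radius of the bump function tends to zero. -/
lemma exists_eLpNorm_mollify_sub_le {h : E → ℝ} (hh : MemLp h 2 volume) {η : ℝ≥0∞} (hη : η ≠ 0) :
    ∃ δ : ℝ, 0 < δ ∧ ∀ ρ : ContDiffBump (0 : E), ρ.rOut < δ →
      eLpNorm (mollify ρ h - h) 2 volume ≤ η := by
  have hη3 : η / 3 ≠ 0 := by simp [hη]
  obtain ⟨k, hkc, hk1, hk2, hk3⟩ := hh.exists_hasCompactSupport_eLpNorm_sub_le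
    ENNReal.ofNat_ne_top hη3
  -- the mollification of the continuous `k` is uniformly close to `k`, on a bounded set
  set S := Metric.cthickening 1 (tsupport k) with hS
  have hSc : IsCompact S := IsCompact.cthickening hkc
  have huc : UniformContinuous k := hkc.uniformContinuous_of_continuous hk2
  obtain ⟨r, hr0, hr⟩ : ∃ r : ℝ, 0 < r ∧ ENNReal.ofReal r * (volume S) ^ (1 / 2 : ℝ) ≤ η / 3 := by
    have hfin : (volume S) ^ (1 / 2 : ℝ) ≠ ⊤ :=
      ENNReal.rpow_ne_top_of_nonneg (by norm_num) hSc.measure_lt_top.ne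
    have ht : Tendsto (fun r : ℝ => ENNReal.ofReal r * (volume S) ^ (1 / 2 : ℝ)) (𝓝 0) (𝓝 0) := by
      have := (ENNReal.Tendsto.mul_const (b := (volume S) ^ (1 / 2 : ℝ))
        (ENNReal.tendsto_ofReal (tendsto_id (α := ℝ) (x := 𝓝 0))) (Or.inr hfin))
      simpa using this
    have := (ht.eventually_lt_const (pos_iff_ne_zero.2 hη3))
    obtain ⟨ε, hε, hεb⟩ := Metric.eventually_nhds_iff.1 this
    exact ⟨ε / 2, by positivity, (hεb (by simpa [abs_of_pos hε] using hε)).le⟩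
  obtain ⟨δ, hδ0, hδ⟩ := Metric.uniformContinuous_iff.1 huc r hr0
  refine ⟨min δ 1, by positivity, fun ρ hρ => ?_⟩
  have hloc : LocallyIntegrable h volume := hh.locallyIntegrable (by norm_num)
  have hkloc : LocallyIntegrable k volume := hk2.locallyIntegrable
  have hdecomp : mollify ρ h - h = mollify ρ (h - k) + ((mollify ρ k - k) + (k - h)) := by
    rw [mollify_sub ρ hloc hkloc]; abel
  have hms : ∀ {f : E → ℝ}, LocallyIntegrable f volume → Continuous (mollify ρ f) := fun hf =>
    ρ.hasCompactSupport_normed.continuous_convolution_left _ ρ.continuous_normed hf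
  have hb : eLpNorm (mollify ρ k - k) 2 volume ≤ η / 3 := by
    have hsupp : ∀ x, x ∉ S → (mollify ρ k - k) x = 0 := by
      intro x hx
      have hxk : ∀ t, dist t 0 < 1 → k (x - t) = 0 := by
        intro t ht
        by_contra hne
        apply hx
        refine Metric.mem_cthickening_of_dist_le x (x - t) 1 _ (subset_tsupport _ hne) ?_
        simpa [dist_eq_norm] using ht.le
      rw [Pi.sub_apply, mollify_apply]
      have h0 : k x = 0 := by simpa using hxk 0 (by simp)
      rw [h0, sub_zero]
      rw [← integral_zero E ℝ]
      congr 1 with t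
      by_cases ht : dist t 0 < 1
      · simp [hxk t ht]
      · have : ρ.normed volume t = 0 := by
          have h2 : t ∉ Function.support (ρ.normed volume) := by
            rw [ρ.support_normed_eq]
            simp only [Metric.mem_ball, not_lt]
            push Not at ht
            exact (hρ.le.trans (min_le_right _ _)).trans ht
          simpa using h2
        simp [this]
    have hpt : ∀ x, ‖(mollify ρ k - k) x‖ ≤ r := by
      intro x
      rw [Pi.sub_apply, ← dist_eq_norm]
      exact ContDiffBump.dist_normed_convolution_le hk2.aestronglyMeasurable
        fun z hz => (hδ ((Metric.mem_ball.1 hz).trans (hρ.trans_le (min_le_left _ _)))).le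
    have : mollify ρ k - k = S.indicator (mollify ρ k - k) := by
      ext x
      by_cases hx : x ∈ S
      · simp [hx]
      · rw [hsupp x hx, indicator_of_notMem hx]
    rw [this, eLpNorm_indicator_eq_eLpNorm_restrict hSc.measurableSet]
    refine (eLpNorm_le_of_ae_bound (Eventually.of_forall hpt)).trans ?_
    rw [Measure.restrict_apply_univ, mul_comm]
    simpa using hr
  calc eLpNorm (mollify ρ h - h) 2 volume
      ≤ eLpNorm (mollify ρ (h - k)) 2 volume +
        (eLpNorm (mollify ρ k - k) 2 volume + eLpNorm (k - h) 2 volume) := by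
        rw [hdecomp]
        refine (eLpNorm_add_le ?_ ?_ (by norm_num)).trans ?_
        · exact (hms (hloc.sub hkloc)).aestronglyMeasurable
        · exact ((hms hkloc).aestronglyMeasurable.sub hk2.aestronglyMeasurable).add
            (hk2.aestronglyMeasurable.sub hh.1)
        · gcongr
          exact eLpNorm_add_le ((hms hkloc).aestronglyMeasurable.sub hk2.aestronglyMeasurable)
            (hk2.aestronglyMeasurable.sub hh.1) (by norm_num)
    _ ≤ η / 3 + (η / 3 + η / 3) := by
        gcongr
        · exact (eLpNorm_mollify_le ρ (hh.1.sub hk3.1)).trans hk1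
        · rw [eLpNorm_sub_comm]; exact hk1
    _ = η := by rw [← add_assoc, ENNReal.add_thirds]

omit [FiniteDimensional ℝ E] [BorelSpace E] [(volume : Measure E).IsAddHaarMeasure] in
/-- `ψ` is the weak derivative of `φ` in the direction `v` on `O`. -/
def HasWeakLineDeriv (O : Set E) (v : E) (φ ψ : E → ℝ) : Prop :=
  ∀ ζ : E → ℝ, ContDiff ℝ ∞ ζ → HasCompactSupport ζ → tsupport ζ ⊆ O →
    ∫ x in O, φ x * fderiv ℝ ζ x v = -∫ x in O, ψ x * ζ x

/-- On points whose distance from the complement of `O` exceeds the radius of the bump function,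
mollification commutes with weak derivatives in `O`. -/
lemma fderiv_mollify_indicator {O : Set E} (hO : IsOpen O) {v : E} {w g : E → ℝ}
    (hw : LocallyIntegrable (O.indicator w) volume) (hd : HasWeakLineDeriv O v w g)
    (ρ : ContDiffBump (0 : E)) {x : E} (hx : Metric.closedBall x ρ.rOut ⊆ O) :
    fderiv ℝ (mollify ρ (O.indicator w)) x v = mollify ρ (O.indicator g) x := by
  have hρ1 : ContDiff ℝ 1 (ρ.normed volume) := ρ.contDiff_normed
  have h1 := (ρ.hasCompactSupport_normed (μ := (volume : Measure E))).hasFDerivAt_convolution_left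
    (ContinuousLinearMap.lsmul ℝ ℝ) hρ1 hw x
  have hex : ConvolutionExistsAt (fderiv ℝ (ρ.normed volume)) (O.indicator w) x
      ((ContinuousLinearMap.lsmul ℝ ℝ).precompL E) volume :=
    ((ρ.hasCompactSupport_normed (μ := (volume : Measure E))).fderiv ℝ).convolutionExists_left _
      (hρ1.continuous_fderiv (by norm_num)) hw x
  rw [show mollify ρ (O.indicator w) =
    (ρ.normed volume ⋆[ContinuousLinearMap.lsmul ℝ ℝ, volume] O.indicator w) from rfl, h1.fderiv,
    convolution_def, ContinuousLinearMap.integral_apply hex]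
  set ζ : E → ℝ := fun y => ρ.normed volume (x - y) with hζ
  have hζd : ContDiff ℝ ∞ ζ := ρ.contDiff_normed.comp (contDiff_const.sub contDiff_id)
  have hsub : tsupport ζ ⊆ Metric.closedBall x ρ.rOut := by
    apply closure_minimal _ Metric.isClosed_closedBall
    intro y hy
    have : x - y ∈ Function.support (ρ.normed (volume : Measure E)) := hy
    rw [ρ.support_normed_eq] at this
    simp only [Metric.mem_ball, dist_zero_right] at this
    rw [Metric.mem_closedBall, dist_comm, dist_eq_norm]
    exact this.le
  have hζc : HasCompactSupport ζ :=
    (isCompact_closedBall x ρ.rOut).of_isClosed_subset (isClosed_tsupport _) hsub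
  have hfd : ∀ y, fderiv ℝ ζ y v = -(fderiv ℝ (ρ.normed volume) (x - y) v) := by
    intro y
    have h2 : HasFDerivAt ζ ((fderiv ℝ (ρ.normed volume) (x - y)).comp
        (-(ContinuousLinearMap.id ℝ E))) y := by
      refine HasFDerivAt.comp y (g := ρ.normed volume) (f := fun y => x - y)
        (hρ1.differentiable (by norm_num) _).hasFDerivAt ?_
      simpa using (hasFDerivAt_id y).const_sub x
    rw [h2.fderiv]
    simp
  have key := hd ζ hζd hζc (hsub.trans hx)
  rw [mollify_apply]
  calc ∫ t, (((ContinuousLinearMap.lsmul ℝ ℝ).precompL E) (fderiv ℝ (ρ.normed volume) t))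
          (O.indicator w (x - t)) v
      = ∫ t, (fderiv ℝ (ρ.normed volume) t v) * O.indicator w (x - t) := by
        congr 1
    _ = ∫ y, (fderiv ℝ (ρ.normed volume) (x - y) v) * O.indicator w y := by
        rw [← integral_sub_left_eq_self _ volume x]
        simp
    _ = -∫ y in O, w y * fderiv ℝ ζ y v := by
        rw [← integral_neg, ← integral_indicator hO.measurableSet]
        congr 1 with y
        by_cases hy : y ∈ O
        · simp [hy, hfd, mul_comm]
        · simp [hy]
    _ = ∫ y in O, g y * ζ y := by rw [key, neg_neg]
    _ = ∫ y, ρ.normed volume (x - y) * O.indicator g y := by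
        rw [← integral_indicator hO.measurableSet]
        congr 1 with y
        by_cases hy : y ∈ O
        · simp [hy, hζ, mul_comm]
        · simp [hy]
    _ = ∫ t, ρ.normed volume t * O.indicator g (x - t) := by
        rw [← integral_sub_left_eq_self _ volume x]
        simp

/-- Interior approximation of Sobolev functions by smooth functions, on a compact subset. -/
theorem exists_smooth_approx {O : Set E} (hO : IsOpen O) {ι : Type*} [Finite ι] {v : ι → E}
    {w : E → ℝ} {g : ι → E → ℝ} (hw : MemLp w 2 (volume.restrict O))
    (hg : ∀ i, MemLp (g i) 2 (volume.restrict O)) (hd : ∀ i, HasWeakLineDeriv O (v i) w (g i))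
    {K : Set E} (hK : IsCompact K) (hKO : K ⊆ O) {η : ℝ≥0∞} (hη : η ≠ 0) :
    ∃ f : E → ℝ, ContDiff ℝ ∞ f ∧ eLpNorm (f - w) 2 (volume.restrict K) ≤ η ∧
      ∀ i, eLpNorm ((fun x => fderiv ℝ f x (v i)) - g i) 2 (volume.restrict K) ≤ η := by
  have hw' : MemLp (O.indicator w) 2 volume := (memLp_indicator_iff_restrict hO.measurableSet).2 hw
  have hg' : ∀ i, MemLp (O.indicator (g i)) 2 volume := fun i =>
    (memLp_indicator_iff_restrict hO.measurableSet).2 (hg i)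
  have hloc : LocallyIntegrable (O.indicator w) volume := hw'.locallyIntegrable (by norm_num)
  obtain ⟨δ₁, hδ₁, h₁⟩ := exists_eLpNorm_mollify_sub_le hw' hη
  choose δ₂ hδ₂ h₂ using fun i => exists_eLpNorm_mollify_sub_le (hg' i) hη
  obtain ⟨δ₃, hδ₃, h₃⟩ := hK.exists_cthickening_subset_open hO hKO
  obtain ⟨δ, hδ, hδa, hδb, hδc⟩ : ∃ δ : ℝ, 0 < δ ∧ δ < δ₁ ∧ (∀ i, δ < δ₂ i) ∧ δ < δ₃ := by
    have e : ∀ᶠ δ in 𝓝[>] (0 : ℝ), δ < δ₁ ∧ (∀ i, δ < δ₂ i) ∧ δ < δ₃ := by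
      have f : ∀ {a : ℝ}, 0 < a → ∀ᶠ δ in 𝓝[>] (0 : ℝ), δ < a := fun ha =>
        mem_nhdsWithin_of_mem_nhds (Iio_mem_nhds ha)
      exact (f hδ₁).and ((eventually_all.2 fun i => f (hδ₂ i)).and (f hδ₃))
    obtain ⟨δ, h, h'⟩ := (e.and self_mem_nhdsWithin).exists
    exact ⟨δ, h', h⟩
  let ρ : ContDiffBump (0 : E) := ⟨δ / 2, δ, by positivity, by linarith⟩
  have hmono : ∀ {f h : E → ℝ}, (∀ x ∈ K, f x = h x) →
      eLpNorm f 2 (volume.restrict K) ≤ eLpNorm h 2 volume := by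
    intro f h hfh
    rw [eLpNorm_congr_ae (g := h)
      ((ae_restrict_mem hK.measurableSet).mono fun x hx => hfh x hx)]
    exact eLpNorm_mono_measure _ Measure.restrict_le_self
  refine ⟨mollify ρ (O.indicator w), ?_, ?_, fun i => ?_⟩
  · exact ρ.hasCompactSupport_normed.contDiff_convolution_left _ ρ.contDiff_normed hloc
  · refine (hmono fun x hx => ?_).trans (h₁ ρ hδa)
    simp [hKO hx]
  · refine (hmono fun x hx => ?_).trans (h₂ i ρ (hδb i))
    have hx' : Metric.closedBall x ρ.rOut ⊆ O := by
      refine Subset.trans ?_ h₃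
      exact (Metric.closedBall_subset_cthickening hx _).trans (Metric.cthickening_mono hδc.le _)
    simp only [Pi.sub_apply]
    rw [fderiv_mollify_indicator hO hloc (hd i) ρ hx']
    simp [hKO hx]

end Mollification

/-! ### A product inequality on squares -/

section Square

/-- A `C¹` function on an interval is bounded pointwise by its mean square plus the total variation
of its square. -/
lemma enorm_sq_le_lintegral_Icc {ρ : ℝ} (hρ : 0 < ρ) {a a' : ℝ → ℝ}
    (ha : ∀ x ∈ Icc (-ρ) ρ, HasDerivAt a (a' x) x) (ha' : ContinuousOn a' (Icc (-ρ) ρ))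
    {x : ℝ} (hx : x ∈ Icc (-ρ) ρ) :
    ‖a x‖ₑ ^ 2 ≤ ∫⁻ y in Icc (-ρ) ρ,
      (ENNReal.ofReal (2 * ρ)⁻¹ * ‖a y‖ₑ ^ 2 + 2 * (‖a y‖ₑ * ‖a' y‖ₑ)) := by
  set I := Icc (-ρ) ρ with hI
  have hac : ContinuousOn a I := fun y hy => (ha y hy).continuousAt.continuousWithinAt
  have hD : ∀ y ∈ I, ‖a x‖ₑ ^ 2 ≤ ‖a y‖ₑ ^ 2 + ∫⁻ z in I, 2 * (‖a z‖ₑ * ‖a' z‖ₑ) := by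
    intro y hy
    have hsub : uIcc y x ⊆ I := by
      rw [hI, ← uIcc_of_le (by linarith : -ρ ≤ ρ)]
      exact uIcc_subset_uIcc (by rwa [uIcc_of_le (by linarith)]) (by rwa [uIcc_of_le (by linarith)])
    have hftc : ∫ z in y..x, 2 * (a z * a' z) = a x ^ 2 - a y ^ 2 := by
      apply intervalIntegral.integral_eq_sub_of_hasDerivAt
      · intro z hz
        have := (ha z (hsub hz)).pow 2
        exact this.congr_deriv (by simp [mul_assoc])
      · apply ContinuousOn.intervalIntegrable
        exact (continuousOn_const.mul (hac.mul ha')).mono hsub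
    have h1 : ‖a x ^ 2 - a y ^ 2‖ₑ ≤ ∫⁻ z in I, 2 * (‖a z‖ₑ * ‖a' z‖ₑ) := by
      rw [← hftc, ← ofReal_norm, intervalIntegral.norm_intervalIntegral_eq,
        ofReal_norm]
      refine (enorm_integral_le_lintegral_enorm _).trans ?_
      refine (lintegral_mono_set (uIoc_subset_uIcc.trans hsub)).trans (le_of_eq ?_)
      congr 1 with z
      rw [enorm_mul, enorm_mul]
      simp [Real.enorm_eq_ofReal]
    calc ‖a x‖ₑ ^ 2 = ‖a x ^ 2‖ₑ := by rw [enorm_pow]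
      _ = ‖a y ^ 2 + (a x ^ 2 - a y ^ 2)‖ₑ := by ring_nf
      _ ≤ ‖a y ^ 2‖ₑ + ‖a x ^ 2 - a y ^ 2‖ₑ := enorm_add_le _ _
      _ ≤ _ := by rw [enorm_pow]; gcongr
  have hvol : volume I = ENNReal.ofReal (2 * ρ) := by
    rw [hI, Real.volume_Icc]; congr 1; ring
  have h2 : ∫⁻ _ in I, ‖a x‖ₑ ^ 2 ≤
      ∫⁻ y in I, (‖a y‖ₑ ^ 2 + ∫⁻ z in I, 2 * (‖a z‖ₑ * ‖a' z‖ₑ)) :=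
    setLIntegral_mono' measurableSet_Icc hD
  have ham : AEMeasurable (fun y => ‖a y‖ₑ ^ 2) (volume.restrict I) :=
    (hac.aemeasurable measurableSet_Icc).enorm.pow_const _
  rw [lintegral_add_left' ham, setLIntegral_const, setLIntegral_const, hvol] at h2
  have hc : ENNReal.ofReal (2 * ρ)⁻¹ * ENNReal.ofReal (2 * ρ) = 1 := by
    rw [← ENNReal.ofReal_mul (by positivity), inv_mul_cancel₀ (by positivity), ENNReal.ofReal_one]
  rw [lintegral_add_left' (ham.const_mul _), lintegral_const_mul'' _ ham]
  calc ‖a x‖ₑ ^ 2 = ENNReal.ofReal (2 * ρ)⁻¹ * (‖a x‖ₑ ^ 2 * ENNReal.ofReal (2 * ρ)) := by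
        rw [mul_comm (‖a x‖ₑ ^ 2), ← mul_assoc, hc, one_mul]
    _ ≤ ENNReal.ofReal (2 * ρ)⁻¹ * (_ + _) := mul_le_mul_right h2 _
    _ = _ := by
        rw [mul_add, mul_comm (∫⁻ z in I, 2 * (‖a z‖ₑ * ‖a' z‖ₑ)) (ENNReal.ofReal (2 * ρ)),
          ← mul_assoc (ENNReal.ofReal (2 * ρ)⁻¹) (ENNReal.ofReal (2 * ρ)), hc, one_mul]

/-- The closed square with centre `0` and side `2ρ`. -/
def square (ρ : ℝ) : Set (ℝ × ℝ) := Icc (-ρ) ρ ×ˢ Icc (-ρ) ρ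

lemma isCompact_square (ρ : ℝ) : IsCompact (square ρ) := isCompact_Icc.prod isCompact_Icc

lemma measurableSet_square (ρ : ℝ) : MeasurableSet (square ρ) :=
  measurableSet_Icc.prod measurableSet_Icc

/-- The product form of Ladyzhenskaya's inequality on a square: each square is dominated by its
maximal function in one of the two coordinate directions. -/
theorem lintegral_sq_mul_sq_le {ρ : ℝ} (hρ : 0 < ρ) {a b : ℝ × ℝ → ℝ}
    {a' b' : ℝ × ℝ → (ℝ × ℝ →L[ℝ] ℝ)}
    (ha : ∀ s ∈ square ρ, HasFDerivAt a (a' s) s) (ha' : ContinuousOn a' (square ρ))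
    (hb : ∀ s ∈ square ρ, HasFDerivAt b (b' s) s) (hb' : ContinuousOn b' (square ρ)) :
    ∫⁻ s in square ρ, ‖a s‖ₑ ^ 2 * ‖b s‖ₑ ^ 2 ≤
      (∫⁻ s in square ρ, (ENNReal.ofReal (2 * ρ)⁻¹ * ‖a s‖ₑ ^ 2 + 2 * (‖a s‖ₑ * ‖a' s‖ₑ))) *
      ∫⁻ s in square ρ, (ENNReal.ofReal (2 * ρ)⁻¹ * ‖b s‖ₑ ^ 2 + 2 * (‖b s‖ₑ * ‖b' s‖ₑ)) := by
  have hmeas : ∀ {c : ℝ × ℝ → ℝ} {c' : ℝ × ℝ → (ℝ × ℝ →L[ℝ] ℝ)},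
      (∀ s ∈ square ρ, HasFDerivAt c (c' s) s) → ContinuousOn c' (square ρ) →
      AEMeasurable (fun s => ‖c s‖ₑ) (volume.restrict (square ρ)) ∧
      AEMeasurable (fun s => ‖c' s‖ₑ) (volume.restrict (square ρ)) := by
    intro c c' hc hc'
    have : ContinuousOn c (square ρ) := fun s hs => (hc s hs).continuousAt.continuousWithinAt
    exact ⟨(this.aemeasurable (measurableSet_square ρ)).enorm,
      (hc'.aestronglyMeasurable (measurableSet_square ρ)).enorm⟩
  obtain ⟨ham, ham'⟩ := hmeas ha ha'
  obtain ⟨hbm, hbm'⟩ := hmeas hb hb'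
  have hA := ((ham.pow_const 2).const_mul (ENNReal.ofReal (2 * ρ)⁻¹)).add
    ((ham.mul ham').const_mul 2)
  have hB := ((hbm.pow_const 2).const_mul (ENNReal.ofReal (2 * ρ)⁻¹)).add
    ((hbm.mul hbm').const_mul 2)
  have hAB := (ham.pow_const 2).mul (hbm.pow_const 2)
  have hprod : (volume.restrict (square ρ) : Measure (ℝ × ℝ)) =
      (volume.restrict (Icc (-ρ) ρ)).prod (volume.restrict (Icc (-ρ) ρ)) := by
    rw [Measure.prod_restrict]; rfl
  set A : ℝ × ℝ → ℝ≥0∞ := fun s =>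
    ENNReal.ofReal (2 * ρ)⁻¹ * ‖a s‖ₑ ^ 2 + 2 * (‖a s‖ₑ * ‖a' s‖ₑ) with hAdef
  set B : ℝ × ℝ → ℝ≥0∞ := fun s =>
    ENNReal.ofReal (2 * ρ)⁻¹ * ‖b s‖ₑ ^ 2 + 2 * (‖b s‖ₑ * ‖b' s‖ₑ) with hBdef
  change AEMeasurable A _ at hA
  change AEMeasurable B _ at hB
  change AEMeasurable (fun s => ‖a s‖ₑ ^ 2 * ‖b s‖ₑ ^ 2) _ at hAB
  rw [hprod] at hA hB hAB ⊢
  rw [lintegral_prod _ hAB, lintegral_prod _ hA, lintegral_prod_symm _ hB]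
  have hA1 : ∀ x ∈ Icc (-ρ) ρ, ∀ y ∈ Icc (-ρ) ρ, ‖a (x, y)‖ₑ ^ 2 ≤
      ∫⁻ z in Icc (-ρ) ρ, A (x, z) := by
    intro x hx y hy
    have hl : ∀ z : ℝ, HasFDerivAt (fun z : ℝ => (x, z)) (ContinuousLinearMap.inr ℝ ℝ ℝ) z :=
      fun z => hasFDerivAt_prodMk_right x z
    refine (enorm_sq_le_lintegral_Icc hρ (a := fun z => a (x, z))
      (a' := fun z => a' (x, z) (0, 1)) (fun z hz => ?_) ?_ hy).trans ?_
    · exact ((ha (x, z) ⟨hx, hz⟩).comp z (hl z)).hasDerivAt.congr_deriv (by simp)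
    · have : ContinuousOn (fun z : ℝ => a' (x, z)) (Icc (-ρ) ρ) :=
        ha'.comp (by fun_prop) fun z hz => ⟨hx, hz⟩
      exact this.clm_apply continuousOn_const
    · refine lintegral_mono fun z => ?_
      simp only [hAdef]
      gcongr
      refine ((a' (x, z)).le_opENorm _).trans ?_
      simp [← ofReal_norm, Prod.norm_def]
  have hB1 : ∀ y ∈ Icc (-ρ) ρ, ∀ x ∈ Icc (-ρ) ρ, ‖b (x, y)‖ₑ ^ 2 ≤
      ∫⁻ z in Icc (-ρ) ρ, B (z, y) := by
    intro y hy x hx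
    have hl : ∀ z : ℝ, HasFDerivAt (fun z : ℝ => (z, y)) (ContinuousLinearMap.inl ℝ ℝ ℝ) z :=
      fun z => hasFDerivAt_prodMk_left z y
    refine (enorm_sq_le_lintegral_Icc hρ (a := fun z => b (z, y))
      (a' := fun z => b' (z, y) (1, 0)) (fun z hz => ?_) ?_ hx).trans ?_
    · exact ((hb (z, y) ⟨hz, hy⟩).comp z (hl z)).hasDerivAt.congr_deriv (by simp)
    · have : ContinuousOn (fun z : ℝ => b' (z, y)) (Icc (-ρ) ρ) :=
        hb'.comp (by fun_prop) fun z hz => ⟨hz, hy⟩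
      exact this.clm_apply continuousOn_const
    · refine lintegral_mono fun z => ?_
      simp only [hBdef]
      gcongr
      refine ((b' (z, y)).le_opENorm _).trans ?_
      simp [← ofReal_norm, Prod.norm_def]
  calc ∫⁻ x in Icc (-ρ) ρ, ∫⁻ y in Icc (-ρ) ρ, ‖a (x, y)‖ₑ ^ 2 * ‖b (x, y)‖ₑ ^ 2
      ≤ ∫⁻ x in Icc (-ρ) ρ, ∫⁻ y in Icc (-ρ) ρ,
          (∫⁻ z in Icc (-ρ) ρ, A (x, z)) * ∫⁻ z in Icc (-ρ) ρ, B (z, y) := by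
        refine setLIntegral_mono' measurableSet_Icc fun x hx =>
          setLIntegral_mono' measurableSet_Icc fun y hy => ?_
        exact mul_le_mul' (hA1 x hx y hy) (hB1 y hy x hx)
    _ = _ := by
        have h1 : AEMeasurable (fun y => ∫⁻ z in Icc (-ρ) ρ, B (z, y))
            (volume.restrict (Icc (-ρ) ρ)) := hB.lintegral_prod_left'
        have h2 : AEMeasurable (fun x => ∫⁻ z in Icc (-ρ) ρ, A (x, z))
            (volume.restrict (Icc (-ρ) ρ)) := hA.lintegral_prod_right'
        simp_rw [lintegral_const_mul'' _ h1]
        rw [lintegral_mul_const'' _ h2]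

end Square

/-! ### Graph charts of a closed surface -/

section LocalInverse

variable {E : Type*} [NormedAddCommGroup E] [NormedSpace ℝ E] [FiniteDimensional ℝ E]

/-- The inverse function theorem on a finite-dimensional space, with neighbourhoods on which the
local inverse is smooth. -/
lemma exists_local_inverse {Φ : E → E} {a : E} {k : ℕ} (hk : k ≠ 0) (hΦ : ContDiffAt ℝ k Φ a)
    (hinj : Function.Injective (fderiv ℝ Φ a)) {N : Set E} (hN : N ∈ 𝓝 a) :
    ∃ V W : Set E, ∃ Ψ : E → E, IsOpen V ∧ IsOpen W ∧ a ∈ V ∧ V ⊆ N ∧ Φ a ∈ W ∧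
      (∀ x ∈ V, Φ x ∈ W ∧ Ψ (Φ x) = x) ∧ (∀ y ∈ W, Ψ y ∈ V ∧ Φ (Ψ y) = y) ∧
      ContDiffOn ℝ k Ψ W := by
  have : CompleteSpace E := FiniteDimensional.complete ℝ E
  have hk0 : (k : WithTop ℕ∞) ≠ 0 := by exact_mod_cast hk
  let e : E ≃L[ℝ] E :=
    (LinearEquiv.ofInjectiveEndo (fderiv ℝ Φ a : E →ₗ[ℝ] E) hinj).toContinuousLinearEquiv
  have he : (e : E →L[ℝ] E) = fderiv ℝ Φ a := by ext x; rfl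
  have hd : HasFDerivAt Φ (e : E →L[ℝ] E) a := by
    rw [he]; exact (hΦ.differentiableAt hk0).hasFDerivAt
  set H := hΦ.toOpenPartialHomeomorph Φ hd hk0 with hH
  have hHc : (H : E → E) = Φ := hΦ.toOpenPartialHomeomorph_coe hd hk0
  have ha : a ∈ H.source := hΦ.mem_toOpenPartialHomeomorph_source hd hk0
  have hs : ContDiffAt ℝ k H.symm (Φ a) := hΦ.to_localInverse hd hk0
  have hev : ∀ᶠ y in 𝓝 (Φ a), ContDiffAt ℝ k H.symm y := hs.eventually (by simp)
  have hat : Φ a ∈ H.target := hΦ.image_mem_toOpenPartialHomeomorph_target hd hk0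
  have hsa : H.symm (Φ a) = a := by rw [← hHc]; exact H.left_inv ha
  have hN' : ∀ᶠ y in 𝓝 (Φ a), H.symm y ∈ N := by
    apply hs.continuousAt.eventually
    rw [hsa]; exact hN
  obtain ⟨W, hW, hWo, haW⟩ := eventually_nhds_iff.1
    ((hev.and hN').and (H.open_target.mem_nhds hat))
  refine ⟨H.source ∩ H ⁻¹' W, W, H.symm, H.isOpen_inter_preimage hWo, hWo, ⟨ha, ?_⟩, ?_, haW,
    ?_, ?_, fun y hy => (hW y hy).1.1.contDiffWithinAt⟩
  · rw [hHc]; exact haW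
  · rintro x ⟨hx, hxW⟩
    have := (hW _ hxW).1.2
    rwa [H.left_inv hx] at this
  · rintro x ⟨hx, hxW⟩
    rw [← hHc]
    exact ⟨hxW, H.left_inv hx⟩
  · intro y hy
    have ht := (hW y hy).2
    rw [← hHc]
    exact ⟨⟨H.map_target ht, by rw [mem_preimage, H.right_inv ht]; exact hy⟩, H.right_inv ht⟩

end LocalInverse

section Surface

variable {Γ : Set E3} {n : E3 → E3}

/-- Near a point of the surface there are a defining function `f` and a unit vector field `ν`
extending `n`, with `∇f` a positive multiple of `ν`. -/
lemma IsClosedSurface.exists_extension (hΓ : IsClosedSurface Γ n) {y₀ : E3} (hy₀ : y₀ ∈ Γ) :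
    ∃ U : Set E3, IsOpen U ∧ y₀ ∈ U ∧ ∃ (f : E3 → ℝ) (ν : E3 → E3), ContDiffOn ℝ 5 f U ∧
      ContDiffOn ℝ 4 ν U ∧ Γ ∩ U = {x ∈ U | f x = 0} ∧ (∀ x ∈ U, ‖ν x‖ = 1) ∧
      (∀ x ∈ Γ ∩ U, n x = ν x) ∧
      ∀ x ∈ U, ∃ l : ℝ, 0 < l ∧ ∀ v, fderiv ℝ f x v = l * ⟪ν x, v⟫ := by
  obtain ⟨U, hU, hyU, f, hf, hΓU, hn⟩ := hΓ.exists_defining y₀ hy₀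
  have hg : ContDiffOn ℝ 4 (gradient f) U := by
    have h1 : ContDiffOn ℝ 4 (fderiv ℝ f) U := hf.fderiv_of_isOpen hU (by norm_num)
    exact (InnerProductSpace.toDual ℝ E3).symm.contDiff.comp_contDiffOn h1
  set U' := U ∩ gradient f ⁻¹' {0}ᶜ with hU'
  have hU'o : IsOpen U' := hg.continuousOn.isOpen_inter_preimage hU isOpen_compl_singleton
  have hy' : y₀ ∈ U' := ⟨hyU, (hn y₀ ⟨hy₀, hyU⟩).1⟩
  refine ⟨U', hU'o, hy', f, fun x => ‖gradient f x‖⁻¹ • gradient f x,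
    hf.mono inter_subset_left, ?_, ?_, ?_, ?_, ?_⟩
  · have hg' := hg.mono (inter_subset_left : U' ⊆ U)
    exact ((hg'.norm ℝ fun x hx => hx.2).inv fun x hx => norm_ne_zero_iff.2 hx.2).smul hg'
  · ext x
    constructor
    · rintro ⟨hx, hxU⟩
      have : x ∈ Γ ∩ U := ⟨hx, hxU.1⟩
      rw [hΓU] at this
      exact ⟨hxU, this.2⟩
    · rintro ⟨hxU, hx⟩
      have : x ∈ {x ∈ U | f x = 0} := ⟨hxU.1, hx⟩
      rw [← hΓU] at this
      exact ⟨this.1, hxU⟩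
  · intro x hx
    have : gradient f x ≠ 0 := hx.2
    rw [norm_smul, norm_inv, norm_norm, inv_mul_cancel₀ (norm_ne_zero_iff.2 this)]
  · intro x hx
    exact (hn x ⟨hx.1, hx.2.1⟩).2
  · intro x hx
    have hx0 : 0 < ‖gradient f x‖ := norm_pos_iff.2 hx.2
    refine ⟨‖gradient f x‖, hx0, fun v => ?_⟩
    rw [real_inner_smul_left, ← mul_assoc, mul_inv_cancel₀ hx0.ne', one_mul, gradient,
      InnerProductSpace.toDual_symm_apply]

lemma IsClosedSurface.norm_normal (hΓ : IsClosedSurface Γ n) {y : E3} (hy : y ∈ Γ) :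
    ‖n y‖ = 1 := by
  obtain ⟨U, _, hyU, f, ν, _, _, _, h1, h2, _⟩ := hΓ.exists_extension hy
  rw [h2 y ⟨hy, hyU⟩, h1 y hyU]

lemma IsClosedSurface.contDiffOn_normal (hΓ : IsClosedSurface Γ n) : ContDiffOn ℝ 4 n Γ := by
  intro y hy
  obtain ⟨U, hU, hyU, f, ν, _, hν, _, h1, h2, _⟩ := hΓ.exists_extension hy
  have h3 : ContDiffWithinAt ℝ 4 ν Γ y := ((hν y hyU).contDiffAt (hU.mem_nhds hyU)).contDiffWithinAt
  refine h3.congr_of_eventuallyEq ?_ (h2 y ⟨hy, hyU⟩)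
  filter_upwards [self_mem_nhdsWithin, mem_nhdsWithin_of_mem_nhds (hU.mem_nhds hyU)] with x hx hxU
  exact h2 x ⟨hx, hxU⟩

/-- Velocities of maps into the surface are orthogonal to the normal. -/
lemma IsClosedSurface.inner_normal_fderiv (hΓ : IsClosedSurface Γ n) {F : Type*}
    [NormedAddCommGroup F] [NormedSpace ℝ F] {γ : F → E3} {γ' : F →L[ℝ] E3} {s : F}
    (hγ : HasFDerivAt γ γ' s) (hmem : ∀ᶠ z in 𝓝 s, γ z ∈ Γ) (v : F) :
    ⟪n (γ s), γ' v⟫ = 0 := by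
  have hs : γ s ∈ Γ := hmem.self_of_nhds
  obtain ⟨U, hU, hyU, f, ν, hf, _, hΓU, _, h2, h3⟩ := hΓ.exists_extension hs
  obtain ⟨l, hl, hl'⟩ := h3 _ hyU
  have hfd : HasFDerivAt f (fderiv ℝ f (γ s)) (γ s) :=
    (((hf _ hyU).contDiffAt (hU.mem_nhds hyU)).differentiableAt (by norm_num)).hasFDerivAt
  have hcomp := hfd.comp s hγ
  have hzero : f ∘ γ =ᶠ[𝓝 s] fun _ => 0 := by
    filter_upwards [hmem, hγ.continuousAt.eventually (hU.mem_nhds hyU)] with z hz hzU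
    have : γ z ∈ Γ ∩ U := ⟨hz, hzU⟩
    rw [hΓU] at this
    exact this.2
  have h0 := hcomp.unique ((hasFDerivAt_const (0 : ℝ) s).congr_of_eventuallyEq hzero)
  have h1 : fderiv ℝ f (γ s) (γ' v) = 0 := by
    have := congrArg (fun L => L v) h0
    simpa using this
  rw [hl'] at h1
  rw [h2 _ ⟨hs, hyU⟩]
  exact (mul_eq_zero.1 h1).resolve_left hl.ne'

end Surface

section Frame

/-- The open square with centre `0` and side `2R`. -/
def openSquare (R : ℝ) : Set (ℝ × ℝ) := Ioo (-R) R ×ˢ Ioo (-R) R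

lemma isOpen_openSquare (R : ℝ) : IsOpen (openSquare R) := isOpen_Ioo.prod isOpen_Ioo

lemma square_subset_openSquare {ρ R : ℝ} (h : ρ < R) : square ρ ⊆ openSquare R :=
  prod_mono (Icc_subset_Ioo (by linarith) h) (Icc_subset_Ioo (by linarith) h)

variable (b : OrthonormalBasis (Fin 3) ℝ E3)

/-- Linear coordinates of `E3` with respect to an orthonormal basis, the third coordinate being
split off. -/
def frame : ((ℝ × ℝ) × ℝ) ≃L[ℝ] E3 :=
  ContinuousLinearEquiv.equivOfInverse
    ((((ContinuousLinearMap.fst ℝ ℝ ℝ).comp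
        (ContinuousLinearMap.fst ℝ (ℝ × ℝ) ℝ)).smulRight (b 0)) +
      (((ContinuousLinearMap.snd ℝ ℝ ℝ).comp
        (ContinuousLinearMap.fst ℝ (ℝ × ℝ) ℝ)).smulRight (b 1)) +
      ((ContinuousLinearMap.snd ℝ (ℝ × ℝ) ℝ).smulRight (b 2)))
    ((((innerSL ℝ (b 0))).prod (innerSL ℝ (b 1))).prod (innerSL ℝ (b 2)))
    (by
      rintro ⟨⟨x, y⟩, z⟩
      simp [inner_add_right, real_inner_smul_right, b.inner_eq_ite])
    (by
      intro x
      have := b.sum_repr' x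
      rw [Fin.sum_univ_three] at this
      simpa using this)

lemma frame_apply (p : (ℝ × ℝ) × ℝ) : frame b p = p.1.1 • b 0 + p.1.2 • b 1 + p.2 • b 2 := rfl

/-- The first two coordinates, with origin `y₀`. -/
def coord (y₀ x : E3) : ℝ × ℝ := (⟪b 0, x - y₀⟫, ⟪b 1, x - y₀⟫)

/-- The parametrization of the graph of `h` over the first two coordinates. -/
def chart (y₀ : E3) (h : ℝ × ℝ → ℝ) (s : ℝ × ℝ) : E3 := y₀ + frame b (s, h s)

lemma coord_chart (y₀ : E3) (h : ℝ × ℝ → ℝ) (s : ℝ × ℝ) : coord b y₀ (chart b y₀ h s) = s := by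
  have : coord b y₀ (chart b y₀ h s) = ((frame b).symm (chart b y₀ h s - y₀)).1 := rfl
  rw [this, chart, add_sub_cancel_left, ContinuousLinearEquiv.symm_apply_apply]

lemma contDiff_coord (y₀ : E3) {k : WithTop ℕ∞} : ContDiff ℝ k (coord b y₀) :=
  ((innerSL ℝ (b 0)).contDiff.comp (contDiff_id.sub contDiff_const)).prodMk
    ((innerSL ℝ (b 1)).contDiff.comp (contDiff_id.sub contDiff_const))

end Frame

/-- A parametrization of a relatively open piece `Γ ∩ U` of the surface as a `C⁵` graph over an open
square in two of the coordinates. -/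
structure IsGraphChart (Γ : Set E3) (b : OrthonormalBasis (Fin 3) ℝ E3) (y₀ : E3) (h : ℝ × ℝ → ℝ)
    (R : ℝ) (U : Set E3) : Prop where
  pos : 0 < R
  isOpen : IsOpen U
  mem : y₀ ∈ Γ ∩ U
  contDiffOn : ContDiffOn ℝ 5 h (openSquare R)
  chart_mem : ∀ s ∈ openSquare R, chart b y₀ h s ∈ Γ ∩ U
  coord_mem : ∀ y ∈ Γ ∩ U, coord b y₀ y ∈ openSquare R
  chart_coord : ∀ y ∈ Γ ∩ U, chart b y₀ h (coord b y₀ y) = y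

/-- Every point of the surface lies in a graph chart.  If `f` is a defining function and the
surface is not tangent to the third basis vector, then `x ↦ (first two coordinates, f x)` is a local
diffeomorphism. -/
theorem IsClosedSurface.exists_graphChart {Γ : Set E3} {n : E3 → E3} (hΓ : IsClosedSurface Γ n)
    {y₀ : E3} (hy₀ : y₀ ∈ Γ) : ∃ b h R U, IsGraphChart Γ b y₀ h R U := by
  obtain ⟨U₀, hU₀, hyU, f, ν, hf, _, hΓU, h1, h2, h3⟩ := hΓ.exists_extension hy₀
  obtain ⟨l, hl, hl'⟩ := h3 _ hyU
  have hfd : HasFDerivAt f (fderiv ℝ f y₀) y₀ :=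
    (((hf _ hyU).contDiffAt (hU₀.mem_nhds hyU)).differentiableAt (by norm_num)).hasFDerivAt
  -- choose the coordinate direction of the graph so that `f` has a nonzero derivative along it
  obtain ⟨i, hi⟩ : ∃ i, ν y₀ i ≠ 0 := by
    by_contra! hcon
    have : ν y₀ = 0 := by ext i; simpa using hcon i
    have h := h1 y₀ hyU
    simp [this] at h
  let b : OrthonormalBasis (Fin 3) ℝ E3 :=
    (EuclideanSpace.basisFun (Fin 3) ℝ).reindex (Equiv.swap i 2)
  have hb : fderiv ℝ f y₀ (b 2) ≠ 0 := by
    rw [hl']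
    have : ⟪ν y₀, b 2⟫ = ν y₀ i := by
      simp [b, EuclideanSpace.inner_single_right]
    rw [this]
    exact mul_ne_zero hl.ne' hi
  let Φ : (ℝ × ℝ) × ℝ → (ℝ × ℝ) × ℝ := fun p => (p.1, f (y₀ + frame b p))
  have h0 : y₀ + frame b (0 : (ℝ × ℝ) × ℝ) = y₀ := by simp
  have hsm : ContDiffAt ℝ (5 : ℕ) Φ 0 := by
    refine contDiffAt_fst.prodMk (ContDiffAt.comp (0 : (ℝ × ℝ) × ℝ) (g := f) ?_ ?_)
    · rw [h0]; exact (hf _ hyU).contDiffAt (hU₀.mem_nhds hyU)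
    · exact contDiffAt_const.add (frame b).contDiff.contDiffAt
  have hder : HasFDerivAt Φ ((ContinuousLinearMap.fst ℝ (ℝ × ℝ) ℝ).prod
      ((fderiv ℝ f y₀).comp (frame b : (ℝ × ℝ) × ℝ →L[ℝ] E3))) 0 := by
    refine hasFDerivAt_fst.prodMk ?_
    refine HasFDerivAt.comp (0 : (ℝ × ℝ) × ℝ) (g := f) ?_ ?_
    · rw [h0]; exact hfd
    · exact ((frame b).hasFDerivAt).const_add y₀
  have hinj : Function.Injective (fderiv ℝ Φ 0) := by
    rw [hder.fderiv, injective_iff_map_eq_zero]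
    rintro ⟨v, c⟩ hvc
    simp only [ContinuousLinearMap.prod_apply, ContinuousLinearMap.coe_fst',
      ContinuousLinearMap.comp_apply, Prod.mk_eq_zero] at hvc
    obtain ⟨rfl, hc⟩ := hvc
    have : fderiv ℝ f y₀ (frame b ((0 : ℝ × ℝ), c)) = c * fderiv ℝ f y₀ (b 2) := by
      simp [frame_apply]
    have hc' : c * fderiv ℝ f y₀ (b 2) = 0 := by rw [← this]; exact hc
    simp [(mul_eq_zero.1 hc').resolve_right hb]
  have hN : (fun p => y₀ + frame b p) ⁻¹' U₀ ∈ 𝓝 (0 : (ℝ × ℝ) × ℝ) := by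
    refine ContinuousAt.preimage_mem_nhds (by fun_prop) ?_
    rw [h0]; exact hU₀.mem_nhds hyU
  obtain ⟨V, W, Ψ, hV, hW, h0V, hVN, h0W, hVW, hWV, hΨ⟩ :=
    exists_local_inverse (by norm_num) hsm hinj hN
  have hfy : f y₀ = 0 := by
    have : y₀ ∈ Γ ∩ U₀ := ⟨hy₀, hyU⟩
    rw [hΓU] at this; exact this.2
  have hΦ0 : Φ 0 = ((0 : ℝ × ℝ), (0 : ℝ)) := by
    change ((0 : ℝ × ℝ), f (y₀ + frame b 0)) = _
    rw [h0, hfy]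
  obtain ⟨R, hR, hRW⟩ : ∃ R : ℝ, 0 < R ∧ ∀ s ∈ openSquare R, (s, (0 : ℝ)) ∈ W := by
    have : (fun s : ℝ × ℝ => (s, (0 : ℝ))) ⁻¹' W ∈ 𝓝 (0 : ℝ × ℝ) := by
      refine ContinuousAt.preimage_mem_nhds (by fun_prop) ?_
      rw [← hΦ0]; exact hW.mem_nhds h0W
    obtain ⟨R, hR, hsub⟩ := Metric.mem_nhds_iff.1 this
    refine ⟨R, hR, fun s hs => hsub ?_⟩
    rw [Metric.mem_ball, dist_zero_right, Prod.norm_def, max_lt_iff, Real.norm_eq_abs,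
      Real.norm_eq_abs, abs_lt, abs_lt]
    exact ⟨hs.1, hs.2⟩
  have hpt : ∀ s ∈ openSquare R, (Ψ (s, 0)).1 = s ∧ f (y₀ + frame b (Ψ (s, 0))) = 0 := by
    intro s hs
    have := (hWV _ (hRW s hs)).2
    exact ⟨congrArg Prod.fst this, congrArg Prod.snd this⟩
  have hchart : ∀ s ∈ openSquare R,
      chart b y₀ (fun s => (Ψ (s, 0)).2) s = y₀ + frame b (Ψ (s, 0)) := by
    intro s hs
    simp only [chart]
    congr 2
    exact Prod.ext (hpt s hs).1.symm rfl
  have hψ : ∀ x : E3, y₀ + frame b ((frame b).symm (x - y₀)) = x := by intro x; simp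
  have hfst : ∀ x : E3, ((frame b).symm (x - y₀)).1 = coord b y₀ x := fun x => rfl
  refine ⟨b, fun s => (Ψ (s, 0)).2, R,
    (fun x => (frame b).symm (x - y₀)) ⁻¹' (V ∩ (Prod.fst ⁻¹' openSquare R)), hR, ?_, ?_, ?_, ?_,
    ?_, ?_⟩
  · exact (hV.inter ((isOpen_openSquare R).preimage continuous_fst)).preimage (by fun_prop)
  · refine ⟨hy₀, ?_, ?_⟩ <;> simp only [mem_preimage, sub_self, map_zero]
    · exact h0V
    · exact ⟨by simpa using hR, by simpa using hR⟩
  · have h4 : ContDiffOn ℝ 5 (fun s : ℝ × ℝ => Ψ (s, 0)) (openSquare R) :=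
      ContDiffOn.comp (t := W) (by exact_mod_cast hΨ)
        ((contDiff_id.prodMk contDiff_const).contDiffOn) fun s hs => hRW s hs
    exact contDiff_snd.comp_contDiffOn h4
  · intro s hs
    rw [hchart s hs]
    have hVs := (hWV _ (hRW s hs)).1
    have hU : y₀ + frame b (Ψ (s, 0)) ∈ Γ ∩ U₀ := by
      rw [hΓU]; exact ⟨hVN hVs, (hpt s hs).2⟩
    refine ⟨hU.1, ?_, ?_⟩
    · simpa using hVs
    · simpa [(hpt s hs).1] using hs
  · intro y hy
    exact hy.2.2
  · rintro y ⟨hy, hyV, hyR⟩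
    have hyU' : y ∈ U₀ := by
      have := hVN hyV
      simpa using this
    have hf0 : f y = 0 := by
      have : y ∈ Γ ∩ U₀ := ⟨hy, hyU'⟩
      rw [hΓU] at this; exact this.2
    have hΦy : Φ ((frame b).symm (y - y₀)) = (coord b y₀ y, 0) := by
      simp only [Φ]
      rw [hψ, hf0, hfst]
    rw [hchart (coord b y₀ y) hyR, ← hΦy, (hVW _ hyV).2, hψ]

/-! ### Tangential calculus and normal coordinates -/

section Tangent

variable {Γ : Set E3} {n : E3 → E3} {b : OrthonormalBasis (Fin 3) ℝ E3} {y₀ : E3} {h : ℝ × ℝ → ℝ}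
  {R : ℝ} {U : Set E3}

/-- The derivative of the graph parametrization. -/
def chartDeriv (b : OrthonormalBasis (Fin 3) ℝ E3) (h : ℝ × ℝ → ℝ) (s : ℝ × ℝ) : ℝ × ℝ →L[ℝ] E3 :=
  (frame b : (ℝ × ℝ) × ℝ →L[ℝ] E3).comp ((ContinuousLinearMap.id ℝ (ℝ × ℝ)).prod (fderiv ℝ h s))

lemma chartDeriv_apply (s v : ℝ × ℝ) : chartDeriv b h s v = frame b (v, fderiv ℝ h s v) := rfl

lemma IsGraphChart.contDiffOn_chart (hC : IsGraphChart Γ b y₀ h R U) :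
    ContDiffOn ℝ 5 (chart b y₀ h) (openSquare R) :=
  contDiffOn_const.add ((frame b).contDiff.comp_contDiffOn (contDiffOn_id.prodMk hC.contDiffOn))

lemma IsGraphChart.hasFDerivAt_chart (hC : IsGraphChart Γ b y₀ h R U) {s : ℝ × ℝ}
    (hs : s ∈ openSquare R) : HasFDerivAt (chart b y₀ h) (chartDeriv b h s) s := by
  have h1 : HasFDerivAt h (fderiv ℝ h s) s :=
    ((hC.contDiffOn.contDiffAt ((isOpen_openSquare R).mem_nhds hs)).differentiableAt
      (by norm_num)).hasFDerivAt
  have h2 := ((frame b).hasFDerivAt (x := (s, h s))).comp s ((hasFDerivAt_id s).prodMk h1)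
  exact h2.const_add y₀

lemma IsGraphChart.inner_normal_chartDeriv (hΓ : IsClosedSurface Γ n)
    (hC : IsGraphChart Γ b y₀ h R U) {s : ℝ × ℝ} (hs : s ∈ openSquare R) (v : ℝ × ℝ) :
    ⟪n (chart b y₀ h s), chartDeriv b h s v⟫ = 0 := by
  refine hΓ.inner_normal_fderiv (hC.hasFDerivAt_chart hs) ?_ v
  filter_upwards [(isOpen_openSquare R).mem_nhds hs] with z hz
  exact (hC.chart_mem z hz).1

lemma inner_frame (x : E3) (p : (ℝ × ℝ) × ℝ) :
    ⟪x, frame b p⟫ = p.1.1 * ⟪x, b 0⟫ + p.1.2 * ⟪x, b 1⟫ + p.2 * ⟪x, b 2⟫ := by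
  simp [frame_apply, inner_add_right, real_inner_smul_right]

lemma inner_eq_sum_three (b : OrthonormalBasis (Fin 3) ℝ E3) (x y : E3) :
    ⟪x, y⟫ = ⟪x, b 0⟫ * ⟪b 0, y⟫ + ⟪x, b 1⟫ * ⟪b 1, y⟫ + ⟪x, b 2⟫ * ⟪b 2, y⟫ := by
  rw [← b.sum_inner_mul_inner x y, Fin.sum_univ_three]

/-- The normal component `⟨n, b₂⟩` of the graph direction does not vanish. -/
lemma IsGraphChart.inner_normal_ne_zero (hΓ : IsClosedSurface Γ n)
    (hC : IsGraphChart Γ b y₀ h R U) {s : ℝ × ℝ} (hs : s ∈ openSquare R) :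
    ⟪n (chart b y₀ h s), b 2⟫ ≠ 0 := by
  intro h2
  have h0 := hC.inner_normal_chartDeriv hΓ hs (1, 0)
  have h1 := hC.inner_normal_chartDeriv hΓ hs (0, 1)
  rw [chartDeriv_apply, inner_frame] at h0 h1
  simp only [h2, mul_zero, add_zero, one_mul, zero_mul, zero_add] at h0 h1
  have hz : ⟪n (chart b y₀ h s), n (chart b y₀ h s)⟫ = 0 := by
    rw [inner_eq_sum_three b]
    simp [h0, h1, h2]
  rw [real_inner_self_eq_norm_sq, hΓ.norm_normal (hC.chart_mem s hs).1] at hz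
  norm_num at hz

/-- Every vector orthogonal to the normal is the velocity of a coordinate curve. -/
lemma IsGraphChart.chartDeriv_coord (hΓ : IsClosedSurface Γ n)
    (hC : IsGraphChart Γ b y₀ h R U) {s : ℝ × ℝ} (hs : s ∈ openSquare R) {v : E3}
    (hv : ⟪n (chart b y₀ h s), v⟫ = 0) : chartDeriv b h s (⟪b 0, v⟫, ⟪b 1, v⟫) = v := by
  have h0 := hC.inner_normal_chartDeriv hΓ hs (⟪b 0, v⟫, ⟪b 1, v⟫)
  rw [chartDeriv_apply, inner_frame] at h0
  rw [inner_eq_sum_three b] at hv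
  have h2 := hC.inner_normal_ne_zero hΓ hs
  have h3 : fderiv ℝ h s (⟪b 0, v⟫, ⟪b 1, v⟫) = ⟪b 2, v⟫ := by
    apply mul_right_cancel₀ h2
    simp only at h0
    linarith
  rw [chartDeriv_apply, h3]
  exact (frame b).apply_symm_apply v

lemma IsGraphChart.coord_self_mem (hC : IsGraphChart Γ b y₀ h R U) {y : E3} (hy : y ∈ Γ ∩ U) :
    coord b y₀ y ∈ openSquare R ∧ chart b y₀ h (coord b y₀ y) = y :=
  ⟨hC.coord_mem y hy, hC.chart_coord y hy⟩

/-- Derivatives within the surface agree on tangent vectors. -/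
lemma IsClosedSurface.fderivWithin_unique (hΓ : IsClosedSurface Γ n) {F : Type*}
    [NormedAddCommGroup F] [NormedSpace ℝ F] {η : E3 → F} {y : E3} (hy : y ∈ Γ)
    {D D' : E3 →L[ℝ] F} (hD : HasFDerivWithinAt η D Γ y) (hD' : HasFDerivWithinAt η D' Γ y)
    {v : E3} (hv : ⟪n y, v⟫ = 0) : D v = D' v := by
  obtain ⟨b, h, R, U, hC⟩ := hΓ.exists_graphChart hy
  obtain ⟨hs, hsy⟩ := hC.coord_self_mem hC.mem
  set s := coord b y y
  have hev : ∀ᶠ z in 𝓝 s, chart b y h z ∈ Γ := by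
    filter_upwards [(isOpen_openSquare R).mem_nhds hs] with z hz
    exact (hC.chart_mem z hz).1
  have hcomp : ∀ {L : E3 →L[ℝ] F}, HasFDerivWithinAt η L Γ y →
      HasFDerivAt (η ∘ chart b y h) (L.comp (chartDeriv b h s)) s := by
    intro L hL
    rw [← hsy] at hL
    exact hL.comp_hasFDerivAt s (hC.hasFDerivAt_chart hs) hev
  have huniq := (hcomp hD).unique (hcomp hD')
  rw [← hsy] at hv
  have hvv := hC.chartDeriv_coord hΓ hs hv
  have := congrArg (fun L => L (⟪b 0, v⟫, ⟪b 1, v⟫)) huniq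
  simpa [hvv] using this

lemma inner_normal_P {y : E3} (hn : ‖n y‖ = 1) (a : E3) : ⟪n y, P n y a⟫ = 0 := by
  simp [P, inner_sub_right, real_inner_smul_right, hn]

lemma P_eq_self {y a : E3} (ha : ⟪n y, a⟫ = 0) : P n y a = a := by simp [P, ha]

lemma inner_P_left (y a c : E3) : ⟪P n y a, c⟫ = ⟪a, P n y c⟫ := by
  simp only [P, inner_sub_left, inner_sub_right, real_inner_smul_left, real_inner_smul_right]
  rw [real_inner_comm a (n y)]
  ring

/-- The tangential gradient, computed with any derivative within the surface; on the surface the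
latter is unique only in tangential directions. -/
lemma tanGrad_apply (hΓ : IsClosedSurface Γ n) {η : E3 → ℝ} {y : E3} (hy : y ∈ Γ)
    {D : E3 →L[ℝ] ℝ} (hD : HasFDerivWithinAt η D Γ y) (i : Fin 3) :
    tanGrad Γ n η y i = D (P n y (EuclideanSpace.single i 1)) := by
  have h1 : tanGrad Γ n η y i = ⟪EuclideanSpace.single i (1 : ℝ), tanGrad Γ n η y⟫ := by
    simp [EuclideanSpace.inner_single_left]
  rw [h1, tanGrad, ← inner_P_left, real_inner_comm, gradientWithin,
    InnerProductSpace.toDual_symm_apply]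
  exact hΓ.fderivWithin_unique hy hD.differentiableWithinAt.hasFDerivWithinAt hD
    (inner_normal_P (hΓ.norm_normal hy) _)

lemma W_apply (hΓ : IsClosedSurface Γ n) {y : E3} (hy : y ∈ Γ) {N : E3 →L[ℝ] E3}
    (hN : HasFDerivWithinAt n N Γ y) (i j : Fin 3) :
    W Γ n y i j = -(N (P n y (EuclideanSpace.single i 1))) j := by
  have hj : HasFDerivWithinAt (fun x => n x j)
      ((EuclideanSpace.proj j : E3 →L[ℝ] ℝ).comp N) Γ y :=
    (EuclideanSpace.proj j : E3 →L[ℝ] ℝ).hasFDerivAt.comp_hasFDerivWithinAt y hN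
  simp [W, tanGradMat, tanGrad_apply hΓ hy hj]

lemma euclidean_sum_single (v : E3) : v = ∑ i, v i • EuclideanSpace.single i (1 : ℝ) := by
  have := (EuclideanSpace.basisFun (Fin 3) ℝ).sum_repr v
  simpa using this.symm

/-- On tangent vectors, the transpose of the Weingarten map is minus the derivative of `n`. -/
lemma W_transpose_mulVec (hΓ : IsClosedSurface Γ n) {y : E3} (hy : y ∈ Γ) {N : E3 →L[ℝ] E3}
    (hN : HasFDerivWithinAt n N Γ y) {v : E3} (hv : ⟪n y, v⟫ = 0) (j : Fin 3) :
    ((W Γ n y).transpose.mulVec v.ofLp) j = -(N v) j := by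
  let PL : E3 →ₗ[ℝ] E3 :=
    { toFun := P n y
      map_add' := fun a c => by simp only [P, inner_add_right, add_smul]; abel
      map_smul' := fun r a => by
        simp only [P, real_inner_smul_right, smul_sub, mul_smul, RingHom.id_apply] }
  have h1 : N v = ∑ i, v i • N (P n y (EuclideanSpace.single i 1)) := by
    conv_lhs => rw [← P_eq_self hv, euclidean_sum_single v]
    change N (PL _) = _
    rw [map_sum, map_sum]
    simp only [map_smul]
    rfl
  rw [h1]
  simp only [Matrix.mulVec, dotProduct, Matrix.transpose_apply, W_apply hΓ hy hN]
  simp [Fin.sum_univ_three]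
  ring

/-- Invertibility of `1 - r W` means that `y ↦ y + r n(y)` has an injective tangential
derivative. -/
lemma eq_zero_of_add_smul_eq_zero (hΓ : IsClosedSurface Γ n) {y : E3} (hy : y ∈ Γ)
    {N : E3 →L[ℝ] E3} (hN : HasFDerivWithinAt n N Γ y) {r : ℝ} (hr : IsUnit (1 - r • W Γ n y))
    {v : E3} (hv : ⟪n y, v⟫ = 0) (h0 : v + r • N v = 0) : v = 0 := by
  have hT : IsUnit (1 - r • W Γ n y).transpose := (Matrix.isUnit_transpose _).2 hr
  have hz : (1 - r • W Γ n y).transpose.mulVec v.ofLp = 0 := by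
    ext j
    have h1 := congrArg (fun x : E3 => x j) h0
    simp only [PiLp.add_apply, PiLp.smul_apply, smul_eq_mul, PiLp.zero_apply] at h1
    rw [Matrix.transpose_sub, Matrix.transpose_one, Matrix.transpose_smul, Matrix.sub_mulVec,
      Matrix.one_mulVec, Matrix.smul_mulVec, Pi.sub_apply, Pi.smul_apply,
      W_transpose_mulVec hΓ hy hN hv, Pi.zero_apply, smul_eq_mul]
    linarith
  have h3 : v.ofLp = 0 := by
    apply (Matrix.mulVec_injective_iff_isUnit.2 hT)
    simpa using hz
  ext j
  simp [h3]

/-- Within a tubular radius `1 - r W` is invertible, since otherwise `r⁻¹` would be an eigenvalue of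
`W`, against the lower bound for `1 - r κ`. -/
lemma IsTubularRadius.isUnit_one_sub {δ : ℝ} (hδ : IsTubularRadius Γ n δ) {y : E3} (hy : y ∈ Γ)
    {r : ℝ} (hr : r ∈ Ioo (-δ) δ) : IsUnit (1 - r • W Γ n y) := by
  obtain ⟨_, _, c, hc, h⟩ := hδ
  by_cases hr0 : r = 0
  · simp [hr0]
  by_contra hcon
  have hmem : r⁻¹ ∈ spectrum ℝ (W Γ n y) := by
    rw [spectrum.mem_iff]
    intro hu
    apply hcon
    have : 1 - r • W Γ n y = (Units.mk0 r hr0) • (algebraMap ℝ _ r⁻¹ - W Γ n y) := by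
      rw [Units.smul_mk0, smul_sub, Algebra.algebraMap_eq_smul_one, smul_smul,
        mul_inv_cancel₀ hr0, one_smul]
    rw [this]
    exact hu.smul _
  have := (h y hy r hr _ hmem).1
  rw [mul_inv_cancel₀ hr0, sub_self] at this
  exact absurd (inv_pos.2 hc) (not_lt.2 this)

/-- Normal coordinates near a point: a smooth local inverse of `(y, r) ↦ y + r n(y)`, obtained by
inverting `(y, r) ↦ (y + r ν(y), f(y))` for an extension `ν` of `n` and a defining function `f`. -/
theorem exists_normal_coords (hΓ : IsClosedSurface Γ n) {y : E3} (hy : y ∈ Γ) {r : ℝ}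
    (hr : IsUnit (1 - r • W Γ n y)) {S : Set (E3 × ℝ)} (hS : S ∈ 𝓝 (y, r)) :
    ∃ O : Set E3, IsOpen O ∧ y + r • n y ∈ O ∧ ∃ Ψ : E3 → E3 × ℝ, ContDiffOn ℝ 4 Ψ O ∧
      (∀ x ∈ O, Ψ x ∈ S ∧ (Ψ x).1 ∈ Γ ∧ (Ψ x).1 + (Ψ x).2 • n (Ψ x).1 = x) ∧
      ∃ V ∈ 𝓝 (y, r), ∀ p ∈ V, p.1 ∈ Γ → Ψ (p.1 + p.2 • n p.1) = p := by
  obtain ⟨U, hU, hyU, f, ν, hf, hν, hΓU, h1, h2, h3⟩ := hΓ.exists_extension hy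
  obtain ⟨l, hl, hl'⟩ := h3 _ hyU
  have hnν : n y = ν y := h2 y ⟨hy, hyU⟩
  have hfA : ContDiffAt ℝ 5 f y := (hf _ hyU).contDiffAt (hU.mem_nhds hyU)
  have hνA : ContDiffAt ℝ 4 ν y := (hν _ hyU).contDiffAt (hU.mem_nhds hyU)
  have hfd : HasFDerivAt f (fderiv ℝ f y) y := (hfA.differentiableAt (by norm_num)).hasFDerivAt
  have hνd : HasFDerivAt ν (fderiv ℝ ν y) y := (hνA.differentiableAt (by norm_num)).hasFDerivAt
  have hN : HasFDerivWithinAt n (fderiv ℝ ν y) Γ y := by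
    refine hνd.hasFDerivWithinAt.congr_of_eventuallyEq ?_ hnν
    filter_upwards [self_mem_nhdsWithin, mem_nhdsWithin_of_mem_nhds (hU.mem_nhds hyU)] with x hx hxU
    exact h2 x ⟨hx, hxU⟩
  let G : E3 × ℝ → E3 × ℝ := fun p => (p.1 + p.2 • ν p.1, f p.1)
  have hG : ContDiffAt ℝ (4 : ℕ) G (y, r) := by
    have e1 : ContDiffAt ℝ 4 (fun p : E3 × ℝ => ν p.1) (y, r) :=
      ContDiffAt.comp (y, r) (g := ν) hνA contDiffAt_fst
    have e2 : ContDiffAt ℝ 4 (fun p : E3 × ℝ => f p.1) (y, r) :=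
      ContDiffAt.comp (y, r) (g := f) (hfA.of_le (by norm_num)) contDiffAt_fst
    exact (contDiffAt_fst.add (contDiffAt_snd.smul e1)).prodMk e2
  have hνu : ∀ v, ⟪ν y, fderiv ℝ ν y v⟫ = 0 := by
    intro v
    have e1 : HasFDerivAt (fun x => ⟪ν x, ν x⟫) _ y := hνd.inner ℝ hνd
    have e2 : (fun x => ⟪ν x, ν x⟫) =ᶠ[𝓝 y] fun _ => (1 : ℝ) := by
      filter_upwards [hU.mem_nhds hyU] with x hx
      rw [real_inner_self_eq_norm_sq, h1 x hx, one_pow]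
    have e3 := e1.unique ((hasFDerivAt_const (1 : ℝ) y).congr_of_eventuallyEq e2)
    have e4 := congrArg (fun L => L v) e3
    simp only [ContinuousLinearMap.comp_apply, ContinuousLinearMap.prod_apply,
      fderivInnerCLM_apply, zero_apply] at e4
    rw [real_inner_comm (ν y)] at e4
    linarith
  -- a vector `(v, q)` in the kernel has `v` tangential and `v + q ν + r Dν v = 0`; here `Dν v` is
  -- orthogonal to `ν`, so that `q = 0`
  have hinj : Function.Injective (fderiv ℝ G (y, r)) := by
    have e1 : HasFDerivAt (fun p : E3 × ℝ => ν p.1)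
        ((fderiv ℝ ν y).comp (ContinuousLinearMap.fst ℝ E3 ℝ)) (y, r) :=
      HasFDerivAt.comp (y, r) (g := ν) hνd hasFDerivAt_fst
    have e2 : HasFDerivAt (fun p : E3 × ℝ => f p.1)
        ((fderiv ℝ f y).comp (ContinuousLinearMap.fst ℝ E3 ℝ)) (y, r) :=
      HasFDerivAt.comp (y, r) (g := f) hfd hasFDerivAt_fst
    have e3 := (hasFDerivAt_fst.add
      ((hasFDerivAt_snd (𝕜 := ℝ) (p := ((y, r) : E3 × ℝ))).smul e1)).prodMk e2
    have e4 : HasFDerivAt G _ (y, r) := e3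
    rw [e4.fderiv, injective_iff_map_eq_zero]
    rintro ⟨v, q⟩ hvq
    simp only [ContinuousLinearMap.prod_apply, add_apply,
      ContinuousLinearMap.coe_fst', smul_apply,
      ContinuousLinearMap.comp_apply, ContinuousLinearMap.smulRight_apply,
      ContinuousLinearMap.coe_snd', Prod.mk_eq_zero, hl'] at hvq
    obtain ⟨ha, hb⟩ := hvq
    have hvn : ⟪ν y, v⟫ = 0 := (mul_eq_zero.1 hb).resolve_left hl.ne'
    have hq : q = 0 := by
      have := congrArg (fun x => ⟪ν y, x⟫) ha
      simpa [inner_add_right, real_inner_smul_right, hvn, hνu, h1 y hyU] using this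
    rw [hq, zero_smul, add_zero] at ha
    rw [eq_zero_of_add_smul_eq_zero hΓ hy hN hr (hnν ▸ hvn) ha, hq]
    rfl
  have hS' : S ∩ (Prod.fst ⁻¹' U) ∈ 𝓝 (y, r) :=
    inter_mem hS (continuous_fst.continuousAt.preimage_mem_nhds (hU.mem_nhds hyU))
  obtain ⟨V, W', Ψ, hV, hW', haV, hVS, haW, hVW, hWV, hΨ⟩ :=
    exists_local_inverse (by norm_num) hG hinj hS'
  have hfz : ∀ {x}, x ∈ Γ → x ∈ U → f x = 0 := by
    intro x hx hxU
    have : x ∈ Γ ∩ U := ⟨hx, hxU⟩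
    rw [hΓU] at this
    exact this.2
  have hGy : G (y, r) = (y + r • n y, 0) := by simp [G, hnν, hfz hy hyU]
  refine ⟨(fun x => (x, (0 : ℝ))) ⁻¹' W', hW'.preimage (by fun_prop), ?_, fun x => Ψ (x, 0),
    ?_, ?_, V, hV.mem_nhds haV, ?_⟩
  · rw [mem_preimage, ← hGy]; exact haW
  · exact ContDiffOn.comp (t := W') (by exact_mod_cast hΨ)
      ((contDiff_id.prodMk contDiff_const).contDiffOn) fun s hs => hs
  · intro x hx
    obtain ⟨ha, hb⟩ := hWV _ hx
    have hSU := hVS ha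
    have hb1 : (Ψ (x, 0)).1 + (Ψ (x, 0)).2 • ν (Ψ (x, 0)).1 = x := congrArg Prod.fst hb
    have hb2 : f (Ψ (x, 0)).1 = 0 := congrArg Prod.snd hb
    have hmem : (Ψ (x, 0)).1 ∈ Γ ∩ U := by rw [hΓU]; exact ⟨hSU.2, hb2⟩
    refine ⟨hSU.1, hmem.1, ?_⟩
    rw [h2 _ hmem, hb1]
  · intro p hp hpΓ
    have hpU : p.1 ∈ U := (hVS hp).2
    have : G p = (p.1 + p.2 • n p.1, 0) := by simp [G, h2 _ ⟨hpΓ, hpU⟩, hfz hpΓ hpU]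
    change Ψ (p.1 + p.2 • n p.1, 0) = p
    rw [← this]
    exact (hVW p hp).2

end Tangent

/-! ### Tubular neighbourhoods -/

section Tube

variable {Γ : Set E3} {n : E3 → E3}

/-- The connecting vector from a closest point of the surface is normal. -/
lemma IsClosedSurface.normal_of_dist_eq_infDist (hΓ : IsClosedSurface Γ n) {x y : E3} (hy : y ∈ Γ)
    (hxy : dist x y = Metric.infDist x Γ) : x = y + ⟪x - y, n y⟫ • n y := by
  obtain ⟨b, h, R, U, hC⟩ := hΓ.exists_graphChart hy
  obtain ⟨hs, hsy⟩ := hC.coord_self_mem hC.mem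
  set s := coord b y y
  have hd := (hC.hasFDerivAt_chart hs).const_sub x
  have hmin : IsLocalMin (fun z => ⟪x - chart b y h z, x - chart b y h z⟫) s := by
    filter_upwards [(isOpen_openSquare R).mem_nhds hs] with z hz
    rw [hsy, real_inner_self_eq_norm_sq, real_inner_self_eq_norm_sq, ← dist_eq_norm,
      ← dist_eq_norm, hxy]
    gcongr
    · exact Metric.infDist_nonneg
    · exact Metric.infDist_le_dist_of_mem (hC.chart_mem z hz).1
  have h0 := hmin.hasFDerivAt_eq_zero (hd.inner ℝ hd)
  have hort : ∀ v, ⟪x - y, chartDeriv b h s v⟫ = 0 := by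
    intro v
    have := congrArg (fun L => L v) h0
    simp only [ContinuousLinearMap.comp_apply, ContinuousLinearMap.prod_apply,
      fderivInnerCLM_apply, zero_apply, neg_apply, inner_neg_left,
      inner_neg_right, hsy] at this
    rw [real_inner_comm (x - y)] at this
    linarith
  have hP : P n y (x - y) = 0 := by
    have h1 : ⟪n (chart b y h s), P n y (x - y)⟫ = 0 := by
      rw [hsy]; exact inner_normal_P (hΓ.norm_normal hy) _
    have h2 := hort (⟪b 0, P n y (x - y)⟫, ⟪b 1, P n y (x - y)⟫)
    rw [hC.chartDeriv_coord hΓ hs h1] at h2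
    have h3 : ⟪P n y (x - y), P n y (x - y)⟫ = 0 := by
      rw [inner_P_left, P_eq_self (inner_normal_P (hΓ.norm_normal hy) _), h2]
    exact inner_self_eq_zero.1 h3
  rw [P, sub_eq_zero] at hP
  rw [real_inner_comm, ← hP]
  abel

variable {δ : ℝ}

/-- The tubular neighbourhood of radius `δ`. -/
def tube (Γ : Set E3) (n : E3 → E3) (δ : ℝ) : Set E3 :=
  {x | ∃ y ∈ Γ, ∃ r ∈ Ioo (-δ) δ, x = y + r • n y}

/-- The closest point projection in normal coordinates: a closest point `z` has a normal connecting
vector, so that `x` has normal coordinates based at `z`, and these are unique. -/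
theorem proj_add_smul (hΓ : IsClosedSurface Γ n) (hδ : IsTubularRadius Γ n δ) {y : E3}
    (hy : y ∈ Γ) {r : ℝ} (hr : r ∈ Ioo (-δ) δ) : proj Γ (y + r • n y) = y := by
  set x := y + r • n y with hx
  have hex : ∃ z ∈ Γ, dist x z = Metric.infDist x Γ := by
    obtain ⟨z, hz, h⟩ := hΓ.isCompact.exists_infDist_eq_dist ⟨y, hy⟩ x
    exact ⟨z, hz, h.symm⟩
  rw [proj, dif_pos hex]
  obtain ⟨hz, hxz⟩ := hex.choose_spec
  set z := hex.choose
  have hxe := hΓ.normal_of_dist_eq_infDist hz hxz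
  have hle : |⟪x - z, n z⟫| ≤ |r| := by
    have h1 : dist x z = |⟪x - z, n z⟫| := by
      rw [dist_eq_norm]
      conv_lhs => rw [hxe, add_sub_cancel_left]
      rw [norm_smul, hΓ.norm_normal hz, mul_one, Real.norm_eq_abs]
    have h2 : dist x y = |r| := by
      rw [dist_eq_norm, hx, add_sub_cancel_left, norm_smul, hΓ.norm_normal hy, mul_one,
        Real.norm_eq_abs]
    rw [← h1, ← h2, hxz]
    exact Metric.infDist_le_dist_of_mem hy
  have hr' : ⟪x - z, n z⟫ ∈ Ioo (-δ) δ := by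
    rw [mem_Ioo, ← abs_lt] at hr ⊢
    exact hle.trans_lt hr
  have := hδ.2.1 (mk_mem_prod hz hr') (mk_mem_prod hy hr) (by simp only; rw [← hxe])
  exact congrArg Prod.fst this

theorem sdist_add_smul (hΓ : IsClosedSurface Γ n) (hδ : IsTubularRadius Γ n δ) {y : E3}
    (hy : y ∈ Γ) {r : ℝ} (hr : r ∈ Ioo (-δ) δ) : sdist Γ n (y + r • n y) = r := by
  rw [sdist, proj_add_smul hΓ hδ hy hr, add_sub_cancel_left, real_inner_smul_left,
    real_inner_self_eq_norm_sq, hΓ.norm_normal hy]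
  ring

lemma proj_mem (hΓ : IsClosedSurface Γ n) (hδ : IsTubularRadius Γ n δ) {x : E3}
    (hx : x ∈ tube Γ n δ) : proj Γ x ∈ Γ := by
  obtain ⟨y, hy, r, hr, rfl⟩ := hx
  rwa [proj_add_smul hΓ hδ hy hr]

lemma proj_add_sdist (hΓ : IsClosedSurface Γ n) (hδ : IsTubularRadius Γ n δ) {x : E3}
    (hx : x ∈ tube Γ n δ) : proj Γ x + sdist Γ n x • n (proj Γ x) = x := by
  obtain ⟨y, hy, r, hr, rfl⟩ := hx
  rw [sdist_add_smul hΓ hδ hy hr, proj_add_smul hΓ hδ hy hr]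

lemma proj_eq_self (hΓ : IsClosedSurface Γ n) (hδ : IsTubularRadius Γ n δ) {y : E3}
    (hy : y ∈ Γ) : proj Γ y = y := by
  have := proj_add_smul hΓ hδ hy (r := 0) ⟨by linarith [hδ.1], hδ.1⟩
  simpa using this

lemma subset_tube (hδ : 0 < δ) : Γ ⊆ tube Γ n δ := fun y hy =>
  ⟨y, hy, 0, ⟨by linarith, hδ⟩, by simp⟩

lemma tube_coords_nhds (hΓ : IsClosedSurface Γ n) (hδ : IsTubularRadius Γ n δ) {x : E3}
    (hx : x ∈ tube Γ n δ) : ∃ O : Set E3, IsOpen O ∧ x ∈ O ∧ O ⊆ tube Γ n δ ∧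
      ContDiffOn ℝ 4 (fun z => (proj Γ z, sdist Γ n z)) O := by
  obtain ⟨y, hy, r, hr, rfl⟩ := hx
  have hS : (Prod.snd ⁻¹' Ioo (-δ) δ : Set (E3 × ℝ)) ∈ 𝓝 (y, r) :=
    continuous_snd.continuousAt.preimage_mem_nhds (isOpen_Ioo.mem_nhds hr)
  obtain ⟨O, hO, hyO, Ψ, hΨ, h1, _⟩ := exists_normal_coords hΓ hy (hδ.isUnit_one_sub hy hr) hS
  refine ⟨O, hO, hyO, ?_, hΨ.congr ?_⟩
  · intro x hx
    obtain ⟨ha, hb, hc⟩ := h1 x hx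
    exact ⟨_, hb, _, ha, hc.symm⟩
  · intro x hx
    obtain ⟨ha, hb, hc⟩ := h1 x hx
    conv_lhs => rw [← hc]
    rw [proj_add_smul hΓ hδ hb ha, sdist_add_smul hΓ hδ hb ha]

lemma isOpen_tube (hΓ : IsClosedSurface Γ n) (hδ : IsTubularRadius Γ n δ) :
    IsOpen (tube Γ n δ) := by
  rw [isOpen_iff_mem_nhds]
  intro x hx
  obtain ⟨O, hO, hxO, hsub, _⟩ := tube_coords_nhds hΓ hδ hx
  exact mem_of_superset (hO.mem_nhds hxO) hsub

theorem contDiffOn_proj_sdist (hΓ : IsClosedSurface Γ n) (hδ : IsTubularRadius Γ n δ) :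
    ContDiffOn ℝ 4 (fun z => (proj Γ z, sdist Γ n z)) (tube Γ n δ) := by
  intro x hx
  obtain ⟨O, hO, hxO, _, h⟩ := tube_coords_nhds hΓ hδ hx
  exact ((h x hxO).contDiffAt (hO.mem_nhds hxO)).contDiffWithinAt

lemma contDiffOn_proj (hΓ : IsClosedSurface Γ n) (hδ : IsTubularRadius Γ n δ) :
    ContDiffOn ℝ 4 (proj Γ) (tube Γ n δ) :=
  contDiff_fst.comp_contDiffOn (contDiffOn_proj_sdist hΓ hδ)

lemma contDiffOn_sdist (hΓ : IsClosedSurface Γ n) (hδ : IsTubularRadius Γ n δ) :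
    ContDiffOn ℝ 4 (sdist Γ n) (tube Γ n δ) :=
  contDiff_snd.comp_contDiffOn (contDiffOn_proj_sdist hΓ hδ)

/-- The constant extension of a smooth function on the surface is smooth in the tube. -/
lemma contDiffOn_ext (hΓ : IsClosedSurface Γ n) (hδ : IsTubularRadius Γ n δ) {F : Type*}
    [NormedAddCommGroup F] [NormedSpace ℝ F] {η : E3 → F} (hη : ContDiffOn ℝ 4 η Γ) :
    ContDiffOn ℝ 4 (ext Γ η) (tube Γ n δ) :=
  hη.comp (contDiffOn_proj hΓ hδ) fun _ hx => proj_mem hΓ hδ hx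

/-- The constant extension of `η` realises the derivative of `η` within the surface. -/
lemma hasFDerivWithinAt_of_ext (hΓ : IsClosedSurface Γ n) (hδ : IsTubularRadius Γ n δ) {F : Type*}
    [NormedAddCommGroup F] [NormedSpace ℝ F] {η : E3 → F} (hη : ContDiffOn ℝ 4 η Γ) {y : E3}
    (hy : y ∈ Γ) : HasFDerivWithinAt η (fderiv ℝ (ext Γ η) y) Γ y := by
  have hyt := subset_tube (n := n) hδ.1 hy
  have h1 : HasFDerivAt (ext Γ η) (fderiv ℝ (ext Γ η) y) y :=
    ((((contDiffOn_ext hΓ hδ hη) y hyt).contDiffAt ((isOpen_tube hΓ hδ).mem_nhds hyt)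
      ).differentiableAt (by norm_num)).hasFDerivAt
  refine h1.hasFDerivWithinAt.congr (fun x hx => ?_) ?_ <;> simp only [ext]
  · rw [proj_eq_self hΓ hδ hx]
  · rw [proj_eq_self hΓ hδ hy]

end Tube

section TubularRadius

variable {Γ : Set E3} {n : E3 → E3}

/-- The derivative of the normal is bounded on the surface. -/
lemma IsClosedSurface.exists_W_bound (hΓ : IsClosedSurface Γ n) :
    ∃ C : ℝ, 0 < C ∧ ∀ y ∈ Γ, ∀ i j, |W Γ n y i j| ≤ C := by
  have hloc : ∀ y ∈ Γ, ∃ t ∈ 𝓝[Γ] y, ∃ C : ℝ, ∀ z ∈ t, z ∈ Γ → ∀ i j, |W Γ n z i j| ≤ C := by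
    intro y hy
    obtain ⟨U, hU, hyU, f, ν, _, hν, _, h1, h2, _⟩ := hΓ.exists_extension hy
    have hc : ContinuousAt (fderiv ℝ ν) y :=
      ((hν.fderiv_of_isOpen (m := 3) hU (by norm_num)).continuousOn y hyU).continuousAt
        (hU.mem_nhds hyU)
    have hb : ∀ᶠ z in 𝓝 y, ‖fderiv ℝ ν z‖ < ‖fderiv ℝ ν y‖ + 1 :=
      hc.norm.eventually_lt_const (by linarith)
    refine ⟨{z | z ∈ U ∧ ‖fderiv ℝ ν z‖ < ‖fderiv ℝ ν y‖ + 1},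
      mem_nhdsWithin_of_mem_nhds (inter_mem (hU.mem_nhds hyU) hb), (‖fderiv ℝ ν y‖ + 1) * 2, ?_⟩
    rintro z ⟨hzU, hz⟩ hzΓ i j
    have hN : HasFDerivWithinAt n (fderiv ℝ ν z) Γ z := by
      have : HasFDerivAt ν (fderiv ℝ ν z) z :=
        (((hν z hzU).contDiffAt (hU.mem_nhds hzU)).differentiableAt (by norm_num)).hasFDerivAt
      refine this.hasFDerivWithinAt.congr_of_eventuallyEq ?_ (h2 z ⟨hzΓ, hzU⟩)
      filter_upwards [self_mem_nhdsWithin, mem_nhdsWithin_of_mem_nhds (hU.mem_nhds hzU)]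
        with x hx hxU
      exact h2 x ⟨hx, hxU⟩
    rw [W_apply hΓ hzΓ hN, abs_neg]
    have hP : ‖P n z (EuclideanSpace.single i 1)‖ ≤ 2 := by
      refine (norm_sub_le _ _).trans ?_
      have h3 := abs_real_inner_le_norm (n z) (EuclideanSpace.single i (1 : ℝ))
      rw [hΓ.norm_normal hzΓ] at h3
      rw [norm_smul, hΓ.norm_normal hzΓ, Real.norm_eq_abs]
      simp only [PiLp.norm_single, norm_one, mul_one] at h3 ⊢
      linarith
    calc |(fderiv ℝ ν z (P n z (EuclideanSpace.single i 1))) j|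
        ≤ ‖fderiv ℝ ν z (P n z (EuclideanSpace.single i 1))‖ := by
          rw [← Real.norm_eq_abs]; exact PiLp.norm_apply_le _ j
      _ ≤ ‖fderiv ℝ ν z‖ * ‖P n z (EuclideanSpace.single i 1)‖ := (fderiv ℝ ν z).le_opNorm _
      _ ≤ _ := by gcongr
  obtain ⟨C, hC⟩ := hΓ.isCompact.induction_on
    (p := fun s => ∃ C : ℝ, ∀ z ∈ s, z ∈ Γ → ∀ i j, |W Γ n z i j| ≤ C) ⟨0, by simp⟩
    (fun s t hst ⟨C, hC⟩ => ⟨C, fun z hz => hC z (hst hz)⟩)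
    (by
      rintro s t ⟨C, hC⟩ ⟨C', hC'⟩
      refine ⟨max C C', ?_⟩
      rintro z (hz | hz) hzΓ i j
      · exact (hC z hz hzΓ i j).trans (le_max_left _ _)
      · exact (hC' z hz hzΓ i j).trans (le_max_right _ _))
    hloc
  exact ⟨max C 1, by positivity, fun y hy i j => (hC y hy hy i j).trans (le_max_left _ _)⟩

lemma abs_le_of_mem_spectrum {A : Matrix (Fin 3) (Fin 3) ℝ} {C : ℝ} (hA : ∀ i j, |A i j| ≤ C)
    {κ : ℝ} (hκ : κ ∈ spectrum ℝ A) : |κ| ≤ 3 * C := by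
  let _ : NormedRing (Matrix (Fin 3) (Fin 3) ℝ) := Matrix.linftyOpNormedRing
  let _ : NormedAlgebra ℝ (Matrix (Fin 3) (Fin 3) ℝ) := Matrix.linftyOpNormedAlgebra
  have : NormOneClass (Matrix (Fin 3) (Fin 3) ℝ) := Matrix.linfty_opNormOneClass
  have h1 := spectrum.norm_le_norm_of_mem hκ
  rw [Real.norm_eq_abs] at h1
  refine h1.trans ?_
  have hC : 0 ≤ C := (abs_nonneg _).trans (hA 0 0)
  rw [Matrix.linfty_opNorm_def]
  have : (Finset.univ.sup fun i => ∑ j, ‖A i j‖₊) ≤ (⟨3 * C, by positivity⟩ : NNReal) := by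
    refine Finset.sup_le fun i _ => ?_
    have hi : ((∑ j, ‖A i j‖₊ : NNReal) : ℝ) ≤ 3 * C := by
      simp only [Fin.sum_univ_three, NNReal.coe_add, coe_nnnorm, Real.norm_eq_abs]
      linarith [hA i 0, hA i 1, hA i 2]
    exact NNReal.coe_le_coe.1 hi
  exact_mod_cast this

/-- A closed surface has a tubular radius, by a compactness argument. -/
theorem IsClosedSurface.exists_isTubularRadius (hΓ : IsClosedSurface Γ n) :
    ∃ δ, IsTubularRadius Γ n δ := by
  obtain ⟨C, hC, hW⟩ := hΓ.exists_W_bound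
  -- injectivity for small radii, by compactness and local injectivity at radius zero
  obtain ⟨δ, hδ, hinj⟩ : ∃ δ : ℝ, 0 < δ ∧
      InjOn (fun p : E3 × ℝ => p.1 + p.2 • n p.1) (Γ ×ˢ Ioo (-δ) δ) := by
    by_contra! hcon
    have hpos : ∀ k : ℕ, (0 : ℝ) < 1 / ((k : ℝ) + 1) := fun k => by positivity
    have hk : ∀ k : ℕ, ∃ p q : E3 × ℝ, p ∈ Γ ×ˢ Ioo (-(1 / ((k : ℝ) + 1))) (1 / ((k : ℝ) + 1)) ∧
        q ∈ Γ ×ˢ Ioo (-(1 / ((k : ℝ) + 1))) (1 / ((k : ℝ) + 1)) ∧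
        p.1 + p.2 • n p.1 = q.1 + q.2 • n q.1 ∧ p ≠ q := by
      intro k
      have := hcon _ (hpos k)
      simp only [InjOn, not_forall] at this
      obtain ⟨p, hp, q, hq, h, hne⟩ := this
      exact ⟨p, q, hp, hq, h, hne⟩
    choose p q hp hq hpq hne using hk
    have hlim : Tendsto (fun k : ℕ => 1 / ((k : ℝ) + 1)) atTop (𝓝 0) :=
      tendsto_one_div_add_atTop_nhds_zero_nat
    have hr : ∀ {p : ℕ → E3 × ℝ},
        (∀ k : ℕ, p k ∈ Γ ×ˢ Ioo (-(1 / ((k : ℝ) + 1))) (1 / ((k : ℝ) + 1))) →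
        Tendsto (fun k => (p k).2) atTop (𝓝 0) := by
      intro p hp
      refine squeeze_zero_norm (fun k => ?_) hlim
      rw [Real.norm_eq_abs]
      exact (abs_lt.2 (hp k).2).le
    obtain ⟨y, hy, φ, hφ, hφy⟩ := hΓ.isCompact.tendsto_subseq fun k => (hp k).1
    have hφt := hφ.tendsto_atTop
    have hdist : Tendsto (fun k => (q (φ k)).1 - (p (φ k)).1) atTop (𝓝 0) := by
      have h1 : Tendsto (fun k => 1 / ((φ k : ℝ) + 1) + 1 / ((φ k : ℝ) + 1)) atTop (𝓝 0) := by
        simpa using (hlim.comp hφt).add (hlim.comp hφt)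
      refine squeeze_zero_norm (fun k => ?_) h1
      have h2 : (q (φ k)).1 - (p (φ k)).1 =
          (p (φ k)).2 • n (p (φ k)).1 - (q (φ k)).2 • n (q (φ k)).1 := by
        have := hpq (φ k)
        rw [sub_eq_sub_iff_add_eq_add, ← this]
        abel
      rw [h2]
      refine (norm_sub_le _ _).trans ?_
      rw [norm_smul, norm_smul, hΓ.norm_normal (hp _).1, hΓ.norm_normal (hq _).1, mul_one, mul_one,
        Real.norm_eq_abs, Real.norm_eq_abs]
      exact add_le_add (abs_lt.2 (hp _).2).le (abs_lt.2 (hq _).2).le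
    have hqy : Tendsto (fun k => (q (φ k)).1) atTop (𝓝 y) := by
      simpa using hφy.add hdist
    have hp2 : Tendsto (fun k => p (φ k)) atTop (𝓝 (y, 0)) :=
      hφy.prodMk_nhds ((hr hp).comp hφt)
    have hq2 : Tendsto (fun k => q (φ k)) atTop (𝓝 (y, 0)) :=
      hqy.prodMk_nhds ((hr hq).comp hφt)
    obtain ⟨O, _, _, Ψ, _, _, V, hV, hΨ⟩ :=
      exists_normal_coords hΓ hy (r := 0) (by simp) (univ_mem (f := 𝓝 (y, (0 : ℝ))))
    obtain ⟨k, hk1, hk2⟩ := ((hp2.eventually hV).and (hq2.eventually hV)).exists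
    apply hne (φ k)
    rw [← hΨ _ hk1 (hp _).1, ← hΨ _ hk2 (hq _).1, hpq]
  -- the eigenvalues of `W` are at most `3C`, so that `|r κ| ≤ 1 / 2` for `|r| < 1 / (6C)`
  refine ⟨min δ (1 / (6 * C)), by positivity, hinj.mono ?_, 2, by norm_num, ?_⟩
  · exact prod_mono_right (Ioo_subset_Ioo (by simp) (by simp))
  · intro y hy r hr κ hκ
    have h1 := abs_le_of_mem_spectrum (hW y hy) hκ
    have h2 : |r| < 1 / (6 * C) := (abs_lt.2 hr).trans_le (min_le_right _ _)
    have h3 : |r * κ| ≤ 1 / 2 := by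
      rw [abs_mul]
      calc |r| * |κ| ≤ 1 / (6 * C) * (3 * C) := by gcongr
        _ = 1 / 2 := by field_simp; norm_num
    have := abs_le.1 h3
    constructor <;> norm_num <;> linarith

end TubularRadius

/-! ### The area formula for graphs -/

section AreaFormula

/-- A locally valid inequality between measures is globally valid. -/
lemma measure_le_of_locally_le {α : Type*} [TopologicalSpace α] [SecondCountableTopology α]
    [MeasurableSpace α] [OpensMeasurableSpace α] {μ ν : Measure α} {O : Set α} {K : ℝ≥0∞}
    (hO : ν Oᶜ = 0)
    (h : ∀ x ∈ O, ∃ V, IsOpen V ∧ x ∈ V ∧ ∀ S ⊆ V, MeasurableSet S → ν S ≤ K * μ S)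
    {S : Set α} (hS : MeasurableSet S) : ν S ≤ K * μ S := by
  choose! V hVo hxV hV using h
  obtain ⟨t, htO, htc, hcov⟩ := TopologicalSpace.countable_cover_nhdsWithin (s := O) (f := V)
    fun x hx => mem_nhdsWithin_of_mem_nhds ((hVo x hx).mem_nhds (hxV x hx))
  rcases t.eq_empty_or_nonempty with rfl | hne
  · have : ν S ≤ ν Oᶜ := measure_mono fun x _ hx => by simpa using hcov hx
    rw [hO] at this
    exact this.trans zero_le
  obtain ⟨e, he⟩ := htc.exists_eq_range hne
  have heO : ∀ k, e k ∈ O := fun k => htO (he ▸ mem_range_self k)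
  set D := disjointed fun k => V (e k) with hD
  have hDm : ∀ k, MeasurableSet (D k) :=
    MeasurableSet.disjointed fun k => (hVo _ (heO k)).measurableSet
  have hsub : S ⊆ Oᶜ ∪ ⋃ k, S ∩ D k := by
    intro x hx
    by_cases hxO : x ∈ O
    · right
      rw [← inter_iUnion, hD, iUnion_disjointed]
      refine ⟨hx, ?_⟩
      obtain ⟨y, hy, hxy⟩ := mem_iUnion₂.1 (hcov hxO)
      rw [he] at hy
      obtain ⟨k, rfl⟩ := hy
      exact mem_iUnion.2 ⟨k, hxy⟩
    · exact Or.inl hxO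
  calc ν S ≤ ν Oᶜ + ν (⋃ k, S ∩ D k) := (measure_mono hsub).trans (measure_union_le _ _)
    _ ≤ ∑' k, ν (S ∩ D k) := by rw [hO, zero_add]; exact measure_iUnion_le _
    _ ≤ ∑' k, K * μ (S ∩ D k) := by
        refine ENNReal.tsum_le_tsum fun k => hV _ (heO k) _ ?_ (hS.inter (hDm k))
        exact inter_subset_right.trans (disjointed_subset _ _)
    _ = K * μ (⋃ k, S ∩ D k) := by
        rw [ENNReal.tsum_mul_left, measure_iUnion _ fun k => hS.inter (hDm k)]
        exact fun i j hij => ((disjoint_disjointed _) hij).mono inter_subset_right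
          inter_subset_right
    _ ≤ K * μ S := by
        gcongr
        exact iUnion_subset fun k => inter_subset_left

lemma le_of_forall_one_lt_mul_le {a b : ℝ≥0∞}
    (h : ∀ l : ℝ, 1 < l → a ≤ ENNReal.ofReal (l ^ 3) * b) : a ≤ b := by
  by_cases hb : b = ⊤
  · rw [hb]; exact le_top
  have h1 : Tendsto (fun l : ℝ => ENNReal.ofReal (l ^ 3) * b) (𝓝[>] 1) (𝓝 (1 * b)) := by
    refine ENNReal.Tendsto.mul_const ?_ (Or.inr hb)
    have : Tendsto (fun l : ℝ => ENNReal.ofReal (l ^ 3)) (𝓝 1) (𝓝 (ENNReal.ofReal (1 ^ 3))) :=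
      ENNReal.tendsto_ofReal ((continuous_pow 3).tendsto 1)
    simpa using this.mono_left nhdsWithin_le_nhds
  rw [one_mul] at h1
  exact ge_of_tendsto h1 (eventually_nhdsWithin_of_forall fun l hl => h l hl)

lemma euclideanHausdorffMeasure_image_le {X Y : Type*} [EMetricSpace X] [EMetricSpace Y]
    [MeasurableSpace X] [BorelSpace X] [MeasurableSpace Y] [BorelSpace Y] {K : NNReal} {f : X → Y}
    {s : Set X} (hf : LipschitzOnWith K f s) :
    (μHE[2] : Measure Y) (f '' s) ≤ (K : ℝ≥0∞) ^ 2 * (μHE[2] : Measure X) s := by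
  rw [Measure.euclideanHausdorffMeasure_def, Measure.euclideanHausdorffMeasure_def,
    Measure.smul_apply, Measure.smul_apply, ENNReal.smul_def, ENNReal.smul_def, smul_eq_mul,
    smul_eq_mul, mul_left_comm]
  gcongr
  have := hf.hausdorffMeasure_image_le (d := ((2 : ℕ) : ℝ)) (by norm_num)
  rwa [ENNReal.rpow_natCast] at this

/-- The Euclidean model of the plane. -/
def planeEquiv : (ℝ × ℝ) ≃L[ℝ] EuclideanSpace ℝ (Fin 2) :=
  ((LinearEquiv.finTwoArrow ℝ ℝ).symm.trans
    (WithLp.linearEquiv 2 ℝ (Fin 2 → ℝ)).symm).toContinuousLinearEquiv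

lemma norm_planeEquiv_sq (v : ℝ × ℝ) : ‖planeEquiv v‖ ^ 2 = v.1 ^ 2 + v.2 ^ 2 := by
  rw [EuclideanSpace.norm_sq_eq, Fin.sum_univ_two]
  simp [planeEquiv]

/-- The Hausdorff measure of the Euclidean plane is a multiple of Lebesgue measure on `ℝ × ℝ`; the
value of the constant is irrelevant below. -/
lemma exists_measure_planeEquiv_image : ∃ c : ℝ≥0∞, c ≠ 0 ∧ c ≠ ⊤ ∧ ∀ S : Set (ℝ × ℝ),
    (μHE[2] : Measure (EuclideanSpace ℝ (Fin 2))) (planeEquiv '' S) = c * volume S := by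
  rw [EuclideanSpace.euclideanHausdorffMeasure_eq_volume]
  have : (Measure.map planeEquiv.symm
      (volume : Measure (EuclideanSpace ℝ (Fin 2)))).IsAddHaarMeasure :=
    planeEquiv.symm.isAddHaarMeasure_map volume
  set m := Measure.map planeEquiv.symm (volume : Measure (EuclideanSpace ℝ (Fin 2))) with hm
  have hc := Measure.isAddLeftInvariant_eq_smul m volume
  have hc0 := Measure.addHaarScalarFactor_pos_of_isAddHaarMeasure m volume
  refine ⟨Measure.addHaarScalarFactor m volume, by exact_mod_cast hc0.ne', ENNReal.coe_ne_top,
    fun S => ?_⟩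
  have h1 : Measure.map planeEquiv.symm volume S = volume (planeEquiv '' S) := by
    have := (planeEquiv.symm.toHomeomorph.toMeasurableEquiv).map_apply (μ := volume) S
    rw [planeEquiv.image_eq_preimage_symm]
    exact this
  rw [← h1, ← hm]
  conv_lhs => rw [hc]
  rw [Measure.smul_apply, ENNReal.smul_def, smul_eq_mul]

/-- The area density of the graph of a function with derivative `L`. -/
def areaDensity (L : ℝ × ℝ →L[ℝ] ℝ) : ℝ := √(1 + L (1, 0) ^ 2 + L (0, 1) ^ 2)

lemma one_le_areaDensity (L : ℝ × ℝ →L[ℝ] ℝ) : 1 ≤ areaDensity L := by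
  rw [areaDensity, Real.one_le_sqrt]
  nlinarith [sq_nonneg (L (1, 0)), sq_nonneg (L (0, 1))]

lemma areaDensity_pos (L : ℝ × ℝ →L[ℝ] ℝ) : 0 < areaDensity L :=
  one_pos.trans_le (one_le_areaDensity L)

lemma areaDensity_sq (L : ℝ × ℝ →L[ℝ] ℝ) :
    areaDensity L ^ 2 = 1 + L (1, 0) ^ 2 + L (0, 1) ^ 2 := by
  rw [areaDensity, Real.sq_sqrt]
  positivity

lemma clm_prod_apply (L : ℝ × ℝ →L[ℝ] ℝ) (v : ℝ × ℝ) :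
    L v = v.1 * L (1, 0) + v.2 * L (0, 1) := by
  have : v = v.1 • ((1 : ℝ), (0 : ℝ)) + v.2 • ((0 : ℝ), (1 : ℝ)) := by ext <;> simp
  conv_lhs => rw [this, map_add, map_smul, map_smul]
  simp

lemma continuous_areaDensity : Continuous areaDensity := by
  unfold areaDensity
  fun_prop

/-- The square root `I + (1 + J)⁻¹ p ⊗ p` of `I + p ⊗ p`, where `p` is the gradient and `J` the
area density. -/
def stretch (L : ℝ × ℝ →L[ℝ] ℝ) : ℝ × ℝ →ₗ[ℝ] ℝ × ℝ :=
  Matrix.toLin (Module.Basis.finTwoProd ℝ) (Module.Basis.finTwoProd ℝ)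
    !![1 + (1 + areaDensity L)⁻¹ * L (1, 0) ^ 2, (1 + areaDensity L)⁻¹ * (L (1, 0) * L (0, 1));
      (1 + areaDensity L)⁻¹ * (L (1, 0) * L (0, 1)), 1 + (1 + areaDensity L)⁻¹ * L (0, 1) ^ 2]

lemma stretch_apply (L : ℝ × ℝ →L[ℝ] ℝ) (v : ℝ × ℝ) :
    stretch L v = (v.1 + (1 + areaDensity L)⁻¹ * L v * L (1, 0),
      v.2 + (1 + areaDensity L)⁻¹ * L v * L (0, 1)) := by
  rw [stretch, Matrix.toLin_finTwoProd_apply, clm_prod_apply L v]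
  ext <;> simp only <;> ring

lemma det_stretch (L : ℝ × ℝ →L[ℝ] ℝ) : LinearMap.det (stretch L) = areaDensity L := by
  rw [stretch, LinearMap.det_toLin, Matrix.det_fin_two_of]
  have h1 := areaDensity_sq L
  have h2 : 1 + areaDensity L ≠ 0 := by linarith [areaDensity_pos L]
  field_simp
  linear_combination -(1 + areaDensity L) * h1

lemma norm_frame_sq (b : OrthonormalBasis (Fin 3) ℝ E3) (p : (ℝ × ℝ) × ℝ) :
    ‖frame b p‖ ^ 2 = p.1.1 ^ 2 + p.1.2 ^ 2 + p.2 ^ 2 := by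
  rw [← real_inner_self_eq_norm_sq, inner_frame]
  simp only [frame_apply, inner_add_left, real_inner_smul_left, b.inner_eq_ite]
  simp
  ring

/-- `stretch` turns the metric induced by the graph of a linear function into the Euclidean one. -/
lemma norm_planeEquiv_stretch (b : OrthonormalBasis (Fin 3) ℝ E3) (L : ℝ × ℝ →L[ℝ] ℝ)
    (v : ℝ × ℝ) : ‖planeEquiv (stretch L v)‖ = ‖frame b (v, L v)‖ := by
  rw [← sq_eq_sq₀ (norm_nonneg _) (norm_nonneg _), norm_planeEquiv_sq, norm_frame_sq,
    stretch_apply]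
  have h1 := areaDensity_sq L
  have h2 : 1 + areaDensity L ≠ 0 := by linarith [areaDensity_pos L]
  have h3 := clm_prod_apply L v
  have h4 : (1 + areaDensity L)⁻¹ * 2 + ((1 + areaDensity L)⁻¹) ^ 2 *
      (L (1, 0) ^ 2 + L (0, 1) ^ 2) = 1 := by
    field_simp
    linear_combination -h1
  simp only
  linear_combination (L v) ^ 2 * h4 - 2 * (1 + areaDensity L)⁻¹ * L v * h3

lemma norm_le_norm_frame (b : OrthonormalBasis (Fin 3) ℝ E3) (v : ℝ × ℝ) (t : ℝ) :
    ‖v‖ ≤ ‖frame b (v, t)‖ := by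
  rw [Prod.norm_def, max_le_iff]
  constructor <;>
  · rw [Real.norm_eq_abs]
    apply abs_le_of_sq_le_sq _ (norm_nonneg _)
    rw [norm_frame_sq]
    nlinarith [sq_nonneg v.1, sq_nonneg v.2, sq_nonneg t]

variable {Γ : Set E3} {n : E3 → E3} {b : OrthonormalBasis (Fin 3) ℝ E3} {y₀ : E3} {h : ℝ × ℝ → ℝ}
  {R : ℝ} {U : Set E3}

/-- Near each point, the graph parametrization is almost isometric, after the linear change of
variables given by `stretch`. -/
lemma IsGraphChart.exists_almost_isometric (hC : IsGraphChart Γ b y₀ h R U) {s₀ : ℝ × ℝ}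
    (hs₀ : s₀ ∈ openSquare R) {l : ℝ} (hl : 1 < l) :
    ∃ V : Set (ℝ × ℝ), IsOpen V ∧ s₀ ∈ V ∧ V ⊆ openSquare R ∧
      (∀ s ∈ V, areaDensity (fderiv ℝ h s) ≤ l * areaDensity (fderiv ℝ h s₀) ∧
        areaDensity (fderiv ℝ h s₀) ≤ l * areaDensity (fderiv ℝ h s)) ∧
      ∀ s ∈ V, ∀ s' ∈ V,
        ‖chart b y₀ h s - chart b y₀ h s'‖ ≤
          l * ‖planeEquiv (stretch (fderiv ℝ h s₀) (s - s'))‖ ∧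
        ‖planeEquiv (stretch (fderiv ℝ h s₀) (s - s'))‖ ≤
          l * ‖chart b y₀ h s - chart b y₀ h s'‖ := by
  have hnh := (isOpen_openSquare R).mem_nhds hs₀
  have hst : HasStrictFDerivAt (chart b y₀ h) (chartDeriv b h s₀) s₀ := by
    have := (hC.contDiffOn_chart.contDiffAt hnh).hasStrictFDerivAt (by norm_num)
    rwa [(hC.hasFDerivAt_chart hs₀).fderiv] at this
  have hl0 : 0 < l := by linarith
  have hη : 0 < 1 - l⁻¹ := by rw [sub_pos]; exact inv_lt_one_of_one_lt₀ hl
  obtain ⟨V₁, hV₁, happ⟩ := hst.approximates_deriv_on_nhds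
    (c := (1 - l⁻¹).toNNReal) (Or.inr (Real.toNNReal_pos.2 hη))
  have hcont : ContinuousAt (fun s => areaDensity (fderiv ℝ h s)) s₀ := by
    refine continuous_areaDensity.continuousAt.comp ?_
    exact ((hC.contDiffOn.fderiv_of_isOpen (m := 4) (isOpen_openSquare R)
      (by norm_num)).continuousOn s₀ hs₀).continuousAt hnh
  have hJ := areaDensity_pos (fderiv ℝ h s₀)
  have h1 : ∀ᶠ s in 𝓝 s₀, areaDensity (fderiv ℝ h s) < l * areaDensity (fderiv ℝ h s₀) :=
    hcont.eventually_lt_const (by nlinarith)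
  have h2 : ∀ᶠ s in 𝓝 s₀, l⁻¹ * areaDensity (fderiv ℝ h s₀) < areaDensity (fderiv ℝ h s) :=
    hcont.eventually_const_lt (by
      have := inv_lt_one_of_one_lt₀ hl
      nlinarith)
  obtain ⟨V, hVsub, hVo, hsV⟩ := mem_nhds_iff.1 (inter_mem (inter_mem hnh hV₁) (h1.and h2))
  refine ⟨V, hVo, hsV, fun s hs => (hVsub hs).1.1, fun s hs => ⟨(hVsub hs).2.1.le, ?_⟩, ?_⟩
  · have := (hVsub hs).2.2
    rw [inv_mul_lt_iff₀ hl0] at this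
    exact this.le
  · intro s hs s' hs'
    have hap : ‖chart b y₀ h s - chart b y₀ h s' - chartDeriv b h s₀ (s - s')‖ ≤
        (1 - l⁻¹) * ‖s - s'‖ := by
      simpa [hη.le] using happ s (hVsub hs).1.2 s' (hVsub hs').1.2
    have hA : ‖planeEquiv (stretch (fderiv ℝ h s₀) (s - s'))‖ = ‖chartDeriv b h s₀ (s - s')‖ := by
      rw [norm_planeEquiv_stretch b, chartDeriv_apply]
    have hge : ‖s - s'‖ ≤ ‖chartDeriv b h s₀ (s - s')‖ := by
      rw [chartDeriv_apply]; exact norm_le_norm_frame b _ _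
    rw [hA]
    set x := chart b y₀ h s - chart b y₀ h s'
    set z := chartDeriv b h s₀ (s - s')
    have hxz : ‖x - z‖ ≤ (1 - l⁻¹) * ‖z‖ := hap.trans (by gcongr)
    have hz := norm_nonneg z
    have hx1 : ‖x‖ ≤ ‖z‖ + ‖x - z‖ := norm_le_norm_add_norm_sub' x z
    have hx2 : ‖z‖ ≤ ‖x‖ + ‖x - z‖ := norm_le_norm_add_norm_sub x z
    have hll : l * l⁻¹ = 1 := mul_inv_cancel₀ hl0.ne'
    constructor
    · have : (2 - l⁻¹) ≤ l := by nlinarith [sq_nonneg (l - 1), inv_pos.2 hl0]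
      nlinarith
    · have : l⁻¹ * ‖z‖ ≤ ‖x‖ := by nlinarith
      calc ‖z‖ = l * (l⁻¹ * ‖z‖) := by rw [← mul_assoc, hll, one_mul]
        _ ≤ l * ‖x‖ := by gcongr

/-- The image of the coordinate measure under a graph parametrization, weighted by the area
density. -/
def chartMeasure (h : ℝ × ℝ → ℝ) (R : ℝ) : Measure (ℝ × ℝ) :=
  (volume.restrict (openSquare R)).withDensity fun s => ENNReal.ofReal (areaDensity (fderiv ℝ h s))

lemma IsGraphChart.chart_image (hC : IsGraphChart Γ b y₀ h R U) {S : Set (ℝ × ℝ)}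
    (hS : S ⊆ openSquare R) : chart b y₀ h '' S = coord b y₀ ⁻¹' S ∩ (Γ ∩ U) := by
  ext y
  constructor
  · rintro ⟨s, hs, rfl⟩
    exact ⟨by rwa [mem_preimage, coord_chart], hC.chart_mem s (hS hs)⟩
  · rintro ⟨hy, hyU⟩
    exact ⟨_, hy, hC.chart_coord y hyU⟩

lemma measurable_coord : Measurable (coord b y₀) :=
  (contDiff_coord b y₀ (k := 0)).continuous.measurable

/-- The area formula for a graph: in graph coordinates, the Hausdorff measure on the surface has
the area density, up to a constant factor which normalises the measure on the plane. -/
theorem IsGraphChart.map_coord_surf (hΓ : IsClosedSurface Γ n) (hC : IsGraphChart Γ b y₀ h R U) :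
    ∃ c : ℝ≥0∞, c ≠ 0 ∧ c ≠ ⊤ ∧
      Measure.map (coord b y₀) ((surf Γ).restrict U) = c • chartMeasure h R := by
  obtain ⟨c, hc0, hct, hc⟩ := exists_measure_planeEquiv_image
  refine ⟨c, hc0, hct, ?_⟩
  have hΓm : MeasurableSet Γ := hΓ.isCompact.measurableSet
  have hsurf : (surf Γ).restrict U = (μHE[2] : Measure E3).restrict (Γ ∩ U) := by
    rw [surf, Measure.restrict_restrict hC.isOpen.measurableSet, inter_comm]
  have hν : ∀ S ⊆ openSquare R, MeasurableSet S →
      Measure.map (coord b y₀) ((surf Γ).restrict U) S = μHE[2] (chart b y₀ h '' S) := by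
    intro S hS hSm
    rw [Measure.map_apply measurable_coord hSm, hsurf,
      Measure.restrict_apply (measurable_coord hSm), hC.chart_image hS]
  have hμ : ∀ S ⊆ openSquare R, MeasurableSet S → (c • chartMeasure h R) S =
      c * ∫⁻ s in S, ENNReal.ofReal (areaDensity (fderiv ℝ h s)) := by
    intro S hS hSm
    rw [Measure.smul_apply, chartMeasure, withDensity_apply _ hSm,
      Measure.restrict_restrict hSm, inter_eq_self_of_subset_left hS, smul_eq_mul]
  have hstr : ∀ (L : ℝ × ℝ →L[ℝ] ℝ) (S : Set (ℝ × ℝ)),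
      (μHE[2] : Measure (EuclideanSpace ℝ (Fin 2))) ((fun s => planeEquiv (stretch L s)) '' S) =
      c * (ENNReal.ofReal (areaDensity L) * volume S) := by
    intro L S
    rw [← image_image (g := planeEquiv) (f := stretch L), hc, Measure.addHaar_image_linearMap,
      det_stretch, abs_of_pos (areaDensity_pos L)]
  -- locally both inequalities hold up to `l³`: a factor `l²` for the Lipschitz constants of the
  -- almost isometric parametrization and its inverse, and `l` for the oscillation of the density
  have hloc : ∀ l : ℝ, 1 < l → ∀ s₀ ∈ openSquare R, ∃ V, IsOpen V ∧ s₀ ∈ V ∧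
      ∀ S ⊆ V, MeasurableSet S →
      Measure.map (coord b y₀) ((surf Γ).restrict U) S ≤
        ENNReal.ofReal (l ^ 3) * (c • chartMeasure h R) S ∧
      (c • chartMeasure h R) S ≤
        ENNReal.ofReal (l ^ 3) * Measure.map (coord b y₀) ((surf Γ).restrict U) S := by
    intro l hl s₀ hs₀
    have hl0 : 0 < l := by linarith
    obtain ⟨V, hVo, hsV, hVR, hJ, hiso⟩ := hC.exists_almost_isometric hs₀ hl
    refine ⟨V, hVo, hsV, fun S hSV hS => ?_⟩
    rw [hν S (hSV.trans hVR) hS, hμ S (hSV.trans hVR) hS]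
    set J₀ := areaDensity (fderiv ℝ h s₀)
    let A : ℝ × ℝ → EuclideanSpace ℝ (Fin 2) := fun s => planeEquiv (stretch (fderiv ℝ h s₀) s)
    have hAsub : ∀ s s', A s - A s' = planeEquiv (stretch (fderiv ℝ h s₀) (s - s')) := by
      intro s s'; simp [A]
    have hAinj : Function.Injective A := by
      intro s s' hss
      have h1 := norm_planeEquiv_stretch b (fderiv ℝ h s₀) (s - s')
      rw [← hAsub, hss, sub_self, norm_zero] at h1
      have h2 := norm_le_norm_frame b (s - s') (fderiv ℝ h s₀ (s - s'))
      rw [← h1] at h2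
      exact sub_eq_zero.1 (norm_le_zero_iff.1 h2)
    have hAS := hstr (fderiv ℝ h s₀) S
    change μHE[2] (A '' S) = _ at hAS
    have hK : ((l.toNNReal : NNReal) : ℝ≥0∞) = ENNReal.ofReal l := rfl
    have hup : μHE[2] (chart b y₀ h '' S) ≤ ENNReal.ofReal l ^ 2 * μHE[2] (A '' S) := by
      have hlip : LipschitzOnWith l.toNNReal (chart b y₀ h ∘ Function.invFun A) (A '' S) := by
        refine LipschitzOnWith.of_dist_le_mul ?_
        rintro _ ⟨s, hs, rfl⟩ _ ⟨s', hs', rfl⟩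
        simp only [Function.comp, Function.leftInverse_invFun hAinj _]
        rw [dist_eq_norm, dist_eq_norm, hAsub, Real.coe_toNNReal _ hl0.le]
        exact (hiso s (hSV hs) s' (hSV hs')).1
      have := euclideanHausdorffMeasure_image_le hlip
      rwa [image_image, show (fun s => (chart b y₀ h ∘ Function.invFun A) (A s)) = chart b y₀ h from
        funext fun s => by simp [Function.leftInverse_invFun hAinj s], hK] at this
    have hdn : μHE[2] (A '' S) ≤ ENNReal.ofReal l ^ 2 * μHE[2] (chart b y₀ h '' S) := by
      have hlip : LipschitzOnWith l.toNNReal (A ∘ coord b y₀) (chart b y₀ h '' S) := by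
        refine LipschitzOnWith.of_dist_le_mul ?_
        rintro _ ⟨s, hs, rfl⟩ _ ⟨s', hs', rfl⟩
        simp only [Function.comp, coord_chart]
        rw [dist_eq_norm, dist_eq_norm, hAsub, Real.coe_toNNReal _ hl0.le]
        exact (hiso s (hSV hs) s' (hSV hs')).2
      have := euclideanHausdorffMeasure_image_le hlip
      rwa [image_image, show (fun s => (A ∘ coord b y₀) (chart b y₀ h s)) = A from
        funext fun s => by simp [coord_chart], hK] at this
    have hl3 : ENNReal.ofReal (l ^ 3) = ENNReal.ofReal l ^ 2 * ENNReal.ofReal l := by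
      rw [← ENNReal.ofReal_pow hl0.le, ← ENNReal.ofReal_mul (by positivity)]; ring_nf
    have hI1 : ENNReal.ofReal J₀ * volume S ≤
        ENNReal.ofReal l * ∫⁻ s in S, ENNReal.ofReal (areaDensity (fderiv ℝ h s)) := by
      rw [← setLIntegral_const, ← lintegral_const_mul' _ _ ENNReal.ofReal_ne_top]
      refine setLIntegral_mono' hS fun s hs => ?_
      rw [← ENNReal.ofReal_mul hl0.le]
      exact ENNReal.ofReal_le_ofReal (hJ s (hSV hs)).2
    have hI2 : ∫⁻ s in S, ENNReal.ofReal (areaDensity (fderiv ℝ h s)) ≤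
        ENNReal.ofReal l * (ENNReal.ofReal J₀ * volume S) := by
      rw [← setLIntegral_const, ← lintegral_const_mul' _ _ ENNReal.ofReal_ne_top]
      refine setLIntegral_mono' hS fun s hs => ?_
      rw [← ENNReal.ofReal_mul hl0.le]
      exact ENNReal.ofReal_le_ofReal (hJ s (hSV hs)).1
    constructor
    · calc μHE[2] (chart b y₀ h '' S) ≤ ENNReal.ofReal l ^ 2 * μHE[2] (A '' S) := hup
        _ ≤ ENNReal.ofReal l ^ 2 * (c * (ENNReal.ofReal l *
            ∫⁻ s in S, ENNReal.ofReal (areaDensity (fderiv ℝ h s)))) := by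
            rw [hAS]; gcongr
        _ = _ := by rw [hl3]; ring
    · calc c * ∫⁻ s in S, ENNReal.ofReal (areaDensity (fderiv ℝ h s))
          ≤ c * (ENNReal.ofReal l * (ENNReal.ofReal J₀ * volume S)) := by gcongr
        _ = ENNReal.ofReal l * μHE[2] (A '' S) := by rw [hAS]; ring
        _ ≤ ENNReal.ofReal l * (ENNReal.ofReal l ^ 2 * μHE[2] (chart b y₀ h '' S)) := by gcongr
        _ = _ := by rw [hl3]; ring
  have hRm := (isOpen_openSquare R).measurableSet
  have hO1 : Measure.map (coord b y₀) ((surf Γ).restrict U) (openSquare R)ᶜ = 0 := by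
    rw [Measure.map_apply measurable_coord hRm.compl, hsurf,
      Measure.restrict_apply (measurable_coord hRm.compl)]
    convert measure_empty (μ := (μHE[2] : Measure E3))
    ext y
    simp only [preimage_compl, mem_inter_iff, mem_compl_iff, mem_preimage, mem_empty_iff_false,
      iff_false, not_and]
    exact fun h1 h2 h3 => h1 (hC.coord_mem y ⟨h2, h3⟩)
  have hO2 : (c • chartMeasure h R) (openSquare R)ᶜ = 0 := by
    rw [Measure.smul_apply, chartMeasure, withDensity_apply _ hRm.compl,
      Measure.restrict_restrict hRm.compl]
    simp
  ext S hS
  refine le_antisymm (le_of_forall_one_lt_mul_le fun l hl => ?_)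
    (le_of_forall_one_lt_mul_le fun l hl => ?_)
  · refine measure_le_of_locally_le hO1 (fun s hs => ?_) hS
    obtain ⟨V, hVo, hsV, hV⟩ := hloc l hl s hs
    exact ⟨V, hVo, hsV, fun T hT hTm => (hV T hT hTm).1⟩
  · refine measure_le_of_locally_le hO2 (fun s hs => ?_) hS
    obtain ⟨V, hVo, hsV, hV⟩ := hloc l hl s hs
    exact ⟨V, hVo, hsV, fun T hT hTm => (hV T hT hTm).2⟩

lemma IsGraphChart.aemeasurable_chart (hC : IsGraphChart Γ b y₀ h R U) :
    AEMeasurable (chart b y₀ h) (chartMeasure h R) :=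
  (hC.contDiffOn_chart.continuousOn.aemeasurable (isOpen_openSquare R).measurableSet).mono_ac
    (withDensity_absolutelyContinuous _ _)

/-- The area formula for a graph, with the Hausdorff measure as an image measure. -/
theorem IsGraphChart.map_chart (hΓ : IsClosedSurface Γ n) (hC : IsGraphChart Γ b y₀ h R U) :
    ∃ c : ℝ≥0∞, c ≠ 0 ∧ c ≠ ⊤ ∧
      (surf Γ).restrict U = c • Measure.map (chart b y₀ h) (chartMeasure h R) := by
  obtain ⟨c, hc0, hct, hc⟩ := hC.map_coord_surf hΓ
  refine ⟨c, hc0, hct, ?_⟩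
  have hm : AEMeasurable (chart b y₀ h) (Measure.map (coord b y₀) ((surf Γ).restrict U)) := by
    rw [hc]; exact hC.aemeasurable_chart.smul_measure c
  rw [← Measure.map_smul, ← hc, AEMeasurable.map_map_of_aemeasurable hm
    measurable_coord.aemeasurable]
  conv_lhs => rw [← Measure.map_id (μ := (surf Γ).restrict U)]
  refine Measure.map_congr ?_
  rw [surf, Measure.restrict_restrict hC.isOpen.measurableSet]
  filter_upwards [ae_restrict_mem (hC.isOpen.measurableSet.inter hΓ.isCompact.measurableSet)]
    with y hy
  exact (hC.chart_coord y hy.symm).symm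

end AreaFormula

/-! ### The thin domain, its layers and patches -/

/-- The standing assumptions on the surface, its tubular radius `δ`, and the functions `g₀`, `g₁`
bounding the thin domain, whose absolute values are at most `δ₀ < δ`. -/
structure IsThinDatum (Γ : Set E3) (n : E3 → E3) (g₀ g₁ : E3 → ℝ) (δ δ₀ a : ℝ) : Prop where
  surface : IsClosedSurface Γ n
  tubular : IsTubularRadius Γ n δ
  contDiffOn_left : ContDiffOn ℝ 4 g₀ Γ
  contDiffOn_right : ContDiffOn ℝ 4 g₁ Γ
  pos : 0 < a
  le_sub : ∀ y ∈ Γ, a ≤ g₁ y - g₀ y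
  radius_lt : δ₀ < δ
  abs_left : ∀ y ∈ Γ, |g₀ y| ≤ δ₀
  abs_right : ∀ y ∈ Γ, |g₁ y| ≤ δ₀

/-- By compactness, `|g₀|` and `|g₁|` stay away from `δ`. -/
lemma exists_isThinDatum {Γ : Set E3} {n : E3 → E3} {g₀ g₁ : E3 → ℝ} {δ a : ℝ}
    (hΓ : IsClosedSurface Γ n) (hδ : IsTubularRadius Γ n δ) (hg₀ : ContDiffOn ℝ 4 g₀ Γ)
    (hg₁ : ContDiffOn ℝ 4 g₁ Γ) (ha : 0 < a) (hga : ∀ y ∈ Γ, a ≤ g₁ y - g₀ y)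
    (hb : ∀ y ∈ Γ, |g₀ y| < δ ∧ |g₁ y| < δ) : ∃ δ₀, IsThinDatum Γ n g₀ g₁ δ δ₀ a := by
  obtain ⟨y, hy, hmax⟩ := hΓ.isCompact.exists_isMaxOn hΓ.isConnected.nonempty
    (f := fun y => max |g₀ y| |g₁ y|) (hg₀.continuousOn.abs.sup hg₁.continuousOn.abs)
  exact ⟨max |g₀ y| |g₁ y|, hΓ, hδ, hg₀, hg₁, ha, hga, max_lt (hb y hy).1 (hb y hy).2,
    fun z hz => (le_max_left _ _).trans (hmax hz), fun z hz => (le_max_right _ _).trans (hmax hz)⟩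

/-- The height over the surface point `y` of the intermediate layer with parameter `τ`, running from
the lower boundary (`τ = 0`) to the upper boundary (`τ = 1`) of the thin domain. -/
def layer (g₀ g₁ : E3 → ℝ) (ε τ : ℝ) (y : E3) : ℝ := ε * (g₀ y + τ * (g₁ y - g₀ y))

/-- The point of the layer `τ` over the surface point `y`. -/
def layerPoint (n : E3 → E3) (g₀ g₁ : E3 → ℝ) (ε τ : ℝ) (y : E3) : E3 :=
  y + layer g₀ g₁ ε τ y • n y

/-- The projection onto the layer `τ` along the normals. -/
def layerProj (Γ : Set E3) (n : E3 → E3) (g₀ g₁ : E3 → ℝ) (ε τ : ℝ) (x : E3) : E3 :=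
  layerPoint n g₀ g₁ ε τ (proj Γ x)

section Layers

variable {Γ : Set E3} {n : E3 → E3} {g₀ g₁ : E3 → ℝ} {δ δ₀ a ε τ : ℝ}

lemma IsThinDatum.radius_nonneg (hT : IsThinDatum Γ n g₀ g₁ δ δ₀ a) : 0 ≤ δ₀ := by
  obtain ⟨y, hy⟩ := hT.surface.isConnected.nonempty
  exact (abs_nonneg _).trans (hT.abs_left y hy)

lemma IsThinDatum.abs_layer_le (hT : IsThinDatum Γ n g₀ g₁ δ δ₀ a) (hε : ε ∈ Icc (0 : ℝ) 1)
    (hτ : τ ∈ Icc (0 : ℝ) 1) {y : E3} (hy : y ∈ Γ) : |layer g₀ g₁ ε τ y| ≤ δ₀ := by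
  have h0 := abs_le.1 (hT.abs_left y hy)
  have h1 := abs_le.1 (hT.abs_right y hy)
  have h2 : |g₀ y + τ * (g₁ y - g₀ y)| ≤ δ₀ := by
    rw [abs_le]
    obtain ⟨ha, hb⟩ := hτ
    constructor <;> nlinarith
  rw [layer, abs_mul, abs_of_nonneg hε.1]
  calc ε * |g₀ y + τ * (g₁ y - g₀ y)| ≤ 1 * δ₀ := by
        gcongr
        exact hε.2
    _ = δ₀ := one_mul _

lemma IsThinDatum.mem_Ioo (hT : IsThinDatum Γ n g₀ g₁ δ δ₀ a) {r : ℝ} (hr : |r| ≤ δ₀) :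
    r ∈ Ioo (-δ) δ := abs_lt.1 (hr.trans_lt hT.radius_lt)

lemma IsThinDatum.proj_layerPoint (hT : IsThinDatum Γ n g₀ g₁ δ δ₀ a) (hε : ε ∈ Icc (0 : ℝ) 1)
    (hτ : τ ∈ Icc (0 : ℝ) 1) {y : E3} (hy : y ∈ Γ) : proj Γ (layerPoint n g₀ g₁ ε τ y) = y :=
  proj_add_smul hT.surface hT.tubular hy (hT.mem_Ioo (hT.abs_layer_le hε hτ hy))

/-- The thin domain is the union of its layers with parameters in `(0, 1)`. -/
lemma IsThinDatum.mem_thin_iff (hT : IsThinDatum Γ n g₀ g₁ δ δ₀ a) (hε : 0 < ε) {x : E3} :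
    x ∈ thin Γ n g₀ g₁ ε ↔ ∃ y ∈ Γ, ∃ τ ∈ Ioo (0 : ℝ) 1, x = layerPoint n g₀ g₁ ε τ y := by
  constructor
  · rintro ⟨y, hy, r, h0, h1, rfl⟩
    have hg : 0 < g₁ y - g₀ y := hT.pos.trans_le (hT.le_sub y hy)
    refine ⟨y, hy, (r - ε * g₀ y) / (ε * (g₁ y - g₀ y)), ⟨by apply div_pos <;> nlinarith, ?_⟩, ?_⟩
    · rw [div_lt_one (by positivity)]; nlinarith
    · rw [layerPoint, layer]
      congr 2
      field_simp
      ring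
  · rintro ⟨y, hy, τ, hτ, rfl⟩
    have hg : 0 < ε * (g₁ y - g₀ y) := mul_pos hε (hT.pos.trans_le (hT.le_sub y hy))
    exact ⟨y, hy, _, by rw [layer]; nlinarith [hτ.1], by rw [layer]; nlinarith [hτ.2], rfl⟩

lemma IsThinDatum.layerPoint_mem (hT : IsThinDatum Γ n g₀ g₁ δ δ₀ a) (hε : 0 < ε)
    (hτ : τ ∈ Ioo (0 : ℝ) 1) {y : E3} (hy : y ∈ Γ) :
    layerPoint n g₀ g₁ ε τ y ∈ thin Γ n g₀ g₁ ε := (hT.mem_thin_iff hε).2 ⟨y, hy, τ, hτ, rfl⟩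

/-- The compact tubular neighbourhood `{y + r n(y) | |r| ≤ δ₀}`. -/
def closedTube (Γ : Set E3) (n : E3 → E3) (δ₀ : ℝ) : Set E3 :=
  (fun p : E3 × ℝ => p.1 + p.2 • n p.1) '' (Γ ×ˢ Icc (-δ₀) δ₀)

lemma IsClosedSurface.isCompact_closedTube (hΓ : IsClosedSurface Γ n) :
    IsCompact (closedTube Γ n δ₀) := by
  refine (hΓ.isCompact.prod isCompact_Icc).image_of_continuousOn ?_
  have hn : ContinuousOn (fun p : E3 × ℝ => n p.1) (Γ ×ˢ Icc (-δ₀) δ₀) :=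
    hΓ.contDiffOn_normal.continuousOn.comp continuousOn_fst fun p hp => hp.1
  exact continuousOn_fst.add (continuousOn_snd.smul hn)

lemma IsThinDatum.closedTube_subset (hT : IsThinDatum Γ n g₀ g₁ δ δ₀ a) :
    closedTube Γ n δ₀ ⊆ tube Γ n δ := by
  rintro _ ⟨p, ⟨hp, hr⟩, rfl⟩
  exact ⟨p.1, hp, p.2, hT.mem_Ioo (abs_le.2 hr), rfl⟩

lemma IsThinDatum.thin_subset_closedTube (hT : IsThinDatum Γ n g₀ g₁ δ δ₀ a)
    (hε : ε ∈ Ioc (0 : ℝ) 1) : thin Γ n g₀ g₁ ε ⊆ closedTube Γ n δ₀ := by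
  intro x hx
  obtain ⟨y, hy, τ, hτ, rfl⟩ := (hT.mem_thin_iff hε.1).1 hx
  exact ⟨(y, _), ⟨hy, abs_le.1 (hT.abs_layer_le ⟨hε.1.le, hε.2⟩ ⟨hτ.1.le, hτ.2.le⟩ hy)⟩, rfl⟩

lemma IsThinDatum.thin_subset_tube (hT : IsThinDatum Γ n g₀ g₁ δ δ₀ a)
    (hε : ε ∈ Ioc (0 : ℝ) 1) : thin Γ n g₀ g₁ ε ⊆ tube Γ n δ :=
  (hT.thin_subset_closedTube hε).trans hT.closedTube_subset

lemma IsThinDatum.proj_mem (hT : IsThinDatum Γ n g₀ g₁ δ δ₀ a) (hε : ε ∈ Ioc (0 : ℝ) 1) {x : E3}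
    (hx : x ∈ thin Γ n g₀ g₁ ε) : proj Γ x ∈ Γ :=
  CTD.proj_mem hT.surface hT.tubular (hT.thin_subset_tube hε hx)

lemma IsThinDatum.isOpen_thin (hT : IsThinDatum Γ n g₀ g₁ δ δ₀ a) (hε : ε ∈ Ioc (0 : ℝ) 1) :
    IsOpen (thin Γ n g₀ g₁ ε) := by
  have hO := isOpen_tube hT.surface hT.tubular
  have hd := (contDiffOn_sdist hT.surface hT.tubular).continuousOn
  have h0 := (contDiffOn_ext hT.surface hT.tubular hT.contDiffOn_left).continuousOn
  have h1 := (contDiffOn_ext hT.surface hT.tubular hT.contDiffOn_right).continuousOn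
  have : thin Γ n g₀ g₁ ε = tube Γ n δ ∩ (fun x => (sdist Γ n x - ε * ext Γ g₀ x,
      ε * ext Γ g₁ x - sdist Γ n x)) ⁻¹' (Ioi 0 ×ˢ Ioi 0) := by
    ext x
    constructor
    · intro hx
      refine ⟨hT.thin_subset_tube hε hx, ?_⟩
      obtain ⟨y, hy, τ, hτ, rfl⟩ := (hT.mem_thin_iff hε.1).1 hx
      have hτ' : τ ∈ Icc (0 : ℝ) 1 := ⟨hτ.1.le, hτ.2.le⟩
      have hε' : ε ∈ Icc (0 : ℝ) 1 := ⟨hε.1.le, hε.2⟩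
      have hg : 0 < ε * (g₁ y - g₀ y) := mul_pos hε.1 (hT.pos.trans_le (hT.le_sub y hy))
      simp only [mem_preimage, mem_prod, mem_Ioi, ext, hT.proj_layerPoint hε' hτ' hy]
      rw [layerPoint, sdist_add_smul hT.surface hT.tubular hy
        (hT.mem_Ioo (hT.abs_layer_le hε' hτ' hy)), layer]
      constructor <;> nlinarith [hτ.1, hτ.2]
    · rintro ⟨hx, h2, h3⟩
      exact ⟨proj Γ x, CTD.proj_mem hT.surface hT.tubular hx, sdist Γ n x,
        sub_pos.1 h2, sub_pos.1 h3, (proj_add_sdist hT.surface hT.tubular hx).symm⟩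
  rw [this]
  exact ContinuousOn.isOpen_inter_preimage (by fun_prop) hO (isOpen_Ioi.prod isOpen_Ioi)

end Layers

/-- A graph chart with its data bundled. -/
structure GraphPatch (Γ : Set E3) where
  b : OrthonormalBasis (Fin 3) ℝ E3
  y₀ : E3
  h : ℝ × ℝ → ℝ
  R : ℝ
  U : Set E3
  isGraphChart : IsGraphChart Γ b y₀ h R U

namespace GraphPatch

variable {Γ : Set E3} (c : GraphPatch Γ)

/-- The parametrization of the patch. -/
def χ (s : ℝ × ℝ) : E3 := chart c.b c.y₀ c.h s

/-- The coordinate square of half the size on which the patch is used. -/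
def Q : Set (ℝ × ℝ) := square (c.R / 2)

lemma Q_subset : c.Q ⊆ openSquare c.R :=
  square_subset_openSquare (by linarith [c.isGraphChart.pos])

lemma measurableSet_Q : MeasurableSet c.Q := measurableSet_square _

lemma χ_mem {s : ℝ × ℝ} (hs : s ∈ openSquare c.R) : c.χ s ∈ Γ := (c.isGraphChart.chart_mem s hs).1

lemma contDiffOn_χ : ContDiffOn ℝ 5 c.χ (openSquare c.R) := c.isGraphChart.contDiffOn_chart

end GraphPatch

/-- By compactness, finitely many patches cover the surface. -/
theorem IsClosedSurface.exists_cover {Γ : Set E3} {n : E3 → E3} (hΓ : IsClosedSurface Γ n) :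
    ∃ t : Finset (GraphPatch Γ), ∀ y ∈ Γ, ∃ c ∈ t, y ∈ c.χ '' c.Q := by
  classical
  have hex : ∀ y ∈ Γ, ∃ c : GraphPatch Γ, c.y₀ = y := by
    intro y hy
    obtain ⟨b, h, R, U, hC⟩ := hΓ.exists_graphChart hy
    exact ⟨⟨b, y, h, R, U, hC⟩, rfl⟩
  have : Nonempty (GraphPatch Γ) := by
    obtain ⟨y, hy⟩ := hΓ.isConnected.nonempty
    exact (hex y hy).nonempty
  choose! c hc using hex
  obtain ⟨t, htΓ, ht⟩ := hΓ.isCompact.elim_nhds_subcover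
    (fun y => (c y).U ∩ coord (c y).b (c y).y₀ ⁻¹' openSquare ((c y).R / 2)) fun y hy => by
      have hC := (c y).isGraphChart
      have hyU : y ∈ (c y).U := by
        have := hC.mem.2
        rwa [hc y hy] at this
      refine inter_mem (hC.isOpen.mem_nhds hyU) ?_
      refine ((contDiff_coord (c y).b (c y).y₀ (k := 0)).continuous).continuousAt.preimage_mem_nhds
        ((isOpen_openSquare _).mem_nhds ?_)
      rw [hc y hy]
      have := hC.pos
      simp [coord, openSquare, this]
  refine ⟨t.image c, fun y hy => ?_⟩
  obtain ⟨z, hz, hyz⟩ := mem_iUnion₂.1 (ht hy)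
  refine ⟨c z, Finset.mem_image_of_mem _ hz, coord (c z).b (c z).y₀ y, ?_, ?_⟩
  · exact ⟨Ioo_subset_Icc_self hyz.2.1, Ioo_subset_Icc_self hyz.2.2⟩
  · exact (c z).isGraphChart.chart_coord y ⟨hy, hyz.1⟩

section NormalChart

variable {Γ : Set E3} {n : E3 → E3} {g₀ g₁ : E3 → ℝ} {δ δ₀ a ε τ : ℝ}

/-- Normal coordinates over a patch. -/
def GraphPatch.normalChart (c : GraphPatch Γ) (n : E3 → E3) (p : (ℝ × ℝ) × ℝ) : E3 :=
  c.χ p.1 + p.2 • n (c.χ p.1)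

lemma GraphPatch.contDiffOn_normal_χ (c : GraphPatch Γ) (hΓ : IsClosedSurface Γ n) :
    ContDiffOn ℝ 4 (fun s => n (c.χ s)) (openSquare c.R) :=
  hΓ.contDiffOn_normal.comp (c.contDiffOn_χ.of_le (by norm_num)) fun _ hs => c.χ_mem hs

lemma GraphPatch.contDiffOn_normalChart (c : GraphPatch Γ) (hΓ : IsClosedSurface Γ n) :
    ContDiffOn ℝ 4 (c.normalChart n) (openSquare c.R ×ˢ univ) := by
  have h1 : ContDiffOn ℝ 4 (fun p : (ℝ × ℝ) × ℝ => c.χ p.1) (openSquare c.R ×ˢ univ) :=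
    (c.contDiffOn_χ.of_le (by norm_num)).comp contDiff_fst.contDiffOn fun p hp => hp.1
  have h2 : ContDiffOn ℝ 4 (fun p : (ℝ × ℝ) × ℝ => n (c.χ p.1)) (openSquare c.R ×ˢ univ) :=
    (c.contDiffOn_normal_χ hΓ).comp contDiff_fst.contDiffOn fun p hp => hp.1
  exact h1.add (contDiff_snd.contDiffOn.smul h2)

/-- The normal chart in linear coordinates, a map of the coordinate space into itself. -/
def GraphPatch.normalChartCoord (c : GraphPatch Γ) (n : E3 → E3) (p : (ℝ × ℝ) × ℝ) :
    (ℝ × ℝ) × ℝ := (frame c.b).symm (c.normalChart n p)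

lemma GraphPatch.contDiffOn_normalChartCoord (c : GraphPatch Γ) (hΓ : IsClosedSurface Γ n) :
    ContDiffOn ℝ 4 (c.normalChartCoord n) (openSquare c.R ×ˢ univ) :=
  (frame c.b).symm.contDiff.comp_contDiffOn (c.contDiffOn_normalChart hΓ)

lemma GraphPatch.injOn_normalChart (c : GraphPatch Γ) (hδ : IsTubularRadius Γ n δ) :
    InjOn (c.normalChart n) (openSquare c.R ×ˢ Ioo (-δ) δ) := by
  rintro ⟨s, r⟩ ⟨hs, hr⟩ ⟨s', r'⟩ ⟨hs', hr'⟩ h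
  have := hδ.2.1 (mk_mem_prod (c.χ_mem hs) hr) (mk_mem_prod (c.χ_mem hs') hr') h
  have h1 : c.χ s = c.χ s' := congrArg Prod.fst this
  have h2 : r = r' := congrArg Prod.snd this
  have h3 := congrArg (coord c.b c.y₀) h1
  simp only [GraphPatch.χ, coord_chart] at h3
  rw [h3, h2]

/-- The Jacobian of the normal chart does not vanish, since the normal chart has the smooth left
inverse `x ↦ (coord (π x), d x)`. -/
lemma GraphPatch.det_normalChartCoord_ne_zero (c : GraphPatch Γ) (hΓ : IsClosedSurface Γ n)
    (hδ : IsTubularRadius Γ n δ) {p : (ℝ × ℝ) × ℝ} (hp : p ∈ openSquare c.R ×ˢ Ioo (-δ) δ) :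
    (fderiv ℝ (c.normalChartCoord n) p).det ≠ 0 := by
  have hO : openSquare c.R ×ˢ Ioo (-δ) δ ∈ 𝓝 p :=
    ((isOpen_openSquare c.R).prod isOpen_Ioo).mem_nhds hp
  have hN : HasFDerivAt (c.normalChartCoord n) (fderiv ℝ (c.normalChartCoord n) p) p := by
    have hO' : openSquare c.R ×ˢ univ ∈ 𝓝 p :=
      ((isOpen_openSquare c.R).prod isOpen_univ).mem_nhds ⟨hp.1, mem_univ _⟩
    exact (((c.contDiffOn_normalChartCoord hΓ).contDiffAt hO').differentiableAt
      (by norm_num)).hasFDerivAt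
  have hmem : c.normalChart n p ∈ tube Γ n δ := ⟨c.χ p.1, c.χ_mem hp.1, p.2, hp.2, rfl⟩
  have hfr : frame c.b (c.normalChartCoord n p) = c.normalChart n p :=
    (frame c.b).apply_symm_apply _
  let Λ : E3 → (ℝ × ℝ) × ℝ := fun x => (coord c.b c.y₀ (proj Γ x), sdist Γ n x)
  have hΛ : DifferentiableAt ℝ Λ (c.normalChart n p) := by
    have h1 := ((contDiffOn_proj_sdist hΓ hδ).contDiffAt
      ((isOpen_tube hΓ hδ).mem_nhds hmem)).differentiableAt (by norm_num)
    have h2 : DifferentiableAt ℝ (coord c.b c.y₀) (proj Γ (c.normalChart n p)) :=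
      (contDiff_coord c.b c.y₀ (k := 1)).differentiable (by norm_num) _
    exact (h2.comp _ h1.fst).prodMk h1.snd
  have hcomp : HasFDerivAt (Λ ∘ (frame c.b) ∘ c.normalChartCoord n)
      ((fderiv ℝ Λ (c.normalChart n p)).comp
        ((frame c.b : (ℝ × ℝ) × ℝ →L[ℝ] E3).comp (fderiv ℝ (c.normalChartCoord n) p))) p := by
    refine HasFDerivAt.comp p ?_ ((frame c.b).hasFDerivAt.comp p hN)
    simp only [Function.comp, hfr]
    exact hΛ.hasFDerivAt
  have hid : Λ ∘ (frame c.b) ∘ c.normalChartCoord n =ᶠ[𝓝 p] id := by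
    filter_upwards [hO] with q hq
    have hfq : frame c.b (c.normalChartCoord n q) = c.normalChart n q :=
      (frame c.b).apply_symm_apply _
    simp only [Function.comp, hfq, Λ, id]
    rw [GraphPatch.normalChart, proj_add_smul hΓ hδ (c.χ_mem hq.1) hq.2,
      sdist_add_smul hΓ hδ (c.χ_mem hq.1) hq.2, GraphPatch.χ, coord_chart]
  have huniq := hcomp.unique ((hasFDerivAt_id p).congr_of_eventuallyEq hid)
  intro hdet
  obtain ⟨v, hv0, hv⟩ := (Submodule.ne_bot_iff _).1 (LinearMap.det_eq_zero_iff_ker_ne_bot.1 hdet)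
  have := congrArg (fun L => L v) huniq
  simp only [ContinuousLinearMap.comp_apply, ContinuousLinearMap.id_apply] at this
  apply hv
  rw [← this]
  have hz : fderiv ℝ (c.normalChartCoord n) p v = 0 := hv0
  simp [hz]

end NormalChart

/-! ### Volume in layer coordinates -/

section PatchMeasure

variable {Γ : Set E3} {n : E3 → E3} {g₀ g₁ : E3 → ℝ} {δ δ₀ a ε τ : ℝ}

lemma setLIntegral_Ioo_affine {α β : ℝ} (h : α < β) (G : ℝ → ℝ≥0∞) :
    ∫⁻ r in Ioo α β, G r =
      ENNReal.ofReal (β - α) * ∫⁻ t in Ioo (0 : ℝ) 1, G (α + t * (β - α)) := by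
  have hpos : 0 < β - α := sub_pos.2 h
  have himg : (fun t => α + t * (β - α)) '' Ioo 0 1 = Ioo α β := by
    ext r
    constructor
    · rintro ⟨t, ht, rfl⟩
      constructor <;> nlinarith [ht.1, ht.2]
    · rintro ⟨h1, h2⟩
      refine ⟨(r - α) / (β - α), ⟨by apply div_pos <;> linarith, ?_⟩, ?_⟩
      · rw [div_lt_one hpos]; linarith
      · simp only
        field_simp
        ring
  rw [← himg, lintegral_image_eq_lintegral_abs_deriv_mul measurableSet_Ioo
    (f' := fun _ => β - α) (fun t _ => by
      have := ((hasDerivAt_id t).mul_const (β - α)).const_add α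
      simpa using this.hasDerivWithinAt) (fun t _ t' _ htt => by
      have : t * (β - α) = t' * (β - α) := by simpa using htt
      exact mul_right_cancel₀ hpos.ne' this),
    lintegral_const_mul' _ _ ENNReal.ofReal_ne_top, abs_of_pos hpos]

instance : (volume : Measure ((ℝ × ℝ) × ℝ)).IsAddHaarMeasure :=
  Measure.prod.instIsAddHaarMeasure volume volume

/-- Lebesgue measure in the coordinates of an orthonormal basis, up to a constant. -/
lemma exists_volume_eq_frame (b : OrthonormalBasis (Fin 3) ℝ E3) : ∃ k : ℝ≥0∞, k ≠ 0 ∧ k ≠ ⊤ ∧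
    ∀ (F : E3 → ℝ≥0∞) (A : Set E3),
      ∫⁻ x in A, F x = k * ∫⁻ p in frame b ⁻¹' A, F (frame b p) := by
  set m := Measure.map (frame b) (volume : Measure ((ℝ × ℝ) × ℝ)) with hm
  have : m.IsAddHaarMeasure := (frame b).isAddHaarMeasure_map volume
  have hc := Measure.isAddLeftInvariant_eq_smul (volume : Measure E3) m
  have hc0 := Measure.addHaarScalarFactor_pos_of_isAddHaarMeasure (volume : Measure E3) m
  refine ⟨Measure.addHaarScalarFactor (volume : Measure E3) m, by exact_mod_cast hc0.ne',
    ENNReal.coe_ne_top, fun F A => ?_⟩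
  have hemb : MeasurableEmbedding (frame b) :=
    (frame b).toHomeomorph.toMeasurableEquiv.measurableEmbedding
  have e : ∫⁻ x in A, F x ∂m = ∫⁻ p in frame b ⁻¹' A, F (frame b p) := by
    rw [hm, hemb.restrict_map, hemb.lintegral_map]
  rw [← e]
  conv_lhs => rw [hc]
  rw [Measure.restrict_smul, lintegral_smul_measure]
  rfl

lemma GraphPatch.layer_mem (c : GraphPatch Γ) (hT : IsThinDatum Γ n g₀ g₁ δ δ₀ a)
    (hε : ε ∈ Ioc (0 : ℝ) 1) {s : ℝ × ℝ} (hs : s ∈ c.Q) {r : ℝ}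
    (hr : r ∈ Ioo (ε * g₀ (c.χ s)) (ε * g₁ (c.χ s))) : r ∈ Icc (-δ₀) δ₀ := by
  have hy := c.χ_mem (c.Q_subset hs)
  have h0 := hT.abs_layer_le (τ := 0) ⟨hε.1.le, hε.2⟩ (by simp) hy
  have h1 := hT.abs_layer_le (τ := 1) ⟨hε.1.le, hε.2⟩ (by simp) hy
  simp only [layer, zero_mul, add_zero, one_mul, add_sub_cancel] at h0 h1
  rw [abs_le] at h0 h1
  exact ⟨h0.1.trans hr.1.le, hr.2.le.trans h1.2⟩

/-- The part of the thin domain over the coordinate square of a patch. -/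
def GraphPatch.part (c : GraphPatch Γ) (n : E3 → E3) (g₀ g₁ : E3 → ℝ) (ε : ℝ) : Set E3 :=
  c.normalChart n ''
    {p | p.1 ∈ c.Q ∧ p.2 ∈ Ioo (ε * g₀ (c.χ p.1)) (ε * g₁ (c.χ p.1))}

lemma GraphPatch.part_subset (c : GraphPatch Γ) : c.part n g₀ g₁ ε ⊆ thin Γ n g₀ g₁ ε := by
  rintro _ ⟨p, ⟨hp, hr⟩, rfl⟩
  exact ⟨_, c.χ_mem (c.Q_subset hp), p.2, hr.1, hr.2, rfl⟩

lemma thin_subset_iUnion_part {t : Finset (GraphPatch Γ)}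
    (ht : ∀ y ∈ Γ, ∃ c ∈ t, y ∈ c.χ '' c.Q) :
    thin Γ n g₀ g₁ ε ⊆ ⋃ c : t, c.1.part n g₀ g₁ ε := by
  rintro _ ⟨y, hy, r, h0, h1, rfl⟩
  obtain ⟨c, hc, s, hs, rfl⟩ := ht y hy
  exact mem_iUnion.2 ⟨⟨c, hc⟩, (s, r), ⟨hs, h0, h1⟩, rfl⟩

/-- In the coordinates given by a patch and the layer parameter, the volume on the thin domain is
comparable to `ε` times the Lebesgue measure, uniformly in `ε`. -/
theorem GraphPatch.exists_lintegral_part (c : GraphPatch Γ)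
    (hT : IsThinDatum Γ n g₀ g₁ δ δ₀ a) :
    ∃ K : ℝ≥0∞, K ≠ ⊤ ∧ ∀ ε ∈ Ioc (0 : ℝ) 1, ∀ F : E3 → ℝ≥0∞,
      Measurable ((thin Γ n g₀ g₁ ε).indicator F) →
      ∫⁻ x in c.part n g₀ g₁ ε, F x ≤ K * (ENNReal.ofReal ε *
        ∫⁻ s in c.Q, ∫⁻ t in Ioo (0 : ℝ) 1, F (layerPoint n g₀ g₁ ε t (c.χ s))) ∧
      ENNReal.ofReal ε *
        ∫⁻ s in c.Q, ∫⁻ t in Ioo (0 : ℝ) 1, F (layerPoint n g₀ g₁ ε t (c.χ s)) ≤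
        K * ∫⁻ x in thin Γ n g₀ g₁ ε, F x := by
  have hΓ := hT.surface
  set B : Set ((ℝ × ℝ) × ℝ) := c.Q ×ˢ Icc (-δ₀) δ₀ with hB
  have hBc : IsCompact B := (isCompact_square _).prod isCompact_Icc
  have hBsub : B ⊆ openSquare c.R ×ˢ Ioo (-δ) δ := fun p hp =>
    ⟨c.Q_subset hp.1, hT.mem_Ioo (abs_le.2 hp.2)⟩
  have hBne : B.Nonempty := by
    have := c.isGraphChart.pos
    have h0 := hT.radius_nonneg
    refine ⟨0, ?_, ?_⟩
    · constructor <;> constructor <;> simp <;> linarith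
    · constructor <;> simp <;> linarith
  have hOo : IsOpen (openSquare c.R ×ˢ (univ : Set ℝ)) := (isOpen_openSquare _).prod isOpen_univ
  have hsm := c.contDiffOn_normalChartCoord hΓ
  have hdiff : ∀ p ∈ B, HasFDerivAt (c.normalChartCoord n)
      (fderiv ℝ (c.normalChartCoord n) p) p := fun p hp =>
    ((hsm.contDiffAt (hOo.mem_nhds ⟨(hBsub hp).1, mem_univ _⟩)).differentiableAt
      (by norm_num)).hasFDerivAt
  have hdet : ContinuousOn (fun p => |(fderiv ℝ (c.normalChartCoord n) p).det|) B := by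
    have h1 : ContinuousOn (fderiv ℝ (c.normalChartCoord n)) B :=
      (hsm.fderiv_of_isOpen (m := 3) hOo (by norm_num)).continuousOn.mono
        fun p hp => ⟨(hBsub hp).1, mem_univ _⟩
    exact (ContinuousLinearMap.continuous_det.comp_continuousOn h1).abs
  obtain ⟨pmin, hpmin, hmin⟩ := hBc.exists_isMinOn hBne hdet
  obtain ⟨pmax, hpmax, hmax⟩ := hBc.exists_isMaxOn hBne hdet
  set d₀ := |(fderiv ℝ (c.normalChartCoord n) pmin).det| with hd₀
  set d₁ := |(fderiv ℝ (c.normalChartCoord n) pmax).det| with hd₁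
  have hd₀pos : 0 < d₀ :=
    abs_pos.2 (c.det_normalChartCoord_ne_zero hΓ hT.tubular (hBsub hpmin))
  obtain ⟨k, hk0, hkt, hk⟩ := exists_volume_eq_frame c.b
  have hδ₀ := hT.radius_nonneg
  have ha := hT.pos
  have hkk : k * k⁻¹ = 1 := ENNReal.mul_inv_cancel hk0 hkt
  have hda : ENNReal.ofReal (d₀ * a) ≠ 0 := by
    simp only [ne_eq, ENNReal.ofReal_eq_zero, not_le]; positivity
  refine ⟨max (k * ENNReal.ofReal (d₁ * (2 * δ₀))) ((k * ENNReal.ofReal (d₀ * a))⁻¹), ?_, ?_⟩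
  · refine max_ne_top ?_ ?_
    · exact ENNReal.mul_ne_top hkt ENNReal.ofReal_ne_top
    · exact ENNReal.inv_ne_top.2 (mul_ne_zero hk0 hda)
  intro ε hε F hF
  have hεi : ε ∈ Icc (0 : ℝ) 1 := ⟨hε.1.le, hε.2⟩
  set D : Set ((ℝ × ℝ) × ℝ) :=
    {p | p.1 ∈ c.Q ∧ p.2 ∈ Ioo (ε * g₀ (c.χ p.1)) (ε * g₁ (c.χ p.1))} with hD
  have hDB : D ⊆ B := fun p hp => ⟨hp.1, c.layer_mem hT hε hp.1 hp.2⟩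
  have hpart : c.part n g₀ g₁ ε = c.normalChart n '' D := rfl
  have hgc : ∀ {g : E3 → ℝ}, ContDiffOn ℝ 4 g Γ → ContinuousOn (fun s => g (c.χ s)) c.Q :=
    fun hg => (hg.continuousOn.comp (c.contDiffOn_χ.continuousOn)
      fun s hs => c.χ_mem hs).mono c.Q_subset
  have hDm : MeasurableSet D := by
    classical
    have hm : ∀ {g : E3 → ℝ}, ContDiffOn ℝ 4 g Γ →
        Measurable (c.Q.piecewise (fun s => ε * g (c.χ s)) (fun _ => 0)) := fun hg =>
      (continuousOn_const.mul (hgc hg)).measurable_piecewise continuousOn_const c.measurableSet_Q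
    have : D = regionBetween (c.Q.piecewise (fun s => ε * g₀ (c.χ s)) (fun _ => 0))
        (c.Q.piecewise (fun s => ε * g₁ (c.χ s)) (fun _ => 0)) c.Q := by
      ext p
      simp only [hD, regionBetween, mem_ofPred_eq]
      refine and_congr_right fun hp => ?_
      rw [piecewise_eq_of_mem _ _ _ hp, piecewise_eq_of_mem _ _ _ hp]
    rw [this]
    exact measurableSet_regionBetween (hm hT.contDiffOn_left) (hm hT.contDiffOn_right)
      c.measurableSet_Q
  -- change of variables to normal coordinates
  have hcv : ∫⁻ x in c.part n g₀ g₁ ε, F x = k * ∫⁻ p in D,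
      ENNReal.ofReal |(fderiv ℝ (c.normalChartCoord n) p).det| * F (c.normalChart n p) := by
    have hpre : frame c.b ⁻¹' (c.part n g₀ g₁ ε) = c.normalChartCoord n '' D := by
      ext p
      constructor
      · rintro ⟨q, hq, hqp⟩
        exact ⟨q, hq, by
          rw [GraphPatch.normalChartCoord, hqp]; exact (frame c.b).symm_apply_apply p⟩
      · rintro ⟨q, hq, rfl⟩
        exact ⟨q, hq, ((frame c.b).apply_symm_apply _).symm⟩
    rw [hk, hpre, lintegral_image_eq_lintegral_abs_det_fderiv_mul volume hDm
      (fun p hp => (hdiff p (hDB hp)).hasFDerivWithinAt)]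
    · congr 1
      refine lintegral_congr fun p => ?_
      rw [show frame c.b (c.normalChartCoord n p) = c.normalChart n p from
        (frame c.b).apply_symm_apply _]
    · intro p hp q hq hpq
      exact c.injOn_normalChart hT.tubular (hBsub (hDB hp)) (hBsub (hDB hq))
        ((frame c.b).symm.injective hpq)
  -- Tonelli and the affine substitution in the normal direction
  have hton : ∫⁻ p in D, F (c.normalChart n p) = ∫⁻ s in c.Q,
      ENNReal.ofReal (ε * (g₁ (c.χ s) - g₀ (c.χ s))) *
        ∫⁻ t in Ioo (0 : ℝ) 1, F (layerPoint n g₀ g₁ ε t (c.χ s)) := by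
    have hmeas : AEMeasurable (fun p => F (c.normalChart n p)) (volume.restrict D) := by
      have h1 : AEMeasurable (c.normalChart n) (volume.restrict D) :=
        ((c.contDiffOn_normalChart hΓ).continuousOn.mono fun p hp =>
          ⟨(hBsub (hDB hp)).1, mem_univ _⟩).aemeasurable hDm
      refine (hF.comp_aemeasurable h1).congr ?_
      filter_upwards [ae_restrict_mem hDm] with p hp
      simp only [Function.comp]
      rw [indicator_of_mem]
      exact c.part_subset ⟨p, hp, rfl⟩
    rw [← lintegral_indicator hDm, Measure.volume_eq_prod,
      lintegral_prod _ ((aemeasurable_indicator_iff hDm).2 hmeas),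
      ← lintegral_indicator c.measurableSet_Q]
    refine lintegral_congr fun s => ?_
    by_cases hs : s ∈ c.Q
    · rw [indicator_of_mem hs]
      have hlt : ε * g₀ (c.χ s) < ε * g₁ (c.χ s) := by
        have := hT.le_sub _ (c.χ_mem (c.Q_subset hs))
        have := hε.1
        nlinarith
      have h1 : ∀ r : ℝ, D.indicator (fun p => F (c.normalChart n p)) (s, r) =
          (Ioo (ε * g₀ (c.χ s)) (ε * g₁ (c.χ s))).indicator
            (fun r => F (c.normalChart n (s, r))) r := by
        intro r
        by_cases hr : r ∈ Ioo (ε * g₀ (c.χ s)) (ε * g₁ (c.χ s))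
        · rw [indicator_of_mem hr, indicator_of_mem (show (s, r) ∈ D from ⟨hs, hr⟩)]
        · rw [indicator_of_notMem hr, indicator_of_notMem fun h : (s, r) ∈ D => hr h.2]
      simp_rw [h1]
      rw [lintegral_indicator measurableSet_Ioo, setLIntegral_Ioo_affine hlt, ← mul_sub]
      congr 1
      refine lintegral_congr fun t => ?_
      rw [GraphPatch.normalChart, layerPoint, layer]
      congr 4
      ring
    · rw [indicator_of_notMem hs]
      have h1 : ∀ r : ℝ, D.indicator (fun p => F (c.normalChart n p)) (s, r) = 0 := fun r =>
        indicator_of_notMem (fun h : (s, r) ∈ D => hs h.1) _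
      simp [h1]
  have hgb : ∀ s ∈ c.Q, ε * a ≤ ε * (g₁ (c.χ s) - g₀ (c.χ s)) ∧
      ε * (g₁ (c.χ s) - g₀ (c.χ s)) ≤ ε * (2 * δ₀) := by
    intro s hs
    have hy := c.χ_mem (c.Q_subset hs)
    have h1 := hT.le_sub _ hy
    have h2 := abs_le.1 (hT.abs_left _ hy)
    have h3 := abs_le.1 (hT.abs_right _ hy)
    constructor
    · exact mul_le_mul_of_nonneg_left h1 hε.1.le
    · exact mul_le_mul_of_nonneg_left (by linarith) hε.1.le
  set I := ∫⁻ s in c.Q, ∫⁻ t in Ioo (0 : ℝ) 1, F (layerPoint n g₀ g₁ ε t (c.χ s)) with hI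
  have hup : ∫⁻ p in D, F (c.normalChart n p) ≤ ENNReal.ofReal (ε * (2 * δ₀)) * I := by
    rw [hton, hI, ← lintegral_const_mul' _ _ ENNReal.ofReal_ne_top]
    exact setLIntegral_mono' c.measurableSet_Q fun s hs =>
      mul_le_mul_left (ENNReal.ofReal_le_ofReal (hgb s hs).2) _
  have hlow : ENNReal.ofReal (ε * a) * I ≤ ∫⁻ p in D, F (c.normalChart n p) := by
    rw [hton, hI, ← lintegral_const_mul' _ _ ENNReal.ofReal_ne_top]
    exact setLIntegral_mono' c.measurableSet_Q fun s hs =>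
      mul_le_mul_left (ENNReal.ofReal_le_ofReal (hgb s hs).1) _
  constructor
  · calc ∫⁻ x in c.part n g₀ g₁ ε, F x
        ≤ k * ∫⁻ p in D, ENNReal.ofReal d₁ * F (c.normalChart n p) := by
          rw [hcv]
          refine mul_le_mul_right (setLIntegral_mono' hDm fun p hp => ?_) _
          exact mul_le_mul_left (ENNReal.ofReal_le_ofReal (hmax (hDB hp))) _
      _ ≤ k * (ENNReal.ofReal d₁ * (ENNReal.ofReal (ε * (2 * δ₀)) * I)) := by
          rw [lintegral_const_mul' _ _ ENNReal.ofReal_ne_top]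
          gcongr
      _ = (k * ENNReal.ofReal (d₁ * (2 * δ₀))) * (ENNReal.ofReal ε * I) := by
          rw [ENNReal.ofReal_mul hε.1.le, ENNReal.ofReal_mul (abs_nonneg _)]
          ring
      _ ≤ _ := by
          gcongr
          exact le_max_left _ _
  · have h1 : (k * ENNReal.ofReal (d₀ * a)) * (ENNReal.ofReal ε * I) ≤
        ∫⁻ x in thin Γ n g₀ g₁ ε, F x := by
      calc (k * ENNReal.ofReal (d₀ * a)) * (ENNReal.ofReal ε * I)
          = k * (ENNReal.ofReal d₀ * (ENNReal.ofReal (ε * a) * I)) := by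
            rw [ENNReal.ofReal_mul hε.1.le, ENNReal.ofReal_mul (abs_nonneg _)]
            ring
        _ ≤ k * (ENNReal.ofReal d₀ * ∫⁻ p in D, F (c.normalChart n p)) := by gcongr
        _ ≤ ∫⁻ x in c.part n g₀ g₁ ε, F x := by
            rw [hcv, ← lintegral_const_mul' _ _ ENNReal.ofReal_ne_top]
            refine mul_le_mul_right (setLIntegral_mono' hDm fun p hp => ?_) _
            exact mul_le_mul_left (ENNReal.ofReal_le_ofReal (hmin (hDB hp))) _
        _ ≤ _ := lintegral_mono_set c.part_subset
    have h2 : ENNReal.ofReal ε * I ≤ (k * ENNReal.ofReal (d₀ * a))⁻¹ *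
        ∫⁻ x in thin Γ n g₀ g₁ ε, F x := by
      rw [← ENNReal.mul_le_iff_le_inv (mul_ne_zero hk0 hda)
        (ENNReal.mul_ne_top hkt ENNReal.ofReal_ne_top)]
      exact h1
    exact h2.trans (mul_le_mul_left (le_max_right _ _) _)

/-- A finite cover by patches, with one constant for the comparison of measures. -/
theorem IsThinDatum.exists_cover (hT : IsThinDatum Γ n g₀ g₁ δ δ₀ a) :
    ∃ t : Finset (GraphPatch Γ), ∃ K : ℝ≥0∞, K ≠ ⊤ ∧ ∀ ε ∈ Ioc (0 : ℝ) 1, ∀ F : E3 → ℝ≥0∞,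
      Measurable ((thin Γ n g₀ g₁ ε).indicator F) →
      (∫⁻ x in thin Γ n g₀ g₁ ε, F x ≤ ∑ c ∈ t, K * (ENNReal.ofReal ε *
        ∫⁻ s in c.Q, ∫⁻ r in Ioo (0 : ℝ) 1, F (layerPoint n g₀ g₁ ε r (c.χ s)))) ∧
      ∀ c ∈ t, ENNReal.ofReal ε *
        ∫⁻ s in c.Q, ∫⁻ r in Ioo (0 : ℝ) 1, F (layerPoint n g₀ g₁ ε r (c.χ s)) ≤
        K * ∫⁻ x in thin Γ n g₀ g₁ ε, F x := by
  obtain ⟨t, ht⟩ := hT.surface.exists_cover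
  choose K hKt hK using fun c : GraphPatch Γ => c.exists_lintegral_part hT
  have hle : ∀ c ∈ t, K c ≤ ∑ c ∈ t, K c := fun c hc =>
    Finset.single_le_sum (f := K) (fun _ _ => zero_le) hc
  refine ⟨t, ∑ c ∈ t, K c, ENNReal.sum_ne_top.2 fun c _ => hKt c, fun ε hε F hF => ⟨?_, ?_⟩⟩
  · calc ∫⁻ x in thin Γ n g₀ g₁ ε, F x ≤ ∫⁻ x in ⋃ c : t, c.1.part n g₀ g₁ ε, F x :=
          lintegral_mono_set (thin_subset_iUnion_part ht)
      _ ≤ ∑' c : t, ∫⁻ x in c.1.part n g₀ g₁ ε, F x := lintegral_iUnion_le _ _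
      _ = ∑ c ∈ t, ∫⁻ x in c.part n g₀ g₁ ε, F x := by
          rw [tsum_fintype, Finset.sum_coe_sort t fun c => ∫⁻ x in c.part n g₀ g₁ ε, F x]
      _ ≤ _ := by
          refine Finset.sum_le_sum fun c hc => ((hK c ε hε F hF).1).trans ?_
          exact mul_le_mul_left (hle c hc) _
  · intro c hc
    exact ((hK c ε hε F hF).2).trans (mul_le_mul_left (hle c hc) _)

end PatchMeasure

section LayerMeasure

variable {Γ : Set E3} {n : E3 → E3} {g₀ g₁ : E3 → ℝ} {δ δ₀ a ε τ : ℝ}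

lemma IsThinDatum.continuousOn_layerProj (hT : IsThinDatum Γ n g₀ g₁ δ δ₀ a)
    (hε : ε ∈ Ioc (0 : ℝ) 1) : ContinuousOn (fun z : E3 × ℝ => layerProj Γ n g₀ g₁ ε z.2 z.1)
      (thin Γ n g₀ g₁ ε ×ˢ univ) := by
  have hπ : ContinuousOn (fun z : E3 × ℝ => proj Γ z.1) (thin Γ n g₀ g₁ ε ×ˢ univ) :=
    (contDiffOn_proj hT.surface hT.tubular).continuousOn.comp continuousOn_fst
      fun z hz => hT.thin_subset_tube hε hz.1
  have hmaps : MapsTo (fun z : E3 × ℝ => proj Γ z.1) (thin Γ n g₀ g₁ ε ×ˢ univ) Γ :=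
    fun z hz => hT.proj_mem hε hz.1
  have h0 := hT.contDiffOn_left.continuousOn.comp hπ hmaps
  have h1 := hT.contDiffOn_right.continuousOn.comp hπ hmaps
  have hn := hT.surface.contDiffOn_normal.continuousOn.comp hπ hmaps
  exact hπ.add ((continuousOn_const.mul (h0.add (continuousOn_snd.mul (h1.sub h0)))).smul hn)

lemma measurable_indicator_comp {α β : Type*} [MeasurableSpace α] [TopologicalSpace α]
    [OpensMeasurableSpace α] [MeasurableSpace β] [TopologicalSpace β] [BorelSpace β] [Nonempty β]
    {S : Set α} (hS : MeasurableSet S) {f : α → β} (hf : ContinuousOn f S) {F : β → ℝ≥0∞}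
    (hF : Measurable F) : Measurable (S.indicator fun x => F (f x)) := by
  classical
  have h1 : Measurable (S.piecewise f fun _ => Classical.arbitrary β) :=
    hf.measurable_piecewise continuousOn_const hS
  have : (S.indicator fun x => F (f x)) =
      S.indicator (F ∘ S.piecewise f fun _ => Classical.arbitrary β) := by
    ext x
    by_cases hx : x ∈ S <;> simp [hx]
  rw [this]
  exact (hF.comp h1).indicator hS

lemma IsThinDatum.measurable_lintegral_layerProj (hT : IsThinDatum Γ n g₀ g₁ δ δ₀ a)
    (hε : ε ∈ Ioc (0 : ℝ) 1) {F : E3 → ℝ≥0∞} (hF : Measurable F) :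
    Measurable ((thin Γ n g₀ g₁ ε).indicator
      fun x => ∫⁻ r in Ioo (0 : ℝ) 1, F (layerProj Γ n g₀ g₁ ε r x)) := by
  have hm := measurable_indicator_comp ((hT.isOpen_thin hε).measurableSet.prod MeasurableSet.univ)
    (hT.continuousOn_layerProj hε) hF
  have : ((thin Γ n g₀ g₁ ε).indicator
      fun x => ∫⁻ r in Ioo (0 : ℝ) 1, F (layerProj Γ n g₀ g₁ ε r x)) =
      fun x => ∫⁻ r in Ioo (0 : ℝ) 1, (thin Γ n g₀ g₁ ε ×ˢ (univ : Set ℝ)).indicator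
        (fun z => F (layerProj Γ n g₀ g₁ ε z.2 z.1)) (x, r) := by
    ext x
    by_cases hx : x ∈ thin Γ n g₀ g₁ ε
    · rw [indicator_of_mem hx]
      refine lintegral_congr fun r => ?_
      rw [indicator_of_mem (show (x, r) ∈ thin Γ n g₀ g₁ ε ×ˢ (univ : Set ℝ) from
        ⟨hx, mem_univ _⟩)]
    · rw [indicator_of_notMem hx]
      symm
      convert lintegral_zero with r
      exact indicator_of_notMem (fun h => hx h.1) _
  rw [this]
  exact hm.lintegral_prod_right'

/-- The projections onto the layers, integrated over the layer parameter, are bounded on `L¹` of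
the thin domain, uniformly in `ε`. -/
theorem IsThinDatum.exists_lintegral_layerProj_le (hT : IsThinDatum Γ n g₀ g₁ δ δ₀ a) :
    ∃ C : ℝ≥0∞, C ≠ ⊤ ∧ ∀ ε ∈ Ioc (0 : ℝ) 1, ∀ F : E3 → ℝ≥0∞, Measurable F →
      ∫⁻ x in thin Γ n g₀ g₁ ε, ∫⁻ r in Ioo (0 : ℝ) 1, F (layerProj Γ n g₀ g₁ ε r x) ≤
        C * ∫⁻ x in thin Γ n g₀ g₁ ε, F x := by
  obtain ⟨t, K, hKt, hK⟩ := hT.exists_cover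
  refine ⟨∑ c ∈ t, K * K, ENNReal.sum_ne_top.2 fun c _ => ENNReal.mul_ne_top hKt hKt,
    fun ε hε F hF => ?_⟩
  have h1 := (hK ε hε _ (hT.measurable_lintegral_layerProj hε hF)).1
  have h2 := (hK ε hε F (hF.indicator (hT.isOpen_thin hε).measurableSet)).2
  refine h1.trans ?_
  rw [Finset.sum_mul]
  refine Finset.sum_le_sum fun c hc => ?_
  rw [mul_assoc]
  refine mul_le_mul_right (le_trans (le_of_eq ?_) (h2 c hc)) _
  congr 1
  refine setLIntegral_congr_fun c.measurableSet_Q fun s hs => ?_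
  have hy := c.χ_mem (c.Q_subset hs)
  have : ∀ t ∈ Ioo (0 : ℝ) 1, ∫⁻ r in Ioo (0 : ℝ) 1,
      F (layerProj Γ n g₀ g₁ ε r (layerPoint n g₀ g₁ ε t (c.χ s))) =
      ∫⁻ r in Ioo (0 : ℝ) 1, F (layerPoint n g₀ g₁ ε r (c.χ s)) := by
    intro t ht
    simp only [layerProj, hT.proj_layerPoint ⟨hε.1.le, hε.2⟩ ⟨ht.1.le, ht.2.le⟩ hy]
  rw [setLIntegral_congr_fun measurableSet_Ioo this, setLIntegral_const]
  simp

end LayerMeasure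

/-! ### Approximation along an exhaustion -/

section SmoothSequence

variable {E : Type*} [NormedAddCommGroup E] [NormedSpace ℝ E]

/-- The density `|f|² + |f||∇f|` which controls the trace-type estimates. -/
def energyDensity (f : E → ℝ) (x : E) : ℝ≥0∞ := ‖f x‖ₑ ^ 2 + ‖f x‖ₑ * ‖fderiv ℝ f x‖ₑ

lemma continuous_energyDensity {f : E → ℝ} (hf : ContDiff ℝ 1 f) :
    Continuous (energyDensity f) := by
  have h1 : Continuous fun x => ‖f x‖ₑ := hf.continuous.enorm
  have h2 : Continuous fun x => ‖fderiv ℝ f x‖ₑ := (hf.continuous_fderiv (by norm_num)).enorm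
  have h3 : Continuous fun x => ‖f x‖ₑ * ‖fderiv ℝ f x‖ₑ := by
    refine continuous_iff_continuousAt.2 fun x => ENNReal.Tendsto.mul h1.continuousAt
      (Or.inr (by simp)) h2.continuousAt (Or.inr (by simp))
  exact ((ENNReal.continuous_pow 2).comp h1).add h3

lemma eLpNorm_two_sq {F : Type*} [NormedAddCommGroup F] {α : Type*} {m : MeasurableSpace α}
    (μ : Measure α) (f : α → F) : eLpNorm f 2 μ ^ 2 = ∫⁻ x, ‖f x‖ₑ ^ 2 ∂μ := by
  rw [eLpNorm_eq_lintegral_rpow_enorm_toReal (by norm_num) (by norm_num)]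
  simp only [ENNReal.toReal_ofNat, ENNReal.rpow_ofNat]
  rw [← ENNReal.rpow_natCast, ← ENNReal.rpow_mul]
  norm_num

lemma lintegral_mul_le_eLpNorm {F G : Type*} [NormedAddCommGroup F] [NormedAddCommGroup G]
    {α : Type*} {m : MeasurableSpace α} {μ : Measure α} {f : α → F} {g : α → G}
    (hf : AEStronglyMeasurable f μ) (hg : AEStronglyMeasurable g μ) :
    ∫⁻ x, ‖f x‖ₑ * ‖g x‖ₑ ∂μ ≤ eLpNorm f 2 μ * eLpNorm g 2 μ := by
  have := ENNReal.lintegral_mul_le_Lp_mul_Lq μ (p := 2) (q := 2)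
    (Real.HolderConjugate.two_two) hf.enorm hg.enorm
  rw [eLpNorm_eq_lintegral_rpow_enorm_toReal (by norm_num) (by norm_num),
    eLpNorm_eq_lintegral_rpow_enorm_toReal (by norm_num) (by norm_num)]
  simpa using this

/-- By the Cauchy-Schwarz inequality, the energy is at most the `L²` norm times the `H¹` norm. -/
lemma lintegral_energyDensity_le [MeasurableSpace E] [BorelSpace E] [FiniteDimensional ℝ E]
    {ι : Type*} [Fintype ι] {v : ι → E}
    (hv : ∀ L : E →L[ℝ] ℝ, ‖L‖ₑ ≤ ∑ i, ‖L (v i)‖ₑ) {μ : Measure E} {f : E → ℝ}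
    (hf : ContDiff ℝ 1 f) :
    ∫⁻ x, energyDensity f x ∂μ ≤
      eLpNorm f 2 μ * (eLpNorm f 2 μ + ∑ i, eLpNorm (fun x => fderiv ℝ f x (v i)) 2 μ) := by
  have hfm : AEStronglyMeasurable f μ := hf.continuous.aestronglyMeasurable
  have hm : ∀ i, AEStronglyMeasurable (fun x => fderiv ℝ f x (v i)) μ := fun i =>
    ((hf.continuous_fderiv (by norm_num)).clm_apply continuous_const).aestronglyMeasurable
  calc ∫⁻ x, energyDensity f x ∂μ
      ≤ ∫⁻ x, ‖f x‖ₑ ^ 2 + ∑ i, ‖f x‖ₑ * ‖fderiv ℝ f x (v i)‖ₑ ∂μ := by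
        refine lintegral_mono fun x => ?_
        rw [energyDensity, ← Finset.mul_sum]
        gcongr
        exact hv _
    _ = ∫⁻ x, ‖f x‖ₑ ^ 2 ∂μ + ∑ i, ∫⁻ x, ‖f x‖ₑ * ‖fderiv ℝ f x (v i)‖ₑ ∂μ := by
        rw [lintegral_add_left' (hfm.enorm.pow_const 2), lintegral_finsetSum'
            (f := fun i x => ‖f x‖ₑ * ‖fderiv ℝ f x (v i)‖ₑ) _
          fun i _ => hfm.enorm.mul (hm i).enorm]
    _ ≤ eLpNorm f 2 μ * eLpNorm f 2 μ +
          ∑ i, eLpNorm f 2 μ * eLpNorm (fun x => fderiv ℝ f x (v i)) 2 μ := by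
        rw [← eLpNorm_two_sq, sq]
        gcongr with i
        exact lintegral_mul_le_eLpNorm hfm (hm i)
    _ = _ := by rw [mul_add, Finset.mul_sum]

/-- Interior approximation by smooth functions along an exhaustion by compact sets.  The errors are
summable, so that there is convergence almost everywhere. -/
theorem exists_smooth_seq [FiniteDimensional ℝ E] [MeasureSpace E] [BorelSpace E]
    [(volume : Measure E).IsAddHaarMeasure] {O : Set E} (hO : IsOpen O) {ι : Type*} [Fintype ι]
    {v : ι → E} (hv : ∀ L : E →L[ℝ] ℝ, ‖L‖ₑ ≤ ∑ i, ‖L (v i)‖ₑ)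
    {w : E → ℝ} {g : ι → E → ℝ} (hw : MemLp w 2 (volume.restrict O))
    (hg : ∀ i, MemLp (g i) 2 (volume.restrict O)) (hd : ∀ i, HasWeakLineDeriv O (v i) w (g i))
    {K : ℕ → Set E} (hK : ∀ k, IsCompact (K k)) (hKO : ∀ k, K k ⊆ O)
    (hKe : ∀ x ∈ O, ∀ᶠ k in atTop, x ∈ K k) :
    ∃ f : ℕ → E → ℝ, (∀ k, ContDiff ℝ ∞ (f k)) ∧
      (∀ k, eLpNorm (f k - w) 2 (volume.restrict (K k)) ≤ 2⁻¹ ^ k) ∧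
      (∀ k i, eLpNorm ((fun x => fderiv ℝ (f k) x (v i)) - g i) 2 (volume.restrict (K k))
        ≤ 2⁻¹ ^ k) ∧
      (∀ᵐ x ∂(volume.restrict O), Tendsto (fun k => f k x) atTop (𝓝 (w x))) ∧
      ∃ b : ℕ → ℝ≥0∞, (∀ k, ∫⁻ x in K k, energyDensity (f k) x ≤ b k) ∧
        Tendsto b atTop (𝓝 (eLpNorm w 2 (volume.restrict O) * (eLpNorm w 2 (volume.restrict O) +
          ∑ i, eLpNorm (g i) 2 (volume.restrict O)))) := by
  have hpow0 : Tendsto (fun k : ℕ => (2⁻¹ : ℝ≥0∞) ^ k) atTop (𝓝 0) :=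
    ENNReal.tendsto_pow_atTop_nhds_zero_of_lt_one (by norm_num)
  choose f hf hfw hfg using fun k => exists_smooth_approx hO hw hg hd (hK k) (hKO k)
    (η := 2⁻¹ ^ k) (by simp)
  have hres : ∀ k, volume.restrict (K k) ≤ volume.restrict O :=
    fun k => Measure.restrict_mono (hKO k) le_rfl
  have hKm : ∀ k, MeasurableSet (K k) := fun k => (hK k).measurableSet
  refine ⟨f, hf, hfw, hfg, ?_, fun k =>
    (eLpNorm w 2 (volume.restrict O) + 2⁻¹ ^ k) * ((eLpNorm w 2 (volume.restrict O) + 2⁻¹ ^ k) +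
      ∑ i, (eLpNorm (g i) 2 (volume.restrict O) + 2⁻¹ ^ k)), fun k => ?_, ?_⟩
  · have hm : ∀ k, AEMeasurable ((K k).indicator fun x => ‖(f k - w) x‖ₑ ^ 2)
        (volume.restrict O) := fun k =>
      (((hf k).continuous.aestronglyMeasurable.sub hw.1).enorm.pow_const 2).indicator (hKm k)
    have hfin : ∫⁻ x in O, ∑' k, (K k).indicator (fun x => ‖(f k - w) x‖ₑ ^ 2) x ≠ ⊤ := by
      rw [lintegral_tsum hm]
      have hle : ∀ k, ∫⁻ x in O, (K k).indicator (fun x => ‖(f k - w) x‖ₑ ^ 2) x ≤ 2⁻¹ ^ k := by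
        intro k
        rw [lintegral_indicator (hKm k), Measure.restrict_restrict (hKm k),
          inter_eq_left.2 (hKO k), ← eLpNorm_two_sq]
        calc eLpNorm (f k - w) 2 (volume.restrict (K k)) ^ 2 ≤ (2⁻¹ ^ k) ^ 2 := by
              gcongr
              exact hfw k
          _ ≤ (2⁻¹ ^ k) ^ 1 :=
            pow_le_pow_right_of_le_one' (pow_le_one' (by norm_num) k) (by norm_num)
          _ = _ := pow_one _
      refine ne_top_of_le_ne_top ?_ (ENNReal.tsum_le_tsum hle)
      rw [ENNReal.tsum_geometric]
      simp
    filter_upwards [ae_lt_top' (AEMeasurable.tsum hm) hfin, ae_restrict_mem hO.measurableSet]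
      with x hx hxO
    have h0 := ENNReal.tendsto_atTop_zero_of_tsum_ne_top hx.ne
    have h1 : Tendsto (fun k => ‖(f k - w) x‖ₑ ^ 2) atTop (𝓝 0) := by
      refine h0.congr' ?_
      filter_upwards [hKe x hxO] with k hk
      rw [indicator_of_mem hk]
    have h2 : Tendsto (fun k => ‖(f k - w) x‖ₑ) atTop (𝓝 0) := by
      have := h1.ennrpow_const (1 / 2)
      simp only [← ENNReal.rpow_natCast, ← ENNReal.rpow_mul] at this
      simpa using this
    rw [tendsto_iff_edist_tendsto_0]
    refine h2.congr fun k => ?_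
    rw [edist_eq_enorm_sub, Pi.sub_apply]
  · have hn : eLpNorm (f k) 2 (volume.restrict (K k)) ≤
        eLpNorm w 2 (volume.restrict O) + 2⁻¹ ^ k := by
      have hwK : AEStronglyMeasurable w (volume.restrict (K k)) := hw.1.mono_measure (hres k)
      calc eLpNorm (f k) 2 (volume.restrict (K k))
          = eLpNorm (w + (f k - w)) 2 (volume.restrict (K k)) := by simp
        _ ≤ eLpNorm w 2 (volume.restrict (K k)) + eLpNorm (f k - w) 2 (volume.restrict (K k)) :=
            eLpNorm_add_le hwK ((hf k).continuous.aestronglyMeasurable.sub hwK) (by norm_num)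
        _ ≤ _ := add_le_add (eLpNorm_mono_measure _ (hres k)) (hfw k)
    have hgn : ∀ i, eLpNorm (fun x => fderiv ℝ (f k) x (v i)) 2 (volume.restrict (K k)) ≤
        eLpNorm (g i) 2 (volume.restrict O) + 2⁻¹ ^ k := by
      intro i
      have hgK : AEStronglyMeasurable (g i) (volume.restrict (K k)) :=
        (hg i).1.mono_measure (hres k)
      have hc : Continuous fun x => fderiv ℝ (f k) x (v i) :=
        ((hf k).continuous_fderiv (by norm_num)).clm_apply continuous_const
      calc eLpNorm (fun x => fderiv ℝ (f k) x (v i)) 2 (volume.restrict (K k))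
          = eLpNorm (g i + ((fun x => fderiv ℝ (f k) x (v i)) - g i)) 2
              (volume.restrict (K k)) := by simp
        _ ≤ eLpNorm (g i) 2 (volume.restrict (K k)) +
              eLpNorm ((fun x => fderiv ℝ (f k) x (v i)) - g i) 2 (volume.restrict (K k)) :=
            eLpNorm_add_le hgK (hc.aestronglyMeasurable.sub hgK) (by norm_num)
        _ ≤ _ := add_le_add (eLpNorm_mono_measure _ (hres k)) (hfg k i)
    refine (lintegral_energyDensity_le hv ((hf k).of_le (by norm_cast))).trans ?_
    beta_reduce
    gcongr with i
    exact hgn i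
  · have h1 : ∀ c : ℝ≥0∞, Tendsto (fun k : ℕ => c + 2⁻¹ ^ k) atTop (𝓝 c) := fun c => by
      simpa using (tendsto_const_nhds (x := c)).add hpow0
    have h2 := (h1 (eLpNorm w 2 (volume.restrict O))).add
      (tendsto_finsetSum Finset.univ fun i _ => h1 (eLpNorm (g i) 2 (volume.restrict O)))
    refine ENNReal.Tendsto.mul (h1 _) (Or.inr ?_) h2 (Or.inr hw.2.ne)
    exact ENNReal.add_ne_top.2 ⟨hw.2.ne, ENNReal.sum_ne_top.2 fun i _ => (hg i).2.ne⟩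

lemma tendsto_indicator_enorm_sq {E : Type*} {f : ℕ → E → ℝ} {w : E → ℝ} {K : ℕ → Set E} {x : E}
    (h : Tendsto (fun k => f k x) atTop (𝓝 (w x))) (hx : ∀ᶠ k in atTop, x ∈ K k) :
    Tendsto (fun k => (K k).indicator (fun x => ‖f k x‖ₑ ^ 2) x) atTop (𝓝 (‖w x‖ₑ ^ 2)) := by
  have h1 : Tendsto (fun k => ‖f k x‖ₑ ^ 2) atTop (𝓝 (‖w x‖ₑ ^ 2)) :=
    ((ENNReal.continuous_pow 2).tendsto _).comp ((continuous_enorm.tendsto _).comp h)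
  refine h1.congr' ?_
  filter_upwards [hx] with k hk
  rw [indicator_of_mem hk]

end SmoothSequence

section CompactLayers

variable {Γ : Set E3} {n : E3 → E3} {g₀ g₁ : E3 → ℝ} {δ δ₀ a ε τ β : ℝ}

/-- The union of the layers with parameter in `[β, 1 - β]`. -/
def compactLayers (Γ : Set E3) (n : E3 → E3) (g₀ g₁ : E3 → ℝ) (ε β : ℝ) : Set E3 :=
  (fun p : E3 × ℝ => layerPoint n g₀ g₁ ε p.2 p.1) '' (Γ ×ˢ Icc β (1 - β))

lemma IsThinDatum.isCompact_compactLayers (hT : IsThinDatum Γ n g₀ g₁ δ δ₀ a) :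
    IsCompact (compactLayers Γ n g₀ g₁ ε β) := by
  refine (hT.surface.isCompact.prod isCompact_Icc).image_of_continuousOn ?_
  have h : ∀ {F : Type} [TopologicalSpace F] {f : E3 → F}, ContinuousOn f Γ →
      ContinuousOn (fun p : E3 × ℝ => f p.1) (Γ ×ˢ Icc β (1 - β)) :=
    fun hf => hf.comp continuousOn_fst fun p hp => hp.1
  have h0 := h hT.contDiffOn_left.continuousOn
  have h1 := h hT.contDiffOn_right.continuousOn
  have hn := h hT.surface.contDiffOn_normal.continuousOn
  exact continuousOn_fst.add
    ((continuousOn_const.mul (h0.add (continuousOn_snd.mul (h1.sub h0)))).smul hn)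

lemma IsThinDatum.compactLayers_subset (hT : IsThinDatum Γ n g₀ g₁ δ δ₀ a) (hε : 0 < ε)
    (hβ : 0 < β) : compactLayers Γ n g₀ g₁ ε β ⊆ thin Γ n g₀ g₁ ε := by
  rintro _ ⟨p, ⟨hp, hr⟩, rfl⟩
  exact hT.layerPoint_mem hε ⟨hβ.trans_le hr.1, by linarith [hr.2]⟩ hp

lemma IsThinDatum.layerPoint_mem_compactLayers (hT : IsThinDatum Γ n g₀ g₁ δ δ₀ a)
    (hε : ε ∈ Ioc (0 : ℝ) 1) (hβ : 0 < β) (hτ : τ ∈ Icc (0 : ℝ) 1) {y : E3} (hy : y ∈ Γ) :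
    layerPoint n g₀ g₁ ε τ y ∈ compactLayers Γ n g₀ g₁ ε β ↔ τ ∈ Icc β (1 - β) := by
  refine ⟨?_, fun h => ⟨(y, τ), ⟨hy, h⟩, rfl⟩⟩
  rintro ⟨⟨z, σ⟩, ⟨hz, hσ⟩, he⟩
  dsimp only at hz hσ he
  have hεi : ε ∈ Icc (0 : ℝ) 1 := ⟨hε.1.le, hε.2⟩
  have hσi : σ ∈ Icc (0 : ℝ) 1 := ⟨hβ.le.trans hσ.1, by linarith [hσ.2]⟩
  have hzy : z = y := by
    rw [← hT.proj_layerPoint hεi hσi hz, ← hT.proj_layerPoint hεi hτ hy]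
    exact congrArg _ he
  subst hzy
  have h1 := congrArg (sdist Γ n) he
  rw [layerPoint, layerPoint, sdist_add_smul hT.surface hT.tubular hz
    (hT.mem_Ioo (hT.abs_layer_le hεi hσi hz)),
    sdist_add_smul hT.surface hT.tubular hz (hT.mem_Ioo (hT.abs_layer_le hεi hτ hz)),
    layer, layer] at h1
  have hg : g₁ z - g₀ z ≠ 0 := (hT.pos.trans_le (hT.le_sub z hz)).ne'
  have h2 := mul_left_cancel₀ hε.1.ne' h1
  have h3 : σ = τ := mul_right_cancel₀ hg (by linarith)
  rwa [← h3]

/-- The exhaustion of the thin domain by compact unions of layers. -/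
def exhaustion (Γ : Set E3) (n : E3 → E3) (g₀ g₁ : E3 → ℝ) (ε : ℝ) (k : ℕ) : Set E3 :=
  compactLayers Γ n g₀ g₁ ε (1 / (k + 1))

lemma one_div_nat_pos (k : ℕ) : (0 : ℝ) < 1 / (k + 1) := Nat.one_div_pos_of_nat

lemma eventually_mem_Icc_one_div (hτ : τ ∈ Ioo (0 : ℝ) 1) :
    ∀ᶠ k : ℕ in atTop, τ ∈ Icc (1 / ((k : ℝ) + 1)) (1 - 1 / ((k : ℝ) + 1)) := by
  have h := tendsto_one_div_add_atTop_nhds_zero_nat (𝕜 := ℝ)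
  filter_upwards [h.eventually (gt_mem_nhds hτ.1),
    h.eventually (gt_mem_nhds (sub_pos.2 hτ.2))] with k h1 h2
  exact ⟨h1.le, by linarith⟩

lemma IsThinDatum.eventually_mem_exhaustion (hT : IsThinDatum Γ n g₀ g₁ δ δ₀ a)
    (hε : ε ∈ Ioc (0 : ℝ) 1) {x : E3} (hx : x ∈ thin Γ n g₀ g₁ ε) :
    ∀ᶠ k in atTop, x ∈ exhaustion Γ n g₀ g₁ ε k := by
  obtain ⟨y, hy, τ, hτ, rfl⟩ := (hT.mem_thin_iff hε.1).1 hx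
  filter_upwards [eventually_mem_Icc_one_div hτ] with k hk
  exact ⟨(y, τ), ⟨hy, hk⟩, rfl⟩

end CompactLayers

/-! ### Parametrized layers -/

section PatchEstimates

variable {Γ : Set E3} {n : E3 → E3} {g₀ g₁ : E3 → ℝ} {δ δ₀ a ε τ β : ℝ}

lemma GraphPatch.contDiffOn_comp_χ (c : GraphPatch Γ) {g : E3 → ℝ} (hg : ContDiffOn ℝ 4 g Γ) :
    ContDiffOn ℝ 4 (fun s => g (c.χ s)) (openSquare c.R) :=
  hg.comp (c.contDiffOn_χ.of_le (by norm_num)) fun _ hs => c.χ_mem hs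

lemma GraphPatch.exists_bound_fderiv (c : GraphPatch Γ) {F : Type*} [NormedAddCommGroup F]
    [NormedSpace ℝ F] {X : ℝ × ℝ → F} (hX : ContDiffOn ℝ 4 X (openSquare c.R)) :
    (∀ s ∈ c.Q, HasFDerivAt X (fderiv ℝ X s) s) ∧ ContinuousOn (fderiv ℝ X) c.Q ∧
      ∃ M, ∀ s ∈ c.Q, ‖fderiv ℝ X s‖ ≤ M := by
  have hO := isOpen_openSquare c.R
  have h1 : ContinuousOn (fderiv ℝ X) c.Q :=
    (hX.fderiv_of_isOpen (m := 3) hO (by norm_num)).continuousOn.mono c.Q_subset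
  refine ⟨fun s hs => ?_, h1, (isCompact_square _).exists_bound_of_continuousOn h1⟩
  exact ((hX.contDiffAt (hO.mem_nhds (c.Q_subset hs))).differentiableAt (by norm_num)).hasFDerivAt

lemma exists_bound_affine_family {V F : Type*} [NormedAddCommGroup V] [NormedSpace ℝ V]
    [NormedAddCommGroup F] [NormedSpace ℝ F] {Q : Set V} {X X0 X1 : V → F} {D D0 D1 : V → V →L[ℝ] F}
    (hd : ∀ s ∈ Q, HasFDerivAt X (D s) s) (hd0 : ∀ s ∈ Q, HasFDerivAt X0 (D0 s) s)
    (hd1 : ∀ s ∈ Q, HasFDerivAt X1 (D1 s) s) (hc : ContinuousOn D Q) (hc0 : ContinuousOn D0 Q)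
    (hc1 : ContinuousOn D1 Q) {M M0 M1 : ℝ} (hM : ∀ s ∈ Q, ‖D s‖ ≤ M) (hM0 : ∀ s ∈ Q, ‖D0 s‖ ≤ M0)
    (hM1 : ∀ s ∈ Q, ‖D1 s‖ ≤ M1) {p q : ℝ} (hp : p ∈ Icc (0 : ℝ) 1) (hq : q ∈ Icc (0 : ℝ) 1) :
    ∃ D' : V → V →L[ℝ] F, ContinuousOn D' Q ∧ ∀ s ∈ Q,
      HasFDerivAt (fun s => X s + (p • X0 s + q • X1 s)) (D' s) s ∧ ‖D' s‖ ≤ M + (M0 + M1) := by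
  have hb : ∀ {r : ℝ}, r ∈ Icc (0 : ℝ) 1 → ∀ {L : V →L[ℝ] F} {N : ℝ}, ‖L‖ ≤ N → ‖r • L‖ ≤ N := by
    intro r hr L N hL
    rw [norm_smul, Real.norm_eq_abs, abs_of_nonneg hr.1]
    exact (mul_le_of_le_one_left (norm_nonneg _) hr.2).trans hL
  refine ⟨fun s => D s + (p • D0 s + q • D1 s),
    by fun_prop, fun s hs => ⟨?_, ?_⟩⟩
  · exact (hd s hs).add (((hd0 s hs).const_smul p).add ((hd1 s hs).const_smul q))
  · exact (norm_add_le _ _).trans (add_le_add (hM s hs) ((norm_add_le _ _).trans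
      (add_le_add (hb hp (hM0 s hs)) (hb hq (hM1 s hs)))))

lemma layerPoint_eq (y : E3) : layerPoint n g₀ g₁ ε τ y =
    y + ((ε * (1 - τ)) • g₀ y • n y + (ε * τ) • g₁ y • n y) := by
  rw [layerPoint, layer]
  module

/-- The parametrizations of the layers have bounded derivatives, uniformly in `ε` and in the layer
parameter. -/
lemma GraphPatch.exists_layer_deriv (c : GraphPatch Γ) (hT : IsThinDatum Γ n g₀ g₁ δ δ₀ a) :
    ∃ M : ℝ, ∀ ε ∈ Ioc (0 : ℝ) 1, ∀ τ ∈ Icc (0 : ℝ) 1,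
      ∃ D : ℝ × ℝ → (ℝ × ℝ →L[ℝ] E3), ContinuousOn D c.Q ∧
        ∀ s ∈ c.Q, HasFDerivAt (fun s => layerPoint n g₀ g₁ ε τ (c.χ s)) (D s) s ∧ ‖D s‖ ≤ M := by
  have hn : ContDiffOn ℝ 4 (fun s => n (c.χ s)) (openSquare c.R) := c.contDiffOn_normal_χ hT.surface
  have hs : ContDiffOn ℝ 4 c.χ (openSquare c.R) := c.contDiffOn_χ.of_le (by norm_num)
  have hs0 : ContDiffOn ℝ 4 (fun s => g₀ (c.χ s) • n (c.χ s)) (openSquare c.R) :=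
    (c.contDiffOn_comp_χ hT.contDiffOn_left).smul hn
  have hs1 : ContDiffOn ℝ 4 (fun s => g₁ (c.χ s) • n (c.χ s)) (openSquare c.R) :=
    (c.contDiffOn_comp_χ hT.contDiffOn_right).smul hn
  obtain ⟨hd, hc, M, hM⟩ := c.exists_bound_fderiv hs
  obtain ⟨hd0, hc0, M0, hM0⟩ := c.exists_bound_fderiv hs0
  obtain ⟨hd1, hc1, M1, hM1⟩ := c.exists_bound_fderiv hs1
  refine ⟨M + (M0 + M1), fun ε hε τ hτ => ?_⟩
  have hp : ε * (1 - τ) ∈ Icc (0 : ℝ) 1 :=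
    ⟨mul_nonneg hε.1.le (by linarith [hτ.2]), mul_le_one₀ hε.2 (by linarith [hτ.2])
      (by linarith [hτ.1])⟩
  have hq : ε * τ ∈ Icc (0 : ℝ) 1 := ⟨mul_nonneg hε.1.le hτ.1, mul_le_one₀ hε.2 hτ.1 hτ.2⟩
  simp_rw [layerPoint_eq]
  exact exists_bound_affine_family hd hd0 hd1 hc hc0 hc1 hM hM0 hM1 hp hq

/-- The two-dimensional energy density of the restriction of a smooth function to a layer is
controlled by its three-dimensional one. -/
lemma GraphPatch.exists_layer_energy (c : GraphPatch Γ) (hT : IsThinDatum Γ n g₀ g₁ δ δ₀ a) :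
    ∃ C : ℝ≥0∞, C ≠ ⊤ ∧ ∀ ε ∈ Ioc (0 : ℝ) 1, ∀ τ ∈ Icc (0 : ℝ) 1, ∀ f : E3 → ℝ, ContDiff ℝ 1 f →
      ∃ D : ℝ × ℝ → (ℝ × ℝ →L[ℝ] ℝ), ContinuousOn D c.Q ∧
        (∀ s ∈ c.Q, HasFDerivAt (fun s => f (layerPoint n g₀ g₁ ε τ (c.χ s))) (D s) s) ∧
        ∀ s ∈ c.Q, ENNReal.ofReal (2 * (c.R / 2))⁻¹ *
            ‖f (layerPoint n g₀ g₁ ε τ (c.χ s))‖ₑ ^ 2 +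
          2 * (‖f (layerPoint n g₀ g₁ ε τ (c.χ s))‖ₑ * ‖D s‖ₑ) ≤
          C * energyDensity f (layerPoint n g₀ g₁ ε τ (c.χ s)) := by
  obtain ⟨M, hM⟩ := c.exists_layer_deriv hT
  refine ⟨max (ENNReal.ofReal (2 * (c.R / 2))⁻¹) (2 * ENNReal.ofReal M),
    max_ne_top ENNReal.ofReal_ne_top (ENNReal.mul_ne_top (by simp) ENNReal.ofReal_ne_top),
    fun ε hε τ hτ f hf => ?_⟩
  obtain ⟨D, hDc, hD⟩ := hM ε hε τ hτ
  have hcont : ContinuousOn (fun s => layerPoint n g₀ g₁ ε τ (c.χ s)) c.Q :=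
    fun s hs => (hD s hs).1.continuousAt.continuousWithinAt
  refine ⟨fun s => (fderiv ℝ f (layerPoint n g₀ g₁ ε τ (c.χ s))).comp (D s), ?_, ?_, ?_⟩
  · exact (((hf.continuous_fderiv (by norm_num)).comp_continuousOn hcont).clm_comp hDc)
  · intro s hs
    exact ((hf.differentiable (by norm_num)) _).hasFDerivAt.comp s (hD s hs).1
  · intro s hs
    rw [energyDensity, mul_add]
    have h1 : ‖(fderiv ℝ f (layerPoint n g₀ g₁ ε τ (c.χ s))).comp (D s)‖ₑ ≤
        ‖fderiv ℝ f (layerPoint n g₀ g₁ ε τ (c.χ s))‖ₑ * ENNReal.ofReal M := by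
      rw [← ofReal_norm, ← ofReal_norm, ← ENNReal.ofReal_mul (norm_nonneg _)]
      refine ENNReal.ofReal_le_ofReal ((ContinuousLinearMap.opNorm_comp_le _ _).trans ?_)
      gcongr
      exact (hD s hs).2
    refine add_le_add (mul_le_mul_left (le_max_left _ _) _) ?_
    calc _ ≤ 2 * (‖f (layerPoint n g₀ g₁ ε τ (c.χ s))‖ₑ *
          (‖fderiv ℝ f (layerPoint n g₀ g₁ ε τ (c.χ s))‖ₑ * ENNReal.ofReal M)) := by gcongr
      _ = (2 * ENNReal.ofReal M) * (‖f (layerPoint n g₀ g₁ ε τ (c.χ s))‖ₑ *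
          ‖fderiv ℝ f (layerPoint n g₀ g₁ ε τ (c.χ s))‖ₑ) := by ring
      _ ≤ _ := mul_le_mul_left (le_max_right _ _) _

/-- A bound for products of slices, by products, integrates over both slice parameters. -/
lemma lintegral_mul_le_of_slices {α T : Type*} [MeasurableSpace α] [MeasurableSpace T]
    {μ : Measure α} [SFinite μ] {ν : Measure T} [SFinite ν] {f g : α × T → ℝ≥0∞}
    (hf : Measurable f) (hg : Measurable g) {I : Set T} (hI : MeasurableSet I) {A B : T → ℝ≥0∞}
    (hA : Measurable A) (hB : Measurable B)
    (h : ∀ τ ∈ I, ∀ t ∈ I, ∫⁻ s, f (s, τ) * g (s, t) ∂μ ≤ A τ * B t) :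
    ∫⁻ s, (∫⁻ τ in I, f (s, τ) ∂ν) * (∫⁻ t in I, g (s, t) ∂ν) ∂μ ≤
      (∫⁻ τ in I, A τ ∂ν) * (∫⁻ t in I, B t ∂ν) := by
  have e1 : ∀ s, (∫⁻ τ in I, f (s, τ) ∂ν) * (∫⁻ t in I, g (s, t) ∂ν) =
      ∫⁻ τ in I, ∫⁻ t in I, f (s, τ) * g (s, t) ∂ν ∂ν := fun s => by
    rw [← lintegral_mul_const'' (f := fun τ => f (s, τ)) _
      (hf.comp measurable_prodMk_left).aemeasurable]
    refine lintegral_congr fun τ => ?_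
    exact (lintegral_const_mul'' _ (hg.comp measurable_prodMk_left).aemeasurable).symm
  have hm : Measurable fun p : (α × T) × T => f (p.1.1, p.1.2) * g (p.1.1, p.2) :=
    (hf.comp measurable_fst).mul
      (hg.comp ((measurable_fst.comp measurable_fst).prodMk measurable_snd))
  have hm2 : ∀ τ, Measurable fun p : α × T => f (p.1, τ) * g p := fun τ =>
    (hf.comp (measurable_fst.prodMk measurable_const)).mul hg
  simp_rw [e1]
  rw [lintegral_lintegral_swap (Measurable.aemeasurable (hm.lintegral_prod_right'
      (ν := ν.restrict I))), ← lintegral_mul_const _ hA]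
  refine setLIntegral_mono' hI fun τ hτ => ?_
  rw [lintegral_lintegral_swap (hm2 τ).aemeasurable, ← lintegral_const_mul _ hB]
  exact setLIntegral_mono' hI fun t ht => h τ hτ t ht

end PatchEstimates

/-! ### The product estimate on the thin domain -/

section LayerProduct

variable {Γ : Set E3} {n : E3 → E3} {g₀ g₁ : E3 → ℝ} {δ δ₀ a ε τ β : ℝ}

lemma GraphPatch.exists_measurable_layer (c : GraphPatch Γ) (hT : IsThinDatum Γ n g₀ g₁ δ δ₀ a)
    (ε : ℝ) : ∃ Θ : (ℝ × ℝ) × ℝ → E3, Measurable Θ ∧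
      ∀ s ∈ c.Q, ∀ τ, Θ (s, τ) = layerPoint n g₀ g₁ ε τ (c.χ s) := by
  classical
  have h : ∀ {F : Type} [TopologicalSpace F] {f : E3 → F}, ContinuousOn f Γ →
      ContinuousOn (fun p : (ℝ × ℝ) × ℝ => f (c.χ p.1)) (c.Q ×ˢ univ) := fun hf =>
    (hf.comp ((c.contDiffOn_χ).continuousOn) fun s hs => c.χ_mem hs).comp continuousOn_fst
      fun p hp => c.Q_subset hp.1
  have h0 := h hT.contDiffOn_left.continuousOn
  have h1 := h hT.contDiffOn_right.continuousOn
  have hn := h hT.surface.contDiffOn_normal.continuousOn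
  have hi := h continuousOn_id
  have hc : ContinuousOn (fun p : (ℝ × ℝ) × ℝ => layerPoint n g₀ g₁ ε p.2 (c.χ p.1))
      (c.Q ×ˢ univ) :=
    hi.add ((continuousOn_const.mul (h0.add (continuousOn_snd.mul (h1.sub h0)))).smul hn)
  refine ⟨_, hc.measurable_piecewise (continuousOn_const (c := 0))
    (c.measurableSet_Q.prod MeasurableSet.univ), fun s hs τ => ?_⟩
  rw [piecewise_eq_of_mem _ _ _ (show (s, τ) ∈ c.Q ×ˢ univ from ⟨hs, mem_univ _⟩)]

/-- The product inequality for the restrictions of two functions to two layers.  As the indicator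
of a union of layers is constant along each layer, it can be inserted into both sides. -/
lemma GraphPatch.lintegral_layer_indicator_le (c : GraphPatch Γ)
    (hT : IsThinDatum Γ n g₀ g₁ δ δ₀ a) {C : ℝ≥0∞}
    (hC : ∀ ε ∈ Ioc (0 : ℝ) 1, ∀ τ ∈ Icc (0 : ℝ) 1, ∀ f : E3 → ℝ, ContDiff ℝ 1 f →
      ∃ D : ℝ × ℝ → (ℝ × ℝ →L[ℝ] ℝ), ContinuousOn D c.Q ∧
        (∀ s ∈ c.Q, HasFDerivAt (fun s => f (layerPoint n g₀ g₁ ε τ (c.χ s))) (D s) s) ∧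
        ∀ s ∈ c.Q, ENNReal.ofReal (2 * (c.R / 2))⁻¹ *
            ‖f (layerPoint n g₀ g₁ ε τ (c.χ s))‖ₑ ^ 2 +
          2 * (‖f (layerPoint n g₀ g₁ ε τ (c.χ s))‖ₑ * ‖D s‖ₑ) ≤
          C * energyDensity f (layerPoint n g₀ g₁ ε τ (c.χ s)))
    (hε : ε ∈ Ioc (0 : ℝ) 1) (hβ : 0 < β) {w φ : E3 → ℝ} (hw : ContDiff ℝ 1 w)
    (hφ : ContDiff ℝ 1 φ) {τ t : ℝ} (hτ : τ ∈ Icc (0 : ℝ) 1) (ht : t ∈ Icc (0 : ℝ) 1) :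
    ∫⁻ s in c.Q, (compactLayers Γ n g₀ g₁ ε β).indicator (fun x => ‖w x‖ₑ ^ 2)
        (layerPoint n g₀ g₁ ε τ (c.χ s)) *
      (compactLayers Γ n g₀ g₁ ε β).indicator (fun x => ‖φ x‖ₑ ^ 2)
        (layerPoint n g₀ g₁ ε t (c.χ s)) ≤
    (∫⁻ s in c.Q, C * (compactLayers Γ n g₀ g₁ ε β).indicator (energyDensity w)
        (layerPoint n g₀ g₁ ε τ (c.χ s))) *
      ∫⁻ s in c.Q, C * (compactLayers Γ n g₀ g₁ ε β).indicator (energyDensity φ)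
        (layerPoint n g₀ g₁ ε t (c.χ s)) := by
  have hmem : ∀ {r : ℝ}, r ∈ Icc (0 : ℝ) 1 → ∀ s ∈ c.Q,
      (layerPoint n g₀ g₁ ε r (c.χ s) ∈ compactLayers Γ n g₀ g₁ ε β ↔ r ∈ Icc β (1 - β)) :=
    fun hr s hs => hT.layerPoint_mem_compactLayers hε hβ hr (c.χ_mem (c.Q_subset hs))
  have hz : ∀ G : ℝ × ℝ → ℝ≥0∞, (∀ s ∈ c.Q, G s = 0) → ∫⁻ s in c.Q, G s = 0 := fun G hG => by
    rw [setLIntegral_congr_fun c.measurableSet_Q hG, lintegral_zero]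
  by_cases hτβ : τ ∈ Icc β (1 - β)
  swap
  · rw [hz _ fun s hs => by rw [indicator_of_notMem (mt (hmem hτ s hs).1 hτβ), zero_mul]]
    exact zero_le
  by_cases htβ : t ∈ Icc β (1 - β)
  swap
  · rw [hz _ fun s hs => by rw [indicator_of_notMem (mt (hmem ht s hs).1 htβ), mul_zero]]
    exact zero_le
  obtain ⟨D, hDc, hD, hDb⟩ := hC ε hε τ hτ w hw
  obtain ⟨D', hDc', hD', hDb'⟩ := hC ε hε t ht φ hφ
  have hR : 0 < c.R / 2 := half_pos c.isGraphChart.pos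
  calc _ = ∫⁻ s in square (c.R / 2), ‖w (layerPoint n g₀ g₁ ε τ (c.χ s))‖ₑ ^ 2 *
        ‖φ (layerPoint n g₀ g₁ ε t (c.χ s))‖ₑ ^ 2 := by
        refine setLIntegral_congr_fun c.measurableSet_Q fun s hs => ?_
        simp only [indicator_of_mem ((hmem hτ s hs).2 hτβ), indicator_of_mem ((hmem ht s hs).2 htβ)]
    _ ≤ _ := lintegral_sq_mul_sq_le hR hD hDc hD' hDc'
    _ ≤ _ := by
        refine mul_le_mul' (setLIntegral_mono' c.measurableSet_Q fun s hs => ?_)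
          (setLIntegral_mono' c.measurableSet_Q fun s hs => ?_)
        · rw [indicator_of_mem ((hmem hτ s hs).2 hτβ)]
          exact hDb s hs
        · rw [indicator_of_mem ((hmem ht s hs).2 htβ)]
          exact hDb' s hs

/-- The product estimate for smooth functions on unions of layers: the two-dimensional inequality is
applied to the restrictions to each pair of layers and integrated over the layer parameters. -/
theorem IsThinDatum.exists_lintegral_smooth_le (hT : IsThinDatum Γ n g₀ g₁ δ δ₀ a) :
    ∃ C : ℝ≥0∞, C ≠ ⊤ ∧ ∀ ε ∈ Ioc (0 : ℝ) 1, ∀ β > 0, ∀ w φ : E3 → ℝ, ContDiff ℝ 1 w →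
      ContDiff ℝ 1 φ →
      ∫⁻ x in thin Γ n g₀ g₁ ε, (∫⁻ r in Ioo (0 : ℝ) 1,
          (compactLayers Γ n g₀ g₁ ε β).indicator (fun x => ‖w x‖ₑ ^ 2)
            (layerProj Γ n g₀ g₁ ε r x)) *
          (compactLayers Γ n g₀ g₁ ε β).indicator (fun x => ‖φ x‖ₑ ^ 2) x ≤
        C * (ENNReal.ofReal ε)⁻¹ *
          ((∫⁻ x in compactLayers Γ n g₀ g₁ ε β, energyDensity w x) *
          ∫⁻ x in compactLayers Γ n g₀ g₁ ε β, energyDensity φ x) := by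
  obtain ⟨T, K, hKt, hK⟩ := hT.exists_cover
  choose C hCt hC using fun c : GraphPatch Γ => c.exists_layer_energy hT
  refine ⟨∑ c ∈ T, K * (C c * K * (C c * K)), ENNReal.sum_ne_top.2 fun c _ =>
    ENNReal.mul_ne_top hKt (ENNReal.mul_ne_top (ENNReal.mul_ne_top (hCt c) hKt)
      (ENNReal.mul_ne_top (hCt c) hKt)), fun ε hε β hβ w φ hw hφ => ?_⟩
  set L := compactLayers Γ n g₀ g₁ ε β with hL
  have hLm : MeasurableSet L := hT.isCompact_compactLayers.measurableSet
  have hLO : L ⊆ thin Γ n g₀ g₁ ε := hT.compactLayers_subset hε.1 hβ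
  have hOm : MeasurableSet (thin Γ n g₀ g₁ ε) := (hT.isOpen_thin hε).measurableSet
  have hsq : ∀ {f : E3 → ℝ}, ContDiff ℝ 1 f → Measurable (L.indicator fun x => ‖f x‖ₑ ^ 2) :=
    fun hf => (hf.continuous.measurable.enorm.pow_const 2).indicator hLm
  have hen : ∀ {f : E3 → ℝ}, ContDiff ℝ 1 f → Measurable (L.indicator (energyDensity f)) :=
    fun hf => (continuous_energyDensity hf).measurable.indicator hLm
  set e := ENNReal.ofReal ε with he
  have he0 : e ≠ 0 := by simpa [he] using hε.1
  have het : e ≠ ⊤ := ENNReal.ofReal_ne_top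
  have hFm : Measurable ((thin Γ n g₀ g₁ ε).indicator fun x => (∫⁻ r in Ioo (0 : ℝ) 1,
      L.indicator (fun x => ‖w x‖ₑ ^ 2) (layerProj Γ n g₀ g₁ ε r x)) *
        L.indicator (fun x => ‖φ x‖ₑ ^ 2) x) := by
    convert (hT.measurable_lintegral_layerProj hε (hsq hw)).mul (hsq hφ) using 1
    ext x
    exact indicator_mul_left _ _ _
  refine ((hK ε hε _ hFm).1).trans ?_
  rw [Finset.sum_mul, Finset.sum_mul]
  refine Finset.sum_le_sum fun c hc => ?_
  obtain ⟨Θ, hΘm, hΘ⟩ := c.exists_measurable_layer hT ε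
  -- the energy of a layer, integrated over the layer parameter
  have hE : ∀ {f : E3 → ℝ}, ContDiff ℝ 1 f →
      e * ∫⁻ r in Ioo (0 : ℝ) 1, ∫⁻ s in c.Q, C c * L.indicator (energyDensity f) (Θ (s, r)) ≤
        C c * K * ∫⁻ x in L, energyDensity f x := by
    intro f hf
    have h2 := (hK ε hε (L.indicator (energyDensity f)) ((hen hf).indicator hOm)).2 c hc
    rw [setLIntegral_indicator hLm, inter_eq_left.2 hLO] at h2
    have h3 : ∫⁻ r in Ioo (0 : ℝ) 1, ∫⁻ s in c.Q, C c * L.indicator (energyDensity f) (Θ (s, r)) =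
        C c * ∫⁻ s in c.Q, ∫⁻ r in Ioo (0 : ℝ) 1,
          L.indicator (energyDensity f) (layerPoint n g₀ g₁ ε r (c.χ s)) := by
      rw [lintegral_lintegral_swap (((hen hf).comp
        (hΘm.comp (measurable_snd.prodMk measurable_fst))).const_mul _).aemeasurable,
        ← lintegral_const_mul' _ _ (hCt c)]
      refine setLIntegral_congr_fun c.measurableSet_Q fun s hs => ?_
      simp only [hΘ s hs]
      rw [lintegral_const_mul' _ _ (hCt c)]
    rw [h3]
    calc _ = C c * (e * ∫⁻ s in c.Q, ∫⁻ r in Ioo (0 : ℝ) 1,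
          L.indicator (energyDensity f) (layerPoint n g₀ g₁ ε r (c.χ s))) := by ring
      _ ≤ C c * (K * ∫⁻ x in L, energyDensity f x) := mul_le_mul_right h2 _
      _ = _ := by ring
  have hS : ∫⁻ s in c.Q, ∫⁻ t in Ioo (0 : ℝ) 1, (∫⁻ r in Ioo (0 : ℝ) 1,
      L.indicator (fun x => ‖w x‖ₑ ^ 2)
        (layerProj Γ n g₀ g₁ ε r (layerPoint n g₀ g₁ ε t (c.χ s)))) *
      L.indicator (fun x => ‖φ x‖ₑ ^ 2) (layerPoint n g₀ g₁ ε t (c.χ s)) ≤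
      (∫⁻ r in Ioo (0 : ℝ) 1, ∫⁻ s in c.Q, C c * L.indicator (energyDensity w) (Θ (s, r))) *
      ∫⁻ r in Ioo (0 : ℝ) 1, ∫⁻ s in c.Q, C c * L.indicator (energyDensity φ) (Θ (s, r)) := by
    have hm : ∀ {f : E3 → ℝ}, ContDiff ℝ 1 f →
        Measurable fun r => ∫⁻ s in c.Q, C c * L.indicator (energyDensity f) (Θ (s, r)) :=
      fun hf => Measurable.lintegral_prod_left' (μ := volume.restrict c.Q)
        (f := fun p : (ℝ × ℝ) × ℝ => C c * L.indicator (energyDensity _) (Θ p))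
        (((hen hf).comp hΘm).const_mul _)
    refine le_trans (le_of_eq ?_) (lintegral_mul_le_of_slices (μ := volume.restrict c.Q)
      (ν := (volume : Measure ℝ)) ((hsq hw).comp hΘm)
      ((hsq hφ).comp hΘm) measurableSet_Ioo (hm hw) (hm hφ) fun r hr t ht => ?_)
    · refine setLIntegral_congr_fun c.measurableSet_Q fun s hs => ?_
      have hy := c.χ_mem (c.Q_subset hs)
      simp only [Function.comp, hΘ s hs]
      rw [← lintegral_const_mul'' (f := fun t => L.indicator (fun x => ‖φ x‖ₑ ^ 2)
        (layerPoint n g₀ g₁ ε t (c.χ s))) _ (by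
          simp only [← hΘ s hs]
          exact ((hsq hφ).comp (hΘm.comp measurable_prodMk_left)).aemeasurable)]
      refine setLIntegral_congr_fun measurableSet_Ioo fun t ht => ?_
      simp only [layerProj, hT.proj_layerPoint ⟨hε.1.le, hε.2⟩ ⟨ht.1.le, ht.2.le⟩ hy]
    · refine le_trans (le_of_eq ?_) ((c.lintegral_layer_indicator_le hT (hC c) hε hβ hw hφ
        ⟨hr.1.le, hr.2.le⟩ ⟨ht.1.le, ht.2.le⟩).trans (le_of_eq ?_))
      · exact setLIntegral_congr_fun c.measurableSet_Q fun s hs => by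
          simp only [Function.comp, hΘ s hs]; rfl
      · congr 1 <;> exact setLIntegral_congr_fun c.measurableSet_Q fun s hs => by
          simp only [hΘ s hs]; rfl
  set A := ∫⁻ r in Ioo (0 : ℝ) 1, ∫⁻ s in c.Q, C c * L.indicator (energyDensity w) (Θ (s, r))
  set B := ∫⁻ r in Ioo (0 : ℝ) 1, ∫⁻ s in c.Q, C c * L.indicator (energyDensity φ) (Θ (s, r))
  -- each of the two factors carries its own power of `ε`, only one of which is available
  have hee : e⁻¹ * e = 1 := ENNReal.inv_mul_cancel he0 het
  calc K * (e * _) ≤ K * (e * (A * B)) := by gcongr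
    _ = K * (e⁻¹ * ((e * A) * (e * B))) := by
        rw [show e⁻¹ * ((e * A) * (e * B)) = (e⁻¹ * e) * (e * (A * B)) by ring, hee, one_mul]
    _ ≤ K * (e⁻¹ * ((C c * K * ∫⁻ x in L, energyDensity w x) *
          (C c * K * ∫⁻ x in L, energyDensity φ x))) :=
        mul_le_mul_right (mul_le_mul_right (mul_le_mul' (hE hw) (hE hφ)) _) _
    _ = _ := by ring

lemma IsThinDatum.measurable_layerProj (hT : IsThinDatum Γ n g₀ g₁ δ δ₀ a)
    (hε : ε ∈ Ioc (0 : ℝ) 1) {x : E3} (hx : x ∈ thin Γ n g₀ g₁ ε) :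
    Measurable fun r => layerProj Γ n g₀ g₁ ε r x := by
  have h := (hT.continuousOn_layerProj hε).comp (f := fun r : ℝ => (x, r)) (s := univ)
    (by fun_prop) fun r _ => ⟨hx, mem_univ r⟩
  exact (continuousOn_univ.1 h).measurable

/-- Properties valid almost everywhere in the thin domain hold at the projection of almost every
point onto almost every layer. -/
lemma IsThinDatum.ae_ae_layerProj (hT : IsThinDatum Γ n g₀ g₁ δ δ₀ a) (hε : ε ∈ Ioc (0 : ℝ) 1)
    {p : E3 → Prop} (hp : ∀ᵐ x ∂(volume.restrict (thin Γ n g₀ g₁ ε)), p x) :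
    ∀ᵐ x ∂(volume.restrict (thin Γ n g₀ g₁ ε)), ∀ᵐ r ∂(volume.restrict (Ioo (0 : ℝ) 1)),
      p (layerProj Γ n g₀ g₁ ε r x) := by
  obtain ⟨C, -, hC⟩ := hT.exists_lintegral_layerProj_le
  obtain ⟨N, hpN, hNm, hN⟩ := exists_measurable_superset_of_null (ae_iff.1 hp)
  have hOm := (hT.isOpen_thin hε).measurableSet
  have hFm : Measurable (N.indicator (1 : E3 → ℝ≥0∞)) := measurable_one.indicator hNm
  have h0 := hC ε hε _ hFm
  rw [lintegral_indicator_one hNm, hN, mul_zero, nonpos_iff_eq_zero, lintegral_eq_zero_iff'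
    ((aemeasurable_indicator_iff hOm).1 (hT.measurable_lintegral_layerProj hε hFm).aemeasurable)]
    at h0
  filter_upwards [h0, ae_restrict_mem hOm] with x hx hxO
  rw [Pi.zero_apply, lintegral_eq_zero_iff (f := fun r => N.indicator (1 : E3 → ℝ≥0∞)
    (layerProj Γ n g₀ g₁ ε r x)) (hFm.comp (hT.measurable_layerProj hε hxO))] at hx
  filter_upwards [hx] with r hr
  by_contra hnp
  have : layerProj Γ n g₀ g₁ ε r x ∈ N := hpN hnp
  simp [indicator_of_mem this] at hr

/-- Fatou's lemma for integrals over the thin domain and the layer parameter. -/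
lemma IsThinDatum.lintegral_layerProj_mul_le_of_tendsto (hT : IsThinDatum Γ n g₀ g₁ δ δ₀ a)
    (hε : ε ∈ Ioc (0 : ℝ) 1) {F Φ : ℕ → E3 → ℝ≥0∞} {F' Φ' : E3 → ℝ≥0∞}
    (hF : ∀ k, Measurable (F k)) (hΦ : ∀ k, Measurable (Φ k)) (hFt : ∀ x, F' x ≠ ⊤)
    (hΦt : ∀ x, Φ' x ≠ ⊤)
    (hFF : ∀ᵐ x ∂(volume.restrict (thin Γ n g₀ g₁ ε)), Tendsto (fun k => F k x) atTop (𝓝 (F' x)))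
    (hΦΦ : ∀ᵐ x ∂(volume.restrict (thin Γ n g₀ g₁ ε)), Tendsto (fun k => Φ k x) atTop (𝓝 (Φ' x)))
    {b : ℕ → ℝ≥0∞} {B : ℝ≥0∞} (hb : Tendsto b atTop (𝓝 B))
    (hle : ∀ k, ∫⁻ x in thin Γ n g₀ g₁ ε,
      (∫⁻ r in Ioo (0 : ℝ) 1, F k (layerProj Γ n g₀ g₁ ε r x)) * Φ k x ≤ b k) :
    ∫⁻ x in thin Γ n g₀ g₁ ε,
      (∫⁻ r in Ioo (0 : ℝ) 1, F' (layerProj Γ n g₀ g₁ ε r x)) * Φ' x ≤ B := by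
  have hOm := (hT.isOpen_thin hε).measurableSet
  have hmeas : ∀ k, AEMeasurable (fun x => (∫⁻ r in Ioo (0 : ℝ) 1,
      F k (layerProj Γ n g₀ g₁ ε r x)) * Φ k x) (volume.restrict (thin Γ n g₀ g₁ ε)) := fun k =>
    ((aemeasurable_indicator_iff hOm).1
      (hT.measurable_lintegral_layerProj hε (hF k)).aemeasurable).mul (hΦ k).aemeasurable
  have hpt : ∀ᵐ x ∂(volume.restrict (thin Γ n g₀ g₁ ε)),
      (∫⁻ r in Ioo (0 : ℝ) 1, F' (layerProj Γ n g₀ g₁ ε r x)) * Φ' x ≤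
      liminf (fun k => (∫⁻ r in Ioo (0 : ℝ) 1, F k (layerProj Γ n g₀ g₁ ε r x)) * Φ k x) atTop := by
    filter_upwards [hT.ae_ae_layerProj hε hFF, hΦΦ, ae_restrict_mem hOm] with x h1 h2 hxO
    have hm : ∀ k, Measurable fun r => F k (layerProj Γ n g₀ g₁ ε r x) := fun k =>
      (hF k).comp (hT.measurable_layerProj hε hxO)
    calc (∫⁻ r in Ioo (0 : ℝ) 1, F' (layerProj Γ n g₀ g₁ ε r x)) * Φ' x
        = ∫⁻ r in Ioo (0 : ℝ) 1, F' (layerProj Γ n g₀ g₁ ε r x) * Φ' x := by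
          rw [lintegral_mul_const' _ _ (hΦt x)]
      _ = ∫⁻ r in Ioo (0 : ℝ) 1,
            liminf (fun k => F k (layerProj Γ n g₀ g₁ ε r x) * Φ k x) atTop := by
          refine lintegral_congr_ae ?_
          filter_upwards [h1] with r hr
          exact (ENNReal.Tendsto.mul hr (Or.inr (hΦt x)) h2 (Or.inr (hFt _))).liminf_eq.symm
      _ ≤ liminf (fun k => ∫⁻ r in Ioo (0 : ℝ) 1,
            F k (layerProj Γ n g₀ g₁ ε r x) * Φ k x) atTop :=
          lintegral_liminf_le fun k => (hm k).mul_const _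
      _ = _ := by
          congr 1
          ext k
          rw [lintegral_mul_const _ (hm k)]
  calc _ ≤ _ := lintegral_mono_ae hpt
    _ ≤ liminf (fun k => ∫⁻ x in thin Γ n g₀ g₁ ε, (∫⁻ r in Ioo (0 : ℝ) 1,
          F k (layerProj Γ n g₀ g₁ ε r x)) * Φ k x) atTop := lintegral_liminf_le' hmeas
    _ ≤ liminf b atTop := liminf_le_liminf (Eventually.of_forall hle)
    _ = B := hb.liminf_eq

lemma enorm_le_sum_enorm_single (L : E3 →L[ℝ] ℝ) :
    ‖L‖ₑ ≤ ∑ i, ‖L (EuclideanSpace.single i 1)‖ₑ := by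
  have h : ‖L‖ ≤ ∑ i, ‖L (EuclideanSpace.single i (1 : ℝ))‖ := by
    refine ContinuousLinearMap.opNorm_le_bound _ (Finset.sum_nonneg fun _ _ => norm_nonneg _)
      fun x => ?_
    have hx : L x = ∑ i, x i * L (EuclideanSpace.single i 1) := by
      conv_lhs => rw [euclidean_sum_single x]
      rw [map_sum]
      simp
    rw [hx, Finset.sum_mul]
    refine (norm_sum_le _ _).trans (Finset.sum_le_sum fun i _ => ?_)
    rw [norm_mul, mul_comm]
    gcongr
    exact PiLp.norm_apply_le x i
  calc ‖L‖ₑ = ENNReal.ofReal ‖L‖ := (ofReal_norm L).symm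
    _ ≤ ENNReal.ofReal (∑ i, ‖L (EuclideanSpace.single i (1 : ℝ))‖) := ENNReal.ofReal_le_ofReal h
    _ = ∑ i, ‖L (EuclideanSpace.single i 1)‖ₑ := by
        rw [ENNReal.ofReal_sum_of_nonneg fun _ _ => norm_nonneg _]
        simp only [ofReal_norm]

end LayerProduct

section SobolevNorms

lemma MemH1.weakDeriv_spec {Ω : Set E3} {φ : E3 → ℝ} (h : MemH1 Ω φ) (i : Fin 3) :
    MemL2 Ω (weakDeriv Ω i φ) ∧ HasWeakDeriv Ω i φ (weakDeriv Ω i φ) := by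
  have := h.2 i
  rw [weakDeriv, dif_pos this]
  exact this.choose_spec

lemma le_rpow_half_of_sq_le {x y : ℝ≥0∞} (h : x ^ 2 ≤ y) : x ≤ y ^ (1 / 2 : ℝ) := by
  calc x = (x ^ 2) ^ (1 / 2 : ℝ) := by
        rw [← ENNReal.rpow_natCast, ← ENNReal.rpow_mul]
        norm_num
    _ ≤ _ := ENNReal.rpow_le_rpow h (by norm_num)

lemma L2_le_H1 (Ω : Set E3) (φ : E3 → ℝ) : L2 Ω φ ≤ H1 Ω φ :=
  le_rpow_half_of_sq_le le_self_add

lemma L2_weakDeriv_le_H1 (Ω : Set E3) (φ : E3 → ℝ) (i : Fin 3) :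
    L2 Ω (weakDeriv Ω i φ) ≤ H1 Ω φ :=
  le_rpow_half_of_sq_le ((Finset.single_le_sum (f := fun i => L2 Ω (weakDeriv Ω i φ) ^ 2)
    (fun _ _ => zero_le) (Finset.mem_univ i)).trans le_add_self)

lemma L2_add_sum_le (Ω : Set E3) (φ : E3 → ℝ) :
    L2 Ω φ + ∑ i, L2 Ω (weakDeriv Ω i φ) ≤ 4 * H1 Ω φ := by
  calc L2 Ω φ + ∑ i, L2 Ω (weakDeriv Ω i φ) ≤ H1 Ω φ + ∑ _i : Fin 3, H1 Ω φ :=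
        add_le_add (L2_le_H1 _ _) (Finset.sum_le_sum fun i _ => L2_weakDeriv_le_H1 _ _ i)
    _ = 4 * H1 Ω φ := by
        simp only [Finset.sum_const, Finset.card_univ, Fintype.card_fin, nsmul_eq_mul]
        push_cast
        ring

end SobolevNorms

section LayerProduct

variable {Γ : Set E3} {n : E3 → E3} {g₀ g₁ : E3 → ℝ} {δ δ₀ a ε τ β : ℝ}

/-- Smooth approximations of a Sobolev function along the exhaustion by unions of layers. -/
lemma IsThinDatum.exists_smooth_seq (hT : IsThinDatum Γ n g₀ g₁ δ δ₀ a)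
    (hε : ε ∈ Ioc (0 : ℝ) 1) {w : E3 → ℝ} (hw : MemH1 (thin Γ n g₀ g₁ ε) w) :
    ∃ f : ℕ → E3 → ℝ, (∀ k, ContDiff ℝ ∞ (f k)) ∧
      (∀ k, eLpNorm (f k - w) 2 (volume.restrict (exhaustion Γ n g₀ g₁ ε k)) ≤ 2⁻¹ ^ k) ∧
      (∀ k i, eLpNorm ((fun x => fderiv ℝ (f k) x (EuclideanSpace.single i 1)) -
        weakDeriv (thin Γ n g₀ g₁ ε) i w) 2 (volume.restrict (exhaustion Γ n g₀ g₁ ε k))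
        ≤ 2⁻¹ ^ k) ∧
      (∀ᵐ x ∂(volume.restrict (thin Γ n g₀ g₁ ε)), Tendsto (fun k => f k x) atTop (𝓝 (w x))) ∧
      ∃ b : ℕ → ℝ≥0∞, (∀ k, ∫⁻ x in exhaustion Γ n g₀ g₁ ε k, energyDensity (f k) x ≤ b k) ∧
        Tendsto b atTop (𝓝 (L2 (thin Γ n g₀ g₁ ε) w * (L2 (thin Γ n g₀ g₁ ε) w +
          ∑ i, L2 (thin Γ n g₀ g₁ ε) (weakDeriv (thin Γ n g₀ g₁ ε) i w)))) :=
  CTD.exists_smooth_seq (hT.isOpen_thin hε) enorm_le_sum_enorm_single hw.1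
    (fun i => (hw.weakDeriv_spec i).1) (fun i => (hw.weakDeriv_spec i).2)
    (fun _ => hT.isCompact_compactLayers)
    (fun k => hT.compactLayers_subset hε.1 (one_div_nat_pos k))
    (fun _ hx => hT.eventually_mem_exhaustion hε hx)

lemma L2_mul_add_sum_ne_top {Ω : Set E3} {φ : E3 → ℝ} (h : MemH1 Ω φ) :
    L2 Ω φ * (L2 Ω φ + ∑ i, L2 Ω (weakDeriv Ω i φ)) ≠ ⊤ :=
  ENNReal.mul_ne_top h.1.2.ne (ENNReal.add_ne_top.2
    ⟨h.1.2.ne, ENNReal.sum_ne_top.2 fun i _ => (h.weakDeriv_spec i).1.2.ne⟩)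

/-- The product estimate behind the bounds for the average part: a Sobolev function restricted to
the layers and extended constantly in the normal direction, times another Sobolev function. -/
theorem IsThinDatum.exists_lintegral_layerProj_sq_mul_sq_le
    (hT : IsThinDatum Γ n g₀ g₁ δ δ₀ a) :
    ∃ C : ℝ≥0∞, C ≠ ⊤ ∧ ∀ ε ∈ Ioc (0 : ℝ) 1, ∀ w φ : E3 → ℝ, MemH1 (thin Γ n g₀ g₁ ε) w →
      MemH1 (thin Γ n g₀ g₁ ε) φ →
      ∫⁻ x in thin Γ n g₀ g₁ ε,
        (∫⁻ r in Ioo (0 : ℝ) 1, ‖w (layerProj Γ n g₀ g₁ ε r x)‖ₑ ^ 2) * ‖φ x‖ₑ ^ 2 ≤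
      C * (ENNReal.ofReal ε)⁻¹ *
        ((L2 (thin Γ n g₀ g₁ ε) w * H1 (thin Γ n g₀ g₁ ε) w) *
          (L2 (thin Γ n g₀ g₁ ε) φ * H1 (thin Γ n g₀ g₁ ε) φ)) := by
  obtain ⟨C, hCt, hC⟩ := hT.exists_lintegral_smooth_le
  refine ⟨16 * C, ENNReal.mul_ne_top (by simp) hCt, fun ε hε w φ hw hφ => ?_⟩
  obtain ⟨f, hf, -, -, hfae, b, hb, hbt⟩ := hT.exists_smooth_seq hε hw
  obtain ⟨ψ, hψ, -, -, hψae, d, hd, hdt⟩ := hT.exists_smooth_seq hε hφ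
  have hOm := (hT.isOpen_thin hε).measurableSet
  have hKm : ∀ k, MeasurableSet (exhaustion Γ n g₀ g₁ ε k) :=
    fun k => hT.isCompact_compactLayers.measurableSet
  have hm : ∀ {u : ℕ → E3 → ℝ}, (∀ k, ContDiff ℝ ∞ (u k)) →
      ∀ k, Measurable ((exhaustion Γ n g₀ g₁ ε k).indicator fun x => ‖u k x‖ₑ ^ 2) := fun hu k =>
    ((hu k).continuous.measurable.enorm.pow_const 2).indicator (hKm k)
  have hae : ∀ {u : ℕ → E3 → ℝ} {v : E3 → ℝ}, (∀ᵐ x ∂(volume.restrict (thin Γ n g₀ g₁ ε)),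
      Tendsto (fun k => u k x) atTop (𝓝 (v x))) →
      ∀ᵐ x ∂(volume.restrict (thin Γ n g₀ g₁ ε)), Tendsto (fun k =>
        (exhaustion Γ n g₀ g₁ ε k).indicator (fun x => ‖u k x‖ₑ ^ 2) x) atTop
          (𝓝 (‖v x‖ₑ ^ 2)) := by
    intro u v h
    filter_upwards [h, ae_restrict_mem hOm] with x hx hxO
    exact tendsto_indicator_enorm_sq hx (hT.eventually_mem_exhaustion hε hxO)
  have he0 : ENNReal.ofReal ε ≠ 0 := by simpa using hε.1
  have hCe : C * (ENNReal.ofReal ε)⁻¹ ≠ ⊤ :=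
    ENNReal.mul_ne_top hCt (ENNReal.inv_ne_top.2 he0)
  have hlim := ENNReal.Tendsto.const_mul (a := C * (ENNReal.ofReal ε)⁻¹)
    (ENNReal.Tendsto.mul hbt (Or.inr (L2_mul_add_sum_ne_top hφ)) hdt
      (Or.inr (L2_mul_add_sum_ne_top hw))) (Or.inr hCe)
  refine (hT.lintegral_layerProj_mul_le_of_tendsto hε (hm hf) (hm hψ) (fun _ => by simp)
    (fun _ => by simp) (hae hfae) (hae hψae) hlim fun k => ?_).trans ?_
  · refine (hC ε hε _ (one_div_nat_pos k) (f k) (ψ k) ((hf k).of_le (by norm_cast))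
      ((hψ k).of_le (by norm_cast))).trans ?_
    exact mul_le_mul_right (mul_le_mul' (hb k) (hd k)) _
  · calc _ ≤ C * (ENNReal.ofReal ε)⁻¹ *
          ((L2 (thin Γ n g₀ g₁ ε) w * (4 * H1 (thin Γ n g₀ g₁ ε) w)) *
          (L2 (thin Γ n g₀ g₁ ε) φ * (4 * H1 (thin Γ n g₀ g₁ ε) φ))) := by
          gcongr <;> exact L2_add_sum_le _ _
      _ = _ := by ring

end LayerProduct

/-! ### Surface integrals in charts -/

section ChartIntegrals

variable {Γ : Set E3} {n : E3 → E3} {g₀ g₁ : E3 → ℝ} {δ δ₀ a ε τ β : ℝ}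

namespace GraphPatch

variable (c : GraphPatch Γ)

/-- The area density of the patch. -/
def J (s : ℝ × ℝ) : ℝ := areaDensity (fderiv ℝ c.h s)

lemma measurable_J : Measurable c.J :=
  continuous_areaDensity.measurable.comp (measurable_fderiv ℝ c.h)

lemma J_pos (s : ℝ × ℝ) : 0 < c.J s := areaDensity_pos _

lemma one_le_J (s : ℝ × ℝ) : 1 ≤ c.J s := one_le_areaDensity _

lemma measurableSet_openSquare : MeasurableSet (openSquare c.R) :=
  (isOpen_openSquare _).measurableSet

lemma aemeasurable_χ : AEMeasurable c.χ (volume.restrict (openSquare c.R)) :=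
  c.contDiffOn_χ.continuousOn.aemeasurable c.measurableSet_openSquare

lemma aemeasurable_χ_chartMeasure : AEMeasurable c.χ (chartMeasure c.h c.R) :=
  c.isGraphChart.aemeasurable_chart

lemma exists_surf_eq (hΓ : IsClosedSurface Γ n) : ∃ k : ℝ≥0∞, k ≠ 0 ∧ k ≠ ⊤ ∧
    (surf Γ).restrict c.U = k • Measure.map c.χ (chartMeasure c.h c.R) :=
  c.isGraphChart.map_chart hΓ

lemma exists_setLIntegral_surf (hΓ : IsClosedSurface Γ n) : ∃ k : ℝ≥0∞, k ≠ 0 ∧ k ≠ ⊤ ∧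
    ∀ F : E3 → ℝ≥0∞, Measurable F → ∫⁻ y in c.U, F y ∂(surf Γ) =
      k * ∫⁻ s in openSquare c.R, ENNReal.ofReal (c.J s) * F (c.χ s) := by
  obtain ⟨k, hk0, hkt, hk⟩ := c.exists_surf_eq hΓ
  refine ⟨k, hk0, hkt, fun F hF => ?_⟩
  rw [hk, lintegral_smul_measure,
    lintegral_map' hF.aemeasurable c.aemeasurable_χ_chartMeasure]
  change k * ∫⁻ s, (F ∘ c.χ) s ∂((volume.restrict (openSquare c.R)).withDensity
    fun s => ENNReal.ofReal (c.J s)) = _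
  rw [lintegral_withDensity_eq_lintegral_mul₀ c.measurable_J.ennreal_ofReal.aemeasurable
      (hF.comp_aemeasurable c.aemeasurable_χ)]
  rfl

/-- The parametrization of a patch pulls null sets back to null sets. -/
lemma ae_χ (hΓ : IsClosedSurface Γ n) {p : E3 → Prop} (hp : ∀ᵐ y ∂(surf Γ), p y) :
    ∀ᵐ s ∂(volume.restrict (openSquare c.R)), p (c.χ s) := by
  obtain ⟨k, hk0, hkt, hk⟩ := c.exists_setLIntegral_surf hΓ
  obtain ⟨N, hpN, hNm, hN⟩ := exists_measurable_superset_of_null (ae_iff.1 hp)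
  have h := hk (N.indicator 1) (measurable_one.indicator hNm)
  rw [lintegral_indicator_one hNm, Measure.restrict_apply hNm,
    measure_mono_null inter_subset_left hN] at h
  have h0 := (mul_eq_zero.1 h.symm).resolve_left hk0
  have hm : AEMeasurable (fun s => ENNReal.ofReal (c.J s) * N.indicator 1 (c.χ s))
      (volume.restrict (openSquare c.R)) := c.measurable_J.ennreal_ofReal.aemeasurable.mul
    ((measurable_one.indicator hNm).comp_aemeasurable c.aemeasurable_χ)
  rw [lintegral_eq_zero_iff' hm] at h0
  filter_upwards [h0] with s hs
  by_contra hnp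
  have hmem : c.χ s ∈ N := hpN hnp
  have := c.J_pos s
  rw [indicator_of_mem hmem] at hs
  simp at hs
  linarith

lemma aestronglyMeasurable_comp_χ (hΓ : IsClosedSurface Γ n) {η : E3 → ℝ}
    (hη : AEStronglyMeasurable η (surf Γ)) :
    AEStronglyMeasurable (fun s => η (c.χ s)) (volume.restrict (openSquare c.R)) := by
  refine (hη.stronglyMeasurable_mk.measurable.comp_aemeasurable
    c.aemeasurable_χ).aestronglyMeasurable.congr ?_
  filter_upwards [c.ae_χ hΓ hη.ae_eq_mk] with s hs
  exact hs.symm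

/-- Pulling back to the coordinate square is bounded in `L²`. -/
lemma exists_eLpNorm_comp_χ_le (hΓ : IsClosedSurface Γ n) : ∃ k : ℝ≥0∞, k ≠ ⊤ ∧
    ∀ η : E3 → ℝ, AEStronglyMeasurable η (surf Γ) →
      eLpNorm (fun s => η (c.χ s)) 2 (volume.restrict (openSquare c.R)) ≤ k * L2Surf Γ η := by
  obtain ⟨k, hk0, hkt, hk⟩ := c.exists_setLIntegral_surf hΓ
  refine ⟨k⁻¹ ^ (1 / 2 : ℝ), ENNReal.rpow_ne_top_of_nonneg (by norm_num)
    (ENNReal.inv_ne_top.2 hk0), fun η hη => ?_⟩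
  have hm := hη.stronglyMeasurable_mk.measurable
  have h1 : ∫⁻ s in openSquare c.R, ‖η (c.χ s)‖ₑ ^ 2 ≤ k⁻¹ * ∫⁻ y, ‖η y‖ₑ ^ 2 ∂(surf Γ) := by
    calc ∫⁻ s in openSquare c.R, ‖η (c.χ s)‖ₑ ^ 2
        = ∫⁻ s in openSquare c.R, ‖hη.mk η (c.χ s)‖ₑ ^ 2 := by
          refine lintegral_congr_ae ?_
          filter_upwards [c.ae_χ hΓ hη.ae_eq_mk] with s hs
          rw [hs]
      _ ≤ ∫⁻ s in openSquare c.R, ENNReal.ofReal (c.J s) * ‖hη.mk η (c.χ s)‖ₑ ^ 2 := by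
          refine lintegral_mono fun s => ?_
          have : (1 : ℝ≥0∞) ≤ ENNReal.ofReal (c.J s) := ENNReal.one_le_ofReal.2 (c.one_le_J s)
          calc ‖hη.mk η (c.χ s)‖ₑ ^ 2 = 1 * ‖hη.mk η (c.χ s)‖ₑ ^ 2 := (one_mul _).symm
            _ ≤ _ := by gcongr
      _ = k⁻¹ * (k * ∫⁻ s in openSquare c.R,
            ENNReal.ofReal (c.J s) * ‖hη.mk η (c.χ s)‖ₑ ^ 2) := by
          rw [← mul_assoc, ENNReal.inv_mul_cancel hk0 hkt, one_mul]
      _ = k⁻¹ * ∫⁻ y in c.U, ‖hη.mk η y‖ₑ ^ 2 ∂(surf Γ) := by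
          rw [hk (fun y => ‖hη.mk η y‖ₑ ^ 2) (hm.enorm.pow_const 2)]
      _ ≤ k⁻¹ * ∫⁻ y, ‖hη.mk η y‖ₑ ^ 2 ∂(surf Γ) := by
          gcongr
          exact Measure.restrict_le_self
      _ = _ := by
          congr 1
          refine lintegral_congr_ae ?_
          filter_upwards [hη.ae_eq_mk] with y hy
          rw [hy]
  rw [← eLpNorm_two_sq, ← eLpNorm_two_sq] at h1
  refine (le_rpow_half_of_sq_le h1).trans (le_of_eq ?_)
  rw [ENNReal.mul_rpow_of_nonneg _ _ (by norm_num), ← ENNReal.rpow_natCast, ← ENNReal.rpow_mul]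
  norm_num
  rfl

/-- Integrals over the surface of functions supported in a patch, in coordinates. -/
lemma exists_integral_surf (hΓ : IsClosedSurface Γ n) : ∃ k : ℝ, k ≠ 0 ∧
    ∀ (g G : E3 → ℝ) (f : ℝ × ℝ → ℝ), AEStronglyMeasurable g (surf Γ) → Measurable f →
      (∀ x ∈ Γ ∩ c.U, G x = f (coord c.b c.y₀ x)) → (∀ x ∈ Γ \ c.U, G x = 0) →
      ∫ y, g y * G y ∂(surf Γ) = k * ∫ s in openSquare c.R, c.J s * (g (c.χ s) * f s) := by
  obtain ⟨k, hk0, hkt, hk⟩ := c.exists_surf_eq hΓ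
  refine ⟨k.toReal, ENNReal.toReal_ne_zero.2 ⟨hk0, hkt⟩, fun g G f hg hf hG hG0 => ?_⟩
  have hΓm : MeasurableSet Γ := hΓ.isCompact.isClosed.measurableSet
  have hUm : MeasurableSet c.U := c.isGraphChart.isOpen.measurableSet
  have hmem : ∀ᵐ y ∂(surf Γ), y ∈ Γ := ae_restrict_mem hΓm
  have e1 : ∫ y, g y * G y ∂(surf Γ) = ∫ y in c.U, g y * f (coord c.b c.y₀ y) ∂(surf Γ) := by
    rw [← integral_indicator hUm]
    refine integral_congr_ae ?_
    filter_upwards [hmem] with y hy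
    by_cases hyU : y ∈ c.U
    · rw [indicator_of_mem hyU, hG y ⟨hy, hyU⟩]
    · rw [indicator_of_notMem hyU, hG0 y ⟨hy, hyU⟩, mul_zero]
  have hgm : AEStronglyMeasurable (fun y => g y * f (coord c.b c.y₀ y)) (surf Γ) :=
    hg.mul (hf.comp measurable_coord).aestronglyMeasurable
  have hgm' : AEStronglyMeasurable (fun y => g y * f (coord c.b c.y₀ y))
      (Measure.map c.χ (chartMeasure c.h c.R)) := by
    have h := hgm.mono_measure (Measure.restrict_le_self (s := c.U))
    rw [hk] at h
    exact h.mono_ac (Measure.absolutelyContinuous_smul hk0)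
  rw [e1, hk, integral_smul_measure, integral_map c.aemeasurable_χ_chartMeasure hgm',
    smul_eq_mul, chartMeasure]
  congr 1
  have hJ : (fun s => ENNReal.ofReal (areaDensity (fderiv ℝ c.h s))) =
      fun s => ((c.J s).toNNReal : ℝ≥0∞) := rfl
  rw [hJ, integral_withDensity_eq_integral_smul c.measurable_J.real_toNNReal]
  refine integral_congr_ae (Eventually.of_forall fun s => ?_)
  change (c.J s).toNNReal • _ = _
  rw [NNReal.smul_def, Real.coe_toNNReal _ (c.J_pos s).le, smul_eq_mul, GraphPatch.χ, coord_chart]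
  rfl

end GraphPatch

end ChartIntegrals

section ProjIntegrals

variable {Γ : Set E3} {n : E3 → E3} {g₀ g₁ : E3 → ℝ} {δ δ₀ a ε τ β : ℝ}

/-- The constant extension in the normal direction, integrated over the thin domain. -/
theorem IsThinDatum.exists_lintegral_proj_le (hT : IsThinDatum Γ n g₀ g₁ δ δ₀ a) :
    ∃ C : ℝ≥0∞, C ≠ ⊤ ∧ ∀ ε ∈ Ioc (0 : ℝ) 1, ∀ F : E3 → ℝ≥0∞, Measurable F →
      ∫⁻ x in thin Γ n g₀ g₁ ε, F (proj Γ x) ≤ C * ∫⁻ y, F y ∂(surf Γ) := by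
  obtain ⟨t, K, hKt, hK⟩ := hT.exists_cover
  choose k hk0 hkt hk using fun c : GraphPatch Γ => c.exists_setLIntegral_surf hT.surface
  refine ⟨∑ c ∈ t, K * (k c)⁻¹, ENNReal.sum_ne_top.2 fun c _ =>
    ENNReal.mul_ne_top hKt (ENNReal.inv_ne_top.2 (hk0 c)), fun ε hε F hF => ?_⟩
  have hm := measurable_indicator_comp (hT.isOpen_thin hε).measurableSet
    ((contDiffOn_proj hT.surface hT.tubular).continuousOn.mono (hT.thin_subset_tube hε)) hF
  refine ((hK ε hε _ hm).1).trans ?_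
  rw [Finset.sum_mul]
  refine Finset.sum_le_sum fun c _ => ?_
  rw [mul_assoc]
  refine mul_le_mul_right ?_ _
  have h1 : ∫⁻ s in c.Q, ∫⁻ r in Ioo (0 : ℝ) 1, F (proj Γ (layerPoint n g₀ g₁ ε r (c.χ s))) =
      ∫⁻ s in c.Q, F (c.χ s) := by
    refine setLIntegral_congr_fun c.measurableSet_Q fun s hs => ?_
    have : ∀ r ∈ Ioo (0 : ℝ) 1, F (proj Γ (layerPoint n g₀ g₁ ε r (c.χ s))) = F (c.χ s) :=
      fun r hr => by
        rw [hT.proj_layerPoint ⟨hε.1.le, hε.2⟩ ⟨hr.1.le, hr.2.le⟩ (c.χ_mem (c.Q_subset hs))]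
    rw [setLIntegral_congr_fun measurableSet_Ioo this, setLIntegral_const]
    simp
  rw [h1]
  calc ENNReal.ofReal ε * ∫⁻ s in c.Q, F (c.χ s)
      ≤ 1 * ∫⁻ s in openSquare c.R, ENNReal.ofReal (c.J s) * F (c.χ s) := by
        refine mul_le_mul' (ENNReal.ofReal_le_one.2 hε.2) ((lintegral_mono_set c.Q_subset).trans
          (lintegral_mono fun s => ?_))
        calc F (c.χ s) = 1 * F (c.χ s) := (one_mul _).symm
          _ ≤ _ := mul_le_mul_left (ENNReal.one_le_ofReal.2 (c.one_le_J s)) _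
    _ = (k c)⁻¹ * (k c * ∫⁻ s in openSquare c.R, ENNReal.ofReal (c.J s) * F (c.χ s)) := by
        rw [← mul_assoc, ENNReal.inv_mul_cancel (hk0 c) (hkt c)]
    _ = (k c)⁻¹ * ∫⁻ y in c.U, F y ∂(surf Γ) := by rw [hk c F hF]
    _ ≤ _ := mul_le_mul_right (setLIntegral_le_lintegral _ _) _

/-- The closest point projection pulls null sets of the surface back to null sets. -/
lemma IsThinDatum.ae_proj (hT : IsThinDatum Γ n g₀ g₁ δ δ₀ a) (hε : ε ∈ Ioc (0 : ℝ) 1)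
    {p : E3 → Prop} (hp : ∀ᵐ y ∂(surf Γ), p y) :
    ∀ᵐ x ∂(volume.restrict (thin Γ n g₀ g₁ ε)), p (proj Γ x) := by
  obtain ⟨C, -, hC⟩ := hT.exists_lintegral_proj_le
  obtain ⟨N, hpN, hNm, hN⟩ := exists_measurable_superset_of_null (ae_iff.1 hp)
  have hOm := (hT.isOpen_thin hε).measurableSet
  have hFm : Measurable (N.indicator (1 : E3 → ℝ≥0∞)) := measurable_one.indicator hNm
  have h0 := hC ε hε _ hFm
  have hm := measurable_indicator_comp hOm
    ((contDiffOn_proj hT.surface hT.tubular).continuousOn.mono (hT.thin_subset_tube hε)) hFm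
  rw [lintegral_indicator_one hNm, hN, mul_zero, nonpos_iff_eq_zero,
    lintegral_eq_zero_iff' ((aemeasurable_indicator_iff hOm).1 hm.aemeasurable)] at h0
  filter_upwards [h0] with x hx
  by_contra hnp
  have : proj Γ x ∈ N := hpN hnp
  simp [indicator_of_mem this] at hx

lemma IsThinDatum.aestronglyMeasurable_ext (hT : IsThinDatum Γ n g₀ g₁ δ δ₀ a)
    (hε : ε ∈ Ioc (0 : ℝ) 1) {η : E3 → ℝ} (hη : AEStronglyMeasurable η (surf Γ)) :
    AEStronglyMeasurable (ext Γ η) (volume.restrict (thin Γ n g₀ g₁ ε)) := by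
  have h1 : AEMeasurable (proj Γ) (volume.restrict (thin Γ n g₀ g₁ ε)) :=
    ((contDiffOn_proj hT.surface hT.tubular).continuousOn.mono
      (hT.thin_subset_tube hε)).aemeasurable (hT.isOpen_thin hε).measurableSet
  refine (hη.stronglyMeasurable_mk.measurable.comp_aemeasurable h1).aestronglyMeasurable.congr ?_
  filter_upwards [hT.ae_proj hε hη.ae_eq_mk] with x hx
  exact hx.symm

end ProjIntegrals

/-! ### Surface divergence in coordinates -/

section ChartDivergence

variable {Γ : Set E3} {n : E3 → E3} {δ : ℝ}

lemma sum_inner_single_mul (x y : E3) :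
    ∑ i, ⟪x, EuclideanSpace.single i (1 : ℝ)⟫ * y i = ⟪x, y⟫ := by
  conv_rhs => rw [euclidean_sum_single y]
  rw [inner_sum]
  refine Finset.sum_congr rfl fun i _ => ?_
  rw [real_inner_smul_right, mul_comm]

lemma inner_P_left_eq (y x z : E3) : ⟪P n y x, z⟫ = ⟪x, z⟫ - ⟪n y, x⟫ * ⟪n y, z⟫ := by
  rw [P, inner_sub_left, real_inner_smul_left]

/-- The derivative of the coordinate projection of a patch. -/
def coordCLM (b : OrthonormalBasis (Fin 3) ℝ E3) : E3 →L[ℝ] ℝ × ℝ :=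
  (innerSL ℝ (b 0)).prod (innerSL ℝ (b 1))

lemma coordCLM_apply (b : OrthonormalBasis (Fin 3) ℝ E3) (x : E3) :
    coordCLM b x = (⟪b 0, x⟫, ⟪b 1, x⟫) := rfl

lemma hasFDerivAt_coord (b : OrthonormalBasis (Fin 3) ℝ E3) (y₀ x : E3) :
    HasFDerivAt (coord b y₀) (coordCLM b) x := by
  have h := (coordCLM b).hasFDerivAt.comp x ((hasFDerivAt_id x).sub_const y₀)
  exact h

/-- The trace of the tangential gradient in terms of derivatives in the coordinates. -/
lemma sum_clm_coord_P (b : OrthonormalBasis (Fin 3) ℝ E3) (L : ℝ × ℝ →L[ℝ] E3) (y : E3) :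
    ∑ i, (L (coordCLM b (P n y (EuclideanSpace.single i 1)))) i =
      ⟪P n y (b 0), L (1, 0)⟫ + ⟪P n y (b 1), L (0, 1)⟫ := by
  have h : ∀ v : ℝ × ℝ, L v = v.1 • L (1, 0) + v.2 • L (0, 1) := by
    intro v
    rw [← map_smul, ← map_smul, ← map_add]
    simp
  rw [← sum_inner_single_mul (P n y (b 0)), ← sum_inner_single_mul (P n y (b 1)),
    ← Finset.sum_add_distrib]
  refine Finset.sum_congr rfl fun i _ => ?_
  rw [h, coordCLM_apply, inner_P_left, inner_P_left]
  simp

namespace GraphPatch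

variable (c : GraphPatch Γ)

lemma contDiffOn_fderiv_h : ContDiffOn ℝ 4 (fderiv ℝ c.h) (openSquare c.R) :=
  c.isGraphChart.contDiffOn.fderiv_of_isOpen (isOpen_openSquare _) (by norm_num)

lemma hasFDerivAt_fderiv_h {s : ℝ × ℝ} (hs : s ∈ openSquare c.R) :
    HasFDerivAt (fderiv ℝ c.h) (fderiv ℝ (fderiv ℝ c.h) s) s :=
  ((c.contDiffOn_fderiv_h.contDiffAt ((isOpen_openSquare _).mem_nhds hs)).differentiableAt
    (by norm_num)).hasFDerivAt

lemma fderiv_fderiv_h_symm {s : ℝ × ℝ} (hs : s ∈ openSquare c.R) (v w : ℝ × ℝ) :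
    fderiv ℝ (fderiv ℝ c.h) s v w = fderiv ℝ (fderiv ℝ c.h) s w v :=
  ((c.isGraphChart.contDiffOn.contDiffAt ((isOpen_openSquare _).mem_nhds hs)).isSymmSndFDerivAt
    (by rw [minSmoothness_of_isRCLikeNormedField]; norm_num)) v w

lemma contDiffOn_J : ContDiffOn ℝ 4 c.J (openSquare c.R) := by
  have h : ∀ v : ℝ × ℝ, ContDiffOn ℝ 4 (fun s => fderiv ℝ c.h s v) (openSquare c.R) := fun v =>
    c.contDiffOn_fderiv_h.clm_apply contDiffOn_const
  exact ContDiffOn.sqrt ((contDiffOn_const.add ((h (1, 0)).pow 2)).add ((h (0, 1)).pow 2))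
    fun s _ => by positivity

lemma hasFDerivAt_J {s : ℝ × ℝ} (hs : s ∈ openSquare c.R) :
    HasFDerivAt c.J (fderiv ℝ c.J s) s :=
  ((c.contDiffOn_J.contDiffAt ((isOpen_openSquare _).mem_nhds hs)).differentiableAt
    (by norm_num)).hasFDerivAt

lemma J_mul_fderiv_J {s : ℝ × ℝ} (hs : s ∈ openSquare c.R) (v : ℝ × ℝ) :
    c.J s * fderiv ℝ c.J s v =
      fderiv ℝ c.h s (1, 0) * fderiv ℝ (fderiv ℝ c.h) s v (1, 0) +
        fderiv ℝ c.h s (0, 1) * fderiv ℝ (fderiv ℝ c.h) s v (0, 1) := by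
  have hw : ∀ w : ℝ × ℝ, HasFDerivAt (fun s => fderiv ℝ c.h s w)
      ((fderiv ℝ (fderiv ℝ c.h) s).flip w) s := fun w =>
    by simpa using (c.hasFDerivAt_fderiv_h hs).clm_apply (hasFDerivAt_const w s)
  have h1 := (c.hasFDerivAt_J hs).pow 2
  have h2 := (((hw (1, 0)).pow 2).const_add 1).add ((hw (0, 1)).pow 2)
  have h3 := h1.unique (h2.congr_of_eventuallyEq (Eventually.of_forall fun z => areaDensity_sq _))
  have h4 := congrArg (fun L => L v) h3
  simp at h4
  linarith

lemma contDiffOn_chartDeriv (v : ℝ × ℝ) :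
    ContDiffOn ℝ 4 (fun s => chartDeriv c.b c.h s v) (openSquare c.R) := by
  simp only [chartDeriv_apply]
  exact (frame c.b).contDiff.comp_contDiffOn
    (contDiffOn_const.prodMk (c.contDiffOn_fderiv_h.clm_apply contDiffOn_const))

lemma hasFDerivAt_chartDeriv {s : ℝ × ℝ} (hs : s ∈ openSquare c.R) (v : ℝ × ℝ) :
    HasFDerivAt (fun s => chartDeriv c.b c.h s v)
      ((frame c.b : (ℝ × ℝ) × ℝ →L[ℝ] E3).comp
        ((0 : ℝ × ℝ →L[ℝ] ℝ × ℝ).prod ((fderiv ℝ (fderiv ℝ c.h) s).flip v))) s := by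
  simp only [chartDeriv_apply]
  have h1 : HasFDerivAt (fun s => fderiv ℝ c.h s v) ((fderiv ℝ (fderiv ℝ c.h) s).flip v) s := by
    simpa using (c.hasFDerivAt_fderiv_h hs).clm_apply (hasFDerivAt_const v s)
  exact (frame c.b).hasFDerivAt.comp s ((hasFDerivAt_const v s).prodMk h1)

/-- The surface divergence of the field `φ ∂_v χ` is `J⁻¹ ∂_v (J φ)`. -/
lemma sum_tangential_divergence (hΓ : IsClosedSurface Γ n) {s : ℝ × ℝ} (hs : s ∈ openSquare c.R)
    {φ ζ : ℝ × ℝ → ℝ} {Dφ Dζ : ℝ × ℝ →L[ℝ] ℝ} (hφ : HasFDerivAt φ Dφ s)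
    (hζ : HasFDerivAt ζ Dζ s) (hφζ : ∀ᶠ z in 𝓝 s, φ z * c.J z = ζ z) (v : ℝ × ℝ)
    {L : ℝ × ℝ →L[ℝ] E3} (hL : HasFDerivAt (fun z => φ z • chartDeriv c.b c.h z v) L s) :
    c.J s * ∑ i, (L (coordCLM c.b (P n (c.χ s) (EuclideanSpace.single i 1)))) i = Dζ v := by
  have hLw : ∀ w, L w = Dφ w • chartDeriv c.b c.h s v +
      φ s • frame c.b (0, fderiv ℝ (fderiv ℝ c.h) s w v) := by
    intro w
    have h1 := hL.unique (hφ.smul (c.hasFDerivAt_chartDeriv hs v))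
    rw [h1, add_comm]
    rfl
  have h0 := c.isGraphChart.inner_normal_chartDeriv hΓ hs
  set N := n (c.χ s) with hN
  have h0' : ∀ w, ⟪N, frame c.b (w, fderiv ℝ c.h s w)⟫ = 0 := h0
  have hNn : ⟪N, N⟫ = 1 := by
    rw [real_inner_self_eq_norm_sq, hΓ.norm_normal (c.χ_mem hs), one_pow]
  have hA0 : ⟪N, c.b 0⟫ = -(fderiv ℝ c.h s (1, 0) * ⟪N, c.b 2⟫) := by
    have := h0' (1, 0)
    rw [inner_frame] at this
    simp only [one_mul, zero_mul, add_zero] at this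
    linarith
  have hA1 : ⟪N, c.b 1⟫ = -(fderiv ℝ c.h s (0, 1) * ⟪N, c.b 2⟫) := by
    have := h0' (0, 1)
    rw [inner_frame] at this
    simp only [one_mul, zero_mul, zero_add] at this
    linarith
  set A := ⟪N, c.b 2⟫ with hA
  set p := fderiv ℝ c.h s (1, 0) with hp
  set q := fderiv ℝ c.h s (0, 1) with hq
  have hJ2 : c.J s ^ 2 = 1 + p ^ 2 + q ^ 2 := areaDensity_sq _
  -- `A² = J⁻²`, as `n` has unit length
  have hAJ : A ^ 2 * c.J s ^ 2 = 1 := by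
    rw [inner_eq_sum_three c.b, real_inner_comm N (c.b 0), real_inner_comm N (c.b 1),
      real_inner_comm N (c.b 2), hA0, hA1] at hNn
    rw [hJ2]
    nlinarith
  have hJD := c.J_mul_fderiv_J hs v
  rw [c.fderiv_fderiv_h_symm hs v (1, 0), c.fderiv_fderiv_h_symm hs v (0, 1)] at hJD
  have hζ' : Dζ v = Dφ v * c.J s + φ s * fderiv ℝ c.J s v := by
    have h1 := hζ.unique ((hφ.mul (c.hasFDerivAt_J hs)).congr_of_eventuallyEq
      (hφζ.mono fun z hz => hz.symm))
    rw [h1]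
    simp
    ring
  have hb : ∀ i j, ⟪c.b i, c.b j⟫ = if i = j then (1 : ℝ) else 0 := c.b.inner_eq_ite
  have hNL : ∀ w, ⟪N, L w⟫ = φ s * (fderiv ℝ (fderiv ℝ c.h) s w v * A) := by
    intro w
    rw [hLw, inner_add_right, real_inner_smul_right, real_inner_smul_right, chartDeriv_apply,
      h0' v, inner_frame]
    simp [hA]
  have hbL0 : ⟪c.b 0, L (1, 0)⟫ = Dφ (1, 0) * v.1 := by
    rw [hLw, inner_add_right, real_inner_smul_right, real_inner_smul_right, chartDeriv_apply,
      inner_frame, inner_frame]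
    simp [hb]
  have hbL1 : ⟪c.b 1, L (0, 1)⟫ = Dφ (0, 1) * v.2 := by
    rw [hLw, inner_add_right, real_inner_smul_right, real_inner_smul_right, chartDeriv_apply,
      inner_frame, inner_frame]
    simp [hb]
  rw [sum_clm_coord_P, inner_P_left_eq, inner_P_left_eq, hNL, hNL, hbL0, hbL1, hA0, hA1, hζ',
    clm_prod_apply Dφ v]
  have hJ := (c.J_pos s).ne'
  have e : c.J s * (Dφ (1, 0) * v.1 - -(p * A) * (φ s * (fderiv ℝ (fderiv ℝ c.h) s (1, 0) v * A)) +
      (Dφ (0, 1) * v.2 - -(q * A) * (φ s * (fderiv ℝ (fderiv ℝ c.h) s (0, 1) v * A)))) =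
      c.J s * (Dφ (1, 0) * v.1 + Dφ (0, 1) * v.2) + A ^ 2 * c.J s * φ s *
        (p * fderiv ℝ (fderiv ℝ c.h) s (1, 0) v + q * fderiv ℝ (fderiv ℝ c.h) s (0, 1) v) := by
    ring
  rw [e, ← hJD]
  linear_combination φ s * fderiv ℝ c.J s v * hAJ

/-- A function on the surface supported in a patch, given in coordinates. -/
def lift (f : ℝ × ℝ → ℝ) : E3 → ℝ := c.U.indicator fun x => f (coord c.b c.y₀ x)

lemma lift_of_mem {f : ℝ × ℝ → ℝ} {x : E3} (hx : x ∈ c.U) :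
    c.lift f x = f (coord c.b c.y₀ x) := indicator_of_mem hx _

lemma lift_eventuallyEq_zero {f : ℝ × ℝ → ℝ} (hf : HasCompactSupport f)
    (hfO : tsupport f ⊆ openSquare c.R) {x : E3} (hx : x ∉ c.U) :
    ∀ᶠ z in 𝓝 x, z ∈ Γ → c.lift f z = 0 := by
  have hK : IsCompact (c.χ '' tsupport f) :=
    hf.isCompact.image_of_continuousOn (c.contDiffOn_χ.continuousOn.mono hfO)
  have hxK : x ∉ c.χ '' tsupport f := by
    rintro ⟨s, hs, rfl⟩
    exact hx (c.isGraphChart.chart_mem s (hfO hs)).2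
  filter_upwards [hK.isClosed.isOpen_compl.mem_nhds hxK] with z hz hzΓ
  by_cases hzU : z ∈ c.U
  · rw [c.lift_of_mem hzU]
    by_contra hne
    exact hz ⟨_, subset_tsupport _ hne, c.isGraphChart.chart_coord z ⟨hzΓ, hzU⟩⟩
  · exact indicator_of_notMem hzU _

lemma hasFDerivWithinAt_lift {f : ℝ × ℝ → ℝ} (hf : ContDiff ℝ 1 f) {x : E3} (hx : x ∈ c.U) :
    HasFDerivWithinAt (c.lift f) ((fderiv ℝ f (coord c.b c.y₀ x)).comp (coordCLM c.b)) Γ x := by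
  have h1 := ((hf.differentiable (by norm_num)) (coord c.b c.y₀ x)).hasFDerivAt.comp x
    (hasFDerivAt_coord c.b c.y₀ x)
  refine (h1.congr_of_eventuallyEq ?_).hasFDerivWithinAt
  filter_upwards [c.isGraphChart.isOpen.mem_nhds hx] with z hz
  exact c.lift_of_mem hz

lemma contDiffOn_lift {f : ℝ × ℝ → ℝ} (hf : ContDiff ℝ 1 f) (hfc : HasCompactSupport f)
    (hfO : tsupport f ⊆ openSquare c.R) : ContDiffOn ℝ 1 (c.lift f) Γ := by
  intro x hxΓ
  by_cases hx : x ∈ c.U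
  · have h1 : ContDiffAt ℝ 1 (fun z => f (coord c.b c.y₀ z)) x :=
      (hf.comp (contDiff_coord c.b c.y₀)).contDiffAt
    refine (h1.congr_of_eventuallyEq ?_).contDiffWithinAt
    filter_upwards [c.isGraphChart.isOpen.mem_nhds hx] with z hz
    exact c.lift_of_mem hz
  · have h0 := c.lift_eventuallyEq_zero hfc hfO hx
    refine (contDiffWithinAt_const (c := (0 : ℝ))).congr_of_eventuallyEq ?_ (h0.self_of_nhds hxΓ)
    filter_upwards [mem_nhdsWithin_of_mem_nhds h0, self_mem_nhdsWithin] with z hz hzΓ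
    exact hz hzΓ

lemma tanGrad_lift_of_notMem (hΓ : IsClosedSurface Γ n) {f : ℝ × ℝ → ℝ}
    (hfc : HasCompactSupport f) (hfO : tsupport f ⊆ openSquare c.R) {x : E3} (hxΓ : x ∈ Γ)
    (hx : x ∉ c.U) (i : Fin 3) : tanGrad Γ n (c.lift f) x i = 0 := by
  have h0 := c.lift_eventuallyEq_zero hfc hfO hx
  have h1 : HasFDerivWithinAt (c.lift f) (0 : E3 →L[ℝ] ℝ) Γ x := by
    refine (hasFDerivWithinAt_const (0 : ℝ) x Γ).congr_of_eventuallyEq ?_ (h0.self_of_nhds hxΓ)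
    filter_upwards [mem_nhdsWithin_of_mem_nhds h0, self_mem_nhdsWithin] with z hz hzΓ
    exact hz hzΓ
  rw [tanGrad_apply hΓ hxΓ h1]
  rfl

end GraphPatch

lemma IsClosedSurface.continuousOn_H (hΓ : IsClosedSurface Γ n) : ContinuousOn (H Γ n) Γ := by
  obtain ⟨δ, hδ⟩ := hΓ.exists_isTubularRadius
  have hN : ContinuousOn (fderiv ℝ (ext Γ n)) Γ :=
    ((contDiffOn_ext hΓ hδ hΓ.contDiffOn_normal).fderiv_of_isOpen (m := 3) (isOpen_tube hΓ hδ)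
      (by norm_num)).continuousOn.mono (subset_tube hδ.1)
  have hn := hΓ.contDiffOn_normal.continuousOn
  have hP : ∀ a : E3, ContinuousOn (fun y => P n y a) Γ := fun a => by
    have h : ContinuousOn (fun y => (inner ℝ (n y) a : ℝ)) Γ := hn.inner continuousOn_const
    exact continuousOn_const.sub (h.smul hn)
  have h : ∀ y ∈ Γ, H Γ n y =
      ∑ i, -(fderiv ℝ (ext Γ n) y (P n y (EuclideanSpace.single i 1))) i := by
    intro y hy
    rw [H, Matrix.trace]
    refine Finset.sum_congr rfl fun i _ => ?_
    exact W_apply hΓ hy (hasFDerivWithinAt_of_ext hΓ hδ hΓ.contDiffOn_normal hy) i i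
  refine ContinuousOn.congr ?_ h
  refine continuousOn_finsetSum _ fun i _ => ContinuousOn.neg ?_
  exact (EuclideanSpace.proj i : E3 →L[ℝ] ℝ).continuous.comp_continuousOn (hN.clm_apply (hP _))

lemma integrable_mul_of_continuousOn {O K : Set (ℝ × ℝ)} (hO : IsOpen O) (hK : IsCompact K)
    (hOf : volume O ≠ ⊤) {g f : ℝ × ℝ → ℝ} (hg : MemLp g 2 (volume.restrict O))
    (hf : ContinuousOn f O) (hKO : K ⊆ O) (hf0 : ∀ s ∈ O, s ∉ K → f s = 0) :
    Integrable (fun s => g s * f s) (volume.restrict O) := by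
  obtain ⟨C, hC⟩ := hK.exists_bound_of_continuousOn (hf.mono hKO)
  have : IsFiniteMeasure (volume.restrict O) := ⟨by
    rw [Measure.restrict_apply_univ]; exact hOf.lt_top⟩
  have hgi : Integrable g (volume.restrict O) := hg.integrable (by norm_num)
  refine hgi.mul_bdd (c := max C 0) (hf.aestronglyMeasurable hO.measurableSet) ?_
  filter_upwards [ae_restrict_mem hO.measurableSet] with s hs
  by_cases hsK : s ∈ K
  · exact (hC s hsK).trans (le_max_left _ _)
  · rw [hf0 s hs hsK, norm_zero]
    exact le_max_right _ _

end ChartDivergence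

/-! ### Sobolev functions on the surface in coordinates -/

section WeakPullback

variable {Γ : Set E3} {n : E3 → E3} {δ : ℝ}

lemma MemH1Surf.weakTanDeriv_spec {η : E3 → ℝ} (h : MemH1Surf Γ n η) (i : Fin 3) :
    MemLp (weakTanDeriv Γ n i η) 2 (surf Γ) ∧ HasWeakTanDeriv Γ n i η (weakTanDeriv Γ n i η) := by
  have := h.2 i
  rw [weakTanDeriv, dif_pos this]
  exact this.choose_spec

lemma volume_openSquare_ne_top (R : ℝ) : volume (openSquare R) ≠ ⊤ := by
  refine ne_top_of_le_ne_top (isCompact_square R).measure_lt_top.ne (measure_mono ?_)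
  exact prod_mono Ioo_subset_Icc_self Ioo_subset_Icc_self

namespace GraphPatch

variable (c : GraphPatch Γ)

lemma memLp_comp_χ (hΓ : IsClosedSurface Γ n) {η : E3 → ℝ} (hη : MemLp η 2 (surf Γ)) :
    MemLp (fun s => η (c.χ s)) 2 (volume.restrict (openSquare c.R)) := by
  obtain ⟨k, hk, h⟩ := c.exists_eLpNorm_comp_χ_le hΓ
  exact ⟨c.aestronglyMeasurable_comp_χ hΓ hη.1,
    (h η hη.1).trans_lt (ENNReal.mul_lt_top hk.lt_top hη.2)⟩

/-- The coordinate expression of an `H¹` function on the surface is weakly differentiable, by the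
chain rule.  The weak tangential derivatives are tested with the field `(ζ / J) ∂_v χ`. -/
theorem hasWeakLineDeriv_comp_χ (hΓ : IsClosedSurface Γ n) {η : E3 → ℝ} (hη : MemH1Surf Γ n η)
    (v : ℝ × ℝ) :
    HasWeakLineDeriv (openSquare c.R) v (fun s => η (c.χ s))
      (fun s => ∑ i, weakTanDeriv Γ n i η (c.χ s) * chartDeriv c.b c.h s v i) := by
  intro ζ hζ hζc hζO
  have hO := isOpen_openSquare c.R
  set O := openSquare c.R with hOdef
  set φ : ℝ × ℝ → ℝ := fun s => ζ s * (c.J s)⁻¹ with hφdef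
  set F : ℝ × ℝ → E3 := fun s => φ s • chartDeriv c.b c.h s v with hF
  have hζ1 : ContDiff ℝ 1 ζ := hζ.of_le (by norm_cast)
  have hφs : ContDiffOn ℝ 1 φ O := hζ1.contDiffOn.mul
    ((c.contDiffOn_J.of_le (by norm_num)).inv fun s _ => (c.J_pos s).ne')
  have hFs : ContDiffOn ℝ 1 F O :=
    hφs.smul ((c.contDiffOn_chartDeriv v).of_le (by norm_num))
  have hFsup : tsupport F ⊆ tsupport ζ := by
    refine closure_mono fun s hs => ?_
    rw [Function.mem_support] at hs ⊢
    contrapose! hs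
    simp [hF, hφdef, hs]
  have hF1 : ContDiff ℝ 1 F := contDiff_iff_contDiffAt.2 fun s => by
    by_cases hs : s ∈ tsupport F
    · exact hFs.contDiffAt (hO.mem_nhds (hζO (hFsup hs)))
    · exact (contDiffAt_const (c := (0 : E3))).congr_of_eventuallyEq
        (notMem_tsupport_iff_eventuallyEq.1 hs)
  have hfi : ∀ i, ContDiff ℝ 1 fun s => F s i := fun i => contDiff_euclidean.1 hF1 i
  have hfisup : ∀ i, tsupport (fun s => F s i) ⊆ tsupport ζ := fun i => by
    refine (closure_mono fun s hs => ?_).trans hFsup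
    rw [Function.mem_support] at hs ⊢
    contrapose! hs
    simp [hs]
  have hfic : ∀ i, HasCompactSupport fun s => F s i := fun i =>
    hζc.of_isClosed_subset (isClosed_tsupport _) (hfisup i)
  have hfiO : ∀ i, tsupport (fun s => F s i) ⊆ O := fun i => (hfisup i).trans hζO
  have hFd : ∀ s, HasFDerivAt F (fderiv ℝ F s) s := fun s =>
    ((hF1.differentiable (by norm_num)) s).hasFDerivAt
  have hfid : ∀ i s w, fderiv ℝ (fun s => F s i) s w = (fderiv ℝ F s w) i := by
    intro i s w
    have := ((EuclideanSpace.proj i : E3 →L[ℝ] ℝ).hasFDerivAt.comp s (hFd s)).fderiv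
    exact congrArg (fun L => L w) this
  have hn := c.contDiffOn_normal_χ hΓ
  have hH : ContinuousOn (fun s => H Γ n (c.χ s)) O :=
    hΓ.continuousOn_H.comp c.contDiffOn_χ.continuousOn fun s hs => c.χ_mem hs
  have hni : ∀ i, ContinuousOn (fun s => n (c.χ s) i) O := fun i =>
    (EuclideanSpace.proj i : E3 →L[ℝ] ℝ).continuous.comp_continuousOn hn.continuousOn
  -- the integrand on the right-hand side of the definition of the weak derivative
  set G : Fin 3 → ℝ × ℝ → ℝ := fun i s =>
    (fderiv ℝ F s (coordCLM c.b (P n (c.χ s) (EuclideanSpace.single i 1)))) i +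
      F s i * H Γ n (c.χ s) * n (c.χ s) i with hG
  have hP : ∀ a : E3, ContinuousOn (fun s => P n (c.χ s) a) O := fun a => by
    have h : ContinuousOn (fun s => (inner ℝ (n (c.χ s)) a : ℝ)) O :=
      hn.continuousOn.inner continuousOn_const
    exact continuousOn_const.sub (h.smul hn.continuousOn)
  have hGc : ∀ i, ContinuousOn (G i) O := by
    intro i
    refine ContinuousOn.add ?_ (((hfi i).continuous.continuousOn.mul hH).mul (hni i))
    exact (EuclideanSpace.proj i : E3 →L[ℝ] ℝ).continuous.comp_continuousOn
      ((hF1.continuous_fderiv (by norm_num)).continuousOn.clm_apply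
        ((coordCLM c.b).continuous.comp_continuousOn (hP _)))
  have hG0 : ∀ i, ∀ s, s ∉ tsupport ζ → G i s = 0 := by
    intro i s hs
    have h1 : s ∉ tsupport F := fun h => hs (hFsup h)
    have h2 : fderiv ℝ F s = 0 := by
      by_contra h
      exact h1 (support_fderiv_subset ℝ h)
    simp [hG, h2, image_eq_zero_of_notMem_tsupport h1]
  obtain ⟨k, hk0, hk⟩ := c.exists_integral_surf hΓ
  have hweak : ∀ i, ∫ s in O, c.J s * (weakTanDeriv Γ n i η (c.χ s) * F s i) =
      -∫ s in O, c.J s * (η (c.χ s) * G i s) := by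
    intro i
    have h1 := (hη.weakTanDeriv_spec i).2 (c.lift fun s => F s i)
      (c.contDiffOn_lift (hfi i) (hfic i) (hfiO i))
    have hm : Measurable (O.indicator (G i)) := by
      classical
      have := (hGc i).measurable_piecewise (continuousOn_const (c := (0 : ℝ))) hO.measurableSet
      rwa [show (fun _ : ℝ × ℝ => (0 : ℝ)) = 0 from rfl, piecewise_eq_indicator] at this
    rw [hk (weakTanDeriv Γ n i η) (c.lift fun s => F s i) (fun s => F s i)
        (hη.weakTanDeriv_spec i).1.1 (hfi i).continuous.measurable
        (fun x hx => c.lift_of_mem hx.2) (fun x hx => indicator_of_notMem hx.2 _),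
      hk η (fun y => tanGrad Γ n (c.lift fun s => F s i) y i +
          c.lift (fun s => F s i) y * H Γ n y * n y i) (O.indicator (G i)) hη.1.1 hm
        (fun x hx => ?_) (fun x hx => ?_)] at h1
    · have h2 : ∫ s in O, c.J s * (η (c.χ s) * O.indicator (G i) s) =
          ∫ s in O, c.J s * (η (c.χ s) * G i s) :=
        setIntegral_congr_fun hO.measurableSet fun s hs => by simp only [indicator_of_mem hs]
      rw [h2, ← mul_neg] at h1
      exact mul_left_cancel₀ hk0 h1
    · have hm := c.isGraphChart.coord_mem x hx
      have hc : c.χ (coord c.b c.y₀ x) = x := c.isGraphChart.chart_coord x hx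
      rw [indicator_of_mem hm, tanGrad_apply hΓ hx.1 (c.hasFDerivWithinAt_lift (hfi i) hx.2),
        c.lift_of_mem hx.2]
      simp only [hG, hc, ContinuousLinearMap.comp_apply, hfid]
    · rw [c.tanGrad_lift_of_notMem hΓ (hfic i) (hfiO i) hx.1 hx.2]
      simp [lift, indicator_of_notMem hx.2]
  have hvol := volume_openSquare_ne_top c.R
  have hJc := c.contDiffOn_J.continuousOn
  have hint1 : ∀ i, Integrable (fun s => c.J s * (weakTanDeriv Γ n i η (c.χ s) * F s i))
      (volume.restrict O) := by
    intro i
    refine (integrable_mul_of_continuousOn hO hζc hvol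
      (c.memLp_comp_χ hΓ (hη.weakTanDeriv_spec i).1) (f := fun s => c.J s * F s i)
      (hJc.mul (hfi i).continuous.continuousOn) hζO fun s _ hs => ?_).congr
      (Eventually.of_forall fun s => by ring)
    simp [image_eq_zero_of_notMem_tsupport fun h => hs (hfisup i h)]
  have hint2 : ∀ i, Integrable (fun s => c.J s * (η (c.χ s) * G i s)) (volume.restrict O) := by
    intro i
    refine (integrable_mul_of_continuousOn hO hζc hvol
      (c.memLp_comp_χ hΓ hη.1) (f := fun s => c.J s * G i s)
      (hJc.mul (hGc i)) hζO fun s _ hs => ?_).congr (Eventually.of_forall fun s => by ring)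
    simp [hG0 i s hs]
  have hsum : ∑ i, ∫ s in O, c.J s * (weakTanDeriv Γ n i η (c.χ s) * F s i) =
      -∑ i, ∫ s in O, c.J s * (η (c.χ s) * G i s) := by
    rw [← Finset.sum_neg_distrib]
    exact Finset.sum_congr rfl fun i _ => hweak i
  rw [← integral_finsetSum _ fun i _ => hint1 i, ← integral_finsetSum _ fun i _ => hint2 i] at hsum
  have e1 : ∫ s in O, ∑ i, c.J s * (weakTanDeriv Γ n i η (c.χ s) * F s i) =
      ∫ s in O, (∑ i, weakTanDeriv Γ n i η (c.χ s) * chartDeriv c.b c.h s v i) * ζ s := by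
    refine setIntegral_congr_fun hO.measurableSet fun s hs => ?_
    simp only
    rw [Finset.sum_mul]
    refine Finset.sum_congr rfl fun i _ => ?_
    have := (c.J_pos s).ne'
    simp only [hF, hφdef, PiLp.smul_apply, smul_eq_mul]
    field_simp
  have e2 : ∫ s in O, ∑ i, c.J s * (η (c.χ s) * G i s) =
      ∫ s in O, η (c.χ s) * fderiv ℝ ζ s v := by
    refine setIntegral_congr_fun hO.measurableSet fun s hs => ?_
    have hd := c.sum_tangential_divergence hΓ hs
      (((hφs.contDiffAt (hO.mem_nhds hs)).differentiableAt (by norm_num)).hasFDerivAt)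
      ((hζ1.differentiable (by norm_num)) s).hasFDerivAt
      (Eventually.of_forall fun z => by
        have := (c.J_pos z).ne'
        simp only [hφdef]; field_simp) v (hFd s)
    -- the field is tangential, so that the curvature term vanishes
    have ht : ∑ i, F s i * n (c.χ s) i = 0 := by
      have h0 : ⟪n (c.χ s), chartDeriv c.b c.h s v⟫ = 0 :=
        c.isGraphChart.inner_normal_chartDeriv hΓ hs v
      have h1 : ⟪n (c.χ s), F s⟫ = 0 := by
        simp only [hF]
        rw [real_inner_smul_right, h0, mul_zero]
      rw [PiLp.inner_apply] at h1
      simpa using h1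
    rw [← hd]
    calc ∑ i, c.J s * (η (c.χ s) * G i s) = η (c.χ s) * (c.J s *
          ∑ i, (fderiv ℝ F s (coordCLM c.b (P n (c.χ s) (EuclideanSpace.single i 1)))) i) +
          η (c.χ s) * c.J s * H Γ n (c.χ s) * ∑ i, F s i * n (c.χ s) i := by
          simp only [hG, Finset.mul_sum, ← Finset.sum_add_distrib]
          refine Finset.sum_congr rfl fun i _ => ?_
          ring
      _ = _ := by rw [ht, mul_zero, add_zero]
  rw [e1, e2] at hsum
  linarith

end GraphPatch

end WeakPullback

/-! ### The product estimate for functions on the surface -/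

section SurfaceProduct

variable {Γ : Set E3} {n : E3 → E3} {g₀ g₁ : E3 → ℝ} {δ δ₀ a ε τ β : ℝ}

lemma HasWeakLineDeriv.mono {E : Type*} [NormedAddCommGroup E] [NormedSpace ℝ E] [MeasureSpace E]
    {O O' : Set E} (hO' : O' ⊆ O) {v : E} {φ ψ : E → ℝ}
    (h : HasWeakLineDeriv O v φ ψ) : HasWeakLineDeriv O' v φ ψ := by
  intro ζ hζ hζc hζO
  have h1 := h ζ hζ hζc (hζO.trans hO')
  have h2 : ∀ x, x ∉ O' → ζ x = 0 := fun x hx =>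
    image_eq_zero_of_notMem_tsupport fun h => hx (hζO h)
  have h3 : ∀ x, x ∉ O' → fderiv ℝ ζ x = 0 := fun x hx => by
    by_contra hne
    exact hx (hζO (support_fderiv_subset ℝ hne))
  have h4 : ∀ u : E → ℝ, (∀ x, x ∉ O' → u x = 0) → ∫ x in O', u x = ∫ x in O, u x := fun u hu => by
    rw [setIntegral_eq_integral_of_forall_compl_eq_zero hu,
      setIntegral_eq_integral_of_forall_compl_eq_zero fun x hx => hu x fun h => hx (hO' h)]
  rw [h4 _ fun x hx => by simp [h3 x hx], h4 _ fun x hx => by simp [h2 x hx], h1]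

lemma enorm_clm_prod_le (L : ℝ × ℝ →L[ℝ] ℝ) :
    ‖L‖ₑ ≤ ∑ i : Fin 2, ‖L ((![(1, 0), (0, 1)] : Fin 2 → ℝ × ℝ) i)‖ₑ := by
  have h : ‖L‖ ≤ ‖L (1, 0)‖ + ‖L (0, 1)‖ := by
    refine ContinuousLinearMap.opNorm_le_bound _ (by positivity) fun x => ?_
    rw [clm_prod_apply L x, add_mul]
    refine (norm_add_le _ _).trans (add_le_add ?_ ?_)
    · rw [norm_mul, mul_comm]
      exact mul_le_mul_of_nonneg_left (norm_fst_le x) (norm_nonneg _)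
    · rw [norm_mul, mul_comm]
      exact mul_le_mul_of_nonneg_left (norm_snd_le x) (norm_nonneg _)
  rw [Fin.sum_univ_two]
  simp only [Matrix.cons_val_zero, Matrix.cons_val_one]
  rw [← ofReal_norm, ← ofReal_norm, ← ofReal_norm, ← ENNReal.ofReal_add (norm_nonneg _)
    (norm_nonneg _)]
  exact ENNReal.ofReal_le_ofReal h

lemma L2Surf_weakTanDeriv_le (η : E3 → ℝ) (i : Fin 3) :
    L2Surf Γ (weakTanDeriv Γ n i η) ≤ H1Surf Γ n η :=
  le_rpow_half_of_sq_le ((Finset.single_le_sum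
    (f := fun i => L2Surf Γ (weakTanDeriv Γ n i η) ^ 2)
    (fun _ _ => zero_le) (Finset.mem_univ i)).trans le_add_self)

lemma L2Surf_le_H1Surf (η : E3 → ℝ) : L2Surf Γ η ≤ H1Surf Γ n η :=
  le_rpow_half_of_sq_le le_self_add

lemma openSquare_mono {ρ R : ℝ} (h : ρ ≤ R) : openSquare ρ ⊆ openSquare R :=
  prod_mono (Ioo_subset_Ioo (by linarith) h) (Ioo_subset_Ioo (by linarith) h)

/-- The coordinate derivatives of an `H¹` function on the surface are bounded in `L²` on a smaller
square. -/
lemma GraphPatch.exists_eLpNorm_deriv_le (c : GraphPatch Γ) (hΓ : IsClosedSurface Γ n)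
    {ρ : ℝ} (hρ : ρ < c.R) (v : ℝ × ℝ) : ∃ k : ℝ≥0∞, k ≠ ⊤ ∧ ∀ η, MemH1Surf Γ n η →
      MemLp (fun s => ∑ i, weakTanDeriv Γ n i η (c.χ s) * chartDeriv c.b c.h s v i) 2
        (volume.restrict (openSquare ρ)) ∧
      eLpNorm (fun s => ∑ i, weakTanDeriv Γ n i η (c.χ s) * chartDeriv c.b c.h s v i) 2
        (volume.restrict (openSquare ρ)) ≤ k * H1Surf Γ n η := by
  obtain ⟨k, hk, hkη⟩ := c.exists_eLpNorm_comp_χ_le hΓ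
  have hsub : openSquare ρ ⊆ openSquare c.R := openSquare_mono hρ.le
  have hcont := (c.contDiffOn_chartDeriv v).continuousOn
  obtain ⟨M, hM⟩ := (isCompact_square ρ).exists_bound_of_continuousOn
    (hcont.mono (square_subset_openSquare hρ))
  have hle : volume.restrict (openSquare ρ) ≤ volume.restrict (openSquare c.R) :=
    Measure.restrict_mono hsub le_rfl
  have hm : MeasurableSet (openSquare ρ) := (isOpen_openSquare ρ).measurableSet
  have hci : ∀ i, AEStronglyMeasurable (fun s => chartDeriv c.b c.h s v i)
      (volume.restrict (openSquare ρ)) := fun i =>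
    ((EuclideanSpace.proj i : E3 →L[ℝ] ℝ).continuous.comp_continuousOn
      (hcont.mono hsub)).aestronglyMeasurable hm
  have hterm : ∀ η, MemH1Surf Γ n η → ∀ i,
      AEStronglyMeasurable (fun s => weakTanDeriv Γ n i η (c.χ s) * chartDeriv c.b c.h s v i)
        (volume.restrict (openSquare ρ)) ∧
      eLpNorm (fun s => weakTanDeriv Γ n i η (c.χ s) * chartDeriv c.b c.h s v i) 2
        (volume.restrict (openSquare ρ)) ≤ ENNReal.ofReal M * (k * H1Surf Γ n η) := by
    intro η hη i
    have hmem := hη.weakTanDeriv_spec i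
    have hmeas := (c.aestronglyMeasurable_comp_χ hΓ hmem.1.1).mono_measure hle
    refine ⟨hmeas.mul (hci i), ?_⟩
    refine (eLpNorm_le_mul_eLpNorm_of_ae_le_mul (c := M)
      (g := fun s => weakTanDeriv Γ n i η (c.χ s)) ?_ 2).trans ?_
    · filter_upwards [ae_restrict_mem hm] with s hs
      rw [norm_mul, mul_comm]
      gcongr
      exact (PiLp.norm_apply_le _ i).trans (hM s
        ⟨Ioo_subset_Icc_self hs.1, Ioo_subset_Icc_self hs.2⟩)
    · gcongr
      exact (eLpNorm_mono_measure _ hle).trans ((hkη _ hmem.1.1).trans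
        (mul_le_mul_right (L2Surf_weakTanDeriv_le η i) _))
  refine ⟨∑ _i : Fin 3, ENNReal.ofReal M * k, ENNReal.sum_ne_top.2 fun _ _ =>
    ENNReal.mul_ne_top ENNReal.ofReal_ne_top hk, fun η hη => ⟨?_, ?_⟩⟩
  · refine memLp_finsetSum _ fun i _ => ⟨(hterm η hη i).1, (hterm η hη i).2.trans_lt ?_⟩
    refine ENNReal.mul_lt_top ENNReal.ofReal_lt_top (ENNReal.mul_lt_top hk.lt_top ?_)
    refine ENNReal.rpow_lt_top_of_nonneg (by norm_num) (ENNReal.add_ne_top.2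
      ⟨ENNReal.pow_ne_top hη.1.2.ne, ENNReal.sum_ne_top.2 fun j _ =>
        ENNReal.pow_ne_top (hη.weakTanDeriv_spec j).1.2.ne⟩)
  · calc _ ≤ ∑ i, eLpNorm (fun s => weakTanDeriv Γ n i η (c.χ s) * chartDeriv c.b c.h s v i) 2
          (volume.restrict (openSquare ρ)) := by
          have := eLpNorm_sum_le (s := Finset.univ) (p := 2) (μ := volume.restrict (openSquare ρ))
            (f := fun i s => weakTanDeriv Γ n i η (c.χ s) * chartDeriv c.b c.h s v i)
            (fun i _ => (hterm η hη i).1) (by norm_num)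
          convert this using 2
          ext s
          simp
      _ ≤ ∑ _i : Fin 3, ENNReal.ofReal M * (k * H1Surf Γ n η) :=
          Finset.sum_le_sum fun i _ => (hterm η hη i).2
      _ = _ := by
          rw [Finset.sum_mul]
          exact Finset.sum_congr rfl fun i _ => by ring

/-- The two-dimensional product estimate, with one factor an `H¹` function on the surface. -/
lemma GraphPatch.exists_lintegral_comp_χ_sq_mul_sq_le (c : GraphPatch Γ)
    (hΓ : IsClosedSurface Γ n) : ∃ C : ℝ≥0∞, C ≠ ⊤ ∧ ∀ η, MemH1Surf Γ n η →
      ∀ (b : ℝ × ℝ → ℝ) (b' : ℝ × ℝ → (ℝ × ℝ →L[ℝ] ℝ)), (∀ s ∈ c.Q, HasFDerivAt b (b' s) s) →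
        ContinuousOn b' c.Q →
      ∫⁻ s in c.Q, ‖η (c.χ s)‖ₑ ^ 2 * ‖b s‖ₑ ^ 2 ≤ C * (L2Surf Γ η * H1Surf Γ n η) *
        ∫⁻ s in c.Q, (ENNReal.ofReal (2 * (c.R / 2))⁻¹ * ‖b s‖ₑ ^ 2 + 2 * (‖b s‖ₑ * ‖b' s‖ₑ)) := by
  have hR := c.isGraphChart.pos
  -- the chart and its derivatives are bounded on the square of side `2ρ`, which still contains the
  -- square `c.Q` of side `R` in its interior
  set ρ := 3 * c.R / 4 with hρ
  have hρR : ρ < c.R := by rw [hρ]; linarith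
  set V : Fin 2 → ℝ × ℝ := ![(1, 0), (0, 1)] with hV
  obtain ⟨k₀, hk₀, hkη⟩ := c.exists_eLpNorm_comp_χ_le hΓ
  choose k hk hkd using fun j => c.exists_eLpNorm_deriv_le hΓ hρR (V j)
  set A := max (ENNReal.ofReal (2 * (c.R / 2))⁻¹) 2 with hA
  have hAt : A ≠ ⊤ := max_ne_top ENNReal.ofReal_ne_top (by simp)
  refine ⟨A * (k₀ * (k₀ + ∑ j, k j)), ENNReal.mul_ne_top hAt (ENNReal.mul_ne_top hk₀
    (ENNReal.add_ne_top.2 ⟨hk₀, ENNReal.sum_ne_top.2 fun j _ => hk j⟩)), fun η hη b b' hb hb' => ?_⟩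
  set O := openSquare ρ with hO
  have hOR : O ⊆ openSquare c.R := openSquare_mono hρR.le
  have hle : volume.restrict O ≤ volume.restrict (openSquare c.R) :=
    Measure.restrict_mono hOR le_rfl
  have hη2 : MemLp (fun s => η (c.χ s)) 2 (volume.restrict O) :=
    (c.memLp_comp_χ hΓ hη.1).mono_measure hle
  have hKρ : ∀ j : ℕ, ρ - c.R / 4 * (1 / ((j : ℝ) + 1)) < ρ := fun j => by
    have := one_div_nat_pos j
    nlinarith
  obtain ⟨f, hf, -, -, hfae, B, hB, hBt⟩ := CTD.exists_smooth_seq (isOpen_openSquare ρ)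
    enorm_clm_prod_le hη2 (fun j => (hkd j η hη).1)
    (fun j => (c.hasWeakLineDeriv_comp_χ hΓ hη (V j)).mono hOR)
    (K := fun j : ℕ => square (ρ - c.R / 4 * (1 / ((j : ℝ) + 1))))
    (fun j => isCompact_square _) (fun j => square_subset_openSquare (hKρ j)) (by
      intro x hx
      have h := (tendsto_one_div_add_atTop_nhds_zero_nat (𝕜 := ℝ)).const_mul (c.R / 4)
      have h2 := (tendsto_const_nhds (x := ρ)).sub h
      rw [mul_zero, sub_zero] at h2
      filter_upwards [h2.eventually (lt_mem_nhds (abs_lt.2 hx.1)),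
        h2.eventually (lt_mem_nhds (abs_lt.2 hx.2))] with j h3 h4
      exact ⟨abs_le.1 h3.le, abs_le.1 h4.le⟩)
  set D := ∫⁻ s in c.Q, (ENNReal.ofReal (2 * (c.R / 2))⁻¹ * ‖b s‖ₑ ^ 2 + 2 * (‖b s‖ₑ * ‖b' s‖ₑ))
    with hD
  have hQO : c.Q ⊆ O := square_subset_openSquare (by rw [hρ]; linarith)
  have hstep : ∀ j, ∫⁻ s in c.Q, ‖f j s‖ₑ ^ 2 * ‖b s‖ₑ ^ 2 ≤ A * B j * D := by
    intro j
    have hf1 : ContDiff ℝ 1 (f j) := (hf j).of_le (by norm_cast)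
    refine (lintegral_sq_mul_sq_le (half_pos hR)
      (fun s _ => ((hf1.differentiable (by norm_num)) s).hasFDerivAt)
      (hf1.continuous_fderiv (by norm_num)).continuousOn hb hb').trans ?_
    refine mul_le_mul_left ?_ _
    calc _ ≤ ∫⁻ s in c.Q, A * energyDensity (f j) s := by
          refine lintegral_mono fun s => ?_
          rw [energyDensity, mul_add]
          exact add_le_add (mul_le_mul_left (le_max_left _ _) _)
            (mul_le_mul_left (le_max_right _ _) _)
      _ = A * ∫⁻ s in c.Q, energyDensity (f j) s := lintegral_const_mul' _ _ hAt
      _ ≤ A * B j := by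
          refine mul_le_mul_right ((lintegral_mono_set ?_).trans (hB j)) _
          have h1 : 1 / ((j : ℝ) + 1) ≤ 1 := by
            rw [div_le_one (by positivity)]
            linarith [Nat.cast_nonneg (α := ℝ) j]
          have h2 : c.R / 2 ≤ ρ - c.R / 4 * (1 / ((j : ℝ) + 1)) := by
            rw [hρ]; nlinarith
          exact prod_mono (Icc_subset_Icc (by linarith) h2) (Icc_subset_Icc (by linarith) h2)
  have hbm : ContinuousOn b c.Q := fun s hs => (hb s hs).continuousAt.continuousWithinAt
  have hbe : AEMeasurable (fun s => ‖b s‖ₑ ^ 2) (volume.restrict c.Q) :=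
    ((hbm.aemeasurable c.measurableSet_Q).enorm).pow_const 2
  have hfaeQ : ∀ᵐ s ∂(volume.restrict c.Q), Tendsto (fun j => f j s) atTop (𝓝 (η (c.χ s))) :=
    ae_mono (Measure.restrict_mono hQO le_rfl) hfae
  have hlim : Tendsto (fun j => A * B j * D) atTop (𝓝 (A * (eLpNorm (fun s => η (c.χ s)) 2
      (volume.restrict O) * (eLpNorm (fun s => η (c.χ s)) 2 (volume.restrict O) +
      ∑ j, eLpNorm (fun s => ∑ i, weakTanDeriv Γ n i η (c.χ s) * chartDeriv c.b c.h s (V j) i) 2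
        (volume.restrict O))) * D)) := by
    refine ENNReal.Tendsto.mul_const (ENNReal.Tendsto.const_mul hBt (Or.inr hAt)) (Or.inr ?_)
    obtain ⟨M, hM⟩ := (isCompact_square (c.R / 2)).exists_bound_of_continuousOn hbm
    obtain ⟨M', hM'⟩ := (isCompact_square (c.R / 2)).exists_bound_of_continuousOn hb'
    have hbd : ∀ s ∈ c.Q, ENNReal.ofReal (2 * (c.R / 2))⁻¹ * ‖b s‖ₑ ^ 2 + 2 * (‖b s‖ₑ * ‖b' s‖ₑ) ≤
        ENNReal.ofReal (2 * (c.R / 2))⁻¹ * ENNReal.ofReal M ^ 2 +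
          2 * (ENNReal.ofReal M * ENNReal.ofReal M') := by
      intro s hs
      have h1 : ‖b s‖ₑ ≤ ENNReal.ofReal M := by
        rw [← ofReal_norm]; exact ENNReal.ofReal_le_ofReal (hM s hs)
      have h2 : ‖b' s‖ₑ ≤ ENNReal.ofReal M' := by
        rw [← ofReal_norm]; exact ENNReal.ofReal_le_ofReal (hM' s hs)
      gcongr
    refine ne_top_of_le_ne_top ?_ (setLIntegral_mono' c.measurableSet_Q hbd)
    rw [setLIntegral_const]
    refine ENNReal.mul_ne_top (ENNReal.add_ne_top.2 ⟨ENNReal.mul_ne_top ENNReal.ofReal_ne_top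
      (ENNReal.pow_ne_top ENNReal.ofReal_ne_top), ENNReal.mul_ne_top (by simp)
      (ENNReal.mul_ne_top ENNReal.ofReal_ne_top ENNReal.ofReal_ne_top)⟩)
      (isCompact_square (c.R / 2)).measure_lt_top.ne
  calc ∫⁻ s in c.Q, ‖η (c.χ s)‖ₑ ^ 2 * ‖b s‖ₑ ^ 2
      = ∫⁻ s in c.Q, liminf (fun j => ‖f j s‖ₑ ^ 2 * ‖b s‖ₑ ^ 2) atTop := by
        refine lintegral_congr_ae ?_
        filter_upwards [hfaeQ] with s hs
        have h1 : Tendsto (fun j => ‖f j s‖ₑ ^ 2) atTop (𝓝 (‖η (c.χ s)‖ₑ ^ 2)) :=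
          ((ENNReal.continuous_pow 2).tendsto _).comp ((continuous_enorm.tendsto _).comp hs)
        exact (ENNReal.Tendsto.mul_const h1 (Or.inr (by simp))).liminf_eq.symm
    _ ≤ liminf (fun j => ∫⁻ s in c.Q, ‖f j s‖ₑ ^ 2 * ‖b s‖ₑ ^ 2) atTop :=
        lintegral_liminf_le' fun j =>
          ((hf j).continuous.measurable.enorm.pow_const 2).aemeasurable.mul hbe
    _ ≤ liminf (fun j => A * B j * D) atTop := liminf_le_liminf (Eventually.of_forall hstep)
    _ = _ := hlim.liminf_eq
    _ ≤ A * ((k₀ * L2Surf Γ η) * (k₀ * H1Surf Γ n η + ∑ j, k j * H1Surf Γ n η)) * D := by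
        have h1 : eLpNorm (fun s => η (c.χ s)) 2 (volume.restrict O) ≤ k₀ * L2Surf Γ η :=
          (eLpNorm_mono_measure _ hle).trans (hkη η hη.1.1)
        gcongr with j
        · exact h1.trans (mul_le_mul_right (L2Surf_le_H1Surf η) _)
        · exact (hkd j η hη).2
    _ = _ := by
        rw [← Finset.sum_mul]
        ring

lemma GraphPatch.exists_measurable_χ (c : GraphPatch Γ) :
    ∃ X : ℝ × ℝ → E3, Measurable X ∧ ∀ s ∈ c.Q, X s = c.χ s := by
  classical
  refine ⟨_, (c.contDiffOn_χ.continuousOn.mono c.Q_subset).measurable_piecewise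
    (continuousOn_const (c := 0)) c.measurableSet_Q, fun s hs => piecewise_eq_of_mem _ _ _ hs⟩

/-- The product estimate with an `H¹` function on the surface, for smooth functions on unions of
layers. -/
theorem IsThinDatum.exists_lintegral_proj_smooth_le (hT : IsThinDatum Γ n g₀ g₁ δ δ₀ a) :
    ∃ C : ℝ≥0∞, C ≠ ⊤ ∧ ∀ ε ∈ Ioc (0 : ℝ) 1, ∀ β > 0, ∀ η φ : E3 → ℝ, MemH1Surf Γ n η →
      ContDiff ℝ 1 φ →
      ∫⁻ x in thin Γ n g₀ g₁ ε, ‖η (proj Γ x)‖ₑ ^ 2 *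
          (compactLayers Γ n g₀ g₁ ε β).indicator (fun x => ‖φ x‖ₑ ^ 2) x ≤
        C * (L2Surf Γ η * H1Surf Γ n η) *
          ∫⁻ x in compactLayers Γ n g₀ g₁ ε β, energyDensity φ x := by
  obtain ⟨T, K, hKt, hK⟩ := hT.exists_cover
  choose C hCt hC using fun c : GraphPatch Γ => c.exists_layer_energy hT
  choose A hAt hA using fun c : GraphPatch Γ =>
    c.exists_lintegral_comp_χ_sq_mul_sq_le hT.surface
  refine ⟨∑ c ∈ T, K * (A c * (C c * K)), ENNReal.sum_ne_top.2 fun c _ =>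
    ENNReal.mul_ne_top hKt (ENNReal.mul_ne_top (hAt c) (ENNReal.mul_ne_top (hCt c) hKt)),
    fun ε hε β hβ η φ hη hφ => ?_⟩
  set L := compactLayers Γ n g₀ g₁ ε β with hL
  set N := L2Surf Γ η * H1Surf Γ n η with hN
  have hLm : MeasurableSet L := hT.isCompact_compactLayers.measurableSet
  have hLO : L ⊆ thin Γ n g₀ g₁ ε := hT.compactLayers_subset hε.1 hβ
  have hOm : MeasurableSet (thin Γ n g₀ g₁ ε) := (hT.isOpen_thin hε).measurableSet
  have hsq : Measurable (L.indicator fun x => ‖φ x‖ₑ ^ 2) :=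
    (hφ.continuous.measurable.enorm.pow_const 2).indicator hLm
  have hen : Measurable (L.indicator (energyDensity φ)) :=
    (continuous_energyDensity hφ).measurable.indicator hLm
  set η' := hη.1.1.mk η with hη'
  have hη'm : Measurable fun y => ‖η' y‖ₑ ^ 2 :=
    hη.1.1.stronglyMeasurable_mk.measurable.enorm.pow_const 2
  set e := ENNReal.ofReal ε with he
  have hFm : Measurable ((thin Γ n g₀ g₁ ε).indicator fun x => ‖η' (proj Γ x)‖ₑ ^ 2 *
      L.indicator (fun x => ‖φ x‖ₑ ^ 2) x) := by
    have h1 := measurable_indicator_comp hOm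
      ((contDiffOn_proj hT.surface hT.tubular).continuousOn.mono (hT.thin_subset_tube hε)) hη'm
    convert h1.mul hsq using 1
    ext x
    exact indicator_mul_left _ _ _
  have e0 : ∫⁻ x in thin Γ n g₀ g₁ ε, ‖η (proj Γ x)‖ₑ ^ 2 * L.indicator (fun x => ‖φ x‖ₑ ^ 2) x =
      ∫⁻ x in thin Γ n g₀ g₁ ε, ‖η' (proj Γ x)‖ₑ ^ 2 * L.indicator (fun x => ‖φ x‖ₑ ^ 2) x := by
    refine lintegral_congr_ae ?_
    filter_upwards [hT.ae_proj hε hη.1.1.ae_eq_mk] with x hx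
    rw [hx]
  rw [e0]
  refine ((hK ε hε _ hFm).1).trans ?_
  rw [Finset.sum_mul, Finset.sum_mul]
  refine Finset.sum_le_sum fun c hc => ?_
  obtain ⟨Θ, hΘm, hΘ⟩ := c.exists_measurable_layer hT ε
  obtain ⟨X, hXm, hX⟩ := c.exists_measurable_χ
  have hE : e * ∫⁻ r in Ioo (0 : ℝ) 1, ∫⁻ s in c.Q, L.indicator (energyDensity φ) (Θ (s, r)) ≤
      K * ∫⁻ x in L, energyDensity φ x := by
    have h2 := (hK ε hε (L.indicator (energyDensity φ)) (hen.indicator hOm)).2 c hc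
    rw [setLIntegral_indicator hLm, inter_eq_left.2 hLO] at h2
    have hm1 : Measurable fun p : ℝ × (ℝ × ℝ) => L.indicator (energyDensity φ) (Θ (p.2, p.1)) :=
      hen.comp (hΘm.comp (measurable_snd.prodMk measurable_fst))
    rw [lintegral_lintegral_swap (f := fun r s => L.indicator (energyDensity φ) (Θ (s, r)))
      hm1.aemeasurable]
    refine le_trans (le_of_eq ?_) h2
    congr 1
    exact setLIntegral_congr_fun c.measurableSet_Q fun s hs => by simp only [hΘ s hs]
  have hS : ∫⁻ s in c.Q, ∫⁻ r in Ioo (0 : ℝ) 1,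
      ‖η' (proj Γ (layerPoint n g₀ g₁ ε r (c.χ s)))‖ₑ ^ 2 *
        L.indicator (fun x => ‖φ x‖ₑ ^ 2) (layerPoint n g₀ g₁ ε r (c.χ s)) ≤
      A c * N * (C c * ∫⁻ r in Ioo (0 : ℝ) 1, ∫⁻ s in c.Q,
        L.indicator (energyDensity φ) (Θ (s, r))) := by
    have hm2 : Measurable fun p : (ℝ × ℝ) × ℝ =>
        ‖η' (X p.1)‖ₑ ^ 2 * L.indicator (fun x => ‖φ x‖ₑ ^ 2) (Θ (p.1, p.2)) :=
      (hη'm.comp (hXm.comp measurable_fst)).mul (hsq.comp hΘm)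
    calc _ = ∫⁻ s in c.Q, ∫⁻ r in Ioo (0 : ℝ) 1,
          ‖η' (X s)‖ₑ ^ 2 * L.indicator (fun x => ‖φ x‖ₑ ^ 2) (Θ (s, r)) := by
          refine setLIntegral_congr_fun c.measurableSet_Q fun s hs => ?_
          refine setLIntegral_congr_fun measurableSet_Ioo fun r hr => ?_
          simp only [hT.proj_layerPoint ⟨hε.1.le, hε.2⟩ ⟨hr.1.le, hr.2.le⟩
            (c.χ_mem (c.Q_subset hs)), hΘ s hs, hX s hs]
      _ = ∫⁻ r in Ioo (0 : ℝ) 1, ∫⁻ s in c.Q,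
          ‖η' (X s)‖ₑ ^ 2 * L.indicator (fun x => ‖φ x‖ₑ ^ 2) (Θ (s, r)) :=
          lintegral_lintegral_swap hm2.aemeasurable
      _ ≤ ∫⁻ r in Ioo (0 : ℝ) 1, A c * N * (C c * ∫⁻ s in c.Q,
          L.indicator (energyDensity φ) (Θ (s, r))) := by
          refine setLIntegral_mono' measurableSet_Ioo fun r hr => ?_
          have hri : r ∈ Icc (0 : ℝ) 1 := ⟨hr.1.le, hr.2.le⟩
          have hmem : ∀ s ∈ c.Q, (layerPoint n g₀ g₁ ε r (c.χ s) ∈ L ↔ r ∈ Icc β (1 - β)) :=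
            fun s hs => hT.layerPoint_mem_compactLayers hε hβ hri (c.χ_mem (c.Q_subset hs))
          by_cases hrβ : r ∈ Icc β (1 - β)
          · obtain ⟨D, hDc, hD, hDb⟩ := hC c ε hε r hri φ hφ
            calc _ = ∫⁻ s in c.Q, ‖η (c.χ s)‖ₑ ^ 2 *
                  ‖φ (layerPoint n g₀ g₁ ε r (c.χ s))‖ₑ ^ 2 := by
                  refine lintegral_congr_ae ?_
                  filter_upwards [ae_mono (Measure.restrict_mono c.Q_subset le_rfl)
                    (c.ae_χ hT.surface hη.1.1.ae_eq_mk), ae_restrict_mem c.measurableSet_Q]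
                    with s hs hsQ
                  have hs' : η (c.χ s) = η' (c.χ s) := hs
                  rw [hΘ s hsQ, hX s hsQ, ← hs', indicator_of_mem ((hmem s hsQ).2 hrβ)]
              _ ≤ _ := hA c η hη _ D hD hDc
              _ ≤ A c * N * ∫⁻ s in c.Q, C c * L.indicator (energyDensity φ) (Θ (s, r)) := by
                  refine mul_le_mul_right (setLIntegral_mono' c.measurableSet_Q fun s hs => ?_) _
                  rw [hΘ s hs, indicator_of_mem ((hmem s hs).2 hrβ)]
                  exact hDb s hs
              _ = _ := by rw [lintegral_const_mul' _ _ (hCt c)]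
          · refine le_trans (le_of_eq ?_) zero_le
            rw [← lintegral_zero (μ := volume.restrict c.Q)]
            refine setLIntegral_congr_fun c.measurableSet_Q fun s hs => ?_
            simp only [hΘ s hs]
            rw [indicator_of_notMem (mt (hmem s hs).1 hrβ), mul_zero]
      _ = _ := by
          have hm : Measurable fun r => ∫⁻ s in c.Q, L.indicator (energyDensity φ) (Θ (s, r)) :=
            Measurable.lintegral_prod_left' (μ := volume.restrict c.Q)
              (f := fun p : (ℝ × ℝ) × ℝ => L.indicator (energyDensity φ) (Θ p)) (hen.comp hΘm)
          rw [lintegral_const_mul _ (hm.const_mul _), lintegral_const_mul _ hm]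
  calc _ ≤ K * (e * (A c * N * (C c * ∫⁻ r in Ioo (0 : ℝ) 1, ∫⁻ s in c.Q,
        L.indicator (energyDensity φ) (Θ (s, r))))) := by gcongr
    _ = K * (A c * N * (C c * (e * ∫⁻ r in Ioo (0 : ℝ) 1, ∫⁻ s in c.Q,
        L.indicator (energyDensity φ) (Θ (s, r))))) := by ring
    _ ≤ K * (A c * N * (C c * (K * ∫⁻ x in L, energyDensity φ x))) := by gcongr
    _ = _ := by ring

lemma MemH1Surf.H1Surf_ne_top {η : E3 → ℝ} (hη : MemH1Surf Γ n η) : H1Surf Γ n η ≠ ⊤ :=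
  ENNReal.rpow_ne_top_of_nonneg (by norm_num) (ENNReal.add_ne_top.2
    ⟨ENNReal.pow_ne_top hη.1.2.ne, ENNReal.sum_ne_top.2 fun j _ =>
      ENNReal.pow_ne_top (hη.weakTanDeriv_spec j).1.2.ne⟩)

/-- The product estimate for the constant extension of an `H¹` function on the surface and a Sobolev
function on the thin domain. -/
theorem IsThinDatum.exists_lintegral_ext_sq_mul_sq_le (hT : IsThinDatum Γ n g₀ g₁ δ δ₀ a) :
    ∃ C : ℝ≥0∞, C ≠ ⊤ ∧ ∀ ε ∈ Ioc (0 : ℝ) 1, ∀ η φ : E3 → ℝ, MemH1Surf Γ n η →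
      MemH1 (thin Γ n g₀ g₁ ε) φ →
      ∫⁻ x in thin Γ n g₀ g₁ ε, ‖ext Γ η x‖ₑ ^ 2 * ‖φ x‖ₑ ^ 2 ≤
      C * (L2Surf Γ η * H1Surf Γ n η) *
        (L2 (thin Γ n g₀ g₁ ε) φ * H1 (thin Γ n g₀ g₁ ε) φ) := by
  obtain ⟨C, hCt, hC⟩ := hT.exists_lintegral_proj_smooth_le
  refine ⟨4 * C, ENNReal.mul_ne_top (by simp) hCt, fun ε hε η φ hη hφ => ?_⟩
  obtain ⟨ψ, hψ, -, -, hψae, d, hd, hdt⟩ := hT.exists_smooth_seq hε hφ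
  have hOm := (hT.isOpen_thin hε).measurableSet
  have hKm : ∀ k, MeasurableSet (exhaustion Γ n g₀ g₁ ε k) :=
    fun k => hT.isCompact_compactLayers.measurableSet
  have hm : ∀ k, Measurable ((exhaustion Γ n g₀ g₁ ε k).indicator fun x => ‖ψ k x‖ₑ ^ 2) :=
    fun k => ((hψ k).continuous.measurable.enorm.pow_const 2).indicator (hKm k)
  have hηm : AEMeasurable (fun x => ‖η (proj Γ x)‖ₑ ^ 2) (volume.restrict (thin Γ n g₀ g₁ ε)) :=
    (hT.aestronglyMeasurable_ext hε hη.1.1).enorm.pow_const 2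
  have hN : C * (L2Surf Γ η * H1Surf Γ n η) ≠ ⊤ :=
    ENNReal.mul_ne_top hCt (ENNReal.mul_ne_top hη.1.2.ne hη.H1Surf_ne_top)
  have hlim := ENNReal.Tendsto.const_mul (a := C * (L2Surf Γ η * H1Surf Γ n η)) hdt (Or.inr hN)
  calc ∫⁻ x in thin Γ n g₀ g₁ ε, ‖ext Γ η x‖ₑ ^ 2 * ‖φ x‖ₑ ^ 2
      = ∫⁻ x in thin Γ n g₀ g₁ ε, liminf (fun k => ‖η (proj Γ x)‖ₑ ^ 2 *
          (exhaustion Γ n g₀ g₁ ε k).indicator (fun x => ‖ψ k x‖ₑ ^ 2) x) atTop := by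
        refine lintegral_congr_ae ?_
        filter_upwards [hψae, ae_restrict_mem hOm] with x hx hxO
        exact (ENNReal.Tendsto.const_mul (tendsto_indicator_enorm_sq hx
          (hT.eventually_mem_exhaustion hε hxO)) (Or.inr (by simp))).liminf_eq.symm
    _ ≤ liminf (fun k => ∫⁻ x in thin Γ n g₀ g₁ ε, ‖η (proj Γ x)‖ₑ ^ 2 *
          (exhaustion Γ n g₀ g₁ ε k).indicator (fun x => ‖ψ k x‖ₑ ^ 2) x) atTop :=
        lintegral_liminf_le' fun k => hηm.mul (hm k).aemeasurable
    _ ≤ liminf (fun k => C * (L2Surf Γ η * H1Surf Γ n η) * d k) atTop := by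
        refine liminf_le_liminf (Eventually.of_forall fun k => ?_)
        exact (hC ε hε _ (one_div_nat_pos k) η (ψ k) hη ((hψ k).of_le (by norm_cast))).trans
          (mul_le_mul_right (hd k) _)
    _ = _ := hlim.liminf_eq
    _ ≤ C * (L2Surf Γ η * H1Surf Γ n η) *
          (L2 (thin Γ n g₀ g₁ ε) φ * (4 * H1 (thin Γ n g₀ g₁ ε) φ)) := by
        gcongr
        exact L2_add_sum_le _ _
    _ = _ := by ring

end SurfaceProduct

/-! ### Coefficient fields of the average part -/

section Coefficients

variable {Γ : Set E3} {n : E3 → E3} {g₀ g₁ : E3 → ℝ} {δ δ₀ a ε τ β : ℝ}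

/-- A jointly smooth family of functions is uniformly bounded in `C¹` for parameters in a compact
set, near a compact set. -/
lemma exists_bound_family {T V E : Type*} [NormedAddCommGroup T] [NormedSpace ℝ T]
    [NormedAddCommGroup E] [NormedSpace ℝ E]
    [NormedAddCommGroup V] [NormedSpace ℝ V] {G : T × E → V} {S : Set T} {K : Set E}
    (hS : IsCompact S) (hK : IsCompact K) (h : ∀ p ∈ S, ∀ x ∈ K, ContDiffAt ℝ 1 G (p, x)) :
    ∃ C : ℝ, ∀ p ∈ S, ∀ x ∈ K, ‖G (p, x)‖ ≤ C ∧ ContDiffAt ℝ 1 (fun x => G (p, x)) x ∧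
      ‖fderiv ℝ (fun x => G (p, x)) x‖ ≤ C := by
  have hc : ContinuousOn G (S ×ˢ K) := fun z hz =>
    (h z.1 hz.1 z.2 hz.2).continuousAt.continuousWithinAt
  have hc' : ContinuousOn (fun z => (fderiv ℝ G z).comp (ContinuousLinearMap.inr ℝ T E))
      (S ×ˢ K) := fun z hz => by
    have h1 : ContinuousAt (fderiv ℝ G) z :=
      ((h z.1 hz.1 z.2 hz.2).fderiv_right (m := 0) (by norm_num)).continuousAt
    exact (h1.clm_comp continuousAt_const).continuousWithinAt
  obtain ⟨C, hC⟩ := (hS.prod hK).exists_bound_of_continuousOn hc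
  obtain ⟨C', hC'⟩ := (hS.prod hK).exists_bound_of_continuousOn hc'
  refine ⟨max C C', fun p hp x hx => ⟨(hC (p, x) ⟨hp, hx⟩).trans (le_max_left _ _), ?_, ?_⟩⟩
  · exact (h p hp x hx).comp x (contDiffAt_const.prodMk contDiffAt_id)
  · have h1 : HasFDerivAt (fun x => G (p, x))
        ((fderiv ℝ G (p, x)).comp (ContinuousLinearMap.inr ℝ T E)) x :=
      ((h p hp x hx).differentiableAt (by norm_num)).hasFDerivAt.comp x
        (hasFDerivAt_prodMk_right p x)
    rw [h1.fderiv]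
    exact (hC' (p, x) ⟨hp, hx⟩).trans (le_max_right _ _)

lemma contDiffAt_det {T ι : Type*} [NormedAddCommGroup T] [NormedSpace ℝ T] [Fintype ι]
    [DecidableEq ι] {M : T → Matrix ι ι ℝ} {z : T} {k : WithTop ℕ∞}
    (hM : ∀ i j, ContDiffAt ℝ k (fun t => M t i j) z) : ContDiffAt ℝ k (fun t => (M t).det) z := by
  simp only [Matrix.det_apply']
  exact ContDiffAt.sum fun σ _ => contDiffAt_const.mul (contDiffAt_prod fun i _ => hM _ _)

/-- The entries of the inverse of an invertible matrix depend smoothly on the entries. -/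
lemma contDiffAt_inv_apply {T ι : Type*} [NormedAddCommGroup T] [NormedSpace ℝ T] [Fintype ι]
    [DecidableEq ι] {M : T → Matrix ι ι ℝ} {z : T} {k : WithTop ℕ∞}
    (hM : ∀ i j, ContDiffAt ℝ k (fun t => M t i j) z) (hz : IsUnit (M z)) (i j : ι) :
    ContDiffAt ℝ k (fun t => (M t)⁻¹ i j) z := by
  have hdet : (M z).det ≠ 0 := ((Matrix.isUnit_iff_isUnit_det _).1 hz).ne_zero
  simp only [Matrix.inv_def, Matrix.smul_apply, smul_eq_mul, Ring.inverse_eq_inv',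
    Matrix.adjugate_apply]
  refine ((contDiffAt_det hM).inv hdet).mul (contDiffAt_det fun i' j' => ?_)
  by_cases h : i' = j
  · subst h
    simp only [Matrix.updateRow_self]
    exact contDiffAt_const
  · simp only [Matrix.updateRow_ne h]
    exact hM _ _

lemma contDiffAt_snd_of {T V : Type*} [NormedAddCommGroup T] [NormedSpace ℝ T]
    [NormedAddCommGroup V] [NormedSpace ℝ V] {f : E3 → V} {k : WithTop ℕ∞} {z : T × E3}
    (hf : ContDiffAt ℝ k f z.2) : ContDiffAt ℝ k (fun w : T × E3 => f w.2) z :=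
  hf.comp z contDiffAt_snd

lemma contDiffAt_P {T : Type*} [NormedAddCommGroup T] [NormedSpace ℝ T] {f v : T → E3} {z : T}
    {k : WithTop ℕ∞} (hf : ContDiffAt ℝ k f z) (hv : ContDiffAt ℝ k v z) :
    ContDiffAt ℝ k (fun t => v t - (inner ℝ (f t) (v t)) • f t) z :=
  hv.sub ((hf.inner ℝ hv).smul hf)

lemma contDiffAt_ext (hT : IsThinDatum Γ n g₀ g₁ δ δ₀ a) {V : Type*} [NormedAddCommGroup V]
    [NormedSpace ℝ V] {f : E3 → V} (hf : ContDiffOn ℝ 4 f Γ) {x : E3} (hx : x ∈ tube Γ n δ) :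
    ContDiffAt ℝ 4 (ext Γ f) x :=
  (contDiffOn_ext hT.surface hT.tubular hf).contDiffAt
    ((isOpen_tube hT.surface hT.tubular).mem_nhds hx)

/-- The tangential derivatives of smooth functions on the surface have smooth constant
extensions. -/
lemma contDiffAt_fderiv_ext_P (hT : IsThinDatum Γ n g₀ g₁ δ δ₀ a) {V : Type*}
    [NormedAddCommGroup V] [NormedSpace ℝ V] {f : E3 → V} (hf : ContDiffOn ℝ 4 f Γ) {x : E3}
    (hx : x ∈ tube Γ n δ) (v : E3) :
    ContDiffAt ℝ 3 (fun x => fderiv ℝ (ext Γ f) (proj Γ x) (P n (proj Γ x) v)) x := by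
  have hO := isOpen_tube hT.surface hT.tubular
  have hπ : ContDiffAt ℝ 3 (proj Γ) x :=
    ((contDiffOn_proj hT.surface hT.tubular).contDiffAt (hO.mem_nhds hx)).of_le (by norm_num)
  have hmem : proj Γ x ∈ tube Γ n δ :=
    subset_tube hT.tubular.1 (CTD.proj_mem hT.surface hT.tubular hx)
  have h1 : ContDiffAt ℝ 3 (fderiv ℝ (ext Γ f)) (proj Γ x) :=
    (contDiffAt_ext hT hf hmem).fderiv_right (by norm_num)
  have h2 : ContDiffAt ℝ 3 (fun x => n (proj Γ x)) x :=
    (contDiffAt_ext hT hT.surface.contDiffOn_normal hx).of_le (by norm_num)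
  have h3 : ContDiffAt ℝ 3 (fun x => P n (proj Γ x) v) x :=
    contDiffAt_P (f := fun x => n (proj Γ x)) h2 contDiffAt_const
  exact (h1.comp x hπ).clm_apply h3

lemma contDiffAt_tanGrad_proj (hT : IsThinDatum Γ n g₀ g₁ δ δ₀ a) {f : E3 → ℝ}
    (hf : ContDiffOn ℝ 4 f Γ) {x : E3} (hx : x ∈ tube Γ n δ) (i : Fin 3) :
    ContDiffAt ℝ 3 (fun x => tanGrad Γ n f (proj Γ x) i) x := by
  refine (contDiffAt_fderiv_ext_P hT hf hx (EuclideanSpace.single i 1)).congr_of_eventuallyEq ?_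
  filter_upwards [(isOpen_tube hT.surface hT.tubular).mem_nhds hx] with z hz
  have hy := CTD.proj_mem hT.surface hT.tubular hz
  exact tanGrad_apply hT.surface hy (hasFDerivWithinAt_of_ext hT.surface hT.tubular hf hy) i

lemma contDiffAt_W_proj (hT : IsThinDatum Γ n g₀ g₁ δ δ₀ a) {x : E3} (hx : x ∈ tube Γ n δ)
    (i j : Fin 3) : ContDiffAt ℝ 3 (fun x => W Γ n (proj Γ x) i j) x := by
  have hn := hT.surface.contDiffOn_normal
  have h1 := (EuclideanSpace.proj j : E3 →L[ℝ] ℝ).contDiff.contDiffAt.comp x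
    (contDiffAt_fderiv_ext_P hT hn hx (EuclideanSpace.single i 1))
  refine h1.neg.congr_of_eventuallyEq ?_
  filter_upwards [(isOpen_tube hT.surface hT.tubular).mem_nhds hx] with z hz
  have hy := CTD.proj_mem hT.surface hT.tubular hz
  exact W_apply hT.surface hy (hasFDerivWithinAt_of_ext hT.surface hT.tubular hn hy) i j

/-- The fields `τ_ε` are smooth jointly in `ε` and the point.  The matrix inverse is written with
the adjugate, as the determinant does not vanish within the tubular radius. -/
lemma contDiffAt_tau (hT : IsThinDatum Γ n g₀ g₁ δ δ₀ a) {g : E3 → ℝ} (hg : ContDiffOn ℝ 4 g Γ)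
    (hgb : ∀ y ∈ Γ, |g y| ≤ δ₀) (hε : ε ∈ Icc (0 : ℝ) 1) {x : E3} (hx : x ∈ tube Γ n δ) :
    ContDiffAt ℝ 3 (fun w : ℝ × E3 => tau Γ n g w.1 (proj Γ w.2)) (ε, x) := by
  have hy := CTD.proj_mem hT.surface hT.tubular hx
  have hM : ∀ i j, ContDiffAt ℝ 3
      (fun w : ℝ × E3 => (1 - (w.1 * g (proj Γ w.2)) • W Γ n (proj Γ w.2)) i j) (ε, x) := by
    intro i j
    have hgx : ContDiffAt ℝ 3 (fun w : ℝ × E3 => g (proj Γ w.2)) (ε, x) :=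
      contDiffAt_snd_of (f := fun x => g (proj Γ x))
        ((contDiffAt_ext hT hg hx).of_le (by norm_num))
    have hWx : ContDiffAt ℝ 3 (fun w : ℝ × E3 => W Γ n (proj Γ w.2) i j) (ε, x) :=
      contDiffAt_snd_of (f := fun x => W Γ n (proj Γ x) i j) (contDiffAt_W_proj hT hx i j)
    exact contDiffAt_const.sub ((contDiffAt_fst.mul hgx).mul hWx)
  have hr : ε * g (proj Γ x) ∈ Ioo (-δ) δ := by
    refine hT.mem_Ioo ?_
    rw [abs_mul, abs_of_nonneg hε.1]
    exact (mul_le_of_le_one_left (abs_nonneg _) hε.2).trans (hgb _ hy)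
  have hU := hT.tubular.isUnit_one_sub hy hr
  rw [contDiffAt_euclidean]
  intro i
  have e : ∀ w : ℝ × E3, tau Γ n g w.1 (proj Γ w.2) i =
      ∑ j, (1 - (w.1 * g (proj Γ w.2)) • W Γ n (proj Γ w.2))⁻¹ i j *
        tanGrad Γ n g (proj Γ w.2) j := fun w => by
    rw [tau]
    rfl
  simp only [e]
  exact ContDiffAt.sum fun j _ => (contDiffAt_inv_apply hM hU i j).mul
    (contDiffAt_snd_of (f := fun x => tanGrad Γ n g (proj Γ x) j)
      (contDiffAt_tanGrad_proj hT hg hx j))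

lemma contDiffAt_Psi (hT : IsThinDatum Γ n g₀ g₁ δ δ₀ a) (hε : ε ∈ Icc (0 : ℝ) 1) {x : E3}
    (hx : x ∈ tube Γ n δ) :
    ContDiffAt ℝ 3 (fun w : ℝ × E3 => Psi Γ n g₀ g₁ w.1 w.2) (ε, x) := by
  have hy := CTD.proj_mem hT.surface hT.tubular hx
  have h0 : ContDiffAt ℝ 3 (fun w : ℝ × E3 => ext Γ g₀ w.2) (ε, x) :=
    contDiffAt_snd_of ((contDiffAt_ext hT hT.contDiffOn_left hx).of_le (by norm_num))
  have h1 : ContDiffAt ℝ 3 (fun w : ℝ × E3 => ext Γ g₁ w.2) (ε, x) :=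
    contDiffAt_snd_of ((contDiffAt_ext hT hT.contDiffOn_right hx).of_le (by norm_num))
  have hd : ContDiffAt ℝ 3 (fun w : ℝ × E3 => sdist Γ n w.2) (ε, x) :=
    contDiffAt_snd_of (((contDiffOn_sdist hT.surface hT.tubular).contDiffAt
      ((isOpen_tube hT.surface hT.tubular).mem_nhds hx)).of_le (by norm_num))
  have hg : ext Γ g₁ x - ext Γ g₀ x ≠ 0 := (hT.pos.trans_le (hT.le_sub _ hy)).ne'
  have hτ0 := contDiffAt_tau hT hT.contDiffOn_left hT.abs_left hε hx
  have hτ1 := contDiffAt_tau hT hT.contDiffOn_right hT.abs_right hε hx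
  exact ((h1.sub h0).inv hg).smul
    (((hd.sub (contDiffAt_fst.mul h0)).smul hτ1).add (((contDiffAt_fst.mul h1).sub hd).smul hτ0))

/-- The impermeable extension of the `k`-th column of the tangential projection: the average part
is a combination of these fields. -/
def impCol (Γ : Set E3) (n : E3 → E3) (g₀ g₁ : E3 → ℝ) (ε : ℝ) (k : Fin 3) : E3 → E3 :=
  impExt Γ n g₀ g₁ ε fun y => P n y (EuclideanSpace.single k 1)

lemma contDiffAt_impCol (hT : IsThinDatum Γ n g₀ g₁ δ δ₀ a) (hε : ε ∈ Icc (0 : ℝ) 1) {x : E3}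
    (hx : x ∈ tube Γ n δ) (k : Fin 3) :
    ContDiffAt ℝ 3 (fun w : ℝ × E3 => impCol Γ n g₀ g₁ w.1 k w.2) (ε, x) := by
  have hn : ContDiffAt ℝ 3 (fun w : ℝ × E3 => n (proj Γ w.2)) (ε, x) :=
    contDiffAt_snd_of (f := fun x => n (proj Γ x))
      ((contDiffAt_ext hT hT.surface.contDiffOn_normal hx).of_le (by norm_num))
  have hP : ContDiffAt ℝ 3
      (fun w : ℝ × E3 => P n (proj Γ w.2) (EuclideanSpace.single k 1)) (ε, x) :=
    contDiffAt_P (f := fun w : ℝ × E3 => n (proj Γ w.2)) hn contDiffAt_const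
  exact hP.add ((hP.inner ℝ (contDiffAt_Psi hT hε hx)).smul hn)

/-- The coefficient fields of the average part are bounded in `C¹`, uniformly in `ε`. -/
theorem IsThinDatum.exists_bound_impCol (hT : IsThinDatum Γ n g₀ g₁ δ δ₀ a) :
    ∃ C : ℝ, 0 ≤ C ∧ ∀ ε ∈ Ioc (0 : ℝ) 1, ∀ k, ∀ x ∈ thin Γ n g₀ g₁ ε,
      ‖impCol Γ n g₀ g₁ ε k x‖ ≤ C ∧ ContDiffAt ℝ 1 (impCol Γ n g₀ g₁ ε k) x ∧
      ‖fderiv ℝ (impCol Γ n g₀ g₁ ε k) x‖ ≤ C := by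
  have h : ∀ k : Fin 3, ∃ C : ℝ, ∀ p ∈ Icc (0 : ℝ) 1, ∀ x ∈ closedTube Γ n δ₀,
      ‖impCol Γ n g₀ g₁ p k x‖ ≤ C ∧ ContDiffAt ℝ 1 (impCol Γ n g₀ g₁ p k) x ∧
      ‖fderiv ℝ (impCol Γ n g₀ g₁ p k) x‖ ≤ C := fun k =>
    exists_bound_family (G := fun w : ℝ × E3 => impCol Γ n g₀ g₁ w.1 k w.2) isCompact_Icc
      hT.surface.isCompact_closedTube fun p hp x hx =>
        (contDiffAt_impCol hT hp (hT.closedTube_subset hx) k).of_le (by norm_num)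
  choose C hC using h
  have hle : ∀ k, C k ≤ ∑ k, |C k| := fun k =>
    (le_abs_self _).trans (Finset.single_le_sum (f := fun k => |C k|) (fun _ _ => abs_nonneg _)
      (Finset.mem_univ k))
  refine ⟨∑ k, |C k|, Finset.sum_nonneg fun _ _ => abs_nonneg _, fun ε hε k x hx => ?_⟩
  obtain ⟨h1, h2, h3⟩ := hC k ε ⟨hε.1.le, hε.2⟩ x (hT.thin_subset_closedTube hε hx)
  exact ⟨h1.trans (hle k), h2, h3.trans (hle k)⟩

/-- The derivatives of the projections onto the layers. -/
theorem IsThinDatum.exists_layerProj_deriv (hT : IsThinDatum Γ n g₀ g₁ δ δ₀ a) :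
    ∃ C : ℝ, 0 ≤ C ∧ ∀ ε ∈ Ioc (0 : ℝ) 1, ∃ D : E3 × ℝ → (E3 →L[ℝ] E3),
      ContinuousOn D (thin Γ n g₀ g₁ ε ×ˢ univ) ∧
      (∀ x ∈ thin Γ n g₀ g₁ ε, ∀ r, HasFDerivAt (layerProj Γ n g₀ g₁ ε r) (D (x, r)) x) ∧
      ∀ x ∈ thin Γ n g₀ g₁ ε, ∀ r ∈ Ioo (0 : ℝ) 1, ‖D (x, r)‖ ≤ C := by
  have hO := isOpen_tube hT.surface hT.tubular
  have hb : ∀ {X : E3 → E3}, ContDiffOn ℝ 4 X (tube Γ n δ) →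
      (∀ x ∈ tube Γ n δ, HasFDerivAt X (fderiv ℝ X x) x) ∧ ContinuousOn (fderiv ℝ X) (tube Γ n δ) ∧
      ∃ M, ∀ x ∈ closedTube Γ n δ₀, ‖fderiv ℝ X x‖ ≤ M := by
    intro X hX
    have h1 : ContinuousOn (fderiv ℝ X) (tube Γ n δ) :=
      (hX.fderiv_of_isOpen (m := 3) hO (by norm_num)).continuousOn
    exact ⟨fun x hx =>
        ((hX.contDiffAt (hO.mem_nhds hx)).differentiableAt (by norm_num)).hasFDerivAt, h1,
      hT.surface.isCompact_closedTube.exists_bound_of_continuousOn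
        (h1.mono hT.closedTube_subset)⟩
  have hn := contDiffOn_ext hT.surface hT.tubular hT.surface.contDiffOn_normal
  have hs0 : ContDiffOn ℝ 4 (fun x => g₀ (proj Γ x) • n (proj Γ x)) (tube Γ n δ) :=
    (contDiffOn_ext hT.surface hT.tubular hT.contDiffOn_left).smul hn
  have hs1 : ContDiffOn ℝ 4 (fun x => g₁ (proj Γ x) • n (proj Γ x)) (tube Γ n δ) :=
    (contDiffOn_ext hT.surface hT.tubular hT.contDiffOn_right).smul hn
  obtain ⟨hd, hc, M, hM⟩ := hb (contDiffOn_proj hT.surface hT.tubular)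
  obtain ⟨hd0, hc0, M0, hM0⟩ := hb hs0
  obtain ⟨hd1, hc1, M1, hM1⟩ := hb hs1
  refine ⟨|M| + (|M0| + |M1|), by positivity, fun ε hε => ⟨fun z => fderiv ℝ (proj Γ) z.1 +
    ((ε * (1 - z.2)) • fderiv ℝ (fun x => g₀ (proj Γ x) • n (proj Γ x)) z.1 +
      (ε * z.2) • fderiv ℝ (fun x => g₁ (proj Γ x) • n (proj Γ x)) z.1), ?_, ?_, ?_⟩⟩
  · have hf : ∀ {X : E3 → (E3 →L[ℝ] E3)}, ContinuousOn X (tube Γ n δ) →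
        ContinuousOn (fun z : E3 × ℝ => X z.1) (thin Γ n g₀ g₁ ε ×ˢ univ) := fun hX =>
      hX.comp continuousOn_fst fun z hz => hT.thin_subset_tube hε hz.1
    have k := hf hc
    have k0 := hf hc0
    have k1 := hf hc1
    fun_prop
  · intro x hx r
    have hxt := hT.thin_subset_tube hε hx
    have h := (hd x hxt).add (((hd0 x hxt).const_smul (ε * (1 - r))).add
      ((hd1 x hxt).const_smul (ε * r)))
    refine h.congr_of_eventuallyEq (Eventually.of_forall fun z => ?_)
    rw [layerProj, layerPoint_eq]
    rfl
  · intro x hx r hr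
    have hxt := hT.thin_subset_closedTube hε hx
    have hbs : ∀ {s : ℝ}, 0 ≤ s → s ≤ 1 → ∀ {L : E3 →L[ℝ] E3} {N : ℝ}, ‖L‖ ≤ N →
        ‖(ε * s) • L‖ ≤ |N| := by
      intro s h0 h1 L N hL
      rw [norm_smul, Real.norm_eq_abs, abs_of_nonneg (mul_nonneg hε.1.le h0)]
      exact (mul_le_of_le_one_left (norm_nonneg _) (mul_le_one₀ hε.2 h0 h1)).trans
        (hL.trans (le_abs_self _))
    refine (norm_add_le _ _).trans (add_le_add ((hM x hxt).trans (le_abs_self _))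
      ((norm_add_le _ _).trans (add_le_add ?_ ?_)))
    · exact hbs (by linarith [hr.2]) (by linarith [hr.1]) (hM0 x hxt)
    · exact hbs hr.1.le hr.2.le (hM1 x hxt)

end Coefficients

/-! ### Integrals over fibres -/

section FibreIntegrals

/-- Jensen's inequality for the square.  No measurability is needed, since the Bochner integral of
a non-measurable function is zero. -/
lemma enorm_integral_sq_le {α : Type*} {m : MeasurableSpace α} {ν : Measure α}
    [IsProbabilityMeasure ν] (f : α → ℝ) : ‖∫ x, f x ∂ν‖ₑ ^ 2 ≤ ∫⁻ x, ‖f x‖ₑ ^ 2 ∂ν := by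
  by_cases hf : AEStronglyMeasurable f ν
  · rw [← eLpNorm_two_sq]
    gcongr
    calc ‖∫ x, f x ∂ν‖ₑ ≤ eLpNorm f 1 ν := by
          rw [eLpNorm_one_eq_lintegral_enorm]
          exact enorm_integral_le_lintegral_enorm _
      _ ≤ eLpNorm f 2 ν := eLpNorm_le_eLpNorm_of_exponent_le (by norm_num) hf
  · rw [integral_non_aestronglyMeasurable hf]
    simp

lemma MemLp.integral_prod_right {α β : Type*} [MeasurableSpace α] [MeasurableSpace β]
    {μ : Measure α} {ν : Measure β} [SFinite μ] [IsProbabilityMeasure ν] {G : α × β → ℝ}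
    (hG : MemLp G 2 (μ.prod ν)) : MemLp (fun x => ∫ y, G (x, y) ∂ν) 2 μ := by
  refine ⟨hG.1.integral_prod_right', ?_⟩
  have h : eLpNorm (fun x => ∫ y, G (x, y) ∂ν) 2 μ ^ 2 ≤ eLpNorm G 2 (μ.prod ν) ^ 2 := by
    rw [eLpNorm_two_sq, eLpNorm_two_sq, lintegral_prod _ (hG.1.enorm.pow_const 2)]
    exact lintegral_mono fun x => enorm_integral_sq_le _
  exact (le_rpow_half_of_sq_le h).trans_lt
    (ENNReal.rpow_lt_top_of_nonneg (by norm_num) (ENNReal.pow_ne_top hG.2.ne))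

/-- If the image of `μ` under `S` is dominated by `ν`, then convergence in `L²(ν)` carries over to
the integrals of the compositions with `S` against a weight in `L²(μ)`. -/
lemma tendsto_integral_mul_comp {α β : Type*} [MeasurableSpace α] [MeasurableSpace β]
    {μ : Measure α} {ν : Measure β} {S : α → β} (hS : AEMeasurable S μ) {C : ℝ≥0∞} (hC : C ≠ ⊤)
    (hle : μ.map S ≤ C • ν) {B : α → ℝ} (hB : MemLp B 2 μ) {F : ℕ → β → ℝ} {w : β → ℝ}
    (hF : ∀ k, MemLp (F k) 2 ν) (hw : MemLp w 2 ν)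
    (h : Tendsto (fun k => eLpNorm (F k - w) 2 ν) atTop (𝓝 0)) :
    Tendsto (fun k => ∫ z, B z * F k (S z) ∂μ) atTop (𝓝 (∫ z, B z * w (S z) ∂μ)) := by
  have hc : ∀ {f : β → ℝ}, MemLp f 2 ν → MemLp (fun z => f (S z)) 2 μ := fun hf =>
    (hf.of_measure_le_smul hC hle).comp_of_map hS
  refine tendsto_integral_of_L1' _ (hB.integrable_mul (hc hw)).1
    (Eventually.of_forall fun k => hB.integrable_mul (hc (hF k))) ?_
  have hb : ∀ k, eLpNorm ((fun z => B z * F k (S z)) - fun z => B z * w (S z)) 1 μ ≤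
      eLpNorm B 2 μ * (C ^ (1 / 2 : ℝ) * eLpNorm (F k - w) 2 ν) := by
    intro k
    have h1 := lintegral_mul_le_eLpNorm hB.1 ((hc (hF k)).1.sub (hc hw).1)
    rw [eLpNorm_one_eq_lintegral_enorm]
    calc _ = ∫⁻ z, ‖B z‖ₑ * ‖((fun z => F k (S z)) - fun z => w (S z)) z‖ₑ ∂μ := by
          refine lintegral_congr fun z => ?_
          rw [← enorm_mul]
          simp only [Pi.sub_apply, mul_sub]
      _ ≤ _ := h1.trans ?_
    gcongr
    have h2 : eLpNorm ((F k - w) ∘ S) 2 μ = eLpNorm (F k - w) 2 (μ.map S) :=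
      (eLpNorm_map_measure (((hF k).sub hw).of_measure_le_smul hC hle).1 hS).symm
    calc _ = eLpNorm (F k - w) 2 (μ.map S) := h2
      _ ≤ eLpNorm (F k - w) 2 (C • ν) := eLpNorm_mono_measure _ hle
      _ ≤ _ := by
        rw [eLpNorm_smul_measure_of_ne_top (by norm_num), smul_eq_mul]
        norm_num
  refine tendsto_of_tendsto_of_tendsto_of_le_of_le tendsto_const_nhds ?_ (fun _ => zero_le) hb
  have h3 := ENNReal.Tendsto.const_mul (a := eLpNorm B 2 μ * C ^ (1 / 2 : ℝ)) h
    (Or.inr (ENNReal.mul_ne_top hB.2.ne (ENNReal.rpow_ne_top_of_nonneg (by norm_num) hC)))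
  simpa only [mul_zero, mul_assoc] using h3

lemma tendsto_zero_of_sq {x : ℕ → ℝ≥0∞} (h : Tendsto (fun k => x k ^ 2) atTop (𝓝 0)) :
    Tendsto x atTop (𝓝 0) := by
  have h1 := (ENNReal.continuous_rpow_const (y := 1 / 2)).tendsto (0 : ℝ≥0∞) |>.comp h
  rw [ENNReal.zero_rpow_of_pos (by norm_num)] at h1
  exact tendsto_of_tendsto_of_tendsto_of_le_of_le tendsto_const_nhds h1 (fun _ => zero_le)
    fun k => le_rpow_half_of_sq_le le_rfl

/-- Functions that approximate `w` on the sets of an exhaustion, cut off outside these sets,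
converge to `w` in `L²`. -/
lemma tendsto_eLpNorm_indicator_sub {α : Type*} [MeasurableSpace α] {μ : Measure α}
    {O : Set α} (hO : MeasurableSet O) {K : ℕ → Set α} (hK : ∀ k, MeasurableSet (K k))
    (hKO : ∀ k, K k ⊆ O) (hKe : ∀ x ∈ O, ∀ᶠ k in atTop, x ∈ K k) {h : ℕ → α → ℝ} {w : α → ℝ}
    (hw : MemLp w 2 (μ.restrict O)) (hm : ∀ k, AEStronglyMeasurable (h k) (μ.restrict O))
    (hh : ∀ k, eLpNorm (h k - w) 2 (μ.restrict (K k)) ≤ 2⁻¹ ^ k) :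
    Tendsto (fun k => eLpNorm ((K k).indicator (h k) - w) 2 (μ.restrict O)) atTop (𝓝 0) := by
  have h1 : Tendsto (fun k => eLpNorm ((K k)ᶜ.indicator w) 2 (μ.restrict O)) atTop (𝓝 0) := by
    refine tendsto_zero_of_sq ?_
    simp only [eLpNorm_two_sq]
    rw [← lintegral_zero (μ := μ.restrict O)]
    refine tendsto_lintegral_of_dominated_convergence' (fun x => ‖w x‖ₑ ^ 2) (fun k => ?_)
      (fun k => Eventually.of_forall fun x => ?_) ?_ ?_
    · exact (hw.1.indicator (hK k).compl).enorm.pow_const 2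
    · exact pow_le_pow_left₀ zero_le (enorm_indicator_le_enorm_self _ _) 2
    · rw [← eLpNorm_two_sq]
      exact ENNReal.pow_ne_top hw.2.ne
    · filter_upwards [ae_restrict_mem hO] with x hx
      refine tendsto_const_nhds.congr' ?_
      filter_upwards [hKe x hx] with k hk
      rw [indicator_of_notMem (by simpa using hk)]
      simp
  have h2 : Tendsto (fun k : ℕ => (2⁻¹ : ℝ≥0∞) ^ k) atTop (𝓝 0) :=
    ENNReal.tendsto_pow_atTop_nhds_zero_of_lt_one (by norm_num)
  have h3 := h2.add h1
  rw [add_zero] at h3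
  refine tendsto_of_tendsto_of_tendsto_of_le_of_le tendsto_const_nhds h3 (fun _ => zero_le)
    fun k => ?_
  have e : (K k).indicator (h k) - w = (K k).indicator (h k - w) - (K k)ᶜ.indicator w := by
    funext x
    by_cases hx : x ∈ K k <;> simp [hx]
  have h4 : eLpNorm ((K k).indicator (h k - w)) 2 (μ.restrict O) ≤ 2⁻¹ ^ k := by
    rw [eLpNorm_indicator_eq_eLpNorm_restrict (hK k), Measure.restrict_restrict (hK k),
      inter_eq_left.2 (hKO k)]
    exact hh k
  change eLpNorm ((K k).indicator (h k) - w) 2 (μ.restrict O) ≤ _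
  rw [e]
  exact (eLpNorm_sub_le (((hm k).sub hw.1).indicator (hK k)) (hw.1.indicator (hK k).compl)
    (by norm_num)).trans (add_le_add_left h4 _)

/-- The partial derivatives of a compactly supported `C¹` function have vanishing integral. -/
lemma integral_eq_zero_of_hasFDerivAt {E : Type*} [NormedAddCommGroup E] [NormedSpace ℝ E]
    [FiniteDimensional ℝ E] [MeasureSpace E] [BorelSpace E]
    [(volume : Measure E).IsAddHaarMeasure] {O K : Set E} (hO : IsOpen O) (hK : IsCompact K)
    (hKO : K ⊆ O) {G : E → ℝ} {G' : E → (E →L[ℝ] ℝ)} (hG : ∀ x ∈ O, HasFDerivAt G (G' x) x)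
    (hG' : ContinuousOn G' O) (h0 : ∀ x ∉ K, G x = 0) (v : E) : ∫ x in O, G' x v = 0 := by
  have hd0 : ∀ x ∉ K, HasFDerivAt G (0 : E →L[ℝ] ℝ) x := fun x hx =>
    (hasFDerivAt_const (0 : ℝ) x).congr_of_eventuallyEq <| by
      filter_upwards [hK.isClosed.isOpen_compl.mem_nhds hx] with z hz using h0 z hz
  have hd : Differentiable ℝ G := fun x => by
    by_cases hx : x ∈ O
    · exact (hG x hx).differentiableAt
    · exact (hd0 x fun h => hx (hKO h)).differentiableAt
  have hc : Continuous (fderiv ℝ G) := by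
    rw [continuous_iff_continuousAt]
    intro x
    by_cases hx : x ∈ O
    · refine (hG'.continuousAt (hO.mem_nhds hx)).congr ?_
      filter_upwards [hO.mem_nhds hx] with z hz using (hG z hz).fderiv.symm
    · refine (continuousAt_const (y := (0 : E →L[ℝ] ℝ))).congr ?_
      filter_upwards [hK.isClosed.isOpen_compl.mem_nhds fun h => hx (hKO h)] with z hz
        using (hd0 z hz).fderiv.symm
  have hs : HasCompactSupport G := HasCompactSupport.intro hK h0
  have hs' : HasCompactSupport fun x => fderiv ℝ G x v := hs.fderiv_apply ℝ v
  have h1 : ∫ x, fderiv ℝ G x v = 0 := by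
    have := integral_mul_fderiv_eq_neg_fderiv_mul_of_integrable (𝕜 := ℝ) (μ := (volume : Measure E))
      (f := fun _ : E => (1 : ℝ)) (g := G) (v := v) (by simp)
      (by simpa using (hc.clm_apply continuous_const).integrable_of_hasCompactSupport hs')
      (by simpa using hd.continuous.integrable_of_hasCompactSupport hs)
      (fun _ _ => differentiableAt_const _) (fun x _ => hd x)
    simpa using this
  have h2 : ∫ x in O, fderiv ℝ G x v = ∫ x, fderiv ℝ G x v :=
    setIntegral_eq_integral_of_forall_compl_eq_zero fun x hx => by
      rw [(hd0 x fun h => hx (hKO h)).fderiv]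
      rfl
  rw [← h1, ← h2]
  exact setIntegral_congr_fun hO.measurableSet fun x hx => by rw [(hG x hx).fderiv]

end FibreIntegrals

/-! ### Integration by parts under a family of maps -/

section WeakGradient

lemma continuousOn_deriv_mul {O : Set E3} {A ζ : E3 → ℝ} (hO : IsOpen O)
    (hA : ContDiffOn ℝ 1 A O) (hζ : ContDiff ℝ 1 ζ) (e : E3) :
    ContinuousOn (fun x => A x * fderiv ℝ ζ x e + ζ x * fderiv ℝ A x e) O := by
  have h1 : ContinuousOn (fderiv ℝ A) O := hA.continuousOn_fderiv_of_isOpen hO (by norm_num)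
  have h2 : Continuous (fderiv ℝ ζ) := hζ.continuous_fderiv (by norm_num)
  have h3 := hA.continuousOn
  have h4 := hζ.continuous
  fun_prop

/-- Integration by parts for the product of a smooth function on the image of `T`, a coefficient
`A` and a test function `ζ`. -/
lemma integral_deriv_mul_comp_eq_zero {O : Set E3} (hO : IsOpen O) {T : E3 → E3}
    {D : E3 → (E3 →L[ℝ] E3)} (hD : ContinuousOn D O) (hT : ∀ x ∈ O, HasFDerivAt T (D x) x)
    {A ζ f : E3 → ℝ} (hA : ContDiffOn ℝ 1 A O) (hζ : ContDiff ℝ 1 ζ) (hζc : HasCompactSupport ζ)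
    (hζO : tsupport ζ ⊆ O) (hf : ContDiff ℝ 1 f) (e : E3) :
    ∫ x in O, ((A x * fderiv ℝ ζ x e + ζ x * fderiv ℝ A x e) * f (T x) +
      ∑ m, A x * ζ x * D x e m * fderiv ℝ f (T x) (EuclideanSpace.single m 1)) = 0 := by
  have hTc : ContinuousOn T O := fun x hx => (hT x hx).continuousAt.continuousWithinAt
  have h1 : ContinuousOn (fderiv ℝ A) O := hA.continuousOn_fderiv_of_isOpen hO (by norm_num)
  have h2 : Continuous (fderiv ℝ ζ) := hζ.continuous_fderiv (by norm_num)
  have h3 := hA.continuousOn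
  have h4 := hζ.continuous
  have h5 : ContinuousOn (fun x => fderiv ℝ f (T x)) O :=
    (hf.continuous_fderiv (by norm_num)).comp_continuousOn hTc
  have h6 : ContinuousOn (fun x => f (T x)) O := hf.continuous.comp_continuousOn hTc
  have hG : ∀ x ∈ O, HasFDerivAt (fun x => A x * ζ x * f (T x))
      ((A x * ζ x) • (fderiv ℝ f (T x)).comp (D x) +
        f (T x) • (A x • fderiv ℝ ζ x + ζ x • fderiv ℝ A x)) x := fun x hx =>
    ((((hA.differentiableOn (by norm_num)).differentiableAt (hO.mem_nhds hx)).hasFDerivAt).mul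
      ((hζ.differentiable (by norm_num)) x).hasFDerivAt).mul
      (((hf.differentiable (by norm_num)) (T x)).hasFDerivAt.comp x (hT x hx))
  have hG' : ContinuousOn (fun x => (A x * ζ x) • (fderiv ℝ f (T x)).comp (D x) +
      f (T x) • (A x • fderiv ℝ ζ x + ζ x • fderiv ℝ A x)) O := by
    have h7 : ContinuousOn (fun x => (fderiv ℝ f (T x)).comp (D x)) O := h5.clm_comp hD
    exact ((h3.mul h4.continuousOn).smul h7).add
      (h6.smul ((h3.smul h2.continuousOn).add (h4.continuousOn.smul h1)))
  have h := integral_eq_zero_of_hasFDerivAt hO hζc hζO hG hG'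
    (fun x hx => by simp [image_eq_zero_of_notMem_tsupport hx]) e
  rw [← h]
  refine setIntegral_congr_fun hO.measurableSet fun x _ => ?_
  have e1 : fderiv ℝ f (T x) (D x e) =
      ∑ m, D x e m * fderiv ℝ f (T x) (EuclideanSpace.single m 1) := by
    conv_lhs => rw [euclidean_sum_single (D x e)]
    simp only [map_sum, map_smul, smul_eq_mul]
  simp only [add_apply, smul_apply,
    ContinuousLinearMap.comp_apply, smul_eq_mul, e1, Finset.mul_sum]
  rw [add_comm, mul_comm (f (T x))]
  simp only [mul_assoc]

/-- The integration by parts formula for the compositions of a weakly differentiable function with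
a family of maps `S (·, r)` of the domain, integrated over `r`. -/
theorem integral_prod_deriv_mul_comp_eq_zero {O : Set E3} (hO : IsOpen O)
    (hfin : volume O ≠ ⊤) {S : E3 × ℝ → E3} {D : E3 × ℝ → (E3 →L[ℝ] E3)}
    (hSm : AEMeasurable S ((volume.restrict O).prod (volume.restrict (Ioo (0 : ℝ) 1))))
    {C : ℝ≥0∞} (hC : C ≠ ⊤)
    (hle : ((volume.restrict O).prod (volume.restrict (Ioo (0 : ℝ) 1))).map S ≤
      C • volume.restrict O)
    (hDc : ContinuousOn D (O ×ˢ univ))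
    (hD : ∀ x ∈ O, ∀ r, HasFDerivAt (fun x => S (x, r)) (D (x, r)) x) {M : ℝ}
    (hDM : ∀ x ∈ O, ∀ r ∈ Ioo (0 : ℝ) 1, ‖D (x, r)‖ ≤ M) {K : ℕ → Set E3} {J : ℕ → Set ℝ}
    (hK : ∀ k, IsCompact (K k)) (hKO : ∀ k, K k ⊆ O) (hKe : ∀ x ∈ O, ∀ᶠ k in atTop, x ∈ K k)
    (hKJ : ∀ k, ∀ x ∈ O, ∀ r ∈ Ioo (0 : ℝ) 1, S (x, r) ∈ K k ↔ r ∈ J k)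
    {w : E3 → ℝ} {g : Fin 3 → E3 → ℝ} (hw : MemL2 O w) (hg : ∀ m, MemL2 O (g m))
    {f : ℕ → E3 → ℝ} (hf : ∀ k, ContDiff ℝ 1 (f k))
    (hfw : ∀ k, eLpNorm (f k - w) 2 (volume.restrict (K k)) ≤ 2⁻¹ ^ k)
    (hfg : ∀ k m, eLpNorm ((fun x => fderiv ℝ (f k) x (EuclideanSpace.single m 1)) - g m) 2
      (volume.restrict (K k)) ≤ 2⁻¹ ^ k)
    {A ζ : E3 → ℝ} (hA : ContDiffOn ℝ 1 A O) (hAM : ∀ x ∈ O, ‖A x‖ ≤ M ∧ ‖fderiv ℝ A x‖ ≤ M)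
    (hζ : ContDiff ℝ 1 ζ) (hζc : HasCompactSupport ζ) (hζO : tsupport ζ ⊆ O) (e : E3) :
    MemLp (fun z : E3 × ℝ => A z.1 * fderiv ℝ ζ z.1 e + ζ z.1 * fderiv ℝ A z.1 e) 2
        ((volume.restrict O).prod (volume.restrict (Ioo (0 : ℝ) 1))) ∧
      (∀ m, MemLp (fun z : E3 × ℝ => A z.1 * ζ z.1 * D z e m) 2
        ((volume.restrict O).prod (volume.restrict (Ioo (0 : ℝ) 1)))) ∧
    ∫ z, (A z.1 * fderiv ℝ ζ z.1 e + ζ z.1 * fderiv ℝ A z.1 e) * w (S z)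
        ∂((volume.restrict O).prod (volume.restrict (Ioo (0 : ℝ) 1))) +
      ∑ m, ∫ z, A z.1 * ζ z.1 * D z e m * g m (S z)
        ∂((volume.restrict O).prod (volume.restrict (Ioo (0 : ℝ) 1))) = 0 := by
  have hOm := hO.measurableSet
  have : IsFiniteMeasure (volume.restrict O) := isFiniteMeasure_restrict.2 hfin
  set μ := (volume.restrict O).prod (volume.restrict (Ioo (0 : ℝ) 1)) with hμ
  have hμr : μ = (volume : Measure (E3 × ℝ)).restrict (O ×ˢ Ioo (0 : ℝ) 1) := by
    rw [hμ, Measure.prod_restrict, Measure.volume_eq_prod]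
  have hmem : ∀ᵐ z ∂μ, z ∈ O ×ˢ Ioo (0 : ℝ) 1 := by
    rw [hμr]
    exact ae_restrict_mem (hOm.prod measurableSet_Ioo)
  have hcm : ∀ {B : E3 × ℝ → ℝ}, ContinuousOn B (O ×ˢ univ) → AEStronglyMeasurable B μ :=
      fun hB => by
    rw [hμr]
    exact (hB.mono (prod_mono_right (subset_univ _))).aestronglyMeasurable
      (hOm.prod measurableSet_Ioo)
  have hfst : ∀ {B : E3 → ℝ}, ContinuousOn B O →
      ContinuousOn (fun z : E3 × ℝ => B z.1) (O ×ˢ univ) :=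
    fun hB => hB.comp continuousOn_fst fun z hz => hz.1
  obtain ⟨Z, hZ⟩ := hζ.continuous.bounded_above_of_compact_support hζc
  obtain ⟨Z', hZ'⟩ := (hζ.continuous_fderiv (by norm_num)).bounded_above_of_compact_support
    (hζc.fderiv ℝ)
  have hB0 : MemLp (fun z : E3 × ℝ => A z.1 * fderiv ℝ ζ z.1 e + ζ z.1 * fderiv ℝ A z.1 e) 2 μ := by
    refine MemLp.of_bound (hcm (hfst (continuousOn_deriv_mul hO hA hζ e)))
      (M * (Z' * ‖e‖) + Z * (M * ‖e‖)) ?_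
    filter_upwards [hmem] with z hz
    obtain ⟨h1, h2⟩ := hAM z.1 hz.1
    have h3 : 0 ≤ M := (norm_nonneg _).trans h1
    have h4 : 0 ≤ Z := (norm_nonneg _).trans (hZ 0)
    refine (norm_add_le _ _).trans (add_le_add ?_ ?_)
    · rw [norm_mul]
      exact mul_le_mul h1 ((ContinuousLinearMap.le_opNorm _ _).trans
        (mul_le_mul_of_nonneg_right (hZ' _) (norm_nonneg _))) (norm_nonneg _) h3
    · rw [norm_mul]
      exact mul_le_mul (hZ _) ((ContinuousLinearMap.le_opNorm _ _).trans
        (mul_le_mul_of_nonneg_right h2 (norm_nonneg _))) (norm_nonneg _) h4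
  have hBm : ∀ m, MemLp (fun z : E3 × ℝ => A z.1 * ζ z.1 * D z e m) 2 μ := fun m => by
    have hDe : ContinuousOn (fun z => D z e m) (O ×ˢ univ) :=
      (EuclideanSpace.proj m : E3 →L[ℝ] ℝ).continuous.comp_continuousOn
        (hDc.clm_apply continuousOn_const)
    refine MemLp.of_bound (hcm (((hfst hA.continuousOn).mul
      (hfst hζ.continuous.continuousOn)).mul hDe)) (M * Z * (M * ‖e‖)) ?_
    filter_upwards [hmem] with z hz
    obtain ⟨h1, h2⟩ := hAM z.1 hz.1
    have h3 : 0 ≤ M := (norm_nonneg _).trans h1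
    have h4 : 0 ≤ Z := (norm_nonneg _).trans (hZ 0)
    rw [norm_mul, norm_mul]
    refine mul_le_mul (mul_le_mul h1 (hZ _) (norm_nonneg _) h3) ?_ (norm_nonneg _)
      (mul_nonneg h3 h4)
    exact (PiLp.norm_apply_le _ m).trans ((ContinuousLinearMap.le_opNorm _ _).trans
      (mul_le_mul_of_nonneg_right (hDM z.1 hz.1 z.2 hz.2) (norm_nonneg _)))
  refine ⟨hB0, hBm, ?_⟩
  -- The cut off approximations satisfy the identity on each layer.
  have hcut : ∀ (k : ℕ) {h : E3 → ℝ}, Continuous h →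
      MemLp ((K k).indicator h) 2 (volume.restrict O) := by
    intro k h hh
    obtain ⟨c, hc⟩ := (hK k).exists_bound_of_continuousOn hh.continuousOn
    refine MemLp.of_bound (hh.aestronglyMeasurable.indicator (hK k).measurableSet) |c|
      (Eventually.of_forall fun x => ?_)
    by_cases hx : x ∈ K k
    · rw [indicator_of_mem hx]
      exact (hc x hx).trans (le_abs_self c)
    · rw [indicator_of_notMem hx, norm_zero]
      exact abs_nonneg c
  have hcomp : ∀ {h : E3 → ℝ}, MemLp h 2 (volume.restrict O) → MemLp (fun z => h (S z)) 2 μ :=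
    fun hh => (hh.of_measure_le_smul hC hle).comp_of_map hSm
  have hfd : ∀ k m, Continuous fun x => fderiv ℝ (f k) x (EuclideanSpace.single m 1) := fun k m =>
    ((hf k).continuous_fderiv (by norm_num)).clm_apply continuous_const
  have hzero : ∀ k, ∫ z, (A z.1 * fderiv ℝ ζ z.1 e + ζ z.1 * fderiv ℝ A z.1 e) *
        (K k).indicator (f k) (S z) ∂μ +
      ∑ m, ∫ z, A z.1 * ζ z.1 * D z e m * (K k).indicator
        (fun x => fderiv ℝ (f k) x (EuclideanSpace.single m 1)) (S z) ∂μ = 0 := by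
    intro k
    have i0 : Integrable (fun z : E3 × ℝ => (A z.1 * fderiv ℝ ζ z.1 e + ζ z.1 * fderiv ℝ A z.1 e) *
        (K k).indicator (f k) (S z)) μ :=
      hB0.integrable_mul (hcomp (hcut k (hf k).continuous))
    have im : ∀ m, Integrable (fun z : E3 × ℝ => A z.1 * ζ z.1 * D z e m * (K k).indicator
        (fun x => fderiv ℝ (f k) x (EuclideanSpace.single m 1)) (S z)) μ := fun m =>
      (hBm m).integrable_mul (hcomp (hcut k (hfd k m)))
    have is : Integrable (fun z : E3 × ℝ => ∑ m, A z.1 * ζ z.1 * D z e m * (K k).indicator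
        (fun x => fderiv ℝ (f k) x (EuclideanSpace.single m 1)) (S z)) μ :=
      integrable_finsetSum _ fun m _ => im m
    rw [← integral_finsetSum _ fun m _ => im m, ← integral_add i0 is]
    rw [hμ] at i0 is ⊢
    refine (integral_prod_symm _ (i0.add is)).trans (integral_eq_zero_of_ae ?_)
    filter_upwards [ae_restrict_mem measurableSet_Ioo] with r hr
    by_cases hrJ : r ∈ J k
    · rw [Pi.zero_apply, ← integral_deriv_mul_comp_eq_zero hO (T := fun x => S (x, r))
        (D := fun x => D (x, r)) (hDc.comp (by fun_prop) fun x hx => ⟨hx, mem_univ _⟩)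
        (fun x hx => hD x hx r) hA hζ hζc hζO (hf k) e]
      refine setIntegral_congr_fun hOm fun x hx => ?_
      have hin := (hKJ k x hx r hr).2 hrJ
      simp only [Pi.add_apply, indicator_of_mem hin]
    · rw [Pi.zero_apply, ← integral_zero E3 ℝ (μ := volume.restrict O)]
      refine setIntegral_congr_fun hOm fun x hx => ?_
      have hin : S (x, r) ∉ K k := fun h => hrJ ((hKJ k x hx r hr).1 h)
      simp only [Pi.add_apply, indicator_of_notMem hin, mul_zero, Finset.sum_const_zero, add_zero]
  have hKm : ∀ k, MeasurableSet (K k) := fun k => (hK k).measurableSet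
  have l0 := tendsto_integral_mul_comp hSm hC hle hB0 (fun k => hcut k (hf k).continuous) hw
    (tendsto_eLpNorm_indicator_sub hOm hKm hKO hKe hw
      (fun k => (hf k).continuous.aestronglyMeasurable) hfw)
  have lm := fun m =>
    tendsto_integral_mul_comp hSm hC hle (hBm m) (fun k => hcut k (hfd k m)) (hg m)
    (tendsto_eLpNorm_indicator_sub hOm hKm hKO hKe (hg m)
      (fun k => (hfd k m).aestronglyMeasurable) fun k => hfg k m)
  have l := l0.add (tendsto_finsetSum Finset.univ fun m _ => lm m)
  simp only [hzero] at l
  exact tendsto_nhds_unique l tendsto_const_nhds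

end WeakGradient

/-! ### Weak derivatives and means over normal segments -/

section WeakDerivatives

variable {Ω : Set E3} {i : Fin 3}

lemma MemL2.integrable_mul_of_hasCompactSupport {f B : E3 → ℝ} (hf : MemL2 Ω f) (hB : Continuous B)
    (hBc : HasCompactSupport B) : Integrable (fun x => f x * B x) (volume.restrict Ω) :=
  MemLp.integrable_mul (p := 2) (q := 2) hf (hB.memLp_of_hasCompactSupport hBc)

lemma HasWeakDeriv.integrable_mul_fderiv {φ ζ : E3 → ℝ} (hφ : MemL2 Ω φ) (hζ : ContDiff ℝ ∞ ζ)
    (hζc : HasCompactSupport ζ) (e : E3) :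
    Integrable (fun x => φ x * fderiv ℝ ζ x e) (volume.restrict Ω) :=
  hφ.integrable_mul_of_hasCompactSupport
    ((hζ.continuous_fderiv (by simp)).clm_apply continuous_const) (hζc.fderiv_apply ℝ e)

lemma HasWeakDeriv.add {φ ψ φ' ψ' : E3 → ℝ} (h : HasWeakDeriv Ω i φ ψ)
    (h' : HasWeakDeriv Ω i φ' ψ') (hφ : MemL2 Ω φ) (hψ : MemL2 Ω ψ) (hφ' : MemL2 Ω φ')
    (hψ' : MemL2 Ω ψ') : HasWeakDeriv Ω i (φ + φ') (ψ + ψ') := by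
  intro ζ hζ hζc hζΩ
  simp only [Pi.add_apply, add_mul]
  rw [integral_add (HasWeakDeriv.integrable_mul_fderiv hφ hζ hζc _)
    (HasWeakDeriv.integrable_mul_fderiv hφ' hζ hζc _),
    integral_add (hψ.integrable_mul_of_hasCompactSupport hζ.continuous hζc)
    (hψ'.integrable_mul_of_hasCompactSupport hζ.continuous hζc), h ζ hζ hζc hζΩ, h' ζ hζ hζc hζΩ]
  ring

lemma HasWeakDeriv.sum {ι : Type*} (s : Finset ι) {φ ψ : ι → E3 → ℝ}
    (h : ∀ k, HasWeakDeriv Ω i (φ k) (ψ k)) (hφ : ∀ k, MemL2 Ω (φ k)) (hψ : ∀ k, MemL2 Ω (ψ k)) :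
    HasWeakDeriv Ω i (∑ k ∈ s, φ k) (∑ k ∈ s, ψ k) := by
  classical
  induction s using Finset.induction_on with
  | empty => intro ζ _ _ _; simp
  | insert k s hk ih =>
    rw [Finset.sum_insert hk, Finset.sum_insert hk]
    exact (h k).add ih (hφ k) (hψ k) (memLp_finsetSum' _ fun k _ => hφ k)
      (memLp_finsetSum' _ fun k _ => hψ k)

lemma HasWeakDeriv.congr_left {φ φ' ψ : E3 → ℝ} (h : HasWeakDeriv Ω i φ ψ)
    (hφ : φ' =ᵐ[volume.restrict Ω] φ) : HasWeakDeriv Ω i φ' ψ := by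
  intro ζ hζ hζc hζΩ
  rw [← h ζ hζ hζc hζΩ]
  refine integral_congr_ae ?_
  filter_upwards [hφ] with x hx
  rw [hx]

/-- Weak derivatives are unique. -/
lemma HasWeakDeriv.ae_eq (hΩ : IsOpen Ω) {φ ψ ψ' : E3 → ℝ} (h : HasWeakDeriv Ω i φ ψ)
    (h' : HasWeakDeriv Ω i φ ψ') (hψ : MemL2 Ω ψ) (hψ' : MemL2 Ω ψ') :
    ψ =ᵐ[volume.restrict Ω] ψ' := by
  have hm : MemLp (ψ - ψ') 2 (volume.restrict Ω) := MemLp.sub hψ hψ'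
  have hl : LocallyIntegrableOn (ψ - ψ') Ω (volume.restrict Ω) :=
    (hm.locallyIntegrable (by norm_num)).locallyIntegrableOn Ω
  have h0 := hΩ.ae_eq_zero_of_integral_contDiff_smul_eq_zero hl fun ζ hζ hζc hζΩ => by
    have e1 := h ζ hζ hζc hζΩ
    rw [h' ζ hζ hζc hζΩ] at e1
    have e2 := integral_sub (hψ.integrable_mul_of_hasCompactSupport hζ.continuous hζc)
      (hψ'.integrable_mul_of_hasCompactSupport hζ.continuous hζc)
    calc ∫ x in Ω, ζ x • (ψ - ψ') x = ∫ x in Ω, (ψ x * ζ x - ψ' x * ζ x) := by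
          refine integral_congr_ae (Eventually.of_forall fun x => ?_)
          simp only [Pi.sub_apply, smul_eq_mul]
          ring
      _ = 0 := by
          rw [e2]
          linarith
  filter_upwards [h0, ae_restrict_mem hΩ.measurableSet] with x hx hxΩ
  exact sub_eq_zero.1 (hx hxΩ)

lemma MemH1.of_hasWeakDeriv {φ : E3 → ℝ} {ψ : Fin 3 → E3 → ℝ} (hφ : MemL2 Ω φ)
    (hψ : ∀ i, MemL2 Ω (ψ i)) (h : ∀ i, HasWeakDeriv Ω i φ (ψ i)) : MemH1 Ω φ :=
  ⟨hφ, fun i => ⟨ψ i, hψ i, h i⟩⟩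

lemma weakDeriv_ae_eq (hΩ : IsOpen Ω) {φ ψ : E3 → ℝ} (hφ : MemH1 Ω φ) (hψ : MemL2 Ω ψ)
    (h : HasWeakDeriv Ω i φ ψ) : weakDeriv Ω i φ =ᵐ[volume.restrict Ω] ψ :=
  (hφ.weakDeriv_spec i).2.ae_eq hΩ h (hφ.weakDeriv_spec i).1 hψ

end WeakDerivatives

lemma sum_sq_le_card_mul {ι : Type*} (s : Finset ι) (f : ι → ℝ≥0∞) :
    (∑ k ∈ s, f k) ^ 2 ≤ s.card * ∑ k ∈ s, f k ^ 2 := by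
  have h := ENNReal.rpow_sum_le_const_mul_sum_rpow s f (p := 2) (by norm_num)
  norm_num at h
  exact_mod_cast h

lemma add_sq_le_two_mul (x y : ℝ≥0∞) : (x + y) ^ 2 ≤ 2 * (x ^ 2 + y ^ 2) := by
  simpa using sum_sq_le_card_mul Finset.univ ![x, y]

section LayerMean

variable {Γ : Set E3} {n : E3 → E3} {g₀ g₁ : E3 → ℝ} {δ δ₀ a ε τ β : ℝ}

/-- The mean of `w` over the normal segment through `x` in the thin domain. -/
def layerMean (Γ : Set E3) (n : E3 → E3) (g₀ g₁ : E3 → ℝ) (ε : ℝ) (w : E3 → ℝ) (x : E3) : ℝ :=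
  ∫ r in Ioo (0 : ℝ) 1, w (layerProj Γ n g₀ g₁ ε r x)

/-- The mean of `|w|²` over the normal segment through `x` in the thin domain. -/
def layerSq (Γ : Set E3) (n : E3 → E3) (g₀ g₁ : E3 → ℝ) (ε : ℝ) (w : E3 → ℝ) (x : E3) : ℝ≥0∞ :=
  ∫⁻ r in Ioo (0 : ℝ) 1, ‖w (layerProj Γ n g₀ g₁ ε r x)‖ₑ ^ 2

lemma isProbabilityMeasure_restrict_Ioo :
    IsProbabilityMeasure ((volume : Measure ℝ).restrict (Ioo (0 : ℝ) 1)) :=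
  ⟨by simp⟩

lemma enorm_layerMean_sq_le (w : E3 → ℝ) (x : E3) :
    ‖layerMean Γ n g₀ g₁ ε w x‖ₑ ^ 2 ≤ layerSq Γ n g₀ g₁ ε w x := by
  have := isProbabilityMeasure_restrict_Ioo
  exact enorm_integral_sq_le _

lemma IsThinDatum.volume_thin_ne_top (hT : IsThinDatum Γ n g₀ g₁ δ δ₀ a)
    (hε : ε ∈ Ioc (0 : ℝ) 1) : volume (thin Γ n g₀ g₁ ε) ≠ ⊤ :=
  ((measure_mono (hT.thin_subset_closedTube hε)).trans_lt
    hT.surface.isCompact_closedTube.measure_lt_top).ne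

/-- The image of Lebesgue measure under the projections onto the layers is dominated by Lebesgue
measure, uniformly in `ε`. -/
lemma IsThinDatum.exists_map_layerProj_le (hT : IsThinDatum Γ n g₀ g₁ δ δ₀ a) :
    ∃ C : ℝ≥0∞, C ≠ ⊤ ∧ ∀ ε ∈ Ioc (0 : ℝ) 1,
      AEMeasurable (fun z : E3 × ℝ => layerProj Γ n g₀ g₁ ε z.2 z.1)
        ((volume.restrict (thin Γ n g₀ g₁ ε)).prod (volume.restrict (Ioo (0 : ℝ) 1))) ∧
      ((volume.restrict (thin Γ n g₀ g₁ ε)).prod (volume.restrict (Ioo (0 : ℝ) 1))).map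
        (fun z : E3 × ℝ => layerProj Γ n g₀ g₁ ε z.2 z.1) ≤
        C • volume.restrict (thin Γ n g₀ g₁ ε) := by
  obtain ⟨C, hCt, hC⟩ := hT.exists_lintegral_layerProj_le
  refine ⟨C, hCt, fun ε hε => ?_⟩
  have hOm := (hT.isOpen_thin hε).measurableSet
  have hS : AEMeasurable (fun z : E3 × ℝ => layerProj Γ n g₀ g₁ ε z.2 z.1)
      ((volume.restrict (thin Γ n g₀ g₁ ε)).prod (volume.restrict (Ioo (0 : ℝ) 1))) := by
    rw [Measure.prod_restrict]
    exact ((hT.continuousOn_layerProj hε).mono (prod_mono_right (subset_univ _))).aemeasurable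
      (hOm.prod measurableSet_Ioo)
  refine ⟨hS, Measure.le_iff.2 fun s hs => ?_⟩
  have hF : Measurable (s.indicator (1 : E3 → ℝ≥0∞)) := measurable_one.indicator hs
  have h1 := hC ε hε _ hF
  rw [lintegral_indicator_one hs] at h1
  rw [← lintegral_indicator_one hs, lintegral_map' hF.aemeasurable hS]
  exact (lintegral_prod _ (hF.comp_aemeasurable hS)).trans_le h1

/-- A regular multiple of the mean over the normal segments of a function in `H¹` belongs to `H¹`,
with derivatives bounded pointwise by the means of the function and its gradient. -/
theorem IsThinDatum.exists_weakDeriv_mul_layerMean (hT : IsThinDatum Γ n g₀ g₁ δ δ₀ a) (M : ℝ) :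
    ∃ N : ℝ≥0∞, N ≠ ⊤ ∧ ∀ ε ∈ Ioc (0 : ℝ) 1, ∀ A : E3 → ℝ,
      ContDiffOn ℝ 1 A (thin Γ n g₀ g₁ ε) →
      (∀ x ∈ thin Γ n g₀ g₁ ε, ‖A x‖ ≤ M ∧ ‖fderiv ℝ A x‖ ≤ M) →
      ∀ w : E3 → ℝ, MemH1 (thin Γ n g₀ g₁ ε) w →
      MemL2 (thin Γ n g₀ g₁ ε) (fun x => A x * layerMean Γ n g₀ g₁ ε w x) ∧
      ∀ i, ∃ V : E3 → ℝ, MemL2 (thin Γ n g₀ g₁ ε) V ∧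
        HasWeakDeriv (thin Γ n g₀ g₁ ε) i (fun x => A x * layerMean Γ n g₀ g₁ ε w x) V ∧
        ∀ x ∈ thin Γ n g₀ g₁ ε, ‖V x‖ₑ ^ 2 ≤ N * (layerSq Γ n g₀ g₁ ε w x +
          ∑ m, layerSq Γ n g₀ g₁ ε (weakDeriv (thin Γ n g₀ g₁ ε) m w) x) := by
  obtain ⟨C, hCt, hC⟩ := hT.exists_map_layerProj_le
  obtain ⟨M', hM', hDer⟩ := hT.exists_layerProj_deriv
  set L := max (max M M') 0 with hL
  have hL0 : 0 ≤ L := le_max_right _ _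
  have hML : M ≤ L := (le_max_left _ _).trans (le_max_left _ _)
  have hML' : M' ≤ L := (le_max_right _ _).trans (le_max_left _ _)
  refine ⟨2 * ENNReal.ofReal L ^ 2 + 2 * (ENNReal.ofReal L ^ 2 * (3 * ENNReal.ofReal L ^ 2)), by
    finiteness, fun ε hε A hA hAM w hw => ?_⟩
  set O := thin Γ n g₀ g₁ ε with hOdef
  have hO : IsOpen O := hT.isOpen_thin hε
  have hOm := hO.measurableSet
  obtain ⟨hSm, hSle⟩ := hC ε hε
  obtain ⟨D, hDc, hDd, hDM⟩ := hDer ε hε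
  obtain ⟨f, hf, hfw, hfg, -⟩ := hT.exists_smooth_seq hε hw
  have hν := isProbabilityMeasure_restrict_Ioo
  have hfin : IsFiniteMeasure (volume.restrict O) :=
    isFiniteMeasure_restrict.2 (hT.volume_thin_ne_top hε)
  have hAL : ∀ x ∈ O, ‖A x‖ ≤ L ∧ ‖fderiv ℝ A x‖ ≤ L := fun x hx =>
    ⟨(hAM x hx).1.trans hML, (hAM x hx).2.trans hML⟩
  have hDL : ∀ x ∈ O, ∀ r ∈ Ioo (0 : ℝ) 1, ‖D (x, r)‖ ≤ L := fun x hx r hr =>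
    (hDM x hx r hr).trans hML'
  have hcomp : ∀ {h : E3 → ℝ}, MemL2 O h →
      MemLp (fun z : E3 × ℝ => h (layerProj Γ n g₀ g₁ ε z.2 z.1)) 2
      ((volume.restrict O).prod (volume.restrict (Ioo (0 : ℝ) 1))) := fun hh =>
    MemLp.comp_of_map (MemLp.of_measure_le_smul hCt hSle hh) hSm
  have hg : ∀ m, MemL2 O (weakDeriv O m w) := fun m => (hw.weakDeriv_spec m).1
  have hKc : ∀ k, IsCompact (exhaustion Γ n g₀ g₁ ε k) := fun k => hT.isCompact_compactLayers
  have hKO : ∀ k, exhaustion Γ n g₀ g₁ ε k ⊆ O := fun k =>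
    hT.compactLayers_subset hε.1 (one_div_nat_pos k)
  have hKJ : ∀ k, ∀ x ∈ O, ∀ r ∈ Ioo (0 : ℝ) 1, layerProj Γ n g₀ g₁ ε r x ∈
      exhaustion Γ n g₀ g₁ ε k ↔ r ∈ Icc (1 / ((k : ℝ) + 1)) (1 - 1 / ((k : ℝ) + 1)) :=
    fun k x hx r hr => hT.layerPoint_mem_compactLayers hε (one_div_nat_pos k) ⟨hr.1.le, hr.2.le⟩
      (hT.proj_mem hε hx)
  have hparts := fun {ζ : E3 → ℝ} (hζ : ContDiff ℝ 1 ζ) (hζc : HasCompactSupport ζ)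
      (hζO : tsupport ζ ⊆ O) (e : E3) => integral_prod_deriv_mul_comp_eq_zero hO
    (hT.volume_thin_ne_top hε) hSm hCt hSle hDc hDd hDL hKc hKO
    (fun x hx => hT.eventually_mem_exhaustion hε hx) hKJ hw.1 hg
    (fun k => (hf k).of_le (by norm_cast)) hfw hfg hA hAL hζ hζc hζO e
  have hmean : MemL2 O (layerMean Γ n g₀ g₁ ε w) := MemLp.integral_prod_right (hcomp hw.1)
  have hbdd : ∀ {B h : E3 → ℝ}, ContinuousOn B O → (∀ x ∈ O, ‖B x‖ ≤ L) → MemL2 O h →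
      MemL2 O fun x => B x * h x := fun {B h} hB hBL hh => by
    refine MemLp.of_le_mul (c := L) hh ((hB.aestronglyMeasurable hOm).mul hh.1) ?_
    filter_upwards [ae_restrict_mem hOm] with x hx
    rw [norm_mul]
    exact mul_le_mul_of_nonneg_right (hBL x hx) (norm_nonneg _)
  have hφ2 := hbdd hA.continuousOn (fun x hx => (hAL x hx).1) hmean
  refine ⟨hφ2, fun i => ?_⟩
  set e : E3 := EuclideanSpace.single i 1 with he
  have hen : ‖e‖ = 1 := by simp [he]
  have hdA : ContinuousOn (fun x => fderiv ℝ A x e) O :=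
    (hA.continuousOn_fderiv_of_isOpen hO (by norm_num)).clm_apply continuousOn_const
  have hdAL : ∀ x ∈ O, ‖fderiv ℝ A x e‖ ≤ L := fun x hx => by
    simpa [hen] using (ContinuousLinearMap.le_opNorm (fderiv ℝ A x) e).trans
      (mul_le_mul_of_nonneg_right (hAL x hx).2 (norm_nonneg _))
  have hDe : ∀ m, ∀ x ∈ O, ∀ r ∈ Ioo (0 : ℝ) 1, ‖D (x, r) e m‖ ≤ L := fun m x hx r hr => by
    refine (PiLp.norm_apply_le _ m).trans ?_
    simpa [hen] using (ContinuousLinearMap.le_opNorm (D (x, r)) e).trans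
      (mul_le_mul_of_nonneg_right (hDL x hx r hr) (norm_nonneg _))
  have hDem : ∀ m, MemLp (fun z : E3 × ℝ => D z e m *
      weakDeriv O m w (layerProj Γ n g₀ g₁ ε z.2 z.1)) 2
      ((volume.restrict O).prod (volume.restrict (Ioo (0 : ℝ) 1))) := fun m => by
    have hc : ContinuousOn (fun z => D z e m) (O ×ˢ Ioo (0 : ℝ) 1) :=
      (EuclideanSpace.proj m : E3 →L[ℝ] ℝ).continuous.comp_continuousOn
        ((hDc.mono (prod_mono_right (subset_univ _))).clm_apply continuousOn_const)
    have hcm : AEStronglyMeasurable (fun z => D z e m)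
        ((volume.restrict O).prod (volume.restrict (Ioo (0 : ℝ) 1))) := by
      rw [Measure.prod_restrict]
      exact hc.aestronglyMeasurable (hOm.prod measurableSet_Ioo)
    refine MemLp.of_le_mul (c := L) (hcomp (hg m)) (hcm.mul (hcomp (hg m)).1) ?_
    rw [Measure.prod_restrict]
    filter_upwards [ae_restrict_mem (hOm.prod measurableSet_Ioo)] with z hz
    rw [norm_mul]
    exact mul_le_mul_of_nonneg_right (hDe m z.1 hz.1 z.2 hz.2) (norm_nonneg _)
  set I : Fin 3 → E3 → ℝ := fun m x => ∫ r in Ioo (0 : ℝ) 1,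
    D (x, r) e m * weakDeriv O m w (layerProj Γ n g₀ g₁ ε r x) with hI
  have hI2 : ∀ m, MemL2 O (I m) := fun m => MemLp.integral_prod_right (hDem m)
  have hIs : MemL2 O fun x => ∑ m, I m x := memLp_finsetSum _ fun m _ => hI2 m
  have hV2 := MemLp.add (hbdd hdA hdAL hmean) (hbdd hA.continuousOn (fun x hx => (hAL x hx).1) hIs)
  refine ⟨_, hV2, ?_, fun x hx => ?_⟩
  · intro ζ hζ hζc hζO
    have hζ1 : ContDiff ℝ 1 ζ := hζ.of_le (by norm_cast)
    -- Fubini's theorem turns the integration by parts formula into the test identity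
    obtain ⟨hB0, hBm, hz⟩ := hparts hζ1 hζc hζO e
    have k0 : Integrable (fun z : E3 × ℝ => (A z.1 * fderiv ℝ ζ z.1 e + ζ z.1 * fderiv ℝ A z.1 e) *
        w (layerProj Γ n g₀ g₁ ε z.2 z.1))
        ((volume.restrict O).prod (volume.restrict (Ioo (0 : ℝ) 1))) :=
      hB0.integrable_mul (hcomp hw.1)
    have km : ∀ m, Integrable (fun z : E3 × ℝ => A z.1 * ζ z.1 * D z e m *
        weakDeriv O m w (layerProj Γ n g₀ g₁ ε z.2 z.1))
        ((volume.restrict O).prod (volume.restrict (Ioo (0 : ℝ) 1))) := fun m =>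
      (hBm m).integrable_mul (hcomp (hg m))
    have hi1 := HasWeakDeriv.integrable_mul_fderiv hφ2 hζ hζc e
    have hi2 := MemL2.integrable_mul_of_hasCompactSupport hV2 hζ.continuous hζc
    rw [integral_prod _ k0] at hz
    simp only [integral_prod _ (km _)] at hz
    rw [← integral_finsetSum _ fun m _ => (km m).integral_prod_left,
      ← integral_add k0.integral_prod_left
        (integrable_finsetSum _ fun m _ => (km m).integral_prod_left)] at hz
    rw [eq_neg_iff_add_eq_zero, ← integral_add hi1 hi2, ← hz]
    refine integral_congr_ae (Eventually.of_forall fun x => ?_)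
    simp only [Pi.add_apply, mul_assoc (A x * ζ x), integral_const_mul]
    simp only [hI, layerMean, ← Finset.mul_sum]
    ring
  · set ℓ := ENNReal.ofReal L with hℓ
    have hen' : ∀ {t : ℝ}, ‖t‖ ≤ L → ‖t‖ₑ ≤ ℓ := fun ht => by
      rw [← ofReal_norm]
      exact ENNReal.ofReal_le_ofReal ht
    have hIm : ∀ m, ‖I m x‖ₑ ^ 2 ≤ ℓ ^ 2 * layerSq Γ n g₀ g₁ ε (weakDeriv O m w) x := fun m => by
      refine (enorm_integral_sq_le _).trans ?_
      rw [layerSq, ← lintegral_const_mul' _ _ (by finiteness)]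
      refine setLIntegral_mono' measurableSet_Ioo fun r hr => ?_
      rw [enorm_mul, mul_pow]
      gcongr
      exact hen' (hDe m x hx r hr)
    have hsum : ‖∑ m, I m x‖ₑ ^ 2 ≤
        3 * ℓ ^ 2 * ∑ m, layerSq Γ n g₀ g₁ ε (weakDeriv O m w) x := by
      calc ‖∑ m, I m x‖ₑ ^ 2 ≤ (∑ m, ‖I m x‖ₑ) ^ 2 := by
            gcongr
            exact enorm_sum_le _ _
        _ ≤ 3 * ∑ m, ‖I m x‖ₑ ^ 2 := by
            simpa using sum_sq_le_card_mul Finset.univ fun m => ‖I m x‖ₑ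
        _ ≤ 3 * ∑ m, ℓ ^ 2 * layerSq Γ n g₀ g₁ ε (weakDeriv O m w) x := by
            gcongr with m
            exact hIm m
        _ = _ := by rw [← Finset.mul_sum, mul_assoc]
    have hmx := enorm_layerMean_sq_le (Γ := Γ) (n := n) (g₀ := g₀) (g₁ := g₁) (ε := ε) w x
    set X := layerSq Γ n g₀ g₁ ε w x
    set Y := ∑ m, layerSq Γ n g₀ g₁ ε (weakDeriv O m w) x
    calc ‖fderiv ℝ A x e * layerMean Γ n g₀ g₁ ε w x + A x * ∑ m, I m x‖ₑ ^ 2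
        ≤ (ℓ * ‖layerMean Γ n g₀ g₁ ε w x‖ₑ + ℓ * ‖∑ m, I m x‖ₑ) ^ 2 := by
          gcongr
          refine (enorm_add_le _ _).trans (add_le_add ?_ ?_)
          · rw [enorm_mul]
            gcongr
            exact hen' (hdAL x hx)
          · rw [enorm_mul]
            gcongr
            exact hen' (hAL x hx).1
      _ ≤ 2 * (ℓ ^ 2 * X + ℓ ^ 2 * (3 * ℓ ^ 2 * Y)) := by
          refine (add_sq_le_two_mul _ _).trans ?_
          rw [mul_pow, mul_pow]
          gcongr
      _ = 2 * ℓ ^ 2 * X + 2 * (ℓ ^ 2 * (3 * ℓ ^ 2)) * Y := by ring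
      _ ≤ (2 * ℓ ^ 2 + 2 * (ℓ ^ 2 * (3 * ℓ ^ 2))) * (X + Y) := by
          rw [mul_add]
          gcongr
          · exact le_self_add
          · exact le_add_self

end LayerMean

/-! ### The average part -/

section AveragePart

variable {Γ : Set E3} {n : E3 → E3} {g₀ g₁ : E3 → ℝ} {δ δ₀ a ε τ β : ℝ}

/-- The average part is a combination of fixed fields with the components of the average as
coefficients. -/
lemma avgPart_eq_sum (u : E3 → E3) (x : E3) : avgPart Γ n g₀ g₁ ε u x =
    ∑ k, avg n g₀ g₁ ε u (proj Γ x) k • impCol Γ n g₀ g₁ ε k x := by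
  let L : E3 →L[ℝ] E3 := ContinuousLinearMap.id ℝ E3 -
    (innerSL ℝ (n (proj Γ x))).smulRight (n (proj Γ x))
  let T : E3 →L[ℝ] E3 := L + ((innerSL ℝ (Psi Γ n g₀ g₁ ε x)).comp L).smulRight (n (proj Γ x))
  have hT : ∀ v : E3, T v = P n (proj Γ x) v +
      ⟪P n (proj Γ x) v, Psi Γ n g₀ g₁ ε x⟫ • n (proj Γ x) := fun v => by
    rw [real_inner_comm]
    rfl
  have h1 : avgPart Γ n g₀ g₁ ε u x = T (avg n g₀ g₁ ε u (proj Γ x)) := (hT _).symm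
  have h2 : ∀ k, impCol Γ n g₀ g₁ ε k x = T (EuclideanSpace.single k 1) := fun k => (hT _).symm
  rw [h1]
  conv_lhs => rw [euclidean_sum_single (avg n g₀ g₁ ε u (proj Γ x))]
  simp only [map_sum, map_smul, h2]

/-- The average over a normal segment as an integral over the layer parameter. -/
lemma IsThinDatum.avg_proj_eq (hT : IsThinDatum Γ n g₀ g₁ δ δ₀ a) (hε : ε ∈ Ioc (0 : ℝ) 1)
    (u : E3 → E3) {x : E3} (hx : x ∈ thin Γ n g₀ g₁ ε) :
    avg n g₀ g₁ ε u (proj Γ x) = ∫ r in Ioo (0 : ℝ) 1, u (layerProj Γ n g₀ g₁ ε r x) := by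
  set y := proj Γ x with hy
  have hg : ε * (g₁ y - g₀ y) ≠ 0 :=
    (mul_pos hε.1 (hT.pos.trans_le (hT.le_sub _ (hT.proj_mem hε hx)))).ne'
  have h := intervalIntegral.integral_comp_add_mul (a := 0) (b := 1)
    (fun r => u (y + r • n y)) hg (ε * g₀ y)
  rw [show ε * g₀ y + ε * (g₁ y - g₀ y) * 0 = ε * g₀ y by ring,
    show ε * g₀ y + ε * (g₁ y - g₀ y) * 1 = ε * g₁ y by ring] at h
  rw [avg, ← h, intervalIntegral.integral_of_le zero_le_one, integral_Ioc_eq_integral_Ioo]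
  refine integral_congr_ae (Eventually.of_forall fun r => ?_)
  simp only [layerProj, layerPoint, layer]
  rw [show ε * g₀ y + ε * (g₁ y - g₀ y) * r = ε * (g₀ y + r * (g₁ y - g₀ y)) by ring]

lemma IsThinDatum.memLp_comp_layerProj (hT : IsThinDatum Γ n g₀ g₁ δ δ₀ a)
    (hε : ε ∈ Ioc (0 : ℝ) 1) {w : E3 → ℝ} (hw : MemL2 (thin Γ n g₀ g₁ ε) w) :
    MemLp (fun z : E3 × ℝ => w (layerProj Γ n g₀ g₁ ε z.2 z.1)) 2
      ((volume.restrict (thin Γ n g₀ g₁ ε)).prod (volume.restrict (Ioo (0 : ℝ) 1))) := by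
  obtain ⟨C, hCt, hC⟩ := hT.exists_map_layerProj_le
  exact MemLp.comp_of_map (MemLp.of_measure_le_smul hCt (hC ε hε).2 hw) (hC ε hε).1

lemma IsThinDatum.aemeasurable_layerSq (hT : IsThinDatum Γ n g₀ g₁ δ δ₀ a)
    (hε : ε ∈ Ioc (0 : ℝ) 1) {w : E3 → ℝ} (hw : MemL2 (thin Γ n g₀ g₁ ε) w) :
    AEMeasurable (layerSq Γ n g₀ g₁ ε w) (volume.restrict (thin Γ n g₀ g₁ ε)) :=
  ((hT.memLp_comp_layerProj hε hw).1.enorm.pow_const 2).lintegral_prod_right'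

/-- Almost everywhere, the components of the average are the means over the normal segments. -/
lemma IsThinDatum.avg_proj_apply_ae (hT : IsThinDatum Γ n g₀ g₁ δ δ₀ a) (hε : ε ∈ Ioc (0 : ℝ) 1)
    {u : E3 → E3} (hu : ∀ k, MemL2 (thin Γ n g₀ g₁ ε) fun x => u x k) :
    ∀ᵐ x ∂(volume.restrict (thin Γ n g₀ g₁ ε)), ∀ k,
      avg n g₀ g₁ ε u (proj Γ x) k = layerMean Γ n g₀ g₁ ε (fun x => u x k) x := by
  have hν := isProbabilityMeasure_restrict_Ioo
  have hfin : IsFiniteMeasure (volume.restrict (thin Γ n g₀ g₁ ε)) :=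
    isFiniteMeasure_restrict.2 (hT.volume_thin_ne_top hε)
  have hi : ∀ k, ∀ᵐ x ∂(volume.restrict (thin Γ n g₀ g₁ ε)), Integrable
      (fun r => u (layerProj Γ n g₀ g₁ ε r x) k) (volume.restrict (Ioo (0 : ℝ) 1)) := fun k =>
    ((hT.memLp_comp_layerProj hε (hu k)).integrable (by norm_num)).prod_right_ae
  filter_upwards [ae_all_iff.2 hi, ae_restrict_mem (hT.isOpen_thin hε).measurableSet]
    with x hx hxO k
  rw [hT.avg_proj_eq hε u hxO, eval_integral_piLp hx]
  rfl

lemma IsThinDatum.avgPart_apply_ae (hT : IsThinDatum Γ n g₀ g₁ δ δ₀ a) (hε : ε ∈ Ioc (0 : ℝ) 1)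
    {u : E3 → E3} (hu : ∀ k, MemL2 (thin Γ n g₀ g₁ ε) fun x => u x k) (j : Fin 3) :
    (fun x => avgPart Γ n g₀ g₁ ε u x j) =ᵐ[volume.restrict (thin Γ n g₀ g₁ ε)]
      ∑ k, fun x => impCol Γ n g₀ g₁ ε k x j * layerMean Γ n g₀ g₁ ε (fun x => u x k) x := by
  filter_upwards [hT.avg_proj_apply_ae hε hu] with x hx
  rw [avgPart_eq_sum, Finset.sum_apply]
  simp only [hx, WithLp.ofLp_sum, Finset.sum_apply, PiLp.smul_apply, smul_eq_mul]
  exact Finset.sum_congr rfl fun k _ => mul_comm _ _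

/-- The average part of a vector field in `H¹` belongs to `H¹`, and it is bounded pointwise by the
means of the field, its gradient by the means of the field and its gradient, uniformly in `ε`. -/
theorem IsThinDatum.exists_avgPart_bound (hT : IsThinDatum Γ n g₀ g₁ δ δ₀ a) :
    ∃ N : ℝ≥0∞, N ≠ ⊤ ∧ ∀ ε ∈ Ioc (0 : ℝ) 1, ∀ u : E3 → E3, MemH1Vec (thin Γ n g₀ g₁ ε) u →
      MemH1Vec (thin Γ n g₀ g₁ ε) (avgPart Γ n g₀ g₁ ε u) ∧
      (∀ j, ∀ᵐ x ∂(volume.restrict (thin Γ n g₀ g₁ ε)), ‖avgPart Γ n g₀ g₁ ε u x j‖ₑ ^ 2 ≤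
        N * ∑ k, layerSq Γ n g₀ g₁ ε (fun x => u x k) x) ∧
      ∀ i j, ∀ᵐ x ∂(volume.restrict (thin Γ n g₀ g₁ ε)),
        ‖weakDeriv (thin Γ n g₀ g₁ ε) i (fun x => avgPart Γ n g₀ g₁ ε u x j) x‖ₑ ^ 2 ≤
        N * ∑ k, (layerSq Γ n g₀ g₁ ε (fun x => u x k) x + ∑ m, layerSq Γ n g₀ g₁ ε
          (weakDeriv (thin Γ n g₀ g₁ ε) m fun x => u x k) x) := by
  obtain ⟨M, hM, hcol⟩ := hT.exists_bound_impCol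
  obtain ⟨N, hN, hder⟩ := hT.exists_weakDeriv_mul_layerMean M
  refine ⟨3 * ENNReal.ofReal M ^ 2 + 3 * N, by finiteness, fun ε hε u hu => ?_⟩
  set O := thin Γ n g₀ g₁ ε with hOdef
  have hO : IsOpen O := hT.isOpen_thin hε
  have hOm := hO.measurableSet
  set A : Fin 3 → Fin 3 → E3 → ℝ := fun j k x => impCol Γ n g₀ g₁ ε k x j with hA
  set φ : Fin 3 → Fin 3 → E3 → ℝ := fun j k x =>
    A j k x * layerMean Γ n g₀ g₁ ε (fun x => u x k) x with hφ
  have hAc : ∀ j k, ContDiffOn ℝ 1 (A j k) O := fun j k x hx =>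
    ((EuclideanSpace.proj j : E3 →L[ℝ] ℝ).contDiff.contDiffAt.comp x
      (hcol ε hε k x hx).2.1).contDiffWithinAt
  have hAM : ∀ j k, ∀ x ∈ O, ‖A j k x‖ ≤ M ∧ ‖fderiv ℝ (A j k) x‖ ≤ M := fun j k x hx => by
    obtain ⟨h1, h2, h3⟩ := hcol ε hε k x hx
    refine ⟨(PiLp.norm_apply_le _ j).trans h1, ?_⟩
    have h4 : HasFDerivAt (A j k) ((EuclideanSpace.proj j : E3 →L[ℝ] ℝ).comp
        (fderiv ℝ (impCol Γ n g₀ g₁ ε k) x)) x :=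
      (EuclideanSpace.proj j : E3 →L[ℝ] ℝ).hasFDerivAt.comp x
        (h2.differentiableAt (by norm_num)).hasFDerivAt
    rw [h4.fderiv]
    refine ContinuousLinearMap.opNorm_le_bound _ hM fun v => ?_
    exact (PiLp.norm_apply_le _ j).trans ((ContinuousLinearMap.le_opNorm _ _).trans
      (mul_le_mul_of_nonneg_right h3 (norm_nonneg _)))
  have hu2 : ∀ k, MemL2 O fun x => u x k := fun k => (hu k).1
  have hφ2 : ∀ j k, MemL2 O (φ j k) := fun j k => (hder ε hε _ (hAc j k) (hAM j k) _ (hu k)).1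
  choose V hV2 hVd hVb using fun j k => (hder ε hε _ (hAc j k) (hAM j k) _ (hu k)).2
  have hae := fun j => hT.avgPart_apply_ae hε hu2 j
  have hW : ∀ j i, HasWeakDeriv O i (fun x => avgPart Γ n g₀ g₁ ε u x j) (∑ k, V j k i) :=
    fun j i => (HasWeakDeriv.sum Finset.univ (fun k => hVd j k i) (hφ2 j)
      fun k => hV2 j k i).congr_left (hae j)
  have hVs : ∀ j i, MemL2 O (∑ k, V j k i) := fun j i => memLp_finsetSum' _ fun k _ => hV2 j k i
  have hH : MemH1Vec O (avgPart Γ n g₀ g₁ ε u) := fun j => MemH1.of_hasWeakDeriv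
    ((memLp_congr_ae (hae j)).2 (memLp_finsetSum' _ fun k _ => hφ2 j k)) (hVs j) (hW j)
  refine ⟨hH, fun j => ?_, fun i j => ?_⟩
  · filter_upwards [hae j, ae_restrict_mem hOm] with x hx hxO
    rw [hx, Finset.sum_apply]
    calc ‖∑ k, A j k x * layerMean Γ n g₀ g₁ ε (fun x => u x k) x‖ₑ ^ 2
        ≤ (∑ k, ‖A j k x * layerMean Γ n g₀ g₁ ε (fun x => u x k) x‖ₑ) ^ 2 := by
          gcongr
          exact enorm_sum_le _ _
      _ ≤ 3 * ∑ k, ‖A j k x * layerMean Γ n g₀ g₁ ε (fun x => u x k) x‖ₑ ^ 2 := by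
          simpa using sum_sq_le_card_mul Finset.univ fun k =>
            ‖A j k x * layerMean Γ n g₀ g₁ ε (fun x => u x k) x‖ₑ
      _ ≤ 3 * ∑ k, ENNReal.ofReal M ^ 2 * layerSq Γ n g₀ g₁ ε (fun x => u x k) x := by
          gcongr with k
          rw [enorm_mul, mul_pow]
          gcongr
          · rw [← ofReal_norm]
            exact ENNReal.ofReal_le_ofReal (hAM j k x hxO).1
          · exact enorm_layerMean_sq_le _ _
      _ = 3 * ENNReal.ofReal M ^ 2 * ∑ k, layerSq Γ n g₀ g₁ ε (fun x => u x k) x := by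
          rw [← Finset.mul_sum, mul_assoc]
      _ ≤ _ := by
          gcongr
          exact le_self_add
  · filter_upwards [weakDeriv_ae_eq hO (hH j) (hVs j i) (hW j i), ae_restrict_mem hOm] with x hx hxO
    rw [hx, Finset.sum_apply]
    calc ‖∑ k, V j k i x‖ₑ ^ 2 ≤ (∑ k, ‖V j k i x‖ₑ) ^ 2 := by
          gcongr
          exact enorm_sum_le _ _
      _ ≤ 3 * ∑ k, ‖V j k i x‖ₑ ^ 2 := by
          simpa using sum_sq_le_card_mul Finset.univ fun k => ‖V j k i x‖ₑ
      _ ≤ 3 * ∑ k, N * (layerSq Γ n g₀ g₁ ε (fun x => u x k) x + ∑ m, layerSq Γ n g₀ g₁ ε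
          (weakDeriv O m fun x => u x k) x) := by
          gcongr with k
          exact hVb j k i x hxO
      _ = 3 * N * ∑ k, (layerSq Γ n g₀ g₁ ε (fun x => u x k) x + ∑ m, layerSq Γ n g₀ g₁ ε
          (weakDeriv O m fun x => u x k) x) := by
          rw [← Finset.mul_sum, mul_assoc]
      _ ≤ _ := by
          gcongr
          exact le_add_self

end AveragePart

section Norms

lemma L2_apply_le (Ω : Set E3) (u : E3 → E3) (k : Fin 3) : L2 Ω (fun x => u x k) ≤ L2 Ω u :=
  eLpNorm_mono fun _ => PiLp.norm_apply_le _ k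

lemma L2_le_H1Vec (Ω : Set E3) (u : E3 → E3) : L2 Ω u ≤ H1Vec Ω u :=
  le_rpow_half_of_sq_le le_self_add

lemma H1Vec_le_H2Vec (Ω : Set E3) (u : E3 → E3) : H1Vec Ω u ≤ H2Vec Ω u :=
  le_rpow_half_of_sq_le le_self_add

lemma H1_apply_le (Ω : Set E3) (u : E3 → E3) (k : Fin 3) :
    H1 Ω (fun x => u x k) ≤ H1Vec Ω u := by
  refine ENNReal.rpow_le_rpow (add_le_add (pow_le_pow_left₀ zero_le (L2_apply_le Ω u k) 2)
    (Finset.sum_le_sum fun i _ => ?_)) (by norm_num)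
  exact Finset.single_le_sum (f := fun j => L2 Ω (fun x => weakGradMat Ω u x i j) ^ 2)
    (fun _ _ => zero_le) (Finset.mem_univ k)

lemma L2_weakDeriv_apply_le (Ω : Set E3) (u : E3 → E3) (m k : Fin 3) :
    L2 Ω (weakDeriv Ω m fun x => u x k) ≤ H1Vec Ω u :=
  (L2_weakDeriv_le_H1 Ω _ m).trans (H1_apply_le Ω u k)

lemma H1_weakDeriv_apply_le (Ω : Set E3) (u : E3 → E3) (m k : Fin 3) :
    H1 Ω (weakDeriv Ω m fun x => u x k) ≤ H2Vec Ω u := by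
  refine ENNReal.rpow_le_rpow (add_le_add
    (pow_le_pow_left₀ zero_le (L2_weakDeriv_apply_le Ω u m k) 2)
    (Finset.sum_le_sum fun i _ => ?_)) (by norm_num)
  calc L2 Ω (weakDeriv Ω i (weakDeriv Ω m fun x => u x k)) ^ 2
      ≤ ∑ k, L2 Ω (weakDeriv Ω i (fun x => weakGradMat Ω u x m k)) ^ 2 :=
        Finset.single_le_sum
          (f := fun k => L2 Ω (weakDeriv Ω i (fun x => weakGradMat Ω u x m k)) ^ 2)
          (fun _ _ => zero_le) (Finset.mem_univ k)
    _ ≤ _ := Finset.single_le_sum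
        (f := fun j => ∑ k, L2 Ω (weakDeriv Ω i (fun x => weakGradMat Ω u x j k)) ^ 2)
          (fun _ _ => zero_le) (Finset.mem_univ m)

end Norms

/-! ### Product estimates for the average part -/

section Finiteness

variable {Ω : Set E3}

lemma MemH1.H1_ne_top {φ : E3 → ℝ} (h : MemH1 Ω φ) : H1 Ω φ ≠ ⊤ :=
  ENNReal.rpow_ne_top_of_nonneg (by norm_num) (ENNReal.add_ne_top.2
    ⟨ENNReal.pow_ne_top h.1.2.ne, ENNReal.sum_ne_top.2 fun i _ =>
      ENNReal.pow_ne_top (h.weakDeriv_spec i).1.2.ne⟩)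

lemma MemH1Vec.memL2 {u : E3 → E3} (h : MemH1Vec Ω u) : MemL2 Ω u :=
  MemLp.of_eval_piLp fun k => (h k).1

lemma MemH1Vec.H1Vec_ne_top {u : E3 → E3} (h : MemH1Vec Ω u) : H1Vec Ω u ≠ ⊤ :=
  ENNReal.rpow_ne_top_of_nonneg (by norm_num) (ENNReal.add_ne_top.2
    ⟨ENNReal.pow_ne_top h.memL2.2.ne, ENNReal.sum_ne_top.2 fun i _ => ENNReal.sum_ne_top.2
      fun j _ => ENNReal.pow_ne_top ((h j).weakDeriv_spec i).1.2.ne⟩)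

lemma MemH2Vec.memH1Vec {u : E3 → E3} (h : MemH2Vec Ω u) : MemH1Vec Ω u := fun j => (h j).1

lemma MemH2Vec.H2Vec_ne_top {u : E3 → E3} (h : MemH2Vec Ω u) : H2Vec Ω u ≠ ⊤ :=
  ENNReal.rpow_ne_top_of_nonneg (by norm_num) (ENNReal.add_ne_top.2
    ⟨ENNReal.pow_ne_top h.memH1Vec.H1Vec_ne_top, ENNReal.sum_ne_top.2 fun i _ =>
      ENNReal.sum_ne_top.2 fun j _ => ENNReal.sum_ne_top.2 fun k _ =>
        ENNReal.pow_ne_top (((h k).2 j).weakDeriv_spec i).1.2.ne⟩)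

/-- An estimate of `∫ |F|² |φ|²` as an estimate of the norm of `F φ` in `L²`. -/
lemma memL2_mul_of_lintegral_le {F φ : E3 → ℝ} (hF : AEStronglyMeasurable F (volume.restrict Ω))
    (hφ : AEStronglyMeasurable φ (volume.restrict Ω)) {N c p q r s : ℝ≥0∞}
    (hN : N ^ (1 / 2 : ℝ) ≤ c) (hNt : N ≠ ⊤) (hp : p ≠ ⊤) (hq : q ≠ ⊤) (hr : r ≠ ⊤) (hs : s ≠ ⊤)
    (h : ∫⁻ x in Ω, ‖F x‖ₑ ^ 2 * ‖φ x‖ₑ ^ 2 ≤ N * ((p * q) * (r * s))) :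
    MemL2 Ω (fun x => F x * φ x) ∧ L2 Ω (fun x => F x * φ x) ≤
      c * p ^ (1 / 2 : ℝ) * q ^ (1 / 2 : ℝ) * r ^ (1 / 2 : ℝ) * s ^ (1 / 2 : ℝ) := by
  have h1 : L2 Ω (fun x => F x * φ x) ≤ (N * ((p * q) * (r * s))) ^ (1 / 2 : ℝ) := by
    refine le_rpow_half_of_sq_le ?_
    rw [L2, eLpNorm_two_sq]
    simpa only [enorm_mul, mul_pow] using h
  refine ⟨⟨hF.mul hφ, h1.trans_lt (ENNReal.rpow_lt_top_of_nonneg (by norm_num)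
    (by finiteness))⟩, h1.trans ?_⟩
  have hz : (0 : ℝ) ≤ 1 / 2 := by norm_num
  rw [ENNReal.mul_rpow_of_nonneg _ _ hz, ENNReal.mul_rpow_of_nonneg _ _ hz,
    ENNReal.mul_rpow_of_nonneg _ _ hz, ENNReal.mul_rpow_of_nonneg _ _ hz]
  simp only [← mul_assoc]
  gcongr

lemma rpow_half_mul_inv_le {N : ℝ≥0∞} {c ε : ℝ} (hc : 0 ≤ c) (hε : 0 < ε)
    (hN : N ^ (1 / 2 : ℝ) ≤ ENNReal.ofReal c) : (N * (ENNReal.ofReal ε)⁻¹) ^ (1 / 2 : ℝ) ≤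
      ENNReal.ofReal (c * ε ^ (-(1 / 2) : ℝ)) := by
  rw [ENNReal.mul_rpow_of_nonneg _ _ (by norm_num), ENNReal.ofReal_mul hc,
    ← ENNReal.ofReal_inv_of_pos hε, ENNReal.ofReal_rpow_of_pos (inv_pos.2 hε), Real.inv_rpow hε.le,
    ← Real.rpow_neg hε.le]
  gcongr

end Finiteness

lemma enorm_sq_eq_ofReal (t : ℝ) : ‖t‖ₑ ^ 2 = ENNReal.ofReal (t ^ 2) := by
  rw [← ofReal_norm, ← ENNReal.ofReal_pow (norm_nonneg _), Real.norm_eq_abs, sq_abs]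

lemma enorm_euclidean_sq (v : E3) : ‖v‖ₑ ^ 2 = ∑ j, ‖v j‖ₑ ^ 2 := by
  simp only [enorm_sq_eq_ofReal]
  rw [← ofReal_norm, ← ENNReal.ofReal_pow (norm_nonneg _), EuclideanSpace.real_norm_sq_eq,
    ENNReal.ofReal_sum_of_nonneg fun j _ => sq_nonneg _]

lemma enorm_frob_sq (A : Matrix (Fin 3) (Fin 3) ℝ) : ‖frob A‖ₑ ^ 2 = ∑ i, ∑ j, ‖A i j‖ₑ ^ 2 := by
  have hs : ∀ i, 0 ≤ ∑ j, A i j ^ 2 := fun i => Finset.sum_nonneg fun j _ => sq_nonneg _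
  simp only [enorm_sq_eq_ofReal]
  rw [frob, Real.sq_sqrt (Finset.sum_nonneg fun i _ => hs i),
    ENNReal.ofReal_sum_of_nonneg fun i _ => hs i]
  exact Finset.sum_congr rfl fun i _ => ENNReal.ofReal_sum_of_nonneg fun j _ => sq_nonneg _

lemma MemH1Vec.aestronglyMeasurable_frob {Ω : Set E3} {u : E3 → E3} (h : MemH1Vec Ω u) :
    AEStronglyMeasurable (fun x => frob (weakGradMat Ω u x)) (volume.restrict Ω) := by
  have hm : ∀ i j, AEMeasurable (fun x => weakGradMat Ω u x i j ^ 2) (volume.restrict Ω) :=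
    fun i j => ((h j).weakDeriv_spec i).1.1.aemeasurable.pow_const 2
  exact (Finset.aemeasurable_fun_sum _ fun i _ =>
    Finset.aemeasurable_fun_sum _ fun j _ => hm i j).sqrt.aestronglyMeasurable

section ProductEstimates

variable {Γ : Set E3} {n : E3 → E3} {g₀ g₁ : E3 → ℝ} {δ δ₀ a ε τ β : ℝ}

/-- The product estimate for the average part of a vector field in `H¹`. -/
lemma IsThinDatum.exists_lintegral_avgPart_sq_mul_sq_le (hT : IsThinDatum Γ n g₀ g₁ δ δ₀ a) :
    ∃ C : ℝ≥0∞, C ≠ ⊤ ∧ ∀ ε ∈ Ioc (0 : ℝ) 1, ∀ (φ : E3 → ℝ) (u : E3 → E3),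
      MemH1 (thin Γ n g₀ g₁ ε) φ → MemH1Vec (thin Γ n g₀ g₁ ε) u →
      ∫⁻ x in thin Γ n g₀ g₁ ε, ‖avgPart Γ n g₀ g₁ ε u x‖ₑ ^ 2 * ‖φ x‖ₑ ^ 2 ≤
      C * (ENNReal.ofReal ε)⁻¹ *
        ((L2 (thin Γ n g₀ g₁ ε) φ * H1 (thin Γ n g₀ g₁ ε) φ) *
          (L2 (thin Γ n g₀ g₁ ε) u * H1Vec (thin Γ n g₀ g₁ ε) u)) := by
  obtain ⟨N, hN, hb⟩ := hT.exists_avgPart_bound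
  obtain ⟨C, hC, hK⟩ := hT.exists_lintegral_layerProj_sq_mul_sq_le
  refine ⟨3 * (N * (3 * C)), by finiteness, fun ε hε φ u hφ hu => ?_⟩
  set O := thin Γ n g₀ g₁ ε with hO
  obtain ⟨-, hb1, -⟩ := hb ε hε u hu
  have hm : ∀ k, AEMeasurable (fun x => layerSq Γ n g₀ g₁ ε (fun x => u x k) x * ‖φ x‖ₑ ^ 2)
      (volume.restrict O) := fun k =>
    (hT.aemeasurable_layerSq hε (hu k).1).mul (hφ.1.1.enorm.pow_const 2)
  have hsum : ∀ k, ∫⁻ x in O, layerSq Γ n g₀ g₁ ε (fun x => u x k) x * ‖φ x‖ₑ ^ 2 ≤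
      C * (ENNReal.ofReal ε)⁻¹ * ((L2 O u * H1Vec O u) * (L2 O φ * H1 O φ)) := fun k =>
    (hK ε hε _ φ (hu k) hφ).trans (by
      gcongr
      · exact L2_apply_le O u k
      · exact H1_apply_le O u k)
  calc ∫⁻ x in O, ‖avgPart Γ n g₀ g₁ ε u x‖ₑ ^ 2 * ‖φ x‖ₑ ^ 2
      ≤ ∫⁻ x in O, (3 * N) * ∑ k, layerSq Γ n g₀ g₁ ε (fun x => u x k) x * ‖φ x‖ₑ ^ 2 := by
        refine lintegral_mono_ae ?_
        filter_upwards [ae_all_iff.2 hb1] with x hx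
        rw [enorm_euclidean_sq, ← Finset.sum_mul, ← mul_assoc]
        gcongr
        calc ∑ j, ‖avgPart Γ n g₀ g₁ ε u x j‖ₑ ^ 2
            ≤ ∑ j : Fin 3, N * ∑ k, layerSq Γ n g₀ g₁ ε (fun x => u x k) x := by
              gcongr with j
              exact hx j
          _ = _ := by simp [mul_assoc]
    _ = 3 * N * ∑ k, ∫⁻ x in O, layerSq Γ n g₀ g₁ ε (fun x => u x k) x * ‖φ x‖ₑ ^ 2 := by
        rw [lintegral_const_mul' _ _ (by finiteness), lintegral_finsetSum' _ fun k _ => hm k]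
    _ ≤ 3 * N * ∑ k : Fin 3, C * (ENNReal.ofReal ε)⁻¹ *
          ((L2 O u * H1Vec O u) * (L2 O φ * H1 O φ)) := by
        gcongr with k
        exact hsum k
    _ = _ := by
        simp only [Finset.sum_const, Finset.card_univ, Fintype.card_fin, nsmul_eq_mul]
        push_cast
        ring

lemma IsThinDatum.memH1Vec_avgPart (hT : IsThinDatum Γ n g₀ g₁ δ δ₀ a) (hε : ε ∈ Ioc (0 : ℝ) 1)
    {u : E3 → E3} (hu : MemH1Vec (thin Γ n g₀ g₁ ε) u) :
    MemH1Vec (thin Γ n g₀ g₁ ε) (avgPart Γ n g₀ g₁ ε u) := by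
  obtain ⟨N, -, h⟩ := hT.exists_avgPart_bound
  exact (h ε hε u hu).1

/-- The product estimate for the gradient of the average part of a vector field in `H²`. -/
lemma IsThinDatum.exists_lintegral_weakGradMat_avgPart_sq_mul_sq_le
    (hT : IsThinDatum Γ n g₀ g₁ δ δ₀ a) :
    ∃ C : ℝ≥0∞, C ≠ ⊤ ∧ ∀ ε ∈ Ioc (0 : ℝ) 1, ∀ (φ : E3 → ℝ) (u : E3 → E3),
      MemH1 (thin Γ n g₀ g₁ ε) φ → MemH2Vec (thin Γ n g₀ g₁ ε) u →
      ∫⁻ x in thin Γ n g₀ g₁ ε, ‖frob (weakGradMat (thin Γ n g₀ g₁ ε)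
        (avgPart Γ n g₀ g₁ ε u) x)‖ₑ ^ 2 * ‖φ x‖ₑ ^ 2 ≤
      C * (ENNReal.ofReal ε)⁻¹ *
        ((L2 (thin Γ n g₀ g₁ ε) φ * H1 (thin Γ n g₀ g₁ ε) φ) *
          (H1Vec (thin Γ n g₀ g₁ ε) u * H2Vec (thin Γ n g₀ g₁ ε) u)) := by
  obtain ⟨N, hN, hb⟩ := hT.exists_avgPart_bound
  obtain ⟨C, hC, hK⟩ := hT.exists_lintegral_layerProj_sq_mul_sq_le
  refine ⟨9 * (N * (12 * C)), by finiteness, fun ε hε φ u hφ hu => ?_⟩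
  set O := thin Γ n g₀ g₁ ε with hO
  obtain ⟨-, -, hb2⟩ := hb ε hε u hu.memH1Vec
  set B := C * (ENNReal.ofReal ε)⁻¹ * ((H1Vec O u * H2Vec O u) * (L2 O φ * H1 O φ)) with hB
  have hm : ∀ {w : E3 → ℝ}, MemL2 O w →
      AEMeasurable (fun x => layerSq Γ n g₀ g₁ ε w x * ‖φ x‖ₑ ^ 2) (volume.restrict O) := fun hw =>
    (hT.aemeasurable_layerSq hε hw).mul (hφ.1.1.enorm.pow_const 2)
  have hm0 : ∀ k, AEMeasurable (fun x => layerSq Γ n g₀ g₁ ε (fun x => u x k) x * ‖φ x‖ₑ ^ 2)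
      (volume.restrict O) := fun k => hm (hu k).1.1
  have hm1 : ∀ k m, AEMeasurable (fun x => layerSq Γ n g₀ g₁ ε
      (weakDeriv O m fun x => u x k) x * ‖φ x‖ₑ ^ 2) (volume.restrict O) := fun k m =>
    hm ((hu k).2 m).1
  have hs0 : ∀ k, ∫⁻ x in O, layerSq Γ n g₀ g₁ ε (fun x => u x k) x * ‖φ x‖ₑ ^ 2 ≤ B := fun k =>
    (hK ε hε _ φ (hu k).1 hφ).trans (by
      rw [hB]
      gcongr
      · exact (L2_apply_le O u k).trans (L2_le_H1Vec O u)
      · exact (H1_apply_le O u k).trans (H1Vec_le_H2Vec O u))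
  have hs1 : ∀ k m, ∫⁻ x in O, layerSq Γ n g₀ g₁ ε (weakDeriv O m fun x => u x k) x * ‖φ x‖ₑ ^ 2 ≤
      B := fun k m =>
    (hK ε hε _ φ ((hu k).2 m) hφ).trans (by
      rw [hB]
      gcongr
      · exact L2_weakDeriv_apply_le O u m k
      · exact H1_weakDeriv_apply_le O u m k)
  calc ∫⁻ x in O, ‖frob (weakGradMat O (avgPart Γ n g₀ g₁ ε u) x)‖ₑ ^ 2 * ‖φ x‖ₑ ^ 2
      ≤ ∫⁻ x in O, (9 * N) * ∑ k, (layerSq Γ n g₀ g₁ ε (fun x => u x k) x * ‖φ x‖ₑ ^ 2 +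
          ∑ m, layerSq Γ n g₀ g₁ ε (weakDeriv O m fun x => u x k) x * ‖φ x‖ₑ ^ 2) := by
        refine lintegral_mono_ae ?_
        filter_upwards [ae_all_iff.2 fun i => ae_all_iff.2 (hb2 i)] with x hx
        simp only [← Finset.sum_mul, ← add_mul]
        rw [enorm_frob_sq, ← mul_assoc]
        gcongr
        calc ∑ i, ∑ j, ‖weakGradMat O (avgPart Γ n g₀ g₁ ε u) x i j‖ₑ ^ 2
            ≤ ∑ i : Fin 3, ∑ j : Fin 3, N * ∑ k, (layerSq Γ n g₀ g₁ ε (fun x => u x k) x +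
                ∑ m, layerSq Γ n g₀ g₁ ε (weakDeriv O m fun x => u x k) x) := by
              gcongr with i _ j
              exact hx i j
          _ = _ := by
              simp only [Finset.sum_const, Finset.card_univ, Fintype.card_fin, nsmul_eq_mul]
              push_cast
              ring
    _ = 9 * N * ∑ k, ((∫⁻ x in O, layerSq Γ n g₀ g₁ ε (fun x => u x k) x * ‖φ x‖ₑ ^ 2) +
          ∑ m, ∫⁻ x in O, layerSq Γ n g₀ g₁ ε (weakDeriv O m fun x => u x k) x * ‖φ x‖ₑ ^ 2) := by
        have hmS : ∀ k, AEMeasurable (fun x => ∑ m, layerSq Γ n g₀ g₁ ε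
            (weakDeriv O m fun x => u x k) x * ‖φ x‖ₑ ^ 2) (volume.restrict O) := fun k =>
          Finset.aemeasurable_fun_sum _ fun m _ => hm1 k m
        have hmA : ∀ k, AEMeasurable (fun x => layerSq Γ n g₀ g₁ ε (fun x => u x k) x * ‖φ x‖ₑ ^ 2 +
            ∑ m, layerSq Γ n g₀ g₁ ε (weakDeriv O m fun x => u x k) x * ‖φ x‖ₑ ^ 2)
            (volume.restrict O) := fun k => (hm0 k).add (hmS k)
        rw [lintegral_const_mul' _ _ (by finiteness), lintegral_finsetSum' _ fun k _ => hmA k]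
        congr 1
        refine Finset.sum_congr rfl fun k _ => ?_
        rw [lintegral_add_left' (hm0 k), lintegral_finsetSum' _ fun m _ => hm1 k m]
    _ ≤ 9 * N * ∑ k : Fin 3, (B + ∑ m : Fin 3, B) := by
        gcongr with k _ m
        · exact hs0 k
        · exact hs1 k m
    _ = _ := by
        simp only [Finset.sum_const, Finset.card_univ, Fintype.card_fin, nsmul_eq_mul, hB]
        push_cast
        ring

end ProductEstimates

end CTD

end

theorem lemma6p15 (Γ : Set CTD.E3) (n : CTD.E3 → CTD.E3) (hΓ : CTD.IsClosedSurface Γ n) :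
    (∃ δ : ℝ, CTD.IsTubularRadius Γ n δ) ∧
    ∀ δ : ℝ, CTD.IsTubularRadius Γ n δ →
    ∀ g₀ g₁ : CTD.E3 → ℝ, ContDiffOn ℝ 4 g₀ Γ → ContDiffOn ℝ 4 g₁ Γ →
    (∃ a : ℝ, 0 < a ∧ ∀ y ∈ Γ, a ≤ g₁ y - g₀ y) →
    (∀ y ∈ Γ, |g₀ y| < δ ∧ |g₁ y| < δ) →
    ∃ c : ℝ, 0 < c ∧ ∀ ε : ℝ, 0 < ε → ε ≤ 1 →
      (∀ η φ : CTD.E3 → ℝ, CTD.MemH1Surf Γ n η → CTD.MemH1 (CTD.thin Γ n g₀ g₁ ε) φ →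
        CTD.MemL2 (CTD.thin Γ n g₀ g₁ ε) (fun x => CTD.ext Γ η x * φ x) ∧
        CTD.L2 (CTD.thin Γ n g₀ g₁ ε) (fun x => CTD.ext Γ η x * φ x) ≤
          ENNReal.ofReal c *
            CTD.L2Surf Γ η ^ (1 / 2 : ℝ) * CTD.H1Surf Γ n η ^ (1 / 2 : ℝ) *
            CTD.L2 (CTD.thin Γ n g₀ g₁ ε) φ ^ (1 / 2 : ℝ) *
            CTD.H1 (CTD.thin Γ n g₀ g₁ ε) φ ^ (1 / 2 : ℝ)) ∧
      (∀ (φ : CTD.E3 → ℝ) (u : CTD.E3 → CTD.E3),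
        CTD.MemH1 (CTD.thin Γ n g₀ g₁ ε) φ → CTD.MemH1Vec (CTD.thin Γ n g₀ g₁ ε) u →
        CTD.MemL2 (CTD.thin Γ n g₀ g₁ ε) (fun x => ‖CTD.avgPart Γ n g₀ g₁ ε u x‖ * φ x) ∧
        CTD.L2 (CTD.thin Γ n g₀ g₁ ε) (fun x => ‖CTD.avgPart Γ n g₀ g₁ ε u x‖ * φ x) ≤
          ENNReal.ofReal (c * ε ^ (-(1 / 2) : ℝ)) *
            CTD.L2 (CTD.thin Γ n g₀ g₁ ε) φ ^ (1 / 2 : ℝ) *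
            CTD.H1 (CTD.thin Γ n g₀ g₁ ε) φ ^ (1 / 2 : ℝ) *
            CTD.L2 (CTD.thin Γ n g₀ g₁ ε) u ^ (1 / 2 : ℝ) *
            CTD.H1Vec (CTD.thin Γ n g₀ g₁ ε) u ^ (1 / 2 : ℝ)) ∧
      (∀ (φ : CTD.E3 → ℝ) (u : CTD.E3 → CTD.E3),
        CTD.MemH1 (CTD.thin Γ n g₀ g₁ ε) φ → CTD.MemH2Vec (CTD.thin Γ n g₀ g₁ ε) u →
        CTD.MemH1Vec (CTD.thin Γ n g₀ g₁ ε) (CTD.avgPart Γ n g₀ g₁ ε u) ∧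
        CTD.MemL2 (CTD.thin Γ n g₀ g₁ ε) (fun x => CTD.frob
          (CTD.weakGradMat (CTD.thin Γ n g₀ g₁ ε) (CTD.avgPart Γ n g₀ g₁ ε u) x) * φ x) ∧
        CTD.L2 (CTD.thin Γ n g₀ g₁ ε) (fun x => CTD.frob
          (CTD.weakGradMat (CTD.thin Γ n g₀ g₁ ε) (CTD.avgPart Γ n g₀ g₁ ε u) x) * φ x) ≤
          ENNReal.ofReal (c * ε ^ (-(1 / 2) : ℝ)) *
            CTD.L2 (CTD.thin Γ n g₀ g₁ ε) φ ^ (1 / 2 : ℝ) *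
            CTD.H1 (CTD.thin Γ n g₀ g₁ ε) φ ^ (1 / 2 : ℝ) *
            CTD.H1Vec (CTD.thin Γ n g₀ g₁ ε) u ^ (1 / 2 : ℝ) *
            CTD.H2Vec (CTD.thin Γ n g₀ g₁ ε) u ^ (1 / 2 : ℝ)) := by
  refine ⟨hΓ.exists_isTubularRadius, ?_⟩
  rintro δ hδ g₀ g₁ hg₀ hg₁ ⟨a, ha, hga⟩ hb
  obtain ⟨δ₀, hT⟩ := CTD.exists_isThinDatum hΓ hδ hg₀ hg₁ ha hga hb
  obtain ⟨C₁, hC₁, h₁⟩ := hT.exists_lintegral_ext_sq_mul_sq_le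
  obtain ⟨C₂, hC₂, h₂⟩ := hT.exists_lintegral_avgPart_sq_mul_sq_le
  obtain ⟨C₃, hC₃, h₃⟩ := hT.exists_lintegral_weakGradMat_avgPart_sq_mul_sq_le
  obtain ⟨N, hN, hbd⟩ : ∃ N : ℝ≥0∞, N ≠ ⊤ ∧ C₁ ≤ N ∧ C₂ ≤ N ∧ C₃ ≤ N :=
    ⟨C₁ + C₂ + C₃, by finiteness, le_self_add.trans le_self_add,
      le_add_self.trans le_self_add, le_add_self⟩
  have hNt : N ^ (1 / 2 : ℝ) ≠ ⊤ := ENNReal.rpow_ne_top_of_nonneg (by norm_num) hN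
  -- the summand `1` makes the constant positive
  set c : ℝ := (N ^ (1 / 2 : ℝ)).toReal + 1 with hc
  have hc0 : 0 < c := by positivity
  have hNc : N ^ (1 / 2 : ℝ) ≤ ENNReal.ofReal c :=
    (ENNReal.le_ofReal_iff_toReal_le hNt hc0.le).2 (by linarith)
  have hle : ∀ {K : ℝ≥0∞}, K ≤ N → K ^ (1 / 2 : ℝ) ≤ ENNReal.ofReal c := fun hK =>
    (ENNReal.rpow_le_rpow hK (by norm_num)).trans hNc
  refine ⟨c, hc0, fun ε hε0 hε1 => ?_⟩
  have hε : ε ∈ Ioc (0 : ℝ) 1 := ⟨hε0, hε1⟩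
  have hεi : (ENNReal.ofReal ε)⁻¹ ≠ ⊤ :=
    ENNReal.inv_ne_top.2 (ENNReal.ofReal_pos.2 hε0).ne'
  refine ⟨fun η φ hη hφ => ?_, fun φ u hφ hu => ?_, fun φ u hφ hu => ?_⟩
  · exact CTD.memL2_mul_of_lintegral_le (hT.aestronglyMeasurable_ext hε hη.1.1) hφ.1.1
      (hle hbd.1) hC₁ hη.1.2.ne hη.H1Surf_ne_top hφ.1.2.ne hφ.H1_ne_top
      (by simpa only [mul_assoc] using h₁ ε hε η φ hη hφ)
  · have h := h₂ ε hε φ u hφ hu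
    simp only [← enorm_norm (CTD.avgPart Γ n g₀ g₁ ε u _)] at h
    exact CTD.memL2_mul_of_lintegral_le ((hT.memH1Vec_avgPart hε hu).memL2.1.norm) hφ.1.1
      (CTD.rpow_half_mul_inv_le hc0.le hε0 (hle hbd.2.1)) (ENNReal.mul_ne_top hC₂ hεi)
      hφ.1.2.ne hφ.H1_ne_top hu.memL2.2.ne hu.H1Vec_ne_top h
  · have hA := hT.memH1Vec_avgPart hε hu.memH1Vec
    exact ⟨hA, CTD.memL2_mul_of_lintegral_le hA.aestronglyMeasurable_frob hφ.1.1
      (CTD.rpow_half_mul_inv_le hc0.le hε0 (hle hbd.2.2)) (ENNReal.mul_ne_top hC₃ hεi)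
      hφ.1.2.ne hφ.H1_ne_top hu.memH1Vec.H1Vec_ne_top hu.H2Vec_ne_top (h₃ ε hε φ u hφ hu)⟩
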